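/- Conventions. All cdga's are $\mathbb{Z}$-graded commutative differential graded algebras over a field of characteristic $0$, and $\mathrm{Ho}(\mathrm{cdga}_k)$ is the localization of $\mathrm{cdga}_k$ at the quasi-isomorphisms. An $\mathbb{R}$-cbba is a $\mathbb{Z}^2$-graded unital $\mathbb{C}$-algebra $A=\bigoplus A^{p,q}$, graded-commutative with respect to the total degree, with derivations $\partial,\bar\partial$ of bidegrees $(1,0)$ and $(0,1)$ satisfying $\partial^2=\bar\partial^2=\partial\bar\partial+\bar\partial\partial=0$, and with an antilinear multiplicative involution $\sigma$ such that $\sigma A^{p,q}=A^{q,p}$ and $\sigma d\sigma=d$, where $d=\partial+\bar\partial$. Write $\mathrm{to}(A)$ for the total cdga $(A,d)$, $H_{dR}(A)=\ker d/\operatorname{im}d$, $H_{BC}(A)=(\ker\partial\cap\ker\bar\partial)/\operatorname{im}\partial\bar\partial$ and $H_A(A)=\ker\partial\bar\partial/(\operatorname{im}\partial+\operatorname{im}\bar\partial)$. We say that $A$ satisfies the $\partial\bar\partial$-Lemma if the natural map $H_{BC}(A)\to H_{dR}(A)$ is injective (it is then bijective); $H_{dR}(A)$ is then bigraded by letting $H^{p,q}_{dR}(A)$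 be the image of $H^{p,q}_{BC}(A)$. A map of $\mathbb{R}$-cbba's is a unital algebra map compatible with the bigradings, $d$ and $\sigma$; it is a pluripotential quasi-isomorphism if it induces isomorphisms on $H_{BC}$ and $H_A$. A cbba with rational structure is a triple $A=(A_{\mathbb Q},A_{\mathbb C},\varphi)$ of a rational cdga $A_{\mathbb Q}$, an $\mathbb{R}$-cbba $A_{\mathbb C}$ and an isomorphism $\varphi:A_{\mathbb Q}\otimes\mathbb{R}\cong \mathrm{to}(A_{\mathbb C})^{\sigma=\mathrm{Id}}$ in $\mathrm{Ho}(\mathrm{cdga}_{\mathbb R})$. A morphism $(A_{\mathbb Q},A_{\mathbb C},\varphi)\to(B_{\mathbb Q},B_{\mathbb C},\psi)$ is a pair $(f_{\mathbb Q},f_{\mathbb C})$ of a cdga map $f_{\mathbb Q}:A_{\mathbb Q}\to B_{\mathbb Q}$ and a map of $\mathbb{R}$-cbba's $f_{\mathbb C}:A_{\mathbb C}\to B_{\mathbb C}$ with $f_{\mathbb C}\circ\varphi=\psi\circ (f_{\mathbb Q}\otimes\mathbb{R})$ in $\mathrm{Ho}(\mathrm{cdga}_{\mathbb R})$; it is a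 quasi-isomorphism if $f_{\mathbb C}$ is a pluripotential quasi-isomorphism. If $A_{\mathbb C}$ satisfies the $\partial\bar\partial$-Lemma, $A$ is called strongly formal over $\mathbb{Q}$ if it is connected by a finite chain (zigzag) of quasi-isomorphisms of cbba's with rational structure to its cohomology $(H(A_{\mathbb Q}),H_{BC}(A_{\mathbb C}),H(\varphi))$, all differentials being zero; here $H(\varphi):H(A_{\mathbb Q})\otimes\mathbb{R}\cong H_{BC}(A_{\mathbb C})^{\sigma=\mathrm{Id}}$ is the map induced by $\varphi$ in cohomology, via $H_{BC}(A_{\mathbb C})\cong H_{dR}(A_{\mathbb C})$. A bigraded $\mathbb{C}$-algebra $H$ is of complete intersection type if, as a bigraded algebra, $H\cong\mathbb{C}[x_1,\dots,x_n]/(r_1,\dots,r_m)$ with $x_i$ of bidegree $(p_i,p_i)$, $p_i\ge 1$, and $r_1,\dots,r_m$ a regular sequence in $\mathbb{C}[x_1,\dots,x_n]$ consisting of elements of pure bidegree. Theorem. Let $A=(A_{\mathbb Q},A_{\mathbb C},\varphi)$ be a cbba with rational structure such that $A_{\mathbb C}$ satisfies the $\partial\bar\partial$-Lemma and $H_{dR}^{*,*}(A_{\mathbb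 C})$ is a bigraded algebra of complete intersection type. Then $A$ is strongly formal over $\mathbb{Q}$. -/

import Mathlib

universe u v

open scoped DirectSum TensorProduct
open CategoryTheory

noncomputable section

/-! ### Gradings: auxiliary facts -/

section Grading

variable {k : Type*} {ι M : Type*} [DecidableEq ι] [Field k]

/-- A family of subspaces that spans and admits "projections" is an internal direct sum. -/
theorem isInternal_of_proj [AddCommGroup M] [Module k M] (𝓜 : ι → Submodule k M)
    (π : ι → M →ₗ[k] M) (h1 : ∀ i, ∀ x ∈ 𝓜 i, π i x = x)
    (h2 : ∀ i j, i ≠ j → ∀ x ∈ 𝓜 j, π i x = 0) (h3 : ∀ x, x ∈ ⨆ i, 𝓜 i) :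
    DirectSum.IsInternal 𝓜 := by
  refine DirectSum.isInternal_submodule_of_iSupIndep_of_iSup_eq_top ?_
    (eq_top_iff.2 fun x _ => h3 x)
  intro i
  rw [Submodule.disjoint_def]
  intro x hx hx'
  have hle : (⨆ j, ⨆ (_ : j ≠ i), 𝓜 j) ≤ LinearMap.ker (π i) :=
    iSup₂_le fun j hj y hy => h2 i j (Ne.symm hj) y hy
  rw [← h1 i x hx]
  exact hle hx'

variable [AddMonoid ι] {A : Type*} [Ring A] [Algebra k A] (𝒜 : ι → Submodule k A)
  [GradedAlgebra 𝒜]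

theorem proj_same {i : ι} {x : A} (hx : x ∈ 𝒜 i) : GradedAlgebra.proj 𝒜 i x = x :=
  DirectSum.decompose_of_mem_same 𝒜 hx

theorem proj_ne {i j : ι} {x : A} (hx : x ∈ 𝒜 j) (h : i ≠ j) : GradedAlgebra.proj 𝒜 i x = 0 :=
  DirectSum.decompose_of_mem_ne 𝒜 hx (Ne.symm h)

theorem proj_mem (i : ι) (x : A) : GradedAlgebra.proj 𝒜 i x ∈ 𝒜 i :=
  (DirectSum.decompose 𝒜 x i).2

theorem exists_sum_proj (x : A) : ∃ s : Finset ι, ∑ i ∈ s, GradedAlgebra.proj 𝒜 i x = x := by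
  classical
  exact ⟨_, DirectSum.sum_support_decompose 𝒜 x⟩

/-- An additive map that shifts degrees injectively commutes with taking components. -/
theorem proj_map {N : Type*} [AddCommGroup N] (f : A →+ N) (g : ι → ι) (hg : Function.Injective g)
    (p : ι → N →+ N) (hsame : ∀ i, ∀ x ∈ 𝒜 i, p (g i) (f x) = f x)
    (hne : ∀ i j, g i ≠ g j → ∀ x ∈ 𝒜 j, p (g i) (f x) = 0) (i : ι) (x : A) :
    p (g i) (f x) = f (GradedAlgebra.proj 𝒜 i x) := by
  induction x using DirectSum.Decomposition.inductionOn 𝒜 with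
  | zero => simp
  | @homogeneous j m =>
    by_cases h : i = j
    · subst h
      rw [proj_same 𝒜 m.2, hsame i _ m.2]
    · rw [proj_ne 𝒜 m.2 h, hne i j (fun e => h (hg e)) _ m.2, map_zero]
  | add a b ha hb => simp only [map_add, ha, hb]

/-- The degree `i` part of a subquotient `Z ⧸ I` of a graded algebra: classes of elements of `Z`
that are homogeneous of degree `i`. -/
def quotPiece (Z : Subalgebra k A) (I : Ideal Z) [I.IsTwoSided] (i : ι) : Submodule k (Z ⧸ I) :=
  ((𝒜 i).comap Z.val.toLinearMap).map (Ideal.Quotient.mkₐ k I).toLinearMap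

/-- The grading on a subquotient by a homogeneous ideal of a homogeneous subalgebra. -/
abbrev quotGradedAlgebra (Z : Subalgebra k A) (I : Ideal Z) [I.IsTwoSided]
    (hZ : ∀ z ∈ Z, ∀ i, GradedAlgebra.proj 𝒜 i z ∈ Z)
    (hI : ∀ z, z ∈ I → ∀ i, (⟨GradedAlgebra.proj 𝒜 i z, hZ z z.2 i⟩ : Z) ∈ I) :
    GradedAlgebra (quotPiece 𝒜 Z I) :=
  { one_mem := ⟨1, SetLike.one_mem_graded 𝒜, rfl⟩
    mul_mem := by
      rintro _ _ _ _ ⟨x, hx, rfl⟩ ⟨y, hy, rfl⟩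
      exact ⟨x * y, SetLike.mul_mem_graded (A := 𝒜) hx hy, map_mul (Ideal.Quotient.mkₐ k I) x y⟩
    toDecomposition := by
      refine DirectSum.IsInternal.chooseDecomposition _ ?_
      let P : ι → Z →ₗ[k] Z := fun i =>
        ((GradedAlgebra.proj 𝒜 i).comp Z.val.toLinearMap).codRestrict
          (Subalgebra.toSubmodule Z) (fun z => hZ z z.2 i)
      let J : Submodule k Z := LinearMap.ker (Ideal.Quotient.mkₐ k I).toLinearMap
      have hJ : ∀ z : Z, z ∈ J ↔ z ∈ I := fun z => by
        simp only [J, LinearMap.mem_ker]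
        exact Ideal.Quotient.eq_zero_iff_mem
      have hP : ∀ i, ∀ x y : Z, Ideal.Quotient.mk I x = Ideal.Quotient.mk I y →
          Ideal.Quotient.mk I (P i x) = Ideal.Quotient.mk I (P i y) := by
        intro i x y h
        rw [Ideal.Quotient.eq] at h ⊢
        rw [← map_sub]
        exact hI _ h i
      let π : ι → (Z ⧸ I) →ₗ[k] (Z ⧸ I) := fun i =>
        { toFun := Quotient.lift (fun z => Ideal.Quotient.mk I (P i z))
            (fun x y h => hP i x y (Quotient.sound h))
          map_add' := by
            intro x y
            obtain ⟨x, rfl⟩ := Ideal.Quotient.mk_surjective x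
            obtain ⟨y, rfl⟩ := Ideal.Quotient.mk_surjective y
            change Ideal.Quotient.mk I (P i (x + y)) =
              Ideal.Quotient.mk I (P i x) + Ideal.Quotient.mk I (P i y)
            rw [map_add, map_add]
          map_smul' := by
            intro c x
            obtain ⟨x, rfl⟩ := Ideal.Quotient.mk_surjective x
            change Ideal.Quotient.mkₐ k I (P i (c • x)) = c • Ideal.Quotient.mkₐ k I (P i x)
            rw [map_smul, map_smul] }
      have hπ : ∀ i z, π i (Ideal.Quotient.mk I z) = Ideal.Quotient.mk I (P i z) :=
        fun _ _ => rfl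
      refine isInternal_of_proj _ π ?_ ?_ ?_
      · rintro i _ ⟨x, hx, rfl⟩
        refine (hπ i x).trans (congrArg _ (Subtype.ext ?_))
        exact proj_same 𝒜 hx
      · rintro i j hij _ ⟨x, hx, rfl⟩
        refine (hπ i x).trans ?_
        have : P i x = 0 := Subtype.ext (proj_ne 𝒜 hx hij)
        rw [this, map_zero]
      · intro x
        obtain ⟨x, rfl⟩ := Ideal.Quotient.mk_surjective x
        obtain ⟨s, hs⟩ := exists_sum_proj 𝒜 (x : A)
        have hx : x = ∑ i ∈ s, P i x := Subtype.ext (by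
          rw [AddSubmonoidClass.coe_finsetSum]; exact hs.symm)
        rw [hx, map_sum]
        exact Submodule.sum_mem _ fun i _ => Submodule.mem_iSup_of_mem i
          ⟨P i x, proj_mem 𝒜 i x, rfl⟩ }

end Grading

/-! ### Commutative differential graded algebras -/

/-- A (`ℤ`-graded, cohomological) commutative differential graded algebra over a field `k`. -/
structure CDGA.{w, w'} (k : Type w') [Field k] where
  carrier : Type w
  [ring : Ring carrier]
  [algebra : Algebra k carrier]
  grading : ℤ → Submodule k carrier
  [gradedAlgebra : GradedAlgebra grading]
  d : carrier →ₗ[k] carrier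
  d_mem : ∀ n, ∀ a ∈ grading n, d a ∈ grading (n + 1)
  d_d : ∀ a, d (d a) = 0
  leibniz : ∀ n, ∀ a ∈ grading n, ∀ b,
    d (a * b) = d a * b + (n.negOnePow : ℤ) • (a * d b)
  graded_comm : ∀ m n, ∀ a ∈ grading m, ∀ b ∈ grading n,
    a * b = ((m * n).negOnePow : ℤ) • (b * a)

namespace CDGA

attribute [instance] CDGA.ring CDGA.algebra CDGA.gradedAlgebra

variable {k : Type v} [Field k]

/-- Morphisms of cdga's: degree preserving unital algebra maps commuting with `d`. -/
@[ext]
structure Hom (A B : CDGA.{u} k) where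
  toAlgHom : A.carrier →ₐ[k] B.carrier
  map_mem : ∀ n, ∀ a ∈ A.grading n, toAlgHom a ∈ B.grading n
  map_d : ∀ a, toAlgHom (A.d a) = B.d (toAlgHom a)

instance : Category (CDGA.{u} k) where
  Hom A B := Hom A B
  id A := ⟨AlgHom.id k A.carrier, fun _ _ h => h, fun _ => rfl⟩
  comp f g := ⟨g.toAlgHom.comp f.toAlgHom, fun n a h => g.map_mem n _ (f.map_mem n a h),
    fun a => (congrArg g.toAlgHom (f.map_d a)).trans (g.map_d _)⟩

variable (A : CDGA.{u} k)

theorem proj_d (i : ℤ) (a : A.carrier) :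
    GradedAlgebra.proj A.grading (i + 1) (A.d a) = A.d (GradedAlgebra.proj A.grading i a) :=
  proj_map A.grading A.d.toAddMonoidHom (· + 1) (add_left_injective 1)
    (fun j => (GradedAlgebra.proj A.grading j).toAddMonoidHom)
    (fun _ x hx => proj_same A.grading (A.d_mem _ x hx))
    (fun _ _ h x hx => proj_ne A.grading (A.d_mem _ x hx) h) i a

theorem d_one : A.d 1 = 0 := by
  have h := A.leibniz 0 1 (SetLike.one_mem_graded A.grading) 1
  simpa using h

theorem d_proj_eq_zero {a : A.carrier} (h : A.d a = 0) (i : ℤ) :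
    A.d (GradedAlgebra.proj A.grading i a) = 0 := by
  rw [← proj_d, h, map_zero]

theorem proj_boundary (b : A.carrier) (i : ℤ) :
    GradedAlgebra.proj A.grading i (A.d b) = A.d (GradedAlgebra.proj A.grading (i - 1) b) := by
  rw [← proj_d, sub_add_cancel]

theorem cocycle_mul_d {a : A.carrier} (ha : A.d a = 0) (b : A.carrier) :
    ∃ c, a * A.d b = A.d c := by
  obtain ⟨s, hs⟩ := exists_sum_proj A.grading a
  refine ⟨∑ i ∈ s, (i.negOnePow : ℤ) • (GradedAlgebra.proj A.grading i a * b), ?_⟩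
  rw [map_sum]
  conv_lhs => rw [← hs, Finset.sum_mul]
  refine Finset.sum_congr rfl fun i _ => ?_
  rw [map_zsmul, A.leibniz i _ (proj_mem A.grading i a), A.d_proj_eq_zero ha, zero_mul, zero_add,
    smul_smul, ← Units.val_mul, Int.units_mul_self, Units.val_one, one_smul]

theorem d_mul_of_cocycle (a : A.carrier) {b : A.carrier} (hb : A.d b = 0) :
    A.d (a * b) = A.d a * b := by
  obtain ⟨s, hs⟩ := exists_sum_proj A.grading a
  conv_lhs => rw [← hs, Finset.sum_mul, map_sum]
  conv_rhs => rw [← hs, map_sum, Finset.sum_mul]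
  refine Finset.sum_congr rfl fun i _ => ?_
  rw [A.leibniz i _ (proj_mem A.grading i a), hb, mul_zero, smul_zero, add_zero]

/-- The algebra of cocycles `ker d`. -/
def cocycles : Subalgebra k A.carrier where
  carrier := {a | A.d a = 0}
  mul_mem' {a b} ha hb := by
    change A.d (a * b) = 0
    rw [A.d_mul_of_cocycle a hb, show A.d a = 0 from ha, zero_mul]
  add_mem' {a b} ha hb := by
    change A.d (a + b) = 0
    rw [map_add, show A.d a = 0 from ha, show A.d b = 0 from hb, add_zero]
  algebraMap_mem' r := by
    change A.d (algebraMap k A.carrier r) = 0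
    rw [Algebra.algebraMap_eq_smul_one, map_smul, A.d_one, smul_zero]

/-- The ideal `im d` of the algebra of cocycles. -/
def coboundaries : Ideal A.cocycles where
  carrier := {z | ∃ b, (z : A.carrier) = A.d b}
  add_mem' := by
    rintro x y ⟨b, hb⟩ ⟨c, hc⟩
    exact ⟨b + c, by rw [map_add, ← hb, ← hc]; rfl⟩
  zero_mem' := ⟨0, by rw [map_zero]; rfl⟩
  smul_mem' := by
    rintro z x ⟨b, hb⟩
    obtain ⟨c, hc⟩ := A.cocycle_mul_d z.2 b
    exact ⟨c, by rw [← hc, ← hb]; rfl⟩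

instance : A.coboundaries.IsTwoSided where
  mul_mem_of_left := by
    rintro x z ⟨b, hb⟩
    exact ⟨b * z, by rw [A.d_mul_of_cocycle b z.2, ← hb]; rfl⟩

/-- The cohomology algebra `ker d / im d`. -/
def H : Type u := A.cocycles ⧸ A.coboundaries

instance : Ring A.H := Ideal.Quotient.ring A.coboundaries

instance : Algebra k A.H := inferInstanceAs (Algebra k (A.cocycles ⧸ A.coboundaries))

/-- The cohomology class of a cocycle. -/
def cls (a : A.carrier) (ha : A.d a = 0) : A.H :=
  Ideal.Quotient.mk A.coboundaries ⟨a, ha⟩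

/-- The cohomology of a cdga as a cdga with trivial differential. -/
def cohomology : CDGA.{u} k where
  carrier := A.H
  grading := quotPiece A.grading A.cocycles A.coboundaries
  gradedAlgebra := quotGradedAlgebra A.grading A.cocycles A.coboundaries
    (fun _ hz i => A.d_proj_eq_zero hz i)
    (by
      rintro z ⟨b, hb⟩ i
      exact ⟨_, (congrArg _ hb).trans (A.proj_boundary b i)⟩)
  d := 0
  d_mem _ _ _ := Submodule.zero_mem _
  d_d _ := rfl
  leibniz _ _ _ _ := by simp
  graded_comm := by
    rintro m n _ ⟨x, hx, rfl⟩ _ ⟨y, hy, rfl⟩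
    have h : x * y = ((m * n).negOnePow : ℤ) • (y * x) :=
      Subtype.ext ((A.graded_comm m n _ hx _ hy).trans (by rfl))
    have h' := congrArg (Ideal.Quotient.mk A.coboundaries) h
    rw [map_zsmul, map_mul, map_mul] at h'
    exact h'

end CDGA

/-- The ring map induced in cohomology by a ring map commuting with the differentials. -/
def cohMap {k k' : Type*} [Field k] [Field k'] {A : CDGA.{u} k} {B : CDGA.{u} k'}
    (f : A.carrier →+* B.carrier) (hf : ∀ a, f (A.d a) = B.d (f a)) : A.H →+* B.H :=
  Ideal.quotientMap B.coboundaries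
    ((f.comp A.cocycles.val.toRingHom).codRestrict B.cocycles (fun z => by
      change B.d (f z) = 0
      rw [← hf, show A.d z = 0 from z.2, map_zero]))
    (by
      rintro z ⟨b, hb⟩
      exact ⟨f b, by rw [← hf, ← hb]; rfl⟩)

theorem cohMap_mk {k k' : Type*} [Field k] [Field k'] {A : CDGA.{u} k} {B : CDGA.{u} k'}
    (f : A.carrier →+* B.carrier) (hf : ∀ a, f (A.d a) = B.d (f a)) (a : A.carrier)
    (ha : A.d a = 0) :
    cohMap f hf (A.cls a ha) = B.cls (f a) (by rw [← hf, ha, map_zero]) :=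
  rfl

namespace CDGA

variable {k : Type v} [Field k]

/-- The map `H(f)` induced in cohomology by a morphism of cdga's. -/
def Hom.mapH {A B : CDGA.{u} k} (f : A ⟶ B) : A.H →ₐ[k] B.H :=
  { cohMap (f.toAlgHom : A.carrier →+* B.carrier) f.map_d with
    commutes' := fun r => congrArg (Ideal.Quotient.mk B.coboundaries)
      (Subtype.ext (f.toAlgHom.commutes r)) }

/-- The cohomology functor, with values in `k`-algebras. -/
def HFunctor (k : Type v) [Field k] : CDGA.{u} k ⥤ AlgCat.{u} k where
  obj A := AlgCat.of k A.H
  map f := AlgCat.ofHom (Hom.mapH f)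
  map_id A := by
    ext x
    obtain ⟨x, rfl⟩ := Ideal.Quotient.mk_surjective x
    rfl
  map_comp f g := by
    ext x
    obtain ⟨x, rfl⟩ := Ideal.Quotient.mk_surjective x
    rfl

/-- Quasi-isomorphisms of cdga's: morphisms inducing an isomorphism in cohomology. -/
def quasiIso (k : Type v) [Field k] : MorphismProperty (CDGA.{u} k) :=
  fun _ _ f => Function.Bijective (Hom.mapH f)

theorem quasiIso_isInvertedBy (k : Type v) [Field k] :
    (quasiIso.{u} k).IsInvertedBy (HFunctor k) := fun _ _ f hf =>
  (ConcreteCategory.isIso_iff_bijective ((HFunctor k).map f)).2 hf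

/-- The homotopy category of cdga's: the localization at all quasi-isomorphisms. -/
abbrev Ho (k : Type v) [Field k] := (quasiIso.{u} k).Localization

/-- The localization functor. -/
abbrev toHo (k : Type v) [Field k] : CDGA.{u} k ⥤ Ho.{u} k := (quasiIso.{u} k).Q

/-- Cohomology as a functor on the homotopy category. -/
def HoH (k : Type v) [Field k] : Ho.{u} k ⥤ AlgCat.{u} k :=
  Localization.Construction.lift (HFunctor k) (quasiIso_isInvertedBy k)

/-- The map `H(φ)` induced in cohomology by a morphism `φ` of the homotopy category. -/
def hoMapH {A B : CDGA.{u} k} (φ : (toHo k).obj A ⟶ (toHo k).obj B) : A.H →ₐ[k] B.H :=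
  AlgCat.Hom.hom (A := AlgCat.of k A.H) (B := AlgCat.of k B.H) ((HoH k).map φ)

/-- Extension of scalars `K ⊗ A` of a cdga along a field extension. -/
def baseChange (K : Type) [Field K] [Algebra ℚ K] (A : CDGA.{u} ℚ) : CDGA.{u} K where
  carrier := K ⊗[ℚ] A.carrier
  grading n := (A.grading n).baseChange K
  d := A.d.baseChange K
  d_mem n x hx := by
    rw [Submodule.baseChange_eq_span] at hx
    induction hx using Submodule.span_induction with
    | mem x hx =>
      obtain ⟨a, ha, rfl⟩ := hx
      exact Submodule.tmul_mem_baseChange_of_mem 1 (A.d_mem n a ha)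
    | zero => rw [map_zero]; exact Submodule.zero_mem _
    | add x y _ _ hx hy => rw [map_add]; exact Submodule.add_mem _ hx hy
    | smul c x _ hx => rw [map_smul]; exact Submodule.smul_mem _ c hx
  d_d x := by
    induction x using TensorProduct.induction_on with
    | zero => simp
    | tmul c a => simp [A.d_d]
    | add x y hx hy => rw [map_add, map_add, hx, hy, add_zero]
  leibniz n x hx y := by
    rw [Submodule.baseChange_eq_span] at hx
    induction hx using Submodule.span_induction with
    | mem x hx =>
      obtain ⟨a, ha, rfl⟩ := hx
      induction y using TensorProduct.induction_on with
      | zero => simp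
      | tmul c b =>
        simp only [TensorProduct.mk_apply, Algebra.TensorProduct.tmul_mul_tmul,
          LinearMap.baseChange_tmul]
        rw [A.leibniz n a ha b, TensorProduct.tmul_add, TensorProduct.tmul_smul]
      | add y z hy hz =>
        rw [mul_add, map_add, hy, hz, mul_add, map_add, mul_add, smul_add]
        abel
    | zero => simp
    | add x z _ _ hx hz =>
      rw [add_mul, map_add, hx, hz, map_add, add_mul, add_mul, smul_add]
      abel
    | smul c x _ hx =>
      rw [smul_mul_assoc, map_smul, hx, map_smul, smul_mul_assoc, smul_mul_assoc, smul_add,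
        smul_comm c]
  graded_comm m n x hx y hy := by
    rw [Submodule.baseChange_eq_span] at hx hy
    induction hx using Submodule.span_induction with
    | mem x hx =>
      obtain ⟨a, ha, rfl⟩ := hx
      induction hy using Submodule.span_induction with
      | mem y hy =>
        obtain ⟨b, hb, rfl⟩ := hy
        simp only [TensorProduct.mk_apply, Algebra.TensorProduct.tmul_mul_tmul]
        rw [A.graded_comm m n a ha b hb, TensorProduct.tmul_smul]
      | zero => simp
      | add y z _ _ hy hz => rw [mul_add, add_mul, hy, hz, smul_add]
      | smul c y _ hy => rw [mul_smul_comm, smul_mul_assoc, hy, smul_comm]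
    | zero => simp
    | add x z _ _ hx hz => rw [mul_add, add_mul, hx, hz, smul_add]
    | smul c x _ hx => rw [mul_smul_comm, smul_mul_assoc, hx, smul_comm]

/-- Extension of scalars of a morphism of cdga's. -/
def baseChangeMap (K : Type) [Field K] [Algebra ℚ K] {A B : CDGA.{u} ℚ} (f : A ⟶ B) :
    baseChange K A ⟶ baseChange K B where
  toAlgHom := Algebra.TensorProduct.map (AlgHom.id K K) f.toAlgHom
  map_mem n x hx := by
    have h : (A.grading n).baseChange K ≤ ((B.grading n).baseChange K).comap
        (Algebra.TensorProduct.map (AlgHom.id K K) f.toAlgHom).toLinearMap := by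
      rw [Submodule.baseChange_eq_span, Submodule.span_le]
      rintro _ ⟨a, ha, rfl⟩
      exact Submodule.tmul_mem_baseChange_of_mem 1 (f.map_mem n a ha)
    exact h hx
  map_d x := by
    change K ⊗[ℚ] A.carrier at x
    change Algebra.TensorProduct.map (AlgHom.id K K) f.toAlgHom (A.d.baseChange K x) =
      B.d.baseChange K (Algebra.TensorProduct.map (AlgHom.id K K) f.toAlgHom x)
    induction x using TensorProduct.induction_on with
    | zero => simp
    | tmul c a => simp [f.map_d]
    | add x y hx hy => rw [map_add, map_add, hx, hy, map_add, map_add]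

/-- The canonical map `H(A) → H(K ⊗ A)`, `[a] ↦ [1 ⊗ a]`. -/
def toBaseChangeH (K : Type) [Field K] [Algebra ℚ K] (A : CDGA.{u} ℚ) :
    A.H →+* (baseChange K A).H :=
  cohMap (B := baseChange K A)
    (Algebra.TensorProduct.includeRight : A.carrier →ₐ[ℚ] K ⊗[ℚ] A.carrier).toRingHom
    (fun _ => rfl)

end CDGA

/-! ### Bigraded bidifferential algebras with real structure -/

/-- An `ℝ`-cbba: a commutative, bigraded, bidifferential algebra over `ℂ` with real structure.
`del` and `delbar` are the differentials of bidegree `(1,0)` and `(0,1)`; the signs are governed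
by the total degree. The real structure `σ` is an antilinear involution, compatible with product
and unit, with `σ A^{p,q} ⊆ A^{q,p}` and `σ (∂ + ∂̄) σ = ∂ + ∂̄`. -/
structure RCBBA.{w} where
  carrier : Type w
  [ring : Ring carrier]
  [algebra : Algebra ℂ carrier]
  grading : ℤ × ℤ → Submodule ℂ carrier
  [gradedAlgebra : GradedAlgebra grading]
  del : carrier →ₗ[ℂ] carrier
  delbar : carrier →ₗ[ℂ] carrier
  del_mem : ∀ p q, ∀ a ∈ grading (p, q), del a ∈ grading (p + 1, q)
  delbar_mem : ∀ p q, ∀ a ∈ grading (p, q), delbar a ∈ grading (p, q + 1)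
  del_del : ∀ a, del (del a) = 0
  delbar_delbar : ∀ a, delbar (delbar a) = 0
  del_delbar : ∀ a, del (delbar a) + delbar (del a) = 0
  del_leibniz : ∀ p q, ∀ a ∈ grading (p, q), ∀ b,
    del (a * b) = del a * b + ((p + q).negOnePow : ℤ) • (a * del b)
  delbar_leibniz : ∀ p q, ∀ a ∈ grading (p, q), ∀ b,
    delbar (a * b) = delbar a * b + ((p + q).negOnePow : ℤ) • (a * delbar b)
  graded_comm : ∀ p q p' q', ∀ a ∈ grading (p, q), ∀ b ∈ grading (p', q'),
    a * b = (((p + q) * (p' + q')).negOnePow : ℤ) • (b * a)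
  σ : carrier →+* carrier
  σ_smul : ∀ (c : ℂ) (a : carrier), σ (c • a) = (starRingEnd ℂ) c • σ a
  σ_σ : ∀ a, σ (σ a) = a
  σ_mem : ∀ p q, ∀ a ∈ grading (p, q), σ a ∈ grading (q, p)
  σ_d : ∀ a, σ (del (σ a) + delbar (σ a)) = del a + delbar a

namespace RCBBA

attribute [instance] RCBBA.ring RCBBA.algebra RCBBA.gradedAlgebra

/-- Morphisms of `ℝ`-cbba's: unital algebra maps preserving the bidegree and commuting with
`d = ∂ + ∂̄` (hence with `∂` and `∂̄`) and with the real structures. -/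
@[ext]
structure Hom (A B : RCBBA.{u}) where
  toAlgHom : A.carrier →ₐ[ℂ] B.carrier
  map_mem : ∀ b, ∀ a ∈ A.grading b, toAlgHom a ∈ B.grading b
  map_del : ∀ a, toAlgHom (A.del a) = B.del (toAlgHom a)
  map_delbar : ∀ a, toAlgHom (A.delbar a) = B.delbar (toAlgHom a)
  map_σ : ∀ a, toAlgHom (A.σ a) = B.σ (toAlgHom a)

instance : Category RCBBA.{u} where
  Hom A B := Hom A B
  id A := ⟨AlgHom.id ℂ A.carrier, fun _ _ h => h, fun _ => rfl, fun _ => rfl, fun _ => rfl⟩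
  comp f g := ⟨g.toAlgHom.comp f.toAlgHom, fun n a h => g.map_mem n _ (f.map_mem n a h),
    fun a => (congrArg g.toAlgHom (f.map_del a)).trans (g.map_del _),
    fun a => (congrArg g.toAlgHom (f.map_delbar a)).trans (g.map_delbar _),
    fun a => (congrArg g.toAlgHom (f.map_σ a)).trans (g.map_σ _)⟩

variable (A : RCBBA.{u})

theorem proj_del (b : ℤ × ℤ) (a : A.carrier) :
    GradedAlgebra.proj A.grading (b + (1, 0)) (A.del a) =
      A.del (GradedAlgebra.proj A.grading b a) := by
  have hm : ∀ j : ℤ × ℤ, ∀ x ∈ A.grading j, A.del x ∈ A.grading (j + (1, 0)) := by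
    rintro ⟨p, q⟩ x hx
    simpa using A.del_mem p q x hx
  exact proj_map A.grading A.del.toAddMonoidHom (· + (1, 0)) (add_left_injective _)
    (fun j => (GradedAlgebra.proj A.grading j).toAddMonoidHom)
    (fun _ x hx => proj_same A.grading (hm _ x hx))
    (fun _ _ h x hx => proj_ne A.grading (hm _ x hx) h) b a

theorem proj_delbar (b : ℤ × ℤ) (a : A.carrier) :
    GradedAlgebra.proj A.grading (b + (0, 1)) (A.delbar a) =
      A.delbar (GradedAlgebra.proj A.grading b a) := by
  have hm : ∀ j : ℤ × ℤ, ∀ x ∈ A.grading j, A.delbar x ∈ A.grading (j + (0, 1)) := by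
    rintro ⟨p, q⟩ x hx
    simpa using A.delbar_mem p q x hx
  exact proj_map A.grading A.delbar.toAddMonoidHom (· + (0, 1)) (add_left_injective _)
    (fun j => (GradedAlgebra.proj A.grading j).toAddMonoidHom)
    (fun _ x hx => proj_same A.grading (hm _ x hx))
    (fun _ _ h x hx => proj_ne A.grading (hm _ x hx) h) b a

theorem proj_σ (b : ℤ × ℤ) (a : A.carrier) :
    GradedAlgebra.proj A.grading b.swap (A.σ a) = A.σ (GradedAlgebra.proj A.grading b a) :=
  proj_map A.grading A.σ.toAddMonoidHom Prod.swap Prod.swap_injective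
    (fun j => (GradedAlgebra.proj A.grading j).toAddMonoidHom)
    (fun _ x hx => proj_same A.grading (A.σ_mem _ _ x hx))
    (fun _ _ h x hx => proj_ne A.grading (A.σ_mem _ _ x hx) h) b a

/-- The real structure interchanges the two differentials. -/
theorem σ_del (a : A.carrier) : A.σ (A.del a) = A.delbar (A.σ a) := by
  have key : ∀ (b : ℤ × ℤ), ∀ x ∈ A.grading b, A.σ (A.del x) = A.delbar (A.σ x) := by
    rintro ⟨p, q⟩ x hx
    have h := A.σ_d (A.σ x)
    rw [A.σ_σ, map_add] at h
    have h' := congrArg (GradedAlgebra.proj A.grading (q, p + 1)) h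
    rw [map_add, map_add, proj_same A.grading (A.σ_mem _ _ _ (A.del_mem p q x hx)),
      proj_ne A.grading (A.σ_mem _ _ _ (A.delbar_mem p q x hx)) (by simp),
      proj_ne A.grading (A.del_mem _ _ _ (A.σ_mem p q x hx)) (by simp),
      proj_same A.grading (A.delbar_mem _ _ _ (A.σ_mem p q x hx)), add_zero, zero_add] at h'
    exact h'
  induction a using DirectSum.Decomposition.inductionOn A.grading with
  | zero => simp
  | homogeneous m => exact key _ _ m.2
  | add a b ha hb => simp only [map_add, ha, hb]

theorem σ_delbar (a : A.carrier) : A.σ (A.delbar a) = A.del (A.σ a) := by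
  have h := A.σ_del (A.σ a)
  rw [A.σ_σ] at h
  rw [← h, A.σ_σ]

/-! #### The total complex -/

/-- The total grading: `to(A)^n` is the (direct) sum of the `A^{p,q}` with `p + q = n`. -/
def totalGrading (n : ℤ) : Submodule ℂ A.carrier :=
  ⨆ b : ℤ × ℤ, ⨆ (_ : b.1 + b.2 = n), A.grading b

theorem totalGrading_le {n : ℤ} {S : Submodule ℂ A.carrier}
    (h : ∀ p q, p + q = n → A.grading (p, q) ≤ S) : A.totalGrading n ≤ S :=
  iSup₂_le fun b hb => h b.1 b.2 hb

theorem le_totalGrading (p q n : ℤ) (h : p + q = n) : A.grading (p, q) ≤ A.totalGrading n :=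
  le_iSup₂_of_le (p, q) h le_rfl

/-- The projection to the part of total degree `n`. -/
def totalProj (n : ℤ) : A.carrier →ₗ[ℂ] A.carrier :=
  (DirectSum.decomposeLinearEquiv A.grading).symm.toLinearMap ∘ₗ
    (DFinsupp.filterLinearMap ℂ (fun b => A.grading b) (fun b : ℤ × ℤ => b.1 + b.2 = n)) ∘ₗ
      (DirectSum.decomposeLinearEquiv A.grading).toLinearMap

theorem totalProj_of_mem {b : ℤ × ℤ} {x : A.carrier} (hx : x ∈ A.grading b) (n : ℤ) :
    A.totalProj n x = if b.1 + b.2 = n then x else 0 := by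
  simp only [totalProj, LinearMap.comp_apply, LinearEquiv.coe_coe,
    DirectSum.decomposeLinearEquiv_apply, DirectSum.decompose_of_mem A.grading hx]
  have h := DFinsupp.filter_single (β := fun b => A.grading b)
    (fun b : ℤ × ℤ => b.1 + b.2 = n) b ⟨x, hx⟩
  change (DirectSum.decomposeLinearEquiv A.grading).symm
    (DFinsupp.filter (fun b : ℤ × ℤ => b.1 + b.2 = n) (DFinsupp.single b ⟨x, hx⟩)) = _
  rw [h]
  split_ifs
  · exact DirectSum.decompose_symm_of A.grading ⟨x, hx⟩
  · exact map_zero _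

theorem totalProj_same {n : ℤ} {x : A.carrier} (hx : x ∈ A.totalGrading n) :
    A.totalProj n x = x := by
  have : A.totalGrading n ≤ LinearMap.ker (A.totalProj n - LinearMap.id) :=
    A.totalGrading_le fun p q h x hx => by
      rw [LinearMap.mem_ker, LinearMap.sub_apply, A.totalProj_of_mem hx, if_pos h]
      exact sub_self x
  exact sub_eq_zero.1 (this hx)

theorem totalProj_ne {m n : ℤ} (hmn : m ≠ n) {x : A.carrier} (hx : x ∈ A.totalGrading n) :
    A.totalProj m x = 0 := by
  have : A.totalGrading n ≤ LinearMap.ker (A.totalProj m) :=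
    A.totalGrading_le fun p q h x hx => by
      rw [LinearMap.mem_ker, A.totalProj_of_mem hx, if_neg (fun e => hmn (e.symm.trans h))]
  exact this hx

theorem totalGrading_isInternal : DirectSum.IsInternal A.totalGrading := by
  refine isInternal_of_proj _ A.totalProj (fun _ _ h => A.totalProj_same h)
    (fun _ _ h _ hx => A.totalProj_ne h hx) fun x => ?_
  induction x using DirectSum.Decomposition.inductionOn A.grading with
  | zero => exact Submodule.zero_mem _
  | @homogeneous b m =>
    exact Submodule.mem_iSup_of_mem (b.1 + b.2) (A.le_totalGrading b.1 b.2 _ rfl m.2)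
  | add a b ha hb => exact Submodule.add_mem _ ha hb

instance totalGradedAlgebra : GradedAlgebra A.totalGrading :=
  { one_mem := A.le_totalGrading 0 0 0 rfl (SetLike.one_mem_graded A.grading)
    mul_mem := by
      intro m n x y hx hy
      have h1 : ∀ y ∈ A.totalGrading n, A.totalGrading m ≤
          (A.totalGrading (m + n)).comap (LinearMap.mulRight ℂ y) := by
        intro y hy
        refine A.totalGrading_le fun p q h x hx => ?_
        have h2 : A.totalGrading n ≤
            (A.totalGrading (m + n)).comap (LinearMap.mulLeft ℂ x) :=
          A.totalGrading_le fun p' q' h' y hy =>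
            A.le_totalGrading (p + p') (q + q') _ (by rw [← h, ← h']; ring)
              (SetLike.mul_mem_graded hx hy)
        exact h2 hy
      exact h1 y hy hx
    toDecomposition := A.totalGrading_isInternal.chooseDecomposition }

/-- The total differential `d = ∂ + ∂̄`. -/
def d : A.carrier →ₗ[ℂ] A.carrier := A.del + A.delbar

theorem d_apply (a : A.carrier) : A.d a = A.del a + A.delbar a := rfl

/-- The total cdga `to(A)` over `ℂ`. -/
def total : CDGA.{u} ℂ where
  carrier := A.carrier
  grading := A.totalGrading
  d := A.d
  d_mem n a ha := by
    have : A.totalGrading n ≤ (A.totalGrading (n + 1)).comap A.d :=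
      A.totalGrading_le fun p q h x hx => Submodule.add_mem _
        (A.le_totalGrading (p + 1) q _ (by rw [← h]; ring) (A.del_mem p q x hx))
        (A.le_totalGrading p (q + 1) _ (by rw [← h]; ring) (A.delbar_mem p q x hx))
    exact this ha
  d_d a := by
    rw [A.d_apply, A.d_apply, map_add, map_add, A.del_del, A.delbar_delbar, zero_add, add_zero,
      A.del_delbar]
  leibniz n a ha b := by
    have : A.totalGrading n ≤ LinearMap.ker
        (A.d ∘ₗ LinearMap.mulRight ℂ b - (LinearMap.mulRight ℂ b ∘ₗ A.d +
          (n.negOnePow : ℤ) • LinearMap.mulRight ℂ (A.d b))) :=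
      A.totalGrading_le fun p q h x hx => by
        rw [LinearMap.mem_ker, LinearMap.sub_apply, sub_eq_zero]
        change A.d (x * b) = A.d x * b + (n.negOnePow : ℤ) • (x * A.d b)
        rw [A.d_apply, A.del_leibniz p q x hx, A.delbar_leibniz p q x hx, A.d_apply, A.d_apply,
          h, add_mul, mul_add, smul_add]
        abel
    exact sub_eq_zero.1 (this ha)
  graded_comm m n a ha b hb := by
    have h1 : ∀ b ∈ A.totalGrading n, A.totalGrading m ≤ LinearMap.ker
        (LinearMap.mulRight ℂ b - ((m * n).negOnePow : ℤ) • LinearMap.mulLeft ℂ b) := by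
      intro b hb
      refine A.totalGrading_le fun p q h x hx => ?_
      have h2 : A.totalGrading n ≤ LinearMap.ker
          (LinearMap.mulLeft ℂ x - ((m * n).negOnePow : ℤ) • LinearMap.mulRight ℂ x) :=
        A.totalGrading_le fun p' q' h' y hy => by
          rw [LinearMap.mem_ker, LinearMap.sub_apply, sub_eq_zero]
          change x * y = ((m * n).negOnePow : ℤ) • (y * x)
          rw [A.graded_comm p q p' q' x hx y hy, h, h']
      exact h2 hb
    exact sub_eq_zero.1 (h1 b hb ha)

/-- The real subalgebra of `σ`-fixed points. -/
def fixed : Subalgebra ℝ A.carrier where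
  carrier := {a | A.σ a = a}
  mul_mem' {a b} ha hb := by
    change A.σ (a * b) = a * b
    rw [map_mul, show A.σ a = a from ha, show A.σ b = b from hb]
  add_mem' {a b} ha hb := by
    change A.σ (a + b) = a + b
    rw [map_add, show A.σ a = a from ha, show A.σ b = b from hb]
  algebraMap_mem' r := by
    change A.σ (algebraMap ℝ A.carrier r) = algebraMap ℝ A.carrier r
    rw [IsScalarTower.algebraMap_apply ℝ ℂ A.carrier, Algebra.algebraMap_eq_smul_one, A.σ_smul,
      map_one]
    simp

theorem σ_d_comm (a : A.carrier) : A.σ (A.d a) = A.d (A.σ a) := by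
  rw [A.d_apply, map_add, A.σ_del, A.σ_delbar, A.d_apply, add_comm]

theorem σ_totalProj (n : ℤ) (a : A.carrier) : A.σ (A.totalProj n a) = A.totalProj n (A.σ a) := by
  induction a using DirectSum.Decomposition.inductionOn A.grading with
  | zero => simp
  | @homogeneous b m =>
    rw [A.totalProj_of_mem m.2, A.totalProj_of_mem (A.σ_mem b.1 b.2 _ m.2), add_comm b.2 b.1]
    split_ifs
    · rfl
    · exact map_zero _
  | add a b ha hb => simp only [map_add, ha, hb]

theorem exists_sum_totalProj (x : A.carrier) :
    ∃ s : Finset ℤ, ∑ n ∈ s, A.totalProj n x = x := by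
  obtain ⟨s, hs⟩ := exists_sum_proj A.totalGrading x
  refine ⟨s, ?_⟩
  conv_rhs => rw [← hs]
  refine Finset.sum_congr rfl fun n _ => ?_
  exact proj_map A.totalGrading (AddMonoidHom.id _) id Function.injective_id
    (fun j => (A.totalProj j).toAddMonoidHom) (fun _ _ hx => A.totalProj_same hx)
    (fun _ _ h _ hx => A.totalProj_ne h hx) n x

/-- The total grading on the `σ`-fixed points. -/
def fixedGrading (n : ℤ) : Submodule ℝ A.fixed :=
  ((A.totalGrading n).restrictScalars ℝ).comap A.fixed.val.toLinearMap

theorem fixedGrading_isInternal : DirectSum.IsInternal A.fixedGrading := by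
  let P : ℤ → A.fixed →ₗ[ℝ] A.fixed := fun n =>
    (((A.totalProj n).restrictScalars ℝ).comp A.fixed.val.toLinearMap).codRestrict
      (Subalgebra.toSubmodule A.fixed) (fun z => by
        change A.σ (A.totalProj n z) = A.totalProj n z
        rw [A.σ_totalProj, show A.σ z = z from z.2])
  refine isInternal_of_proj _ P (fun _ _ hx => Subtype.ext (A.totalProj_same hx))
    (fun _ _ h _ hx => Subtype.ext (A.totalProj_ne h hx)) fun x => ?_
  obtain ⟨s, hs⟩ := A.exists_sum_totalProj x
  have hx : x = ∑ n ∈ s, P n x := Subtype.ext (by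
    rw [AddSubmonoidClass.coe_finsetSum]; exact hs.symm)
  rw [hx]
  refine Submodule.sum_mem _ fun n _ => Submodule.mem_iSup_of_mem n ?_
  change A.totalProj n x ∈ A.totalGrading n
  obtain ⟨t, ht⟩ := exists_sum_proj A.grading (x : A.carrier)
  rw [← ht, map_sum]
  refine Submodule.sum_mem _ fun b _ => ?_
  rw [A.totalProj_of_mem (proj_mem A.grading b _)]
  split_ifs with h
  · exact A.le_totalGrading b.1 b.2 n h (proj_mem A.grading b _)
  · exact Submodule.zero_mem _

/-- The real total cdga `to(A)^{σ = Id}`. -/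
def realTotal : CDGA.{u} ℝ where
  carrier := A.fixed
  grading := A.fixedGrading
  gradedAlgebra :=
    { one_mem := SetLike.one_mem_graded A.totalGrading
      mul_mem := fun _ _ _ _ hx hy => SetLike.mul_mem_graded (A := A.totalGrading) hx hy
      toDecomposition := A.fixedGrading_isInternal.chooseDecomposition }
  d := ((A.d.restrictScalars ℝ).comp A.fixed.val.toLinearMap).codRestrict
    (Subalgebra.toSubmodule A.fixed) (fun z => by
      change A.σ (A.d z) = A.d z
      rw [A.σ_d_comm, show A.σ z = z from z.2])
  d_mem n a ha := A.total.d_mem n a.1 ha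
  d_d a := Subtype.ext (A.total.d_d a.1)
  leibniz n a ha b := Subtype.ext (A.total.leibniz n a.1 ha b.1)
  graded_comm m n a ha b hb := Subtype.ext (A.total.graded_comm m n a.1 ha b.1 hb)

/-- The morphism `to(f)^{σ = Id}`. -/
def realTotalMap {A B : RCBBA.{u}} (f : A ⟶ B) : A.realTotal ⟶ B.realTotal where
  toAlgHom := ((f.toAlgHom.restrictScalars ℝ).comp A.fixed.val).codRestrict B.fixed (fun z => by
      change B.σ (f.toAlgHom z) = f.toAlgHom z
      rw [← f.map_σ, show A.σ z = z from z.2])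
  map_mem n a ha := by
    have : A.totalGrading n ≤ (B.totalGrading n).comap f.toAlgHom.toLinearMap :=
      A.totalGrading_le fun p q h x hx => B.le_totalGrading p q n h (f.map_mem _ x hx)
    exact this ha
  map_d := fun a : A.fixed => Subtype.ext (by
    change f.toAlgHom (A.del a.1 + A.delbar a.1) =
      B.del (f.toAlgHom a.1) + B.delbar (f.toAlgHom a.1)
    rw [map_add, f.map_del, f.map_delbar])

/-- The map `H(to(A)^{σ = Id}) → H_dR(A)` induced by the inclusion of the real forms. -/
def realToComplexH : A.realTotal.H →+* A.total.H :=
  cohMap (A := A.realTotal) (B := A.total) A.fixed.val.toRingHom (fun _ => rfl)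

end RCBBA

namespace RCBBA

variable (A : RCBBA.{u})

/-! #### Bott-Chern and Aeppli cohomology -/

theorem del_one : A.del 1 = 0 := by
  have h := A.del_leibniz 0 0 1 (SetLike.one_mem_graded A.grading) 1
  simpa using h

theorem delbar_one : A.delbar 1 = 0 := by
  have h := A.delbar_leibniz 0 0 1 (SetLike.one_mem_graded A.grading) 1
  simpa using h

theorem del_proj_eq_zero {a : A.carrier} (h : A.del a = 0) (b : ℤ × ℤ) :
    A.del (GradedAlgebra.proj A.grading b a) = 0 := by
  rw [← proj_del, h, map_zero]

theorem delbar_proj_eq_zero {a : A.carrier} (h : A.delbar a = 0) (b : ℤ × ℤ) :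
    A.delbar (GradedAlgebra.proj A.grading b a) = 0 := by
  rw [← proj_delbar, h, map_zero]

theorem proj_del_delbar (a : A.carrier) (b : ℤ × ℤ) :
    GradedAlgebra.proj A.grading b (A.del (A.delbar a)) =
      A.del (A.delbar (GradedAlgebra.proj A.grading (b - (1, 0) - (0, 1)) a)) := by
  rw [← proj_delbar, sub_add_cancel, ← proj_del, sub_add_cancel]

theorem del_mul_of_closed (a : A.carrier) {z : A.carrier} (hz : A.del z = 0) :
    A.del (a * z) = A.del a * z := by
  obtain ⟨s, hs⟩ := exists_sum_proj A.grading a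
  conv_lhs => rw [← hs, Finset.sum_mul, map_sum]
  conv_rhs => rw [← hs, map_sum, Finset.sum_mul]
  refine Finset.sum_congr rfl fun b _ => ?_
  rw [A.del_leibniz b.1 b.2 _ (proj_mem A.grading b a), hz, mul_zero, smul_zero, add_zero]

theorem delbar_mul_of_closed (a : A.carrier) {z : A.carrier} (hz : A.delbar z = 0) :
    A.delbar (a * z) = A.delbar a * z := by
  obtain ⟨s, hs⟩ := exists_sum_proj A.grading a
  conv_lhs => rw [← hs, Finset.sum_mul, map_sum]
  conv_rhs => rw [← hs, map_sum, Finset.sum_mul]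
  refine Finset.sum_congr rfl fun b _ => ?_
  rw [A.delbar_leibniz b.1 b.2 _ (proj_mem A.grading b a), hz, mul_zero, smul_zero, add_zero]

theorem closed_mul_del_delbar {z : A.carrier} (hz : A.del z = 0) (hz' : A.delbar z = 0)
    (a : A.carrier) : z * A.del (A.delbar a) = A.del (A.delbar (z * a)) := by
  obtain ⟨s, hs⟩ := exists_sum_proj A.grading z
  conv_lhs => rw [← hs, Finset.sum_mul]
  conv_rhs => rw [← hs, Finset.sum_mul, map_sum, map_sum]
  refine Finset.sum_congr rfl fun b _ => ?_
  rw [A.delbar_leibniz b.1 b.2 _ (proj_mem A.grading b z), A.delbar_proj_eq_zero hz' b, zero_mul,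
    zero_add, map_zsmul, A.del_leibniz b.1 b.2 _ (proj_mem A.grading b z),
    A.del_proj_eq_zero hz b, zero_mul, zero_add, smul_smul, ← Units.val_mul, Int.units_mul_self,
    Units.val_one, one_smul]

/-- The algebra `ker ∂ ∩ ker ∂̄`. -/
def bcCocycles : Subalgebra ℂ A.carrier where
  carrier := {a | A.del a = 0 ∧ A.delbar a = 0}
  mul_mem' {a b} ha hb := by
    refine ⟨?_, ?_⟩
    · rw [A.del_mul_of_closed a hb.1, ha.1, zero_mul]
    · rw [A.delbar_mul_of_closed a hb.2, ha.2, zero_mul]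
  add_mem' {a b} ha hb := by
    refine ⟨?_, ?_⟩
    · rw [map_add, ha.1, hb.1, add_zero]
    · rw [map_add, ha.2, hb.2, add_zero]
  algebraMap_mem' r := by
    rw [Algebra.algebraMap_eq_smul_one]
    refine ⟨?_, ?_⟩
    · rw [map_smul, A.del_one, smul_zero]
    · rw [map_smul, A.delbar_one, smul_zero]

/-- The ideal `im ∂∂̄` of `ker ∂ ∩ ker ∂̄`. -/
def bcBoundaries : Ideal A.bcCocycles where
  carrier := {z | ∃ b, (z : A.carrier) = A.del (A.delbar b)}
  add_mem' := by
    rintro x y ⟨b, hb⟩ ⟨c, hc⟩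
    exact ⟨b + c, by rw [map_add, map_add, ← hb, ← hc]; rfl⟩
  zero_mem' := ⟨0, by rw [map_zero, map_zero]; rfl⟩
  smul_mem' := by
    rintro z x ⟨b, hb⟩
    exact ⟨z * b, by rw [← A.closed_mul_del_delbar z.2.1 z.2.2, ← hb]; rfl⟩

instance : A.bcBoundaries.IsTwoSided where
  mul_mem_of_left := by
    rintro x z ⟨b, hb⟩
    exact ⟨b * z, by
      rw [A.delbar_mul_of_closed b z.2.2, A.del_mul_of_closed _ z.2.1, ← hb]; rfl⟩

/-- Bott-Chern cohomology `(ker ∂ ∩ ker ∂̄) / im ∂∂̄`, as an algebra. -/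
def HBC : Type u := A.bcCocycles ⧸ A.bcBoundaries

instance : Ring A.HBC := Ideal.Quotient.ring A.bcBoundaries

instance : Algebra ℂ A.HBC := inferInstanceAs (Algebra ℂ (A.bcCocycles ⧸ A.bcBoundaries))

/-- The real structure on Bott-Chern cohomology. -/
def bcσ : A.HBC →+* A.HBC :=
  Ideal.quotientMap A.bcBoundaries
    ((A.σ.comp A.bcCocycles.val.toRingHom).codRestrict A.bcCocycles (fun z => by
      refine ⟨?_, ?_⟩
      · change A.del (A.σ z) = 0
        rw [← A.σ_delbar, z.2.2, map_zero]
      · change A.delbar (A.σ z) = 0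
        rw [← A.σ_del, z.2.1, map_zero]))
    (by
      rintro z ⟨b, hb⟩
      refine ⟨-A.σ b, ?_⟩
      change A.σ z = _
      rw [hb, A.σ_del, A.σ_delbar, map_neg, map_neg]
      exact eq_neg_of_add_eq_zero_right (A.del_delbar _))

/-- Bott-Chern cohomology as an `ℝ`-cbba with trivial differentials. -/
def bcCohomology : RCBBA.{u} where
  carrier := A.HBC
  grading := quotPiece A.grading A.bcCocycles A.bcBoundaries
  gradedAlgebra := quotGradedAlgebra A.grading A.bcCocycles A.bcBoundaries
    (fun _ hz i => ⟨A.del_proj_eq_zero hz.1 i, A.delbar_proj_eq_zero hz.2 i⟩)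
    (by
      rintro z ⟨b, hb⟩ i
      exact ⟨_, (congrArg _ hb).trans (A.proj_del_delbar b i)⟩)
  del := 0
  delbar := 0
  del_mem _ _ _ _ := Submodule.zero_mem _
  delbar_mem _ _ _ _ := Submodule.zero_mem _
  del_del _ := rfl
  delbar_delbar _ := rfl
  del_delbar _ := add_zero _
  del_leibniz _ _ _ _ _ := by simp
  delbar_leibniz _ _ _ _ _ := by simp
  graded_comm := by
    rintro p q p' q' _ ⟨x, hx, rfl⟩ _ ⟨y, hy, rfl⟩
    have h : x * y = (((p + q) * (p' + q')).negOnePow : ℤ) • (y * x) :=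
      Subtype.ext ((A.graded_comm p q p' q' _ hx _ hy).trans (by rfl))
    have h' := congrArg (Ideal.Quotient.mk A.bcBoundaries) h
    rw [map_zsmul, map_mul, map_mul] at h'
    exact h'
  σ := A.bcσ
  σ_smul c x := by
    obtain ⟨x, rfl⟩ := Ideal.Quotient.mk_surjective x
    exact congrArg (Ideal.Quotient.mk A.bcBoundaries) (Subtype.ext (A.σ_smul c x.1))
  σ_σ x := by
    obtain ⟨x, rfl⟩ := Ideal.Quotient.mk_surjective x
    exact congrArg (Ideal.Quotient.mk A.bcBoundaries) (Subtype.ext (A.σ_σ x.1))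
  σ_mem := by
    rintro p q _ ⟨x, hx, rfl⟩
    exact ⟨_, A.σ_mem p q x.1 hx, rfl⟩
  σ_d _ := by simp

/-- The canonical map `H_BC(A) → H_dR(A)` induced by the identity. -/
def bcToDR : A.HBC →+* A.total.H :=
  Ideal.quotientMap A.total.coboundaries
    (A.bcCocycles.val.toRingHom.codRestrict A.total.cocycles (fun z => by
      change A.del z.1 + A.delbar z.1 = 0
      rw [z.2.1, z.2.2, add_zero]))
    (by
      rintro z ⟨b, hb⟩
      refine ⟨A.delbar b, hb.trans ?_⟩
      change _ = A.del (A.delbar b) + A.delbar (A.delbar b)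
      rw [A.delbar_delbar, add_zero])

/-- The `∂∂̄`-Lemma: the canonical map `H_BC(A) → H_dR(A)` is injective. -/
def DdbarLemma : Prop := Function.Injective A.bcToDR

/-- `H_dR^{p,q}(A)`: the classes in `H_dR(A)` of `d`-closed elements of pure bidegree `(p, q)`,
i.e. the image of `H_BC^{p,q}(A)`. -/
def dRPiece (b : ℤ × ℤ) : Submodule ℂ A.total.H :=
  quotPiece (k := ℂ) (A := A.total.carrier) A.grading A.total.cocycles A.total.coboundaries b

/-- Aeppli cohomology `ker ∂∂̄ / (im ∂ + im ∂̄)`. -/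
abbrev HA : Type u :=
  LinearMap.ker (A.del ∘ₗ A.delbar) ⧸
    (LinearMap.range A.del ⊔ LinearMap.range A.delbar).submoduleOf
      (LinearMap.ker (A.del ∘ₗ A.delbar))

variable {A} {B : RCBBA.{u}}

/-- The map `H_BC(f)`. -/
def Hom.mapBC (f : A ⟶ B) : A.HBC →+* B.HBC :=
  Ideal.quotientMap B.bcBoundaries
    (((f.toAlgHom : A.carrier →+* B.carrier).comp A.bcCocycles.val.toRingHom).codRestrict
      B.bcCocycles (fun z => by
        refine ⟨?_, ?_⟩
        · change B.del (f.toAlgHom z.1) = 0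
          rw [← f.map_del, z.2.1, map_zero]
        · change B.delbar (f.toAlgHom z.1) = 0
          rw [← f.map_delbar, z.2.2, map_zero]))
    (by
      rintro z ⟨b, hb⟩
      refine ⟨f.toAlgHom b, ?_⟩
      rw [← f.map_delbar, ← f.map_del, ← hb]; rfl)

/-- The map `H_A(f)`. -/
def Hom.mapA (f : A ⟶ B) : A.HA →ₗ[ℂ] B.HA :=
  Submodule.mapQ _ _
    (f.toAlgHom.toLinearMap.restrict (p := LinearMap.ker (A.del ∘ₗ A.delbar))
      (q := LinearMap.ker (B.del ∘ₗ B.delbar)) (fun x hx => by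
        change B.del (B.delbar (f.toAlgHom x)) = 0
        rw [← f.map_delbar, ← f.map_del, show A.del (A.delbar x) = 0 from hx, map_zero]))
    (by
      intro x hx
      obtain ⟨y, ⟨a, rfl⟩, z, ⟨b, rfl⟩, h⟩ := Submodule.mem_sup.1 (show (x : A.carrier) ∈ _ from hx)
      refine Submodule.mem_sup.2 ⟨_, ⟨f.toAlgHom a, rfl⟩, _, ⟨f.toAlgHom b, rfl⟩, ?_⟩
      rw [← f.map_del, ← f.map_delbar, ← map_add, h]; rfl)

/-- Pluripotential quasi-isomorphisms. -/
def IsPluripotentialQuasiIso (f : A ⟶ B) : Prop :=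
  Function.Bijective (Hom.mapBC f) ∧ Function.Bijective (Hom.mapA f)

end RCBBA

/-! ### Algebras of complete intersection type -/

/-- A bigraded `k`-algebra `H = ⨁ 𝓗 b` is of complete intersection type if it is isomorphic, as a
bigraded algebra, to `k[x₁,…,xₙ]/(r₁,…,rₘ)` with `x_i` of bidegree `(p_i, p_i)`, `p_i ≥ 1`, and
`r₁,…,rₘ` a regular sequence of elements of pure bidegree. -/
def IsCompleteIntersectionType {k : Type*} [Field k] {H : Type*} [Ring H] [Algebra k H]
    (𝓗 : ℤ × ℤ → Submodule k H) : Prop :=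
  ∃ (n : ℕ) (p : Fin n → ℕ) (r : List (MvPolynomial (Fin n) k)),
    let w : Fin n → ℤ × ℤ := fun i => ((p i : ℤ), (p i : ℤ))
    (∀ i, 1 ≤ p i) ∧
    (∀ f ∈ r, ∃ b, MvPolynomial.IsWeightedHomogeneous w f b) ∧
    RingTheory.Sequence.IsRegular (MvPolynomial (Fin n) k) r ∧
    ∃ e : (MvPolynomial (Fin n) k ⧸ Ideal.ofList r) ≃ₐ[k] H, ∀ b,
      ((MvPolynomial.weightedHomogeneousSubmodule k w b).map
        (Ideal.Quotient.mkₐ k (Ideal.ofList r)).toLinearMap).map e.toLinearMap = 𝓗 b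

/-! ### Rational structures -/

/-- A cbba with rational structure `(A_ℚ, A_ℂ, φ)`, where `φ` is an isomorphism
`A_ℚ ⊗ ℝ ≅ to(A_ℂ)^{σ = Id}` in the homotopy category of cdga's over `ℝ`. -/
structure RationalCBBA.{w} where
  AQ : CDGA.{w} ℚ
  AC : RCBBA.{w}
  φ : (CDGA.toHo ℝ).obj (CDGA.baseChange ℝ AQ) ≅ (CDGA.toHo ℝ).obj AC.realTotal

namespace RationalCBBA

/-- Morphisms of cbba's with rational structure: pairs of morphisms compatible with the
comparison isomorphisms in the homotopy category. -/
structure Hom (A B : RationalCBBA.{u}) where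
  fQ : A.AQ ⟶ B.AQ
  fC : A.AC ⟶ B.AC
  comm : A.φ.hom ≫ (CDGA.toHo ℝ).map (RCBBA.realTotalMap fC) =
    (CDGA.toHo ℝ).map (CDGA.baseChangeMap ℝ fQ) ≫ B.φ.hom

/-- A quasi-isomorphism is a morphism whose complex part is a pluripotential
quasi-isomorphism. -/
def Hom.IsQuasiIso {A B : RationalCBBA.{u}} (f : Hom A B) : Prop :=
  RCBBA.IsPluripotentialQuasiIso f.fC

/-- `A` and `B` are connected by a finite chain (zigzag) of quasi-isomorphisms. -/
def Connected : RationalCBBA.{u} → RationalCBBA.{u} → Prop :=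
  Relation.EqvGen fun A B => ∃ f : Hom A B, f.IsQuasiIso

variable (A : RationalCBBA.{u})

/-- An isomorphism `ψ : H(A_ℚ) ⊗ ℝ ≅ H_BC(A_ℂ)^{σ = Id}` of cdga's (with trivial differentials) is
`H(φ)` if, under the canonical maps `H_BC(A_ℂ) → H_dR(A_ℂ) ← H(to(A_ℂ)^{σ = Id})`, it agrees with
the map induced by `φ` in cohomology. If `A_ℂ` satisfies the `∂∂̄`-Lemma there is exactly one
such `ψ`. -/
def IsInducedByφ
    (ψ : CDGA.baseChange ℝ A.AQ.cohomology ≅ A.AC.bcCohomology.realTotal) : Prop :=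
  ∀ h : A.AQ.H,
    A.AC.bcToDR (A.AC.bcCohomology.fixed.val (ψ.hom.toAlgHom ((1 : ℝ) ⊗ₜ[ℚ] h))) =
      A.AC.realToComplexH (CDGA.hoMapH A.φ.hom (CDGA.toBaseChangeH ℝ A.AQ h))

/-- The triple `(H(A_ℚ), H_BC(A_ℂ), ψ)`, with trivial differentials. -/
def cohomologyTriple
    (ψ : CDGA.baseChange ℝ A.AQ.cohomology ≅ A.AC.bcCohomology.realTotal) :
    RationalCBBA.{u} where
  AQ := A.AQ.cohomology
  AC := A.AC.bcCohomology
  φ := (CDGA.toHo ℝ).mapIso ψ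

/-- Strong formality over `ℚ`: `A_ℂ` satisfies the `∂∂̄`-Lemma and `A` is connected by a chain of
quasi-isomorphisms to its cohomology `(H(A_ℚ), H_BC(A_ℂ), H(φ))`. -/
def StronglyFormal : Prop :=
  A.AC.DdbarLemma ∧
    ∃ ψ : CDGA.baseChange ℝ A.AQ.cohomology ≅ A.AC.bcCohomology.realTotal,
      A.IsInducedByφ ψ ∧ Connected A (A.cohomologyTriple ψ)

end RationalCBBA

end

/-!
Write `H` for the cohomology of `A`. Strong formality is witnessed by a single span `A ← M → H` of
cbba's with rational structure, whose middle term is a Koszul model `M = (M_ℚ, M_ℂ, φ_M)` of a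
presentation of `H` as a complete intersection (`RationalCBBA.connected_of_span`).

*Descent of the presentation.* The hypothesis presents `H_dR(A_ℂ) = ℂ ⊗ H(A_ℚ)` as `ℂ[x]/(r)` with
`r` a regular sequence over `ℂ`, whereas a presentation is needed whose variables are classes in
`H(A_ℚ)` and whose relations have rational coefficients. The variables may be replaced by
homogeneous elements with invertible linear part, the relations by linear combinations with an
invertible homogeneous matrix of coefficients. Both conditions say that a determinant, a
multilinear form in the data to be chosen, does not vanish. As rational elements span, a form that
does not vanish identically does not vanish at some rational point
(`MultilinearMap.exists_ne_zero_of_mem_span`). The order of the relations and the ground field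
change in the process, so regularity is carried along as the vanishing of the first Koszul
homology (`TrivialSyzygies`), which for homogeneous elements of positive weight is equivalent to
regularity (`TrivialSyzygies.of_regularModulo`, `TrivialSyzygies.regularModulo`). The result is
`exists_rational_presentation`: `H(A_ℚ) = ℚ[x]/(r')` and `H_dR(A_ℂ) = ℂ[x]/(r')`.

*The models.* Over `ℚ`, the model `M_ℚ` adjoins to `ℚ[x]` one odd generator `y` with `dy = r'_j`
for each relation (`PureModel`). Its bigraded analogue `M_ℂ` adjoins to `ℂ[x]` a real potential
`z` with `∂∂̄z = i r'_j`, that is, the free generators `z`, `∂z` and `∂̄z` (`BigradedModel`).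
Regularity implies that the cohomology of the models is `ℚ[x]/(r')` and `ℂ[x]/(r')`. For `M_ℂ`
this is proved for the cohomology of `∂̄` by an integration in the variable `z`; the passage to
Bott-Chern cohomology uses that `M_ℂ` lives in the first quadrant and has `∂̄`-cohomology on the
diagonal only (`BigradedModel.exists_rep_closed`). A morphism out of the models is given by the
images of the variables, together with primitives of the images of the relations, respectively
real `∂∂̄`-primitives. In `A_ℂ` the latter exist by the `∂∂̄`-Lemma. Hence representatives of the
generators of `H` define maps from the models to `A`, and the generators themselves define maps to
`H`; all of them are quasi-isomorphisms.

*Compatibility with the rational structures.* The isomorphism `φ_M` is the one transported from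
`φ` along `M → A`, so that this map is compatible by construction. It remains to see that `M → H`
is compatible with `φ_M` and `H(φ)`. This is an equality in the homotopy category of morphisms
from `ℝ ⊗ M_ℚ` to the real part of `H_BC(A_ℂ)`. The model `M_ℚ` has the homotopy lifting property
with respect to quasi-isomorphisms, where homotopies take values in the path object `N[t, dt]`;
hence every such morphism is represented by a map of cdga's
(`CDGA.HasHomotopyLifting.exists_toHo_map_eq`). As `H` vanishes in odd degrees, a map of
cdga's from `M_ℚ` to it is determined by the images of the variables, and these are determined by
the induced map in cohomology (`RationalCBBA.comm_cohomology`).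
-/

noncomputable section

/-! ### Odd extensions of rings with a parity automorphism -/

section OddExt

variable {k R : Type*} [Field k] [Ring R] [Algebra k R]

/-- A linear map `δ` that is an odd derivation with respect to the parity automorphism `ε`. -/
structure IsOddDer (ε : R →ₐ[k] R) (δ : R →ₗ[k] R) : Prop where
  mul : ∀ a b, δ (a * b) = δ a * b + ε a * δ b
  anti : ∀ a, δ (ε a) = -ε (δ a)

/-- A derivation `θ` that commutes with the parity automorphism `ε`. -/
structure IsEvenDer (ε : R →ₐ[k] R) (θ : R →ₗ[k] R) : Prop where
  mul : ∀ a b, θ (a * b) = θ a * b + a * θ b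
  comm : ∀ a, θ (ε a) = ε (θ a)

theorem IsEvenDer.zero (ε : R →ₐ[k] R) : IsEvenDer ε 0 := ⟨by simp, by simp⟩

/-- An even central element. -/
structure IsEvenCentral (ε : R →ₐ[k] R) (r : R) : Prop where
  comm : ∀ a, a * r = r * a
  fix : ε r = r

theorem IsEvenCentral.zero (ε : R →ₐ[k] R) : IsEvenCentral ε 0 := ⟨by simp, by simp⟩

/-- The ring `R ⊕ yR` obtained from `R` by adjoining an odd element `y` of square zero with
`a y = y ε(a)`. The pair `(a, b)` stands for `a + y b`. -/
@[ext]
structure OddExt (ε : R →ₐ[k] R) where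
  fst : R
  snd : R

namespace OddExt

variable {ε : R →ₐ[k] R}

/-- The underlying pair. -/
def equivProd : OddExt ε ≃ R × R :=
  ⟨fun x => (x.1, x.2), fun x => ⟨x.1, x.2⟩, fun _ => rfl, fun _ => rfl⟩

instance : AddCommGroup (OddExt ε) := equivProd.addCommGroup

instance : Module k (OddExt ε) := equivProd.module k

@[simp] theorem fst_add (x y : OddExt ε) : (x + y).fst = x.fst + y.fst := rfl
@[simp] theorem snd_add (x y : OddExt ε) : (x + y).snd = x.snd + y.snd := rfl
@[simp] theorem fst_zero : (0 : OddExt ε).fst = 0 := rfl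
@[simp] theorem snd_zero : (0 : OddExt ε).snd = 0 := rfl
@[simp] theorem fst_neg (x : OddExt ε) : (-x).fst = -x.fst := rfl
@[simp] theorem snd_neg (x : OddExt ε) : (-x).snd = -x.snd := rfl
@[simp] theorem fst_sub (x y : OddExt ε) : (x - y).fst = x.fst - y.fst := rfl
@[simp] theorem snd_sub (x y : OddExt ε) : (x - y).snd = x.snd - y.snd := rfl
@[simp] theorem fst_smul (c : k) (x : OddExt ε) : (c • x).fst = c • x.fst := rfl
@[simp] theorem snd_smul (c : k) (x : OddExt ε) : (c • x).snd = c • x.snd := rfl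

instance : Mul (OddExt ε) := ⟨fun x y => ⟨x.1 * y.1, x.2 * y.1 + ε x.1 * y.2⟩⟩

instance : One (OddExt ε) := ⟨⟨1, 0⟩⟩

@[simp] theorem fst_mul (x y : OddExt ε) : (x * y).fst = x.fst * y.fst := rfl
@[simp] theorem snd_mul (x y : OddExt ε) : (x * y).snd = x.snd * y.fst + ε x.fst * y.snd := rfl
@[simp] theorem fst_one : (1 : OddExt ε).fst = 1 := rfl
@[simp] theorem snd_one : (1 : OddExt ε).snd = 0 := rfl

instance : Ring (OddExt ε) :=
  { (inferInstance : AddCommGroup (OddExt ε)) with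
    mul := (· * ·)
    one := 1
    left_distrib := fun x y z => by ext <;> simp <;> noncomm_ring
    right_distrib := fun x y z => by ext <;> simp <;> noncomm_ring
    zero_mul := fun x => by ext <;> simp
    mul_zero := fun x => by ext <;> simp
    mul_assoc := fun x y z => by ext <;> simp <;> noncomm_ring
    one_mul := fun x => by ext <;> simp
    mul_one := fun x => by ext <;> simp }

instance : Algebra k (OddExt ε) :=
  Algebra.ofModule (fun c x y => by ext <;> simp) (fun c x y => by ext <;> simp)

variable (ε) in
/-- The inclusion `R → R ⊕ yR`. -/
def incl : R →ₐ[k] OddExt ε :=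
  AlgHom.ofLinearMap
    { toFun := fun a => ⟨a, 0⟩
      map_add' := fun a b => by ext <;> simp
      map_smul' := fun a b => by ext <;> simp } rfl
    (fun a b => by ext <;> simp)

variable (ε) in
/-- The adjoined odd element. -/
def gen : OddExt ε := ⟨0, 1⟩

@[simp] theorem fst_incl (a : R) : (incl ε a).fst = a := rfl
@[simp] theorem snd_incl (a : R) : (incl ε a).snd = 0 := rfl
@[simp] theorem fst_gen : (gen ε).fst = 0 := rfl
@[simp] theorem snd_gen : (gen ε).snd = 1 := rfl

/-- `x ↦ a` for `x = a + y b`, as a linear map. -/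
def fstL : OddExt ε →ₗ[k] R := ⟨⟨fst, fun _ _ => rfl⟩, fun _ _ => rfl⟩

/-- `x ↦ b` for `x = a + y b`, as a linear map. -/
def sndL : OddExt ε →ₗ[k] R := ⟨⟨snd, fun _ _ => rfl⟩, fun _ _ => rfl⟩

@[simp] theorem fst_zsmul (c : ℤ) (x : OddExt ε) : (c • x).fst = c • x.fst :=
  map_zsmul (fstL (ε := ε)) c x
@[simp] theorem snd_zsmul (c : ℤ) (x : OddExt ε) : (c • x).snd = c • x.snd :=
  map_zsmul (sndL (ε := ε)) c x

@[simp] theorem fstL_apply (x : OddExt ε) : fstL x = x.fst := rfl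
@[simp] theorem sndL_apply (x : OddExt ε) : sndL x = x.snd := rfl

/-- The linear map of `R ⊕ yR` given by a pair of linear maps into the two components. -/
def ofPair (f g : OddExt ε →ₗ[k] R) : OddExt ε →ₗ[k] OddExt ε where
  toFun x := ⟨f x, g x⟩
  map_add' x y := by ext <;> simp
  map_smul' c x := by ext <;> simp

variable (ε) in
/-- The parity automorphism of `R ⊕ yR`, for which `y` is odd. -/
def par : OddExt ε →ₐ[k] OddExt ε :=
  AlgHom.ofLinearMap (ofPair (ε.toLinearMap ∘ₗ fstL) (-(ε.toLinearMap ∘ₗ sndL)))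
    (by ext <;> simp [ofPair])
    (fun a b => by ext <;> simp [ofPair]; abel)

@[simp] theorem fst_par (x : OddExt ε) : (par ε x).fst = ε x.fst := rfl
@[simp] theorem snd_par (x : OddExt ε) : (par ε x).snd = -ε x.snd := rfl

theorem par_par (h : ∀ a, ε (ε a) = a) (x : OddExt ε) : par ε (par ε x) = x := by
  ext <;> simp [h]

/-- The extension of a linear map to `R ⊕ yR` by `y ↦ y`. -/
def ext₀ (θ : R →ₗ[k] R) : OddExt ε →ₗ[k] OddExt ε := ofPair (θ ∘ₗ fstL) (θ ∘ₗ sndL)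

@[simp] theorem fst_ext₀ (θ : R →ₗ[k] R) (x : OddExt ε) : (ext₀ θ x).fst = θ x.fst := rfl
@[simp] theorem snd_ext₀ (θ : R →ₗ[k] R) (x : OddExt ε) : (ext₀ θ x).snd = θ x.snd := rfl

theorem isEvenDer_ext₀ {θ : R →ₗ[k] R} (h : IsEvenDer ε θ) : IsEvenDer (par ε) (ext₀ θ) where
  mul a b := by ext <;> simp [h.mul, h.comm]; abel
  comm a := by ext <;> simp [h.comm]

theorem isEvenCentral_incl {r : R} (h : IsEvenCentral ε r) : IsEvenCentral (par ε) (incl ε r) where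
  comm a := by ext <;> simp [h.comm, h.fix]
  fix := by ext <;> simp [h.fix]

/-- The differential `a + y b ↦ (δ a + r b) + y (θ a - δ b)` of `R ⊕ yR`. It extends `δ + y θ` and
sends `y` to `r`. -/
def diff (δ : R →ₗ[k] R) (r : R) (θ : R →ₗ[k] R) : OddExt ε →ₗ[k] OddExt ε :=
  ofPair (δ ∘ₗ fstL + LinearMap.mulLeft k r ∘ₗ sndL) (θ ∘ₗ fstL - δ ∘ₗ sndL)

@[simp] theorem fst_diff (δ : R →ₗ[k] R) (r : R) (θ : R →ₗ[k] R) (x : OddExt ε) :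
    (diff δ r θ x).fst = δ x.fst + r * x.snd := rfl
@[simp] theorem snd_diff (δ : R →ₗ[k] R) (r : R) (θ : R →ₗ[k] R) (x : OddExt ε) :
    (diff δ r θ x).snd = θ x.fst - δ x.snd := rfl

theorem isOddDer_diff {δ θ : R →ₗ[k] R} {r : R} (hε : ∀ a, ε (ε a) = a) (hδ : IsOddDer ε δ)
    (hr : IsEvenCentral ε r) (hθ : IsEvenDer ε θ) :
    IsOddDer (par ε) (diff (ε := ε) δ r θ) where
  mul a b := by
    have h1 : ε a.fst * (r * b.snd) = r * (ε a.fst * b.snd) := by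
      rw [← mul_assoc, hr.comm, mul_assoc]
    have h2 : ε a.snd * (r * b.snd) = r * (ε a.snd * b.snd) := by
      rw [← mul_assoc, hr.comm, mul_assoc]
    ext
    · simp only [fst_diff, fst_mul, snd_mul, hδ.mul, fst_add, fst_par, mul_add, add_mul, h1,
        mul_assoc]
      abel
    · simp only [snd_diff, fst_mul, snd_mul, hδ.mul, hθ.mul, snd_add, snd_par, fst_par, fst_diff,
        mul_add, add_mul, map_add, hδ.anti, hε, mul_sub, sub_mul, neg_mul, h2, map_mul, hr.fix,
        mul_assoc]
      abel
  anti a := by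
    ext <;> simp [hδ.anti, hθ.comm, hr.fix]
    abel

/-- The anticommutator of two differentials of `R ⊕ yR`. -/
theorem diff_diff_add {δ θ δ' θ' : R →ₗ[k] R} {r r' : R} (hδ : IsOddDer ε δ)
    (hδ' : IsOddDer ε δ') (hr : IsEvenCentral ε r) (hr' : IsEvenCentral ε r')
    (hθ : IsEvenDer ε θ) (hθ' : IsEvenDer ε θ') (h1 : δ r' + δ' r = 0) (h2 : θ r' + θ' r = 0)
    (h3 : ∀ a, θ (δ' a) - δ' (θ a) + (θ' (δ a) - δ (θ' a)) = 0) (x : OddExt ε) :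
    diff δ r θ (diff δ' r' θ' x) + diff δ' r' θ' (diff δ r θ x) =
      ext₀ (δ ∘ₗ δ' + δ' ∘ₗ δ + LinearMap.mulLeft k r ∘ₗ θ' + LinearMap.mulLeft k r' ∘ₗ θ) x := by
  have e1 : δ r' * x.snd = -(δ' r * x.snd) := by
    rw [← neg_mul, ← eq_neg_of_add_eq_zero_left h1]
  have e2 : θ r' * x.snd = -(θ' r * x.snd) := by
    rw [← neg_mul, ← eq_neg_of_add_eq_zero_left h2]
  have e3 : θ (δ' x.fst) = δ' (θ x.fst) - (θ' (δ x.fst) - δ (θ' x.fst)) := by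
    have := h3 x.fst
    rw [add_eq_zero_iff_eq_neg, sub_eq_iff_eq_add] at this
    rw [this]; abel
  ext
  · simp [hδ.mul, hδ'.mul, hr.fix, hr'.fix, mul_sub, e1]
    abel
  · simp [hθ.mul, hθ'.mul, e2, e3]
    abel

/-- A ring map out of `R ⊕ yR` is a ring map out of `R` together with the image of `y`. -/
def lift {N : Type*} [Ring N] (f : R →+* N) (c : N) (hc : c * c = 0)
    (hf : ∀ a, f a * c = c * f (ε a)) : OddExt ε →+* N where
  toFun x := f x.fst + c * f x.snd
  map_one' := by simp
  map_zero' := by simp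
  map_add' x y := by simp [mul_add]; abel
  map_mul' x y := by
    have h1 : f x.fst * (c * f y.snd) = c * (f (ε x.fst) * f y.snd) := by
      rw [← mul_assoc, hf, mul_assoc]
    have h2 : f x.snd * (c * f y.snd) = c * (f (ε x.snd) * f y.snd) := by
      rw [← mul_assoc, hf, mul_assoc]
    simp only [fst_mul, snd_mul, map_mul, map_add, mul_add, add_mul, mul_assoc, h1, h2]
    rw [← mul_assoc c c, hc, zero_mul, add_zero]
    abel

theorem lift_apply {N : Type*} [Ring N] (f : R →+* N) (c : N) (hc : c * c = 0)
    (hf : ∀ a, f a * c = c * f (ε a)) (x : OddExt ε) :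
    lift f c hc hf x = f x.fst + c * f x.snd := rfl

theorem eq_incl_add (x : OddExt ε) : x = incl ε x.fst + gen ε * incl ε x.snd := by
  ext <;> simp

theorem ringHom_ext {N : Type*} [Ring N] {f g : OddExt ε →+* N}
    (h : ∀ a, f (incl ε a) = g (incl ε a)) (h' : f (gen ε) = g (gen ε)) : f = g := by
  ext x
  rw [eq_incl_add x, map_add, map_add, map_mul, map_mul, h, h, h']

/-- A lifted map is compatible with the differentials if it is so on `R` and on the generator. -/
theorem lift_diff {N : Type*} [Ring N] {f : R →+* N} {c : N} {hc : c * c = 0}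
    {hf : ∀ a, f a * c = c * f (ε a)} {δ θ : R →ₗ[k] R} {r : R} {D : N →+ N}
    (hD : ∀ a, D (c * a) = D c * a - c * D a) (h : ∀ a, D (f a) = f (δ a) + c * f (θ a))
    (hr : D c = f r) (x : OddExt ε) :
    D (lift f c hc hf x) = lift f c hc hf (diff δ r θ x) := by
  have h2 : c * (c * f (θ x.snd)) = 0 := by rw [← mul_assoc, hc, zero_mul]
  simp only [lift_apply, map_add, hD, h, hr, fst_diff, snd_diff, map_mul, map_sub, mul_add,
    mul_sub, h2]
  abel

end OddExt

end OddExt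

/-! ### Coefficientwise maps of polynomials -/

namespace Polynomial

variable {k R : Type*} [Field k] [Ring R] [Algebra k R]

/-- The linear map of polynomials that applies `f n` to the `n`-th coefficient. -/
def coeffMap (f : ℕ → R →ₗ[k] R) : R[X] →ₗ[k] R[X] :=
  lsum fun n => ((monomial n).restrictScalars k : R →ₗ[k] R[X]) ∘ₗ f n

@[simp] theorem coeffMap_monomial (f : ℕ → R →ₗ[k] R) (n : ℕ) (a : R) :
    coeffMap f (monomial n a) = monomial n (f n a) := by
  simp [coeffMap]

@[simp] theorem coeff_coeffMap (f : ℕ → R →ₗ[k] R) (P : R[X]) (n : ℕ) :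
    (coeffMap f P).coeff n = f n (P.coeff n) := by
  induction P using Polynomial.induction_on' with
  | add p q hp hq => simp [hp, hq]
  | monomial m a =>
    rw [coeffMap_monomial, coeff_monomial, coeff_monomial]
    split_ifs with h
    · rw [h]
    · simp

theorem coeffMap_C (f : ℕ → R →ₗ[k] R) (a : R) : coeffMap f (C a) = C (f 0 a) :=
  coeffMap_monomial f 0 a

theorem isOddDer_coeffMap {ε : R →ₐ[k] R} {δ : R →ₗ[k] R} (h : IsOddDer ε δ) :
    IsOddDer (mapAlgHom ε) (coeffMap fun _ => δ) where
  mul P Q := by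
    induction P using Polynomial.induction_on' with
    | add p q hp hq => simp only [add_mul, map_add, hp, hq]; abel
    | monomial m a =>
      induction Q using Polynomial.induction_on' with
      | add p q hp hq => simp only [mul_add, map_add, hp, hq]; abel
      | monomial n b => simp [monomial_mul_monomial, h.mul]
  anti P := by
    ext n
    simp [h.anti]

variable (k) in
/-- The derivative as a `k`-linear map. -/
def derivativeₗ : R[X] →ₗ[k] R[X] := (derivative : R[X] →ₗ[R] R[X]).restrictScalars k

@[simp] theorem derivativeₗ_apply (P : R[X]) : derivativeₗ k P = derivative P := rfl

theorem isEvenDer_derivative (ε : R →ₐ[k] R) : IsEvenDer (mapAlgHom ε) (derivativeₗ k) where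
  mul P Q := derivative_mul
  comm P := by
    change derivative (map _ P) = map _ (derivative P)
    rw [derivative_map]

theorem derivative_coeffMap (δ : R →ₗ[k] R) (P : R[X]) :
    derivative (coeffMap (fun _ => δ) P) = coeffMap (fun _ => δ) (derivative P) := by
  ext n
  rw [coeff_derivative, coeff_coeffMap, coeff_coeffMap, coeff_derivative]
  have h : ∀ a : R, a * ((n : R) + 1) = (n + 1) • a := fun a => by
    rw [nsmul_eq_mul, Nat.cast_comm]; push_cast; rfl
  rw [h, h, map_nsmul]

/-- The antiderivative without constant term. -/
def antideriv [CharZero k] : R[X] →ₗ[k] R[X] :=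
  lsum fun n => ((monomial (n + 1)).restrictScalars k : R →ₗ[k] R[X]) ∘ₗ
    ((n + 1 : k)⁻¹ • LinearMap.id)

variable [CharZero k]

@[simp] theorem antideriv_monomial (n : ℕ) (a : R) :
    antideriv (k := k) (monomial n a) = monomial (n + 1) ((n + 1 : k)⁻¹ • a) := by
  simp [antideriv]

theorem derivative_antideriv (P : R[X]) : derivative (antideriv (k := k) P) = P := by
  induction P using Polynomial.induction_on' with
  | add p q hp hq => simp [hp, hq]
  | monomial m a =>
    rw [antideriv_monomial, derivative_monomial]
    have h : (m : k) + 1 ≠ 0 := by exact_mod_cast Nat.succ_ne_zero m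
    have h2 : ((m + 1 : k)⁻¹ • a) * ((m + 1 : ℕ) : R) = a := by
      rw [← Nat.cast_comm, ← nsmul_eq_mul, ← Nat.cast_smul_eq_nsmul k, smul_smul]
      push_cast
      rw [mul_inv_cancel₀ h, one_smul]
    rw [h2, Nat.add_sub_cancel]

end Polynomial

set_option linter.unusedSectionVars false

/-! ### Gradings with parity -/

section Parity

variable {k ι R : Type*} [Field k] [AddCommGroup ι] [DecidableEq ι] [Ring R] [Algebra k R]

/-- Graded commutativity with respect to the parity of the degree given by `π : ι → ℤ`. -/
def IsGradedComm (𝒜 : ι → Submodule k R) (π : ι →+ ℤ) : Prop :=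
  ∀ m n, ∀ a ∈ 𝒜 m, ∀ b ∈ 𝒜 n, a * b = ((π m * π n).negOnePow : ℤ) • (b * a)

/-- The automorphism `ε` is multiplication by `(-1)^{π n}` in degree `n`. -/
def IsParity (𝒜 : ι → Submodule k R) (π : ι →+ ℤ) (ε : R →ₐ[k] R) : Prop :=
  ∀ n, ∀ a ∈ 𝒜 n, ε a = ((π n).negOnePow : ℤ) • a

theorem IsParity.mem {𝒜 : ι → Submodule k R} {π : ι →+ ℤ} {ε : R →ₐ[k] R} (h : IsParity 𝒜 π ε)
    {n : ι} {a : R} (ha : a ∈ 𝒜 n) : ε a ∈ 𝒜 n := by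
  rw [h n a ha]
  exact zsmul_mem ha _

theorem IsParity.even {𝒜 : ι → Submodule k R} {π : ι →+ ℤ} {ε : R →ₐ[k] R} (h : IsParity 𝒜 π ε)
    {n : ι} {a : R} (ha : a ∈ 𝒜 n) (hn : Even (π n)) : ε a = a := by
  rw [h n a ha, Int.negOnePow_even _ hn]; simp

theorem IsParity.odd {𝒜 : ι → Submodule k R} {π : ι →+ ℤ} {ε : R →ₐ[k] R} (h : IsParity 𝒜 π ε)
    {n : ι} {a : R} (ha : a ∈ 𝒜 n) (hn : Odd (π n)) : ε a = -a := by
  rw [h n a ha, Int.negOnePow_odd _ hn]; simp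

theorem negOnePow_smul_smul {M : Type*} [AddCommGroup M] (n : ℤ) (x : M) :
    (n.negOnePow : ℤ) • (n.negOnePow : ℤ) • x = x := by
  rw [smul_smul, ← Units.val_mul, Int.units_mul_self, Units.val_one, one_smul]

variable (𝒜 : ι → Submodule k R) [GradedAlgebra 𝒜] (π : ι →+ ℤ)

/-- The linear map underlying the parity automorphism of a graded algebra. -/
def parityMap : R →ₗ[k] R :=
  DirectSum.toModule k ι R (fun i => ((π i).negOnePow : ℤ) • (𝒜 i).subtype) ∘ₗ
    (DirectSum.decomposeLinearEquiv 𝒜).toLinearMap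

variable {𝒜} in
theorem parityMap_of_mem {n : ι} {a : R} (ha : a ∈ 𝒜 n) :
    parityMap 𝒜 π a = ((π n).negOnePow : ℤ) • a := by
  simp only [parityMap, LinearMap.comp_apply, LinearEquiv.coe_coe,
    DirectSum.decomposeLinearEquiv_apply, DirectSum.decompose_of_mem 𝒜 ha]
  exact DirectSum.toModule_lof k (M := fun i => 𝒜 i) n ⟨a, ha⟩

/-- The parity automorphism of a graded algebra. -/
def parityAut : R →ₐ[k] R :=
  AlgHom.ofLinearMap (parityMap 𝒜 π)
    (by
      rw [parityMap_of_mem π (SetLike.one_mem_graded 𝒜), map_zero, Int.negOnePow_zero]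
      simp)
    (fun a b => by
      induction a using DirectSum.Decomposition.inductionOn 𝒜 with
      | zero => simp
      | add x y hx hy => simp only [add_mul, map_add, hx, hy]
      | @homogeneous i a =>
        induction b using DirectSum.Decomposition.inductionOn 𝒜 with
        | zero => simp
        | add x y hx hy => simp only [mul_add, map_add, hx, hy]
        | @homogeneous j b =>
          rw [parityMap_of_mem π (SetLike.mul_mem_graded a.2 b.2), parityMap_of_mem π a.2,
            parityMap_of_mem π b.2, map_add, Int.negOnePow_add, smul_mul_assoc, mul_smul_comm,
            smul_smul, Units.val_mul])

theorem isParity_parityAut : IsParity 𝒜 π (parityAut 𝒜 π) := fun _ _ ha => parityMap_of_mem π ha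

variable {𝒜 π}

theorem IsParity.invol {ε : R →ₐ[k] R} (h : IsParity 𝒜 π ε) (a : R) : ε (ε a) = a := by
  induction a using DirectSum.Decomposition.inductionOn 𝒜 with
  | zero => simp
  | add x y hx hy => simp only [map_add, hx, hy]
  | @homogeneous i a => rw [h i a a.2, map_zsmul, h i a a.2, negOnePow_smul_smul]

theorem IsParity.isOddDer {ε : R →ₐ[k] R} (h : IsParity 𝒜 π ε) {δ : R →ₗ[k] R} {e : ι}
    (he : Odd (π e)) (hδ : ∀ n, ∀ a ∈ 𝒜 n, δ a ∈ 𝒜 (n + e))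
    (hmul : ∀ n, ∀ a ∈ 𝒜 n, ∀ b, δ (a * b) = δ a * b + ((π n).negOnePow : ℤ) • (a * δ b)) :
    IsOddDer ε δ where
  mul a b := by
    induction a using DirectSum.Decomposition.inductionOn 𝒜 with
    | zero => simp
    | add x y hx hy => simp only [add_mul, map_add, hx, hy]; abel
    | @homogeneous i a => rw [hmul i a a.2, h i a a.2, smul_mul_assoc]
  anti a := by
    induction a using DirectSum.Decomposition.inductionOn 𝒜 with
    | zero => simp
    | add x y hx hy => simp only [map_add, hx, hy]; abel
    | @homogeneous i a =>
      rw [h i a a.2, map_zsmul, h _ _ (hδ i a a.2), map_add, Int.negOnePow_add,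
        Int.negOnePow_odd _ he]
      simp

theorem IsOddDer.leibniz {ε : R →ₐ[k] R} {δ : R →ₗ[k] R} (hδ : IsOddDer ε δ)
    (h : IsParity 𝒜 π ε) {n : ι} {a : R} (ha : a ∈ 𝒜 n) (b : R) :
    δ (a * b) = δ a * b + ((π n).negOnePow : ℤ) • (a * δ b) := by
  rw [hδ.mul, h n a ha, smul_mul_assoc]

theorem IsGradedComm.isEvenCentral {ε : R →ₐ[k] R} (h : IsParity 𝒜 π ε) (hc : IsGradedComm 𝒜 π)
    {n : ι} (hn : Even (π n)) {r : R} (hr : r ∈ 𝒜 n) : IsEvenCentral ε r where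
  comm a := by
    induction a using DirectSum.Decomposition.inductionOn 𝒜 with
    | zero => simp
    | add x y hx hy => simp only [add_mul, mul_add, hx, hy]
    | @homogeneous i a =>
      rw [hc i n a a.2 r hr, Int.negOnePow_even _ (hn.mul_left _)]
      simp
  fix := h.even hr hn

theorem IsGradedComm.mul_odd {ε : R →ₐ[k] R} (h : IsParity 𝒜 π ε) (hc : IsGradedComm 𝒜 π)
    {n : ι} (hn : Odd (π n)) {c : R} (hr : c ∈ 𝒜 n) (a : R) : a * c = c * ε a := by
  induction a using DirectSum.Decomposition.inductionOn 𝒜 with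
  | zero => simp
  | add x y hx hy => simp only [add_mul, mul_add, hx, hy, map_add]
  | @homogeneous i a =>
    rw [hc i n a a.2 c hr, h i a a.2, mul_smul_comm]
    congr 2
    rcases Int.even_or_odd (π i) with hi | hi
    · rw [Int.negOnePow_even _ hi, Int.negOnePow_even _ (hi.mul_right _)]
    · rw [Int.negOnePow_odd _ hi, Int.negOnePow_odd _ (hi.mul hn)]

theorem IsGradedComm.odd_mul_odd (hc : IsGradedComm 𝒜 π) {m n : ι} (hm : Odd (π m))
    (hn : Odd (π n)) {a b : R} (ha : a ∈ 𝒜 m) (hb : b ∈ 𝒜 n) : a * b = -(b * a) := by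
  rw [hc m n a ha b hb, Int.negOnePow_odd _ (hm.mul hn)]
  simp

theorem IsGradedComm.odd_sq [CharZero k] (hc : IsGradedComm 𝒜 π) {n : ι} (hn : Odd (π n)) {c : R}
    (hr : c ∈ 𝒜 n) : c * c = 0 := by
  have h := hc.odd_mul_odd hn hn hr hr
  have h2 : (2 : k) • (c * c) = 0 := by
    rw [two_smul]
    exact add_eq_zero_iff_eq_neg.2 h
  exact (smul_eq_zero_iff_right two_ne_zero).1 h2

end Parity

section OddGrading

variable {k ι R : Type*} [Field k] [AddCommGroup ι] [DecidableEq ι] [Ring R] [Algebra k R]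
  (𝒜 : ι → Submodule k R) {π : ι →+ ℤ} (ε : R →ₐ[k] R) (q : ι)

/-- The grading of `R ⊕ yR` with `y` of degree `q`. -/
def oddGrading (n : ι) : Submodule k (OddExt ε) where
  carrier := {x | x.fst ∈ 𝒜 n ∧ x.snd ∈ 𝒜 (n - q)}
  add_mem' hx hy := ⟨Submodule.add_mem _ hx.1 hy.1, Submodule.add_mem _ hx.2 hy.2⟩
  zero_mem' := ⟨Submodule.zero_mem _, Submodule.zero_mem _⟩
  smul_mem' c _ hx := ⟨Submodule.smul_mem _ c hx.1, Submodule.smul_mem _ c hx.2⟩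

variable {𝒜 ε q}

theorem incl_mem {n : ι} {a : R} (ha : a ∈ 𝒜 n) : OddExt.incl ε a ∈ oddGrading 𝒜 ε q n :=
  ⟨ha, Submodule.zero_mem _⟩

variable [GradedAlgebra 𝒜]

theorem gen_mem : OddExt.gen ε ∈ oddGrading 𝒜 ε q q := by
  refine ⟨Submodule.zero_mem _, ?_⟩
  rw [sub_self]
  exact SetLike.one_mem_graded 𝒜

/-- The grading of `R ⊕ yR` is a grading of algebras. -/
abbrev oddGradedAlgebra (hε : IsParity 𝒜 π ε) : GradedAlgebra (oddGrading 𝒜 ε q) :=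
  { one_mem := ⟨SetLike.one_mem_graded 𝒜, Submodule.zero_mem _⟩
    mul_mem := by
      intro m n x y hx hy
      refine ⟨SetLike.mul_mem_graded hx.1 hy.1, Submodule.add_mem _ ?_ ?_⟩
      · rw [show m + n - q = m - q + n by abel]
        exact SetLike.mul_mem_graded hx.2 hy.1
      · rw [add_sub_assoc]
        exact SetLike.mul_mem_graded (hε.mem hx.1) hy.2
    toDecomposition := by
      refine DirectSum.IsInternal.chooseDecomposition _ (isInternal_of_proj _
        (fun n => OddExt.ofPair (GradedAlgebra.proj 𝒜 n ∘ₗ OddExt.fstL)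
          (GradedAlgebra.proj 𝒜 (n - q) ∘ₗ OddExt.sndL)) ?_ ?_ ?_)
      · intro n x hx
        exact OddExt.ext (proj_same 𝒜 hx.1) (proj_same 𝒜 hx.2)
      · intro m n h x hx
        exact OddExt.ext (proj_ne 𝒜 hx.1 h) (proj_ne 𝒜 hx.2 (fun e => h (sub_left_injective e)))
      · intro x
        obtain ⟨s, hs⟩ := exists_sum_proj 𝒜 x.fst
        obtain ⟨t, ht⟩ := exists_sum_proj 𝒜 x.snd
        have h : x = OddExt.incl ε x.fst + (⟨0, x.snd⟩ : OddExt ε) := by ext <;> simp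
        rw [h]
        refine Submodule.add_mem _ ?_ ?_
        · rw [← hs, map_sum]
          exact Submodule.sum_mem _ fun i _ =>
            Submodule.mem_iSup_of_mem i (incl_mem (proj_mem 𝒜 i _))
        · have h' : (⟨0, x.snd⟩ : OddExt ε) =
              ∑ i ∈ t, OddExt.ofPair 0 OddExt.sndL
                (⟨0, GradedAlgebra.proj 𝒜 i x.snd⟩ : OddExt ε) := by
            conv_lhs => rw [← ht]
            ext
            · rw [← OddExt.fstL_apply (∑ i ∈ t, _), map_sum]
              exact (Finset.sum_eq_zero fun _ _ => rfl).symm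
            · rw [← OddExt.sndL_apply (∑ i ∈ t, _), map_sum]
              rfl
          rw [h']
          refine Submodule.sum_mem _ fun i _ => Submodule.mem_iSup_of_mem (i + q)
            ⟨Submodule.zero_mem _, ?_⟩
          rw [add_sub_cancel_right]
          exact proj_mem 𝒜 i _ }

theorem isParity_par (hε : IsParity 𝒜 π ε) (hq : Odd (π q)) :
    IsParity (oddGrading 𝒜 ε q) π (OddExt.par ε) := by
  intro n x hx
  ext
  · rw [OddExt.fst_par, OddExt.fst_zsmul, hε n _ hx.1]
  · simp only [OddExt.snd_par, OddExt.snd_zsmul]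
    rw [hε _ _ hx.2, map_sub, Int.negOnePow_sub, Int.negOnePow_odd _ hq]
    simp

theorem isGradedComm_odd (hε : IsParity 𝒜 π ε) (hq : Odd (π q)) (hc : IsGradedComm 𝒜 π) :
    IsGradedComm (oddGrading 𝒜 ε q) π := by
  intro m n x hx y hy
  ext
  · simp only [OddExt.fst_mul, OddExt.fst_zsmul]
    exact hc m n _ hx.1 _ hy.1
  · simp only [OddExt.snd_mul, OddExt.snd_zsmul]
    rw [hc (m - q) n _ hx.2 _ hy.1, hε _ _ hx.1, hε _ _ hy.1, smul_mul_assoc,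
      hc m (n - q) _ hx.1 _ hy.2, smul_add, smul_mul_assoc, smul_smul, smul_smul, add_comm,
      ← Units.val_mul, ← Units.val_mul, ← Int.negOnePow_add, ← Int.negOnePow_add]
    congr 3
    · rw [Int.negOnePow_eq_iff, map_sub]
      obtain ⟨t, ht⟩ := hq
      exact ⟨-π m * t, by rw [ht]; ring⟩
    · rw [Int.negOnePow_eq_iff, map_sub]
      obtain ⟨t, ht⟩ := hq
      exact ⟨-(t + 1) * π n, by rw [ht]; ring⟩

theorem ext₀_mem {θ : R →ₗ[k] R} {e : ι} (h : ∀ n, ∀ a ∈ 𝒜 n, θ a ∈ 𝒜 (n + e)) {n : ι}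
    {x : OddExt ε} (hx : x ∈ oddGrading 𝒜 ε q n) :
    OddExt.ext₀ θ x ∈ oddGrading 𝒜 ε q (n + e) := by
  refine ⟨h _ _ hx.1, ?_⟩
  rw [show n + e - q = n - q + e by abel]
  exact h _ _ hx.2

theorem diff_mem {δ θ : R →ₗ[k] R} {r : R} {e : ι} (hδ : ∀ n, ∀ a ∈ 𝒜 n, δ a ∈ 𝒜 (n + e))
    (hr : r ∈ 𝒜 (q + e)) (hθ : ∀ n, ∀ a ∈ 𝒜 n, θ a ∈ 𝒜 (n + (e - q))) {n : ι}
    {x : OddExt ε} (hx : x ∈ oddGrading 𝒜 ε q n) :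
    OddExt.diff δ r θ x ∈ oddGrading 𝒜 ε q (n + e) := by
  refine ⟨Submodule.add_mem _ (hδ _ _ hx.1) ?_, Submodule.sub_mem _ ?_ ?_⟩
  · rw [show n + e = q + e + (n - q) by abel]
    exact SetLike.mul_mem_graded hr hx.2
  · rw [add_sub_assoc]
    exact hθ _ _ hx.1
  · rw [show n + e - q = n - q + e by abel]
    exact hδ _ _ hx.2

end OddGrading

section PolyGrading

open Polynomial

variable {k ι R : Type*} [Field k] [AddCommGroup ι] [DecidableEq ι] [Ring R] [Algebra k R]
  (𝒜 : ι → Submodule k R) {π : ι →+ ℤ} (w : ι)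

/-- The grading of `R[t]` with `t` of degree `w`. -/
def polyGrading (n : ι) : Submodule k R[X] where
  carrier := {P | ∀ m : ℕ, P.coeff m ∈ 𝒜 (n - m • w)}
  add_mem' hP hQ m := by rw [coeff_add]; exact Submodule.add_mem _ (hP m) (hQ m)
  zero_mem' m := by rw [coeff_zero]; exact Submodule.zero_mem _
  smul_mem' c P hP m := by rw [coeff_smul]; exact Submodule.smul_mem _ c (hP m)

variable {𝒜 w}

theorem monomial_mem_polyGrading {n : ι} {a : R} (m : ℕ) (ha : a ∈ 𝒜 (n - m • w)) :
    monomial m a ∈ polyGrading 𝒜 w n := by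
  intro i
  rw [coeff_monomial]
  split_ifs with h
  · rw [← h]; exact ha
  · exact Submodule.zero_mem _

theorem C_mem_polyGrading {n : ι} {a : R} (ha : a ∈ 𝒜 n) : C a ∈ polyGrading 𝒜 w n :=
  monomial_mem_polyGrading 0 (by simpa using ha)

variable [GradedAlgebra 𝒜]

/-- The grading of `R[t]` is a grading of algebras. -/
instance polyGradedAlgebra : GradedAlgebra (polyGrading 𝒜 w) :=
  { one_mem := C_mem_polyGrading (SetLike.one_mem_graded 𝒜)
    mul_mem := by
      intro m n P Q hP hQ i
      rw [coeff_mul]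
      refine Submodule.sum_mem _ fun p hp => ?_
      rw [← Finset.HasAntidiagonal.mem_antidiagonal.1 hp,
        show m + n - (p.1 + p.2) • w = (m - p.1 • w) + (n - p.2 • w) by rw [add_smul]; abel]
      exact SetLike.mul_mem_graded (hP _) (hQ _)
    toDecomposition := by
      refine DirectSum.IsInternal.chooseDecomposition _ (isInternal_of_proj _
        (fun n => coeffMap fun m => GradedAlgebra.proj 𝒜 (n - m • w)) ?_ ?_ ?_)
      · intro n P hP
        ext m
        rw [coeff_coeffMap]
        exact proj_same 𝒜 (hP m)
      · intro m n h P hP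
        ext i
        rw [coeff_coeffMap]
        exact proj_ne 𝒜 (hP i) (fun e => h (sub_left_injective e))
      · intro P
        induction P using Polynomial.induction_on' with
        | add p q hp hq => exact Submodule.add_mem _ hp hq
        | monomial m a =>
          obtain ⟨s, hs⟩ := exists_sum_proj 𝒜 a
          rw [← hs, map_sum]
          exact Submodule.sum_mem _ fun i _ => Submodule.mem_iSup_of_mem (i + m • w)
            (monomial_mem_polyGrading m (by
              rw [add_sub_cancel_right]; exact proj_mem 𝒜 i a)) }

theorem isParity_mapAlgHom {ε : R →ₐ[k] R} (hε : IsParity 𝒜 π ε) (hw : Even (π w)) :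
    IsParity (polyGrading 𝒜 w) π (mapAlgHom ε) := by
  intro n P hP
  ext m
  have h : (((π n).negOnePow : ℤ) • P).coeff m = ((π n).negOnePow : ℤ) • P.coeff m :=
    coeff_smul _ _ _
  rw [h]
  change (Polynomial.map _ P).coeff m = _
  rw [coeff_map]
  change ε _ = _
  rw [hε _ _ (hP m)]
  congr 2
  rw [Int.negOnePow_eq_iff, map_sub, map_nsmul, sub_sub_cancel_left]
  exact (hw.nsmul_right m).neg

theorem isGradedComm_poly (hc : IsGradedComm 𝒜 π) (hw : Even (π w)) :
    IsGradedComm (polyGrading 𝒜 w) π := by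
  intro m n P hP Q hQ
  ext i
  have h : (((π m * π n).negOnePow : ℤ) • (Q * P)).coeff i =
    ((π m * π n).negOnePow : ℤ) • (Q * P).coeff i := coeff_smul _ _ _
  rw [h, coeff_mul, coeff_mul, Finset.smul_sum, ← Finset.Nat.sum_antidiagonal_swap]
  refine Finset.sum_congr rfl fun p _ => ?_
  simp only [Prod.fst_swap, Prod.snd_swap]
  rw [hc _ _ _ (hP p.2) _ (hQ p.1)]
  congr 2
  rw [Int.negOnePow_eq_iff, map_sub, map_sub, map_nsmul, map_nsmul]
  obtain ⟨t, ht⟩ := hw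
  rw [ht]
  refine ⟨-π m * p.1 * t - p.2 * t * π n + 2 * p.1 * p.2 * t * t, ?_⟩
  simp only [nsmul_eq_mul]
  ring

theorem coeffMap_mem {δ : R →ₗ[k] R} {e : ι} (hδ : ∀ n, ∀ a ∈ 𝒜 n, δ a ∈ 𝒜 (n + e)) {n : ι}
    {P : R[X]} (hP : P ∈ polyGrading 𝒜 w n) :
    coeffMap (fun _ => δ) P ∈ polyGrading 𝒜 w (n + e) := by
  intro m
  rw [coeff_coeffMap, show n + e - m • w = n - m • w + e by abel]
  exact hδ _ _ (hP m)

theorem derivative_mem {n : ι} {P : R[X]} (hP : P ∈ polyGrading 𝒜 w n) :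
    derivative P ∈ polyGrading 𝒜 w (n - w) := by
  intro m
  rw [coeff_derivative, show n - w - m • w = n - (m + 1) • w by rw [add_smul, one_smul]; abel]
  have h : P.coeff (m + 1) * ((m : R) + 1) = (m + 1) • P.coeff (m + 1) := by
    rw [nsmul_eq_mul, Nat.cast_comm]; push_cast; rfl
  rw [h]
  exact nsmul_mem (hP (m + 1)) _

end PolyGrading

/-! ### Path objects of cdga's -/

namespace CDGA

section Basic

variable {k : Type v} [Field k] (A : CDGA.{u} k)

/-- The parity automorphism of a cdga. -/
def par : A.carrier →ₐ[k] A.carrier := parityAut A.grading (AddMonoidHom.id ℤ)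

theorem isParity : IsParity A.grading (AddMonoidHom.id ℤ) A.par := isParity_parityAut _ _

theorem isGradedComm : IsGradedComm A.grading (AddMonoidHom.id ℤ) := A.graded_comm

theorem isOddDer : IsOddDer A.par A.d :=
  A.isParity.isOddDer (e := 1) odd_one A.d_mem A.leibniz

/-- A cdga given by a graded-commutative algebra and an odd derivation of square zero. -/
def ofDer {R : Type u} [Ring R] [Algebra k R] (𝒜 : ℤ → Submodule k R) [GradedAlgebra 𝒜]
    (ε : R →ₐ[k] R) (hε : IsParity 𝒜 (AddMonoidHom.id ℤ) ε)
    (hc : IsGradedComm 𝒜 (AddMonoidHom.id ℤ)) (δ : R →ₗ[k] R) (hδ : IsOddDer ε δ)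
    (hmem : ∀ n, ∀ a ∈ 𝒜 n, δ a ∈ 𝒜 (n + 1)) (hsq : ∀ a, δ (δ a) = 0) : CDGA.{u} k where
  carrier := R
  grading := 𝒜
  d := δ
  d_mem := hmem
  d_d := hsq
  leibniz _ _ ha b := hδ.leibniz hε ha b
  graded_comm := hc

variable {A}

theorem cls_eq_zero_iff {a : A.carrier} (ha : A.d a = 0) :
    A.cls a ha = 0 ↔ ∃ b, a = A.d b :=
  Ideal.Quotient.eq_zero_iff_mem

theorem cls_eq_iff {a b : A.carrier} (ha : A.d a = 0) (hb : A.d b = 0) :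
    A.cls a ha = A.cls b hb ↔ ∃ c, a - b = A.d c :=
  Ideal.Quotient.eq

theorem exists_cls (x : A.H) : ∃ a, ∃ ha : A.d a = 0, x = A.cls a ha := by
  obtain ⟨x, rfl⟩ := Ideal.Quotient.mk_surjective x
  exact ⟨x.1, x.2, rfl⟩

theorem mapH_cls {B : CDGA.{u} k} (f : A ⟶ B) (a : A.carrier) (ha : A.d a = 0) :
    Hom.mapH f (A.cls a ha) = B.cls (f.toAlgHom a) (by rw [← f.map_d, ha, map_zero]) := rfl

theorem cls_mem_iff {n : ℤ} {x : A.H} :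
    x ∈ A.cohomology.grading n ↔ ∃ a, ∃ ha : A.d a = 0, a ∈ A.grading n ∧ x = A.cls a ha := by
  constructor
  · rintro ⟨z, hz, rfl⟩
    exact ⟨z.1, z.2, hz, rfl⟩
  · rintro ⟨a, ha, h, rfl⟩
    exact ⟨⟨a, ha⟩, h, rfl⟩

/-- A homogeneous boundary is the differential of a homogeneous element. -/
theorem exists_homogeneous_primitive {n : ℤ} {a b : A.carrier} (ha : a ∈ A.grading n)
    (h : a = A.d b) : ∃ c ∈ A.grading (n - 1), a = A.d c :=
  ⟨_, proj_mem A.grading (n - 1) b, by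
    rw [← A.proj_boundary, ← h, proj_same A.grading ha]⟩

theorem map_proj {B : CDGA.{u} k} (f : A ⟶ B) (i : ℤ) (a : A.carrier) :
    GradedAlgebra.proj B.grading i (f.toAlgHom a) =
      f.toAlgHom (GradedAlgebra.proj A.grading i a) :=
  proj_map A.grading (f.toAlgHom : A.carrier →+ B.carrier) id Function.injective_id
    (fun j => (GradedAlgebra.proj B.grading j).toAddMonoidHom)
    (fun _ x hx => proj_same B.grading (f.map_mem _ x hx))
    (fun _ _ h x hx => proj_ne B.grading (f.map_mem _ x hx) h) i a

theorem exists_lift_of_quasiIso {B : CDGA.{u} k} {s : A ⟶ B} (hs : quasiIso k s) {n : ℤ}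
    {x : B.carrier} (hx : x ∈ B.grading n) (hd : B.d x = 0) :
    ∃ z ∈ A.grading n, A.d z = 0 ∧ ∃ b ∈ B.grading (n - 1), x = s.toAlgHom z + B.d b := by
  obtain ⟨y, hy⟩ := hs.2 (B.cls x hd)
  obtain ⟨a, ha, rfl⟩ := exists_cls y
  rw [mapH_cls, eq_comm, cls_eq_iff] at hy
  obtain ⟨c, hc⟩ := hy
  refine ⟨_, proj_mem A.grading n a, A.d_proj_eq_zero ha n, _, proj_mem B.grading (n - 1) c, ?_⟩
  rw [← A.map_proj s, ← B.proj_boundary, ← hc, map_sub, proj_same B.grading hx]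
  abel

theorem exists_primitive_of_quasiIso {B : CDGA.{u} k} {s : A ⟶ B} (hs : quasiIso k s) {n : ℤ}
    {z : A.carrier} (hz : z ∈ A.grading n) (hd : A.d z = 0) {b : B.carrier}
    (h : s.toAlgHom z = B.d b) : ∃ w ∈ A.grading (n - 1), z = A.d w := by
  have h0 : A.cls z hd = 0 := hs.1 (by
    rw [map_zero, mapH_cls, cls_eq_zero_iff]
    exact ⟨b, h⟩)
  obtain ⟨w, hw⟩ := (cls_eq_zero_iff hd).1 h0
  exact exists_homogeneous_primitive hz hw

end Basic

section Path

open Polynomial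

variable {k : Type v} [Field k] (N : CDGA.{u} k)

/-- The parity automorphism of `N[t]`. -/
abbrev polyPar : N.carrier[X] →ₐ[k] N.carrier[X] := mapAlgHom N.par

theorem isParity_polyPar :
    IsParity (polyGrading N.grading 0) (AddMonoidHom.id ℤ) N.polyPar :=
  isParity_mapAlgHom N.isParity (by simp)

theorem isOddDer_pathDiff : IsOddDer (OddExt.par N.polyPar)
    (OddExt.diff (ε := N.polyPar) (coeffMap fun _ => N.d) 0 (derivativeₗ k)) :=
  OddExt.isOddDer_diff N.isParity_polyPar.invol (isOddDer_coeffMap N.isOddDer)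
    (IsEvenCentral.zero _) (isEvenDer_derivative _)

/-- The path object `N[t, dt]` of polynomial differential forms on the line with values in `N`;
the pair `(a, b)` stands for `a + dt b`. -/
def path : CDGA.{u} k :=
  letI := oddGradedAlgebra (q := 1) N.isParity_polyPar
  ofDer (oddGrading (polyGrading N.grading 0) N.polyPar 1) (OddExt.par N.polyPar)
    (isParity_par N.isParity_polyPar odd_one)
    (isGradedComm_odd N.isParity_polyPar odd_one (isGradedComm_poly N.isGradedComm (by simp)))
    (OddExt.diff (coeffMap fun _ => N.d) 0 (derivativeₗ k)) N.isOddDer_pathDiff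
    (fun n a ha => diff_mem (fun n a ha => coeffMap_mem N.d_mem ha) (Submodule.zero_mem _)
      (fun n a ha => by simpa using derivative_mem ha) ha)
    (fun a => by
      ext
      · simp [N.d_d]
      · simp [derivative_coeffMap, N.d_d])

theorem path_d (x : OddExt N.polyPar) :
    N.path.d x = OddExt.diff (coeffMap fun _ => N.d) 0 (derivativeₗ k) x := rfl

theorem mem_path_grading {n : ℤ} {x : OddExt N.polyPar} :
    x ∈ N.path.grading n ↔ (∀ m, x.fst.coeff m ∈ N.grading n) ∧
      ∀ m, x.snd.coeff m ∈ N.grading (n - 1) := by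
  change (∀ m, x.fst.coeff m ∈ N.grading (n - m • 0)) ∧
    (∀ m, x.snd.coeff m ∈ N.grading (n - 1 - m • 0)) ↔ _
  simp

/-- The inclusion of constant paths. -/
def constPath : N ⟶ N.path where
  toAlgHom := (OddExt.incl N.polyPar).comp CAlgHom
  map_mem n a ha := incl_mem (C_mem_polyGrading ha)
  map_d a := by
    apply OddExt.ext
    · change C (N.d a) = coeffMap (fun _ => N.d) (C a) + 0 * 0
      rw [coeffMap_C, zero_mul, add_zero]
    · change 0 = derivative (C a) - coeffMap (fun _ => N.d) 0
      simp

theorem eval_coeffMap (c : k) (P : N.carrier[X]) :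
    eval (algebraMap k N.carrier c) (coeffMap (fun _ => N.d) P) =
      N.d (eval (algebraMap k N.carrier c) P) := by
  induction P using Polynomial.induction_on' with
  | add p q hp hq => simp only [map_add, eval_add, hp, hq]
  | monomial m a =>
    rw [coeffMap_monomial, eval_monomial, eval_monomial, ← map_pow, ← Algebra.commutes,
      ← Algebra.commutes, ← Algebra.smul_def, ← Algebra.smul_def, map_smul]

/-- The evaluation of paths at a scalar `c`. -/
def evPath (c : k) : N.path ⟶ N where
  toAlgHom := AlgHom.ofLinearMap
    ((eval₂AlgHom (AlgHom.id k N.carrier) (algebraMap k N.carrier c)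
      (fun a => (Algebra.commutes c a).symm)).toLinearMap ∘ₗ OddExt.fstL (ε := N.polyPar))
    (map_one (eval₂AlgHom (AlgHom.id k N.carrier) (algebraMap k N.carrier c)
      (fun a => (Algebra.commutes c a).symm)))
    (fun x y => map_mul (eval₂AlgHom (AlgHom.id k N.carrier) (algebraMap k N.carrier c)
      (fun a => (Algebra.commutes c a).symm)) x.fst y.fst)
  map_mem n x hx := by
    change eval₂ (RingHom.id _) (algebraMap k N.carrier c) (OddExt.fst x) ∈ N.grading n
    rw [eval₂_eq_sum_range]
    refine Submodule.sum_mem _ fun i _ => ?_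
    rw [← map_pow, ← Algebra.commutes, ← Algebra.smul_def]
    exact Submodule.smul_mem _ _ ((N.mem_path_grading.1 hx).1 i)
  map_d x := by
    change eval (algebraMap k N.carrier c) (coeffMap (fun _ => N.d) (OddExt.fst x) +
      0 * OddExt.snd x) = _
    rw [zero_mul, add_zero, eval_coeffMap]
    rfl

theorem evPath_apply (c : k) (x : OddExt N.polyPar) :
    (N.evPath c).toAlgHom x = eval (algebraMap k N.carrier c) x.fst := rfl

theorem constPath_evPath (c : k) : N.constPath ≫ N.evPath c = 𝟙 N := by
  apply Hom.ext
  ext a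
  exact eval_C

variable [CharZero k]

/-- A closed path with a zero is the differential of a path with the same zero: the primitive is
the integral of the `dt`-component. -/
theorem exists_path_primitive (c : k) {n : ℤ} {x : N.path.carrier} (hx : x ∈ N.path.grading n)
    (hd : N.path.d x = 0) (h0 : (N.evPath c).toAlgHom x = 0) :
    ∃ e ∈ N.path.grading (n - 1), N.path.d e = x ∧ (N.evPath c).toAlgHom e = 0 := by
  set J : N.carrier[X] := antideriv (k := k) (OddExt.snd x) with hJ
  set j : N.carrier := eval (algebraMap k N.carrier c) J with hj
  have hd1 : coeffMap (fun _ => N.d) (OddExt.fst x) = 0 := by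
    have := congrArg OddExt.fst hd
    change coeffMap (fun _ => N.d) (OddExt.fst x) + 0 * _ = 0 at this
    rwa [zero_mul, add_zero] at this
  have hd2 : coeffMap (fun _ => N.d) (OddExt.snd x) = derivative (OddExt.fst x) := by
    have := congrArg OddExt.snd hd
    change derivative (OddExt.fst x) - coeffMap (fun _ => N.d) (OddExt.snd x) = 0 at this
    exact (sub_eq_zero.1 this).symm
  have hJd : derivative J = OddExt.snd x := derivative_antideriv _
  have key : coeffMap (fun _ => N.d) (J - C j) = OddExt.fst x := by
    have h1 : derivative (coeffMap (fun _ => N.d) (J - C j) - OddExt.fst x) = 0 := by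
      rw [map_sub, derivative_coeffMap, map_sub, hJd, derivative_C, sub_zero, hd2, sub_self]
    have : IsAddTorsionFree N.carrier := by
      have : Module ℚ N.carrier := Module.compHom N.carrier (algebraMap ℚ k)
      exact IsAddTorsionFree.of_module_rat _
    have h2 := eq_C_of_derivative_eq_zero h1
    have h3 := congrArg (eval (algebraMap k N.carrier c)) h2
    rw [eval_sub, eval_coeffMap, eval_sub, eval_C, ← hj, sub_self, map_zero, eval_C,
      show eval (algebraMap k N.carrier c) (OddExt.fst x) = 0 from h0, sub_self] at h3
    rw [← h3, C_0] at h2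
    exact sub_eq_zero.1 h2
  obtain ⟨hx1, hx2⟩ := N.mem_path_grading.1 hx
  have hJm : ∀ m, J.coeff m ∈ N.grading (n - 1) := by
    intro m
    have : J ∈ polyGrading N.grading 0 (n - 1) := by
      have h4 : OddExt.snd x = ∑ i ∈ (OddExt.snd x).support,
          monomial i ((OddExt.snd x).coeff i) := as_sum_support _
      rw [hJ, h4, map_sum]
      refine Submodule.sum_mem _ fun i _ => ?_
      rw [antideriv_monomial]
      refine monomial_mem_polyGrading _ ?_
      rw [smul_zero, sub_zero]
      exact Submodule.smul_mem _ _ (hx2 i)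
    simpa using this m
  have hjm : j ∈ N.grading (n - 1) := by
    have : (OddExt.incl N.polyPar J : N.path.carrier) ∈ N.path.grading (n - 1) :=
      N.mem_path_grading.2 ⟨hJm, fun m => by simp⟩
    exact (N.evPath c).map_mem _ _ this
  refine ⟨OddExt.incl N.polyPar (J - C j), N.mem_path_grading.2 ⟨fun m => ?_, fun m => ?_⟩, ?_, ?_⟩
  · rw [OddExt.fst_incl, coeff_sub, coeff_C]
    split_ifs
    · exact Submodule.sub_mem _ (hJm m) hjm
    · simpa using hJm m
  · simp
  · apply OddExt.ext
    · rw [path_d, OddExt.fst_diff, OddExt.fst_incl, OddExt.snd_incl, mul_zero, add_zero, key]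
    · rw [path_d, OddExt.snd_diff, OddExt.fst_incl, OddExt.snd_incl, map_zero, sub_zero,
        derivativeₗ_apply, map_sub, hJd, derivative_C, sub_zero]
  · rw [evPath_apply, OddExt.fst_incl, eval_sub, eval_C, ← hj, sub_self]

theorem quasiIso_constPath : quasiIso k N.constPath := by
  refine ⟨?_, ?_⟩
  · intro x y h
    have : ∀ z : N.H, Hom.mapH (N.evPath 0) (Hom.mapH N.constPath z) = z := by
      intro z
      have h1 := congrArg (fun f => Hom.mapH f z) (N.constPath_evPath 0)
      obtain ⟨a, ha, rfl⟩ := exists_cls z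
      exact h1
    rw [← this x, ← this y, h]
  · intro z
    obtain ⟨x, hx, rfl⟩ := exists_cls z
    have hev : N.d ((N.evPath 0).toAlgHom x) = 0 := by rw [← (N.evPath 0).map_d, hx, map_zero]
    refine ⟨N.cls _ hev, ?_⟩
    rw [mapH_cls, eq_comm, cls_eq_iff]
    set y := x - N.constPath.toAlgHom ((N.evPath 0).toAlgHom x) with hy
    have hyd : N.path.d y = 0 := by
      rw [hy, map_sub, hx, ← N.constPath.map_d, hev, map_zero, sub_zero]
    have hy0 : (N.evPath 0).toAlgHom y = 0 := by
      rw [hy, map_sub, sub_eq_zero]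
      exact (congrArg (fun f => Hom.toAlgHom f ((N.evPath 0).toAlgHom x))
        (N.constPath_evPath 0)).symm
    have : ∀ i, ∃ e, N.path.d e = GradedAlgebra.proj N.path.grading i y := fun i => by
      obtain ⟨e, -, he, -⟩ := N.exists_path_primitive 0 (proj_mem N.path.grading i y)
        (N.path.d_proj_eq_zero hyd i) (by rw [← map_proj, hy0, map_zero])
      exact ⟨e, he⟩
    choose e he using this
    obtain ⟨s, hs⟩ := exists_sum_proj N.path.grading y
    refine ⟨∑ i ∈ s, e i, ?_⟩
    rw [map_sum]
    simp only [he, hs]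

/-- All evaluations of paths agree in the homotopy category. -/
theorem toHo_map_evPath (c c' : k) :
    (toHo k).map (N.evPath c) = (toHo k).map (N.evPath c') := by
  have : IsIso ((toHo k).map N.constPath) :=
    Localization.inverts (toHo k) (quasiIso k) _ N.quasiIso_constPath
  rw [← cancel_epi ((toHo k).map N.constPath), ← Functor.map_comp, ← Functor.map_comp,
    constPath_evPath, constPath_evPath]

end Path

end CDGA

/-! ### Semilinear maps of cdga's and homotopy lifting -/

namespace CDGA

/-- A degree preserving unital ring map between cdga's over possibly different fields that commutes
with the differentials. -/
structure SemiHom {k K : Type*} [Field k] [Field K] (M : CDGA.{u} k) (N : CDGA.{u} K) where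
  toRingHom : M.carrier →+* N.carrier
  map_mem : ∀ n, ∀ a ∈ M.grading n, toRingHom a ∈ N.grading n
  map_d : ∀ a, toRingHom (M.d a) = N.d (toRingHom a)

namespace SemiHom

section

variable {k K : Type*} [Field k] [Field K] {M : CDGA.{u} k} {N N' : CDGA.{u} K}

/-- A morphism of cdga's as a semilinear map. -/
def ofHom {M N : CDGA.{u} k} (f : M ⟶ N) : SemiHom M N :=
  ⟨f.toAlgHom, f.map_mem, f.map_d⟩

/-- Composition of a semilinear map with a morphism of cdga's. -/
def comp (f : SemiHom M N) (g : N ⟶ N') : SemiHom M N' where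
  toRingHom := (g.toAlgHom : N.carrier →+* N'.carrier).comp f.toRingHom
  map_mem n a ha := g.map_mem n _ (f.map_mem n a ha)
  map_d a := (congrArg g.toAlgHom (f.map_d a)).trans (g.map_d _)

theorem map_par (f : SemiHom M N) (a : M.carrier) :
    f.toRingHom (M.par a) = N.par (f.toRingHom a) := by
  induction a using DirectSum.Decomposition.inductionOn M.grading with
  | zero => simp
  | add x y hx hy => simp only [map_add, hx, hy]
  | @homogeneous i a =>
    rw [M.isParity i a a.2, N.isParity i _ (f.map_mem i a a.2), map_zsmul]

end

section Extend

variable {K : Type} [Field K] [Algebra ℚ K] {M : CDGA.{u} ℚ} {N : CDGA.{u} K}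

/-- The algebra map underlying the linear extension of a semilinear map. -/
def extendAlgHom (f : SemiHom M N) : K ⊗[ℚ] M.carrier →ₐ[K] N.carrier :=
  letI : Algebra ℚ N.carrier := Algebra.compHom N.carrier (algebraMap ℚ K)
  haveI : IsScalarTower ℚ K N.carrier := IsScalarTower.of_algebraMap_eq fun _ => rfl
  Algebra.TensorProduct.lift (Algebra.ofId K N.carrier) f.toRingHom.toRatAlgHom
    (fun c _ => Algebra.commutes c _)

theorem extendAlgHom_tmul (f : SemiHom M N) (c : K) (a : M.carrier) :
    f.extendAlgHom (c ⊗ₜ a) = c • f.toRingHom a := by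
  rw [Algebra.smul_def]
  rfl

/-- The extension of a semilinear map to a morphism out of the base change. -/
def extend (f : SemiHom M N) : baseChange K M ⟶ N where
  toAlgHom := f.extendAlgHom
  map_mem n x hx := by
    have h : (M.grading n).baseChange K ≤ (N.grading n).comap f.extendAlgHom.toLinearMap := by
      rw [Submodule.baseChange_eq_span, Submodule.span_le]
      rintro _ ⟨a, ha, rfl⟩
      change f.extendAlgHom (1 ⊗ₜ a) ∈ N.grading n
      rw [extendAlgHom_tmul, one_smul]
      exact f.map_mem n a ha
    exact h hx
  map_d x := by
    change K ⊗[ℚ] M.carrier at x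
    change f.extendAlgHom (M.d.baseChange K x) = N.d (f.extendAlgHom x)
    induction x using TensorProduct.induction_on with
    | zero => simp
    | tmul c a => rw [LinearMap.baseChange_tmul, extendAlgHom_tmul, extendAlgHom_tmul, map_smul,
        f.map_d]
    | add x y hx hy => rw [map_add, map_add, map_add, map_add, hx, hy]

theorem extend_tmul (f : SemiHom M N) (c : K) (a : M.carrier) :
    f.extend.toAlgHom (c ⊗ₜ a : K ⊗[ℚ] M.carrier) = c • f.toRingHom a :=
  f.extendAlgHom_tmul c a

variable (K M) in
/-- The inclusion `a ↦ 1 ⊗ a` of a cdga in its base change. -/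
def unit : SemiHom M (baseChange K M) where
  toRingHom :=
    (Algebra.TensorProduct.includeRight : M.carrier →ₐ[ℚ] K ⊗[ℚ] M.carrier).toRingHom
  map_mem _ _ ha := Submodule.tmul_mem_baseChange_of_mem 1 ha
  map_d _ := rfl

/-- The restriction of a morphism out of the base change. -/
def restrict (g : baseChange K M ⟶ N) : SemiHom M N := (unit K M).comp g

theorem hom_ext {g h : baseChange K M ⟶ N}
    (H : ∀ a : M.carrier, g.toAlgHom (1 ⊗ₜ a : K ⊗[ℚ] M.carrier) =
      h.toAlgHom (1 ⊗ₜ a : K ⊗[ℚ] M.carrier)) : g = h := by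
  apply Hom.ext
  have h1 : ∀ x : K ⊗[ℚ] M.carrier, g.toAlgHom x = h.toAlgHom x := fun x => by
    induction x using TensorProduct.induction_on with
    | zero => exact (map_zero g.toAlgHom).trans (map_zero h.toAlgHom).symm
    | tmul c a =>
      have h2 : (c ⊗ₜ a : K ⊗[ℚ] M.carrier) = c • (1 ⊗ₜ a) := by
        rw [TensorProduct.smul_tmul', smul_eq_mul, mul_one]
      rw [h2]
      exact (map_smul g.toAlgHom c _).trans ((congrArg (c • ·) (H a)).trans
        (map_smul h.toAlgHom c _).symm)
    | add x y hx hy =>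
      exact (map_add g.toAlgHom x y).trans ((congrArg₂ (· + ·) hx hy).trans
        (map_add h.toAlgHom x y).symm)
  exact AlgHom.ext h1

theorem extend_comp {N' : CDGA.{u} K} (f : SemiHom M N) (g : N ⟶ N') :
    (f.comp g).extend = f.extend ≫ g :=
  hom_ext fun a => by
    rw [extend_tmul, one_smul]
    exact congrArg g.toAlgHom ((f.extend_tmul 1 a).trans (one_smul K _)).symm

end Extend

end SemiHom

/-- The homotopy lifting property of `M` with respect to quasi-isomorphisms of cdga's over `K`. -/
def HasHomotopyLifting {k : Type*} (K : Type*) [Field k] [Field K] (M : CDGA.{u} k) : Prop :=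
  ∀ (N' N : CDGA.{u} K) (s : N' ⟶ N), quasiIso K s → ∀ f : SemiHom M N,
    ∃ (f' : SemiHom M N') (h : SemiHom M N.path),
      (∀ a, (N.evPath 0).toAlgHom (h.toRingHom a) = s.toAlgHom (f'.toRingHom a)) ∧
      ∀ a, (N.evPath 1).toAlgHom (h.toRingHom a) = f.toRingHom a

section Lifting

variable {K : Type*} [Field K] {N' N : CDGA.{u} K}

/-- The path `t ↦ b - t b`, from `b` to `0`. -/
theorem exists_path_to_zero {n : ℤ} {b : N.carrier} (hb : b ∈ N.grading n) :
    ∃ e ∈ N.path.grading n, (N.evPath 0).toAlgHom e = b ∧ (N.evPath 1).toAlgHom e = 0 := by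
  refine ⟨OddExt.incl N.polyPar (Polynomial.C b - Polynomial.monomial 1 b),
    N.mem_path_grading.2 ⟨fun m => ?_, fun m => ?_⟩, ?_, ?_⟩
  · rw [OddExt.fst_incl, Polynomial.coeff_sub, Polynomial.coeff_C, Polynomial.coeff_monomial]
    refine Submodule.sub_mem _ ?_ ?_ <;> split_ifs <;> simp [hb]
  · simp
  · rw [evPath_apply]; simp
  · rw [evPath_apply]; simp

/-- Lifting of cocycles up to homotopy. -/
theorem exists_homotopy_lift_cocycle {s : N' ⟶ N} (hs : quasiIso K s) {n : ℤ} {x : N.carrier}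
    (hx : x ∈ N.grading n) (hd : N.d x = 0) :
    ∃ z ∈ N'.grading n, N'.d z = 0 ∧ ∃ h ∈ N.path.grading n, N.path.d h = 0 ∧
      (N.evPath 0).toAlgHom h = s.toAlgHom z ∧ (N.evPath 1).toAlgHom h = x := by
  obtain ⟨z, hz, hzd, b, hb, hxb⟩ := exists_lift_of_quasiIso hs hx hd
  obtain ⟨e, he, he0, he1⟩ := exists_path_to_zero hb
  refine ⟨z, hz, hzd, N.constPath.toAlgHom x - N.path.d e, Submodule.sub_mem _
    (N.constPath.map_mem _ _ hx) ?_, ?_, ?_, ?_⟩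
  · have := N.path.d_mem _ e he
    rwa [sub_add_cancel] at this
  · rw [map_sub, N.path.d_d, ← N.constPath.map_d, hd, map_zero, sub_zero]
  · rw [map_sub, (N.evPath 0).map_d, he0]
    have := congrArg (fun f => Hom.toAlgHom f x) (N.constPath_evPath 0)
    rw [show (N.evPath 0).toAlgHom (N.constPath.toAlgHom x) = x from this, hxb,
      add_sub_cancel_right]
  · rw [map_sub, (N.evPath 1).map_d, he1, map_zero, sub_zero]
    exact congrArg (fun f => Hom.toAlgHom f x) (N.constPath_evPath 1)

variable [CharZero K]

/-- Lifting of primitives up to homotopy: the inductive step of the homotopy lifting property. -/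
theorem exists_homotopy_lift_primitive {s : N' ⟶ N} (hs : quasiIso K s) {q : ℤ}
    {r' : N'.carrier} (hr' : r' ∈ N'.grading (q + 1)) (hdr' : N'.d r' = 0)
    {R : N.path.carrier} (hR : R ∈ N.path.grading (q + 1)) (hdR : N.path.d R = 0)
    (h0 : (N.evPath 0).toAlgHom R = s.toAlgHom r') {c : N.carrier} (hc : c ∈ N.grading q)
    (h1 : (N.evPath 1).toAlgHom R = N.d c) :
    ∃ c' ∈ N'.grading q, N'.d c' = r' ∧ ∃ η ∈ N.path.grading q, N.path.d η = R ∧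
      (N.evPath 0).toAlgHom η = s.toAlgHom c' ∧ (N.evPath 1).toAlgHom η = c := by
  have hcev : ∀ (t : K) (x : N.carrier), (N.evPath t).toAlgHom (N.constPath.toAlgHom x) = x :=
    fun t x => congrArg (fun f => Hom.toAlgHom f x) (N.constPath_evPath t)
  obtain ⟨e, he, hde, he1⟩ := N.exists_path_primitive 1
    (x := R - N.constPath.toAlgHom (N.d c))
    (Submodule.sub_mem _ hR (N.constPath.map_mem _ _ (N.d_mem _ c hc)))
    (by rw [map_sub, hdR, ← N.constPath.map_d, N.d_d, map_zero, sub_zero])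
    (by rw [map_sub, h1, hcev, sub_self])
  rw [add_sub_cancel_right] at he
  set η₀ := N.constPath.toAlgHom c + e with hη₀
  have hη₀m : η₀ ∈ N.path.grading q := Submodule.add_mem _ (N.constPath.map_mem _ _ hc) he
  have hdη₀ : N.path.d η₀ = R := by
    rw [hη₀, map_add, hde, ← N.constPath.map_d, add_sub_cancel]
  set c₀ := (N.evPath 0).toAlgHom η₀ with hc₀
  have hc₀m : c₀ ∈ N.grading q := (N.evPath 0).map_mem _ _ hη₀m
  have hdc₀ : N.d c₀ = s.toAlgHom r' := by rw [hc₀, ← (N.evPath 0).map_d, hdη₀, h0]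
  obtain ⟨c₁, hc₁, hrc₁⟩ := exists_primitive_of_quasiIso hs hr' hdr' hdc₀.symm
  rw [add_sub_cancel_right] at hc₁
  obtain ⟨z, hz, hzd, b, hb, hzb⟩ := exists_lift_of_quasiIso hs
    (Submodule.sub_mem _ (s.map_mem _ _ hc₁) hc₀m)
    (by rw [map_sub, hdc₀, ← s.map_d, ← hrc₁, sub_self])
  obtain ⟨ω, hω, hω0, hω1⟩ := exists_path_to_zero hb
  refine ⟨c₁ - z, Submodule.sub_mem _ hc₁ hz, by rw [map_sub, hzd, sub_zero, hrc₁],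
    η₀ + N.path.d ω, Submodule.add_mem _ hη₀m ?_, ?_, ?_, ?_⟩
  · have := N.path.d_mem _ ω hω
    rwa [sub_add_cancel] at this
  · rw [map_add, N.path.d_d, add_zero, hdη₀]
  · rw [map_add, (N.evPath 0).map_d, hω0, ← hc₀, map_sub, sub_eq_iff_eq_add.1 hzb]
    abel
  · rw [map_add, (N.evPath 1).map_d, hω1, map_zero, add_zero, hη₀, map_add, hcev, he1, add_zero]

end Lifting

/-! ### Morphisms of the homotopy category out of a cdga with the homotopy lifting property -/

/-- A property of morphisms between objects `Q X` of a localization holds for all of them if it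
holds for the images of morphisms and for the inverses of the localized ones and is stable under
composition. -/
theorem localization_induction {C : Type*} [Category* C] (W : MorphismProperty C)
    (P : ∀ {X Y : C}, (W.Q.obj X ⟶ W.Q.obj Y) → Prop)
    (hQ : ∀ {X Y : C} (f : X ⟶ Y), P (W.Q.map f))
    (hinv : ∀ {X Y : C} (s : X ⟶ Y) (hs : W s), P (Localization.isoOfHom W.Q W s hs).inv)
    (hcomp : ∀ {X Y Z : C} (f : W.Q.obj X ⟶ W.Q.obj Y) (g : W.Q.obj Y ⟶ W.Q.obj Z),
      P f → P g → P (f ≫ g)) {X Y : C} (f : W.Q.obj X ⟶ W.Q.obj Y) : P f := by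
  let e := Localization.Construction.objEquiv W
  have he : Function.Injective W.Q.obj := e.injective
  let P' : MorphismProperty W.Localization := fun X Y θ =>
    ∀ (X₀ Y₀ : C) (hX : W.Q.obj X₀ = X) (hY : W.Q.obj Y₀ = Y),
      P (eqToHom hX ≫ θ ≫ eqToHom hY.symm)
  have hP' : P'.IsStableUnderComposition := ⟨fun {X Y Z} θ₁ θ₂ h₁ h₂ X₀ Z₀ hX hZ => by
    obtain ⟨Y₀, hY⟩ : ∃ Y₀, W.Q.obj Y₀ = Y := e.surjective Y
    have := hcomp _ _ (h₁ X₀ Y₀ hX hY) (h₂ Y₀ Z₀ hY hZ)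
    simpa using this⟩
  have htop : P' = ⊤ := by
    refine Localization.Construction.morphismProperty_eq_top P' ?_ ?_
    · intro X Y f X₀ Y₀ hX hY
      obtain rfl := he hX
      obtain rfl := he hY
      simpa using hQ f
    · intro X Y s hs X₀ Y₀ hX hY
      obtain rfl := he hX
      obtain rfl := he hY
      have h : Localization.Construction.wIso s hs = Localization.isoOfHom W.Q W s hs :=
        Iso.ext rfl
      have := hinv s hs
      rw [← h] at this
      simpa [Localization.Construction.wInv] using this
  have h : P' f := by rw [htop]; trivial
  simpa using h X Y rfl rfl

section Representable

variable {K : Type} [Field K] [Algebra ℚ K] [CharZero K]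

/-- Every morphism of the homotopy category out of the base change of a cdga with the homotopy
lifting property is represented by a morphism of cdga's. -/
theorem HasHomotopyLifting.exists_toHo_map_eq {M : CDGA.{u} ℚ} (hM : HasHomotopyLifting K M)
    {N : CDGA.{u} K} (θ : (toHo K).obj (baseChange K M) ⟶ (toHo K).obj N) :
    ∃ f : baseChange K M ⟶ N, (toHo K).map f = θ := by
  have key : ∀ g : baseChange K M ⟶ baseChange K M, ∃ f : baseChange K M ⟶ N,
      (toHo K).map f = (toHo K).map g ≫ θ := by
    refine localization_induction (quasiIso K)
      (fun {X Y} θ => ∀ g : baseChange K M ⟶ X, ∃ f : baseChange K M ⟶ Y,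
        (toHo K).map f = (toHo K).map g ≫ θ) ?_ ?_ ?_ θ
    · intro X Y f g
      exact ⟨g ≫ f, Functor.map_comp _ _ _⟩
    · intro N' N s hs g
      obtain ⟨f', h, h0, h1⟩ := hM N' N s hs (SemiHom.restrict g)
      refine ⟨f'.extend, ?_⟩
      have e0 : h.extend ≫ N.evPath 0 = f'.extend ≫ s := by
        rw [← SemiHom.extend_comp, ← SemiHom.extend_comp]
        exact SemiHom.hom_ext fun a => by
          rw [SemiHom.extend_tmul, SemiHom.extend_tmul]
          exact congrArg _ (h0 a)
      have e1 : h.extend ≫ N.evPath 1 = g := by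
        rw [← SemiHom.extend_comp]
        refine SemiHom.hom_ext fun a => ?_
        rw [SemiHom.extend_tmul, one_smul]
        exact h1 a
      rw [Iso.eq_comp_inv, Localization.isoOfHom_hom, ← Functor.map_comp, ← e0, ← e1,
        Functor.map_comp, Functor.map_comp, N.toHo_map_evPath 0 1]
    · intro X Y Z θ₁ θ₂ h₁ h₂ g
      obtain ⟨f₁, hf₁⟩ := h₁ g
      obtain ⟨f₂, hf₂⟩ := h₂ f₁
      exact ⟨f₂, by rw [hf₂, hf₁, Category.assoc]⟩
  obtain ⟨f, hf⟩ := key (𝟙 _)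
  exact ⟨f, by rw [hf, CategoryTheory.Functor.map_id, Category.id_comp]⟩

end Representable

end CDGA

/-! ### Evaluation of polynomials at central elements -/

section EvalCentral

variable {σ k K N : Type*} [Field k] [Field K] [Ring N] [Algebra K N]

/-- The evaluation of polynomials at central elements of a noncommutative algebra. -/
def evalCentral (φ : k →+* K) (a : σ → N) (ha : ∀ i x, x * a i = a i * x) :
    MvPolynomial σ k →+* N :=
  (Subalgebra.center K N).val.toRingHom.comp
    (MvPolynomial.eval₂Hom ((algebraMap K (Subalgebra.center K N)).comp φ)
      (fun i => ⟨a i, Subalgebra.mem_center_iff.2 (fun x => ha i x)⟩))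

variable (φ : k →+* K) (a : σ → N) (ha : ∀ i x, x * a i = a i * x)

@[simp] theorem evalCentral_C (c : k) :
    evalCentral φ a ha (MvPolynomial.C c) = algebraMap K N (φ c) := by
  simp [evalCentral]

@[simp] theorem evalCentral_X (i : σ) : evalCentral φ a ha (MvPolynomial.X i) = a i := by
  simp [evalCentral]

theorem evalCentral_mem {ι : Type*} [AddCommGroup ι] [DecidableEq ι] {𝒩 : ι → Submodule K N}
    [GradedAlgebra 𝒩] {w : σ → ι} (h : ∀ i, a i ∈ 𝒩 (w i)) {n : ι} {f : MvPolynomial σ k}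
    (hf : f ∈ MvPolynomial.weightedHomogeneousSubmodule k w n) :
    evalCentral φ a ha f ∈ 𝒩 n := by
  have key : ∀ m : σ →₀ ℕ, evalCentral φ a ha (MvPolynomial.monomial m 1) ∈
      𝒩 (Finsupp.weight w m) := by
    intro m
    induction m using Finsupp.induction_linear with
    | zero =>
      rw [map_zero]
      change evalCentral φ a ha 1 ∈ _
      rw [map_one]
      exact SetLike.one_mem_graded 𝒩
    | add x y hx hy =>
      rw [map_add, ← one_mul (1 : k), ← MvPolynomial.monomial_mul, map_mul]
      exact SetLike.mul_mem_graded hx hy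
    | single i j =>
      rw [Finsupp.weight_single, ← MvPolynomial.X_pow_eq_monomial, map_pow, evalCentral_X]
      exact SetLike.pow_mem_graded j (h i)
  rw [f.as_sum, map_sum]
  refine Submodule.sum_mem _ fun m hm => ?_
  rw [← mul_one (f.coeff m), ← MvPolynomial.C_mul_monomial, map_mul, evalCentral_C,
    ← Algebra.smul_def, ← hf (MvPolynomial.mem_support_iff.1 hm)]
  exact Submodule.smul_mem _ _ (key m)

end EvalCentral

/-! ### Regular sequences of polynomials -/

/-- The sequence `rs` is regular modulo the ideal `J` (without the condition that it generates a
proper ideal). -/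
def RegularModulo {S : Type*} [CommRing S] : Ideal S → List S → Prop
  | _, [] => True
  | J, r :: rs => (∀ p, r * p ∈ J → p ∈ J) ∧ RegularModulo (J ⊔ Ideal.span {r}) rs

/-! ### Adjoining an odd generator to a cdga -/

namespace CDGA

section Adjoin

variable {k : Type v} [Field k] (B : CDGA.{u} k) (q : ℤ) (hq : Odd q) (r : B.carrier)
  (hr : r ∈ B.grading (q + 1)) (hd : B.d r = 0)

/-- The cdga `B ⊕ yB` obtained from `B` by adjoining an odd element `y` of degree `q` with
`d y = r`. -/
def adjoin : CDGA.{u} k :=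
  letI := oddGradedAlgebra (q := q) B.isParity
  have hc : IsEvenCentral B.par r :=
    B.isGradedComm.isEvenCentral B.isParity (n := q + 1) hq.add_one hr
  ofDer (oddGrading B.grading B.par q) (OddExt.par B.par) (isParity_par B.isParity hq)
    (isGradedComm_odd B.isParity hq B.isGradedComm) (OddExt.diff B.d r 0)
    (OddExt.isOddDer_diff B.isParity.invol B.isOddDer hc (IsEvenDer.zero _))
    (fun n a ha => diff_mem B.d_mem hr (fun _ _ _ => Submodule.zero_mem _) ha)
    (fun a => by
      ext
      · simp [B.d_d, B.isOddDer.mul, hd, hc.fix]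
      · simp [B.d_d])

/-- The inclusion of `B` in `B ⊕ yB`. -/
def adjoinIncl : B ⟶ B.adjoin q hq r hr hd where
  toAlgHom := OddExt.incl B.par
  map_mem _ _ ha := incl_mem ha
  map_d a := by
    apply OddExt.ext
    · change B.d a = B.d a + r * 0
      rw [mul_zero, add_zero]
    · change 0 = 0 - B.d 0
      rw [map_zero, sub_zero]

/-- The adjoined generator `y` of `B ⊕ yB`. -/
def adjoinGen : (B.adjoin q hq r hr hd).carrier := OddExt.gen B.par

variable {B q hq r hr hd}

/-- A map out of `B ⊕ yB` is given by a map out of `B` and a primitive of the image of `r`. -/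
def adjoinLift {K : Type*} [Field K] [CharZero K] {N : CDGA.{u} K} (f : SemiHom B N)
    (c : N.carrier) (hc : c ∈ N.grading q) (hdc : N.d c = f.toRingHom r) :
    SemiHom (B.adjoin q hq r hr hd) N where
  toRingHom := OddExt.lift f.toRingHom c (N.isGradedComm.odd_sq hq hc) (fun a => by
    rw [f.map_par]; exact N.isGradedComm.mul_odd N.isParity hq hc _)
  map_mem n x hx := by
    refine Submodule.add_mem _ (f.map_mem _ _ hx.1) ?_
    have := SetLike.mul_mem_graded hc (f.map_mem _ _ hx.2)
    rwa [add_sub_cancel] at this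
  map_d x := by
    have h := OddExt.lift_diff (ε := B.par) (f := f.toRingHom) (c := c)
      (hc := N.isGradedComm.odd_sq hq hc) (hf := fun a => by
        rw [f.map_par]; exact N.isGradedComm.mul_odd N.isParity hq hc _)
      (δ := B.d) (θ := 0) (r := r) (D := N.d.toAddMonoidHom)
      (fun a => (N.isOddDer.mul c a).trans (by
        rw [N.isParity.odd hc hq, neg_mul, ← sub_eq_add_neg]; rfl))
      (fun a => (f.map_d a).symm.trans (by simp)) hdc x
    exact h.symm

theorem adjoinLift_incl {K : Type*} [Field K] [CharZero K] {N : CDGA.{u} K} (f : SemiHom B N)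
    (c : N.carrier) (hc : c ∈ N.grading q) (hdc : N.d c = f.toRingHom r) (a : B.carrier) :
    (adjoinLift (hq := hq) (hr := hr) (hd := hd) f c hc hdc).toRingHom
      ((B.adjoinIncl q hq r hr hd).toAlgHom a) = f.toRingHom a := by
  change f.toRingHom a + c * f.toRingHom 0 = _
  rw [map_zero, mul_zero, add_zero]

theorem adjoinLift_gen {K : Type*} [Field K] [CharZero K] {N : CDGA.{u} K} (f : SemiHom B N)
    (c : N.carrier) (hc : c ∈ N.grading q) (hdc : N.d c = f.toRingHom r) :
    (adjoinLift (hq := hq) (hr := hr) (hd := hd) f c hc hdc).toRingHom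
      (B.adjoinGen q hq r hr hd) = c := by
  change f.toRingHom 0 + c * f.toRingHom 1 = _
  rw [map_zero, map_one, mul_one, zero_add]

/-- The restriction of a semilinear map out of `B ⊕ yB` to `B`. -/
def SemiHom.ofAdjoin {K : Type*} [Field K] {N : CDGA.{u} K}
    (f : SemiHom (B.adjoin q hq r hr hd) N) : SemiHom B N where
  toRingHom := f.toRingHom.comp ((B.adjoinIncl q hq r hr hd).toAlgHom : B.carrier →+* _)
  map_mem n a ha := f.map_mem n _ ((B.adjoinIncl q hq r hr hd).map_mem n a ha)
  map_d a := (congrArg f.toRingHom ((B.adjoinIncl q hq r hr hd).map_d a)).trans (f.map_d _)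

theorem adjoin_ringHom_ext {N : Type*} [Ring N]
    {f g : (B.adjoin q hq r hr hd).carrier →+* N}
    (h : ∀ a, f ((B.adjoinIncl q hq r hr hd).toAlgHom a) =
      g ((B.adjoinIncl q hq r hr hd).toAlgHom a))
    (h' : f (B.adjoinGen q hq r hr hd) = g (B.adjoinGen q hq r hr hd))
    (x : (B.adjoin q hq r hr hd).carrier) :
    f x = g x := by
  have : f = g := OddExt.ringHom_ext (f := f) (g := g) h h'
  rw [this]

theorem gen_mem_adjoin :
    B.adjoinGen q hq r hr hd ∈ (B.adjoin q hq r hr hd).grading q := gen_mem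

theorem d_gen_adjoin : (B.adjoin q hq r hr hd).d (B.adjoinGen q hq r hr hd) =
    (B.adjoinIncl q hq r hr hd).toAlgHom r := by
  apply OddExt.ext
  · change B.d 0 + r * 1 = r
    rw [map_zero, zero_add, mul_one]
  · change 0 - B.d 1 = 0
    rw [B.d_one, sub_zero]

theorem HasHomotopyLifting.adjoin {K : Type*} [Field K] [CharZero K]
    (hB : HasHomotopyLifting K B) : HasHomotopyLifting K (B.adjoin q hq r hr hd) := by
  intro N' N s hs f
  obtain ⟨f₀, h₀, e0, e1⟩ := hB N' N s hs f.ofAdjoin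
  have hfr : N.d (f.toRingHom (B.adjoinGen q hq r hr hd)) = f.ofAdjoin.toRingHom r := by
    rw [← f.map_d]
    exact congrArg f.toRingHom d_gen_adjoin
  obtain ⟨c', hc', hdc', η, hη, hdη, hη0, hη1⟩ := exists_homotopy_lift_primitive hs
    (f₀.map_mem _ _ hr) (by rw [← f₀.map_d, hd, map_zero]) (h₀.map_mem _ _ hr)
    (by rw [← h₀.map_d, hd, map_zero]) (e0 r) (f.map_mem _ _ gen_mem_adjoin)
    ((e1 r).trans hfr.symm)
  refine ⟨adjoinLift f₀ c' hc' hdc', adjoinLift h₀ η hη hdη, ?_, ?_⟩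
  · intro a
    refine adjoin_ringHom_ext
      (f := ((N.evPath 0).toAlgHom : N.path.carrier →+* N.carrier).comp
        (adjoinLift (hq := hq) (hr := hr) (hd := hd) h₀ η hη hdη).toRingHom)
      (g := (s.toAlgHom : N'.carrier →+* N.carrier).comp
        (adjoinLift (hq := hq) (hr := hr) (hd := hd) f₀ c' hc' hdc').toRingHom)
      (fun a => ?_) ?_ a
    · simp only [RingHom.comp_apply, adjoinLift_incl]
      exact e0 a
    · simp only [RingHom.comp_apply, adjoinLift_gen]
      exact hη0
  · intro a
    refine adjoin_ringHom_ext
      (f := ((N.evPath 1).toAlgHom : N.path.carrier →+* N.carrier).comp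
        (adjoinLift (hq := hq) (hr := hr) (hd := hd) h₀ η hη hdη).toRingHom)
      (g := f.toRingHom) (fun a => ?_) ?_ a
    · simp only [RingHom.comp_apply, adjoinLift_incl]
      exact e1 a
    · simp only [RingHom.comp_apply, adjoinLift_gen]
      exact hη1

end Adjoin

/-! ### Pure models over the rationals -/

section Pure

variable {σ : Type u} (p : σ → ℕ)

/-- The cohomological degrees `2 p_i` of the variables. -/
abbrev evenWeight : σ → ℤ := fun i => 2 * (p i : ℤ)

theorem evenWeight_eq_zero {n : ℤ} (hn : ¬ Even n) {f : MvPolynomial σ ℚ}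
    (hf : f ∈ MvPolynomial.weightedHomogeneousSubmodule ℚ (evenWeight p) n) : f = 0 := by
  by_contra h
  obtain ⟨m, hm⟩ := MvPolynomial.ne_zero_iff.1 h
  refine hn ?_
  rw [← hf hm, Finsupp.weight_apply]
  exact Finset.even_sum _ fun i _ => (even_two_mul _).nsmul_right _

/-- The polynomial ring as a cdga without differential. -/
def polynomialCDGA : CDGA.{u} ℚ :=
  letI := MvPolynomial.weightedGradedAlgebra ℚ (evenWeight p)
  ofDer (MvPolynomial.weightedHomogeneousSubmodule ℚ (evenWeight p)) (AlgHom.id ℚ _)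
    (fun n f hf => by
      by_cases hn : Even n
      · rw [AddMonoidHom.id_apply, Int.negOnePow_even _ hn]; simp
      · rw [evenWeight_eq_zero p hn hf]; simp)
    (fun m n f hf g hg => by
      by_cases hm : Even m
      · rw [AddMonoidHom.id_apply, Int.negOnePow_even _ (hm.mul_right _), mul_comm f g]; simp
      · rw [evenWeight_eq_zero p hm hf]; simp)
    0 ⟨by simp, by simp⟩ (fun _ _ _ => Submodule.zero_mem _) (fun _ => rfl)

theorem d_evalCentral {K : Type*} [Field K] [CharZero K] {N : CDGA.{u} K} (a : σ → N.carrier)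
    (ha : ∀ i x, x * a i = a i * x) (hd : ∀ i, N.d (a i) = 0) (f : MvPolynomial σ ℚ) :
    N.d (evalCentral (Rat.castHom K) a ha f) = 0 := by
  induction f using MvPolynomial.induction_on with
  | C c => rw [evalCentral_C, Algebra.algebraMap_eq_smul_one, map_smul, N.d_one, smul_zero]
  | add f g hf hg => rw [map_add, map_add, hf, hg, add_zero]
  | mul_X f i hf => rw [map_mul, evalCentral_X, N.d_mul_of_cocycle _ (hd i), hf, zero_mul]

theorem mul_comm_of_even {K : Type*} [Field K] {N : CDGA.{u} K} {a : σ → N.carrier}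
    (ha : ∀ i, a i ∈ N.grading (evenWeight p i)) (i : σ) (x : N.carrier) : x * a i = a i * x :=
  (N.isGradedComm.isEvenCentral N.isParity (n := evenWeight p i) (even_two_mul _) (ha i)).comm x

/-- The evaluation of polynomials at even cocycles. -/
def evalCocycles {K : Type*} [Field K] [CharZero K] {N : CDGA.{u} K} (a : σ → N.carrier)
    (ha : ∀ i, a i ∈ N.grading (evenWeight p i)) (hd : ∀ i, N.d (a i) = 0) :
    SemiHom (polynomialCDGA p) N where
  toRingHom := evalCentral (Rat.castHom K) a (mul_comm_of_even p ha)
  map_mem _ _ hf := evalCentral_mem _ _ _ ha hf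
  map_d f := (map_zero (evalCentral (Rat.castHom K) a (mul_comm_of_even p ha))).trans
    (d_evalCentral a _ hd f).symm

/-- The variables of the polynomial ring. -/
def polyX (i : σ) : (polynomialCDGA p).carrier := (MvPolynomial.X i : MvPolynomial σ ℚ)

theorem evalCocycles_X {K : Type*} [Field K] [CharZero K] {N : CDGA.{u} K} (a : σ → N.carrier)
    (ha : ∀ i, a i ∈ N.grading (evenWeight p i)) (hd : ∀ i, N.d (a i) = 0) (i : σ) :
    (evalCocycles p a ha hd).toRingHom (polyX p i) = a i :=
  evalCentral_X _ _ (mul_comm_of_even p ha) i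

theorem X_mem_polynomialCDGA (i : σ) :
    polyX p i ∈ (polynomialCDGA p).grading (evenWeight p i) :=
  MvPolynomial.isWeightedHomogeneous_X ℚ (evenWeight p) i

theorem polynomialCDGA_ringHom_ext {N : Type*} [Ring N] {f g : (polynomialCDGA p).carrier →+* N}
    (h : ∀ i, f (polyX p i) = g (polyX p i)) (x : (polynomialCDGA p).carrier) : f x = g x := by
  have : f = g := MvPolynomial.ringHom_ext (f := f) (g := g) (fun r => by
    have : Subsingleton (ℚ →+* N) := inferInstance
    exact congrArg (fun φ : ℚ →+* N => φ r) (Subsingleton.elim (f.comp MvPolynomial.C)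
      (g.comp MvPolynomial.C))) h
  rw [this]

theorem hasHomotopyLifting_polynomialCDGA {K : Type*} [Field K] [CharZero K] :
    HasHomotopyLifting K (polynomialCDGA p) := by
  intro N' N s hs f
  have hd : ∀ i, N.d (f.toRingHom (polyX p i)) = 0 := fun i =>
    (f.map_d _).symm.trans (map_zero f.toRingHom)
  choose z hz hzd h hh hhd h0 h1 using fun i =>
    exists_homotopy_lift_cocycle hs (f.map_mem _ _ (X_mem_polynomialCDGA p i)) (hd i)
  refine ⟨evalCocycles p z hz hzd, evalCocycles p h hh hhd, fun a => ?_, fun a => ?_⟩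
  · refine polynomialCDGA_ringHom_ext p
      (f := ((N.evPath 0).toAlgHom : N.path.carrier →+* N.carrier).comp
        (evalCocycles p h hh hhd).toRingHom)
      (g := (s.toAlgHom : N'.carrier →+* N.carrier).comp (evalCocycles p z hz hzd).toRingHom)
      (fun i => ?_) a
    simp only [RingHom.comp_apply, evalCocycles_X]
    exact h0 i
  · refine polynomialCDGA_ringHom_ext p
      (f := ((N.evPath 1).toAlgHom : N.path.carrier →+* N.carrier).comp
        (evalCocycles p h hh hhd).toRingHom)
      (g := f.toRingHom) (fun i => ?_) a
    simp only [RingHom.comp_apply, evalCocycles_X]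
    exact h1 i

/-- A cdga under the polynomial ring `S = ℚ[x_i]`, with `x_i` of degree `2 p_i`, that is a model of
`S ⧸ I` obtained from `S` by adjoining odd generators whose differentials lie in `S`. The fields
record its cohomology and its mapping properties; in particular (`ext_of_even`) a map to a cdga
that vanishes in odd degrees is determined by its restriction to `S`. -/
structure PureModel (I : Ideal (MvPolynomial σ ℚ)) where
  M : CDGA.{u} ℚ
  ι : SemiHom (polynomialCDGA p) M
  exists_rep : ∀ x, M.d x = 0 → ∃ (f : MvPolynomial σ ℚ) (b : M.carrier),
    x = ι.toRingHom f + M.d b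
  exact_iff : ∀ f : MvPolynomial σ ℚ, (∃ b, ι.toRingHom f = M.d b) ↔ f ∈ I
  lifting : ∀ (K : Type) [Field K] [CharZero K], HasHomotopyLifting K M
  exists_extension : ∀ (K : Type) [Field K] [CharZero K] (N : CDGA.{u} K)
    (g : SemiHom (polynomialCDGA p) N),
    (∀ f : MvPolynomial σ ℚ, f ∈ I → ∃ b, g.toRingHom f = N.d b) →
    ∃ F : SemiHom M N, ∀ f, F.toRingHom (ι.toRingHom f) = g.toRingHom f
  ext_of_even : ∀ (K : Type) [Field K] (N : CDGA.{u} K),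
    (∀ n, Odd n → ∀ x ∈ N.grading n, x = 0) → ∀ F G : SemiHom M N,
    (∀ f, F.toRingHom (ι.toRingHom f) = G.toRingHom (ι.toRingHom f)) →
    ∀ x, F.toRingHom x = G.toRingHom x

/-- The polynomial ring is a pure model of itself. -/
def PureModel.bot : PureModel p ⊥ where
  M := polynomialCDGA p
  ι := SemiHom.ofHom (𝟙 _)
  exists_rep x _ := ⟨x, 0, by rw [map_zero, add_zero]; rfl⟩
  exact_iff f := by
    rw [Ideal.mem_bot]
    exact ⟨fun ⟨_, h⟩ => h, fun h => ⟨0, h⟩⟩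
  lifting _ _ _ := hasHomotopyLifting_polynomialCDGA p
  exists_extension _ _ _ _ g _ := ⟨g, fun _ => rfl⟩
  ext_of_even _ _ _ _ _ _ h := h

variable {p}

theorem PureModel.d_ι {I : Ideal (MvPolynomial σ ℚ)} (P : PureModel p I) (f : MvPolynomial σ ℚ) :
    P.M.d (P.ι.toRingHom f) = 0 :=
  (P.ι.map_d f).symm.trans (map_zero P.ι.toRingHom)

/-- Adjoining an odd generator `y` with `d y = r` to a model of `S ⧸ I` yields a model of
`S ⧸ (I + (r))` if `r` is not a zero divisor modulo `I`. -/
def PureModel.adjoin {I : Ideal (MvPolynomial σ ℚ)} (P : PureModel p I) {r : MvPolynomial σ ℚ}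
    {n : ℤ} (hr : r ∈ MvPolynomial.weightedHomogeneousSubmodule ℚ (evenWeight p) (2 * n))
    (hreg : ∀ f, r * f ∈ I → f ∈ I) : PureModel p (I ⊔ Ideal.span {r}) :=
  have hq : Odd (2 * n - 1) := (even_two_mul n).sub_odd odd_one
  have hr' : P.ι.toRingHom r ∈ P.M.grading (2 * n - 1 + 1) := by
    rw [sub_add_cancel]; exact P.ι.map_mem _ _ hr
  let M' := P.M.adjoin (2 * n - 1) hq (P.ι.toRingHom r) hr' (P.d_ι r)
  let j := P.M.adjoinIncl (2 * n - 1) hq (P.ι.toRingHom r) hr' (P.d_ι r)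
  { M := M'
    ι := P.ι.comp j
    exists_rep := fun x hx => by
      have h1 : P.M.d (OddExt.fst x) + P.ι.toRingHom r * OddExt.snd x = 0 :=
        congrArg OddExt.fst hx
      have h2 : P.M.d (OddExt.snd x) = 0 := by
        have : 0 - P.M.d (OddExt.snd x) = 0 := congrArg OddExt.snd hx
        rwa [zero_sub, neg_eq_zero] at this
      -- the component `f` along `y` is killed by `r` in `S ⧸ I`, hence is exact
      obtain ⟨f, b, hfb⟩ := P.exists_rep _ h2
      have hrc : ∀ x, P.M.d (P.ι.toRingHom r * x) = P.ι.toRingHom r * P.M.d x := fun x => by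
        rw [P.M.isOddDer.mul, P.d_ι, zero_mul, zero_add,
          P.M.isParity.even (P.ι.map_mem _ _ hr) (even_two_mul n)]
      have h3 : r * f ∈ I := by
        rw [← P.exact_iff]
        refine ⟨-OddExt.fst x - P.ι.toRingHom r * b, ?_⟩
        have e : P.M.d (OddExt.fst x) = -(P.ι.toRingHom r * OddExt.snd x) :=
          eq_neg_of_add_eq_zero_left h1
        refine (map_mul P.ι.toRingHom _ _).trans ?_
        rw [map_sub, map_neg, hrc, e, hfb, mul_add]
        abel
      obtain ⟨b', hb'⟩ := (P.exact_iff f).2 (hreg f h3)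
      set c := b' + b with hc
      have hxc : OddExt.snd x = P.M.d c := by rw [hfb, hb', hc, map_add]
      obtain ⟨g, e, hge⟩ := P.exists_rep (OddExt.fst x + P.ι.toRingHom r * c) (by
        rw [map_add, hrc, ← hxc, h1])
      refine ⟨g, (⟨e, -c⟩ : OddExt P.M.par), ?_⟩
      apply OddExt.ext
      · change OddExt.fst x = P.ι.toRingHom g + (P.M.d e + P.ι.toRingHom r * (-c))
        rw [← add_assoc, ← hge, mul_neg, add_neg_cancel_right]
      · change OddExt.snd x = 0 + (0 - P.M.d (-c))
        rw [map_neg, zero_add, zero_sub, neg_neg, hxc]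
    exact_iff := fun f => by
      constructor
      · rintro ⟨x, hx⟩
        have h1 : P.ι.toRingHom f = P.M.d (OddExt.fst x) + P.ι.toRingHom r * OddExt.snd x :=
          congrArg OddExt.fst hx
        have h2 : P.M.d (OddExt.snd x) = 0 := by
          have : 0 = 0 - P.M.d (OddExt.snd x) := congrArg OddExt.snd hx
          rwa [zero_sub, zero_eq_neg] at this
        obtain ⟨g, b, hgb⟩ := P.exists_rep _ h2
        have h3 : f - r * g ∈ I := by
          rw [← P.exact_iff]
          refine ⟨OddExt.fst x + P.ι.toRingHom r * b, ?_⟩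
          refine (map_sub P.ι.toRingHom _ _).trans ?_
          rw [map_add, P.M.isOddDer.mul, P.d_ι, zero_mul, zero_add,
            P.M.isParity.even (P.ι.map_mem _ _ hr) (even_two_mul n), h1, hgb, mul_add]
          refine sub_eq_iff_eq_add.2 ?_
          rw [show P.ι.toRingHom (r * g) = P.ι.toRingHom r * P.ι.toRingHom g from
            map_mul P.ι.toRingHom _ _]
          abel
        have h4 : f = (f - r * g) + r * g := by ring
        rw [h4]
        exact Ideal.add_mem _ (Ideal.mem_sup_left h3)
          (Ideal.mem_sup_right (Ideal.mul_mem_right _ _ (Ideal.mem_span_singleton_self r)))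
      · intro hf
        obtain ⟨g, hg, h, hh, rfl⟩ := Submodule.mem_sup.1 hf
        obtain ⟨s, rfl⟩ := Ideal.mem_span_singleton'.1 hh
        obtain ⟨b, hb⟩ := (P.exact_iff g).2 hg
        refine ⟨(⟨b, P.ι.toRingHom s⟩ : OddExt P.M.par), ?_⟩
        apply OddExt.ext
        · change P.ι.toRingHom (g + s * r) = P.M.d b + P.ι.toRingHom r * P.ι.toRingHom s
          rw [← hb, mul_comm s r]
          exact (map_add P.ι.toRingHom _ _).trans (congrArg _ (map_mul P.ι.toRingHom _ _))
        · change 0 = 0 - P.M.d (P.ι.toRingHom s)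
          rw [P.d_ι, sub_zero]
    lifting := fun K _ _ => (P.lifting K).adjoin
    exists_extension := fun K _ _ N g hg => by
      obtain ⟨F, hF⟩ := P.exists_extension K N g fun f hf => hg f (Ideal.mem_sup_left hf)
      obtain ⟨b, hb⟩ := hg r (Ideal.mem_sup_right (Ideal.mem_span_singleton_self r))
      obtain ⟨c, hc, hc'⟩ := exists_homogeneous_primitive (g.map_mem _ _ hr) hb
      exact ⟨adjoinLift F c hc (hc'.symm.trans (hF r).symm), fun f =>
        (adjoinLift_incl F c hc _ _).trans (hF f)⟩
    ext_of_even := fun K _ N hN F G hFG x => by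
      refine adjoin_ringHom_ext (f := F.toRingHom) (g := G.toRingHom)
        (fun a => P.ext_of_even K N hN F.ofAdjoin G.ofAdjoin hFG a) ?_ x
      rw [hN _ hq _ (F.map_mem _ _ gen_mem_adjoin), hN _ hq _ (G.map_mem _ _ gen_mem_adjoin)] }

/-- The Koszul model of `S ⧸ (I + (rs))`. -/
theorem PureModel.exists_of_regularModulo {rs : List (MvPolynomial σ ℚ)}
    (hrs : ∀ r ∈ rs, ∃ n : ℤ,
      r ∈ MvPolynomial.weightedHomogeneousSubmodule ℚ (evenWeight p) (2 * n))
    {I : Ideal (MvPolynomial σ ℚ)} (hreg : RegularModulo I rs) (P : PureModel p I) :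
    Nonempty (PureModel p (I ⊔ Ideal.ofList rs)) := by
  induction rs generalizing I with
  | nil => rw [Ideal.ofList_nil, sup_bot_eq]; exact ⟨P⟩
  | cons r rs ih =>
    rw [Ideal.ofList_cons, ← sup_assoc]
    obtain ⟨n, hn⟩ := hrs r List.mem_cons_self
    exact ih (fun r' hr' => hrs r' (List.mem_cons_of_mem _ hr')) hreg.2 (P.adjoin hn hreg.1)

end Pure

end CDGA

/-! ### Adjoining a potential to a bigraded bidifferential algebra -/

theorem OddExt.diff_diff {k R : Type*} [Field k] [CharZero k] [Ring R] [Algebra k R]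
    {ε : R →ₐ[k] R} {δ θ : R →ₗ[k] R} {r : R} (hδ : IsOddDer ε δ) (hr : IsEvenCentral ε r)
    (hθ : IsEvenDer ε θ) (h0 : ∀ a, δ (δ a) = 0) (h1 : δ r = 0) (h2 : ∀ a, r * θ a = 0)
    (h3 : ∀ a, θ (δ a) = δ (θ a)) (h4 : θ r = 0) (x : OddExt ε) :
    OddExt.diff δ r θ (OddExt.diff δ r θ x) = 0 := by
  have h := OddExt.diff_diff_add hδ hδ hr hr hθ hθ (by simp [h1]) (by simp [h4])
    (by simp [h3]) x
  have h' : (2 : k) • OddExt.diff δ r θ (OddExt.diff δ r θ x) = 0 := by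
    rw [two_smul, h]
    ext <;> simp [h0, h2]
  exact (smul_eq_zero_iff_right two_ne_zero).1 h'

namespace RCBBA

open Polynomial

/-- The total degree, which governs the signs. -/
def totalDegree : ℤ × ℤ →+ ℤ := AddMonoidHom.coprod (AddMonoidHom.id ℤ) (AddMonoidHom.id ℤ)

@[simp] theorem totalDegree_apply (n : ℤ × ℤ) : totalDegree n = n.1 + n.2 := rfl

section Basic

variable (B : RCBBA.{u})

/-- The parity automorphism. -/
def par : B.carrier →ₐ[ℂ] B.carrier := parityAut B.grading totalDegree

theorem isParity : IsParity B.grading totalDegree B.par := isParity_parityAut _ _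

theorem isGradedComm : IsGradedComm B.grading totalDegree :=
  fun m n a ha b hb => B.graded_comm m.1 m.2 n.1 n.2 a ha b hb

theorem del_mem' (n : ℤ × ℤ) (a : B.carrier) (ha : a ∈ B.grading n) :
    B.del a ∈ B.grading (n + (1, 0)) := by
  have := B.del_mem n.1 n.2 a ha
  rwa [show n + (1, 0) = (n.1 + 1, n.2) by ext <;> simp]

theorem delbar_mem' (n : ℤ × ℤ) (a : B.carrier) (ha : a ∈ B.grading n) :
    B.delbar a ∈ B.grading (n + (0, 1)) := by
  have := B.delbar_mem n.1 n.2 a ha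
  rwa [show n + (0, 1) = (n.1, n.2 + 1) by ext <;> simp]

theorem isOddDer_del : IsOddDer B.par B.del :=
  B.isParity.isOddDer (e := (1, 0)) (by simp) B.del_mem'
    (fun n a ha b => B.del_leibniz n.1 n.2 a ha b)

theorem isOddDer_delbar : IsOddDer B.par B.delbar :=
  B.isParity.isOddDer (e := (0, 1)) (by simp) B.delbar_mem'
    (fun n a ha b => B.delbar_leibniz n.1 n.2 a ha b)

theorem par_σ (a : B.carrier) : B.par (B.σ a) = B.σ (B.par a) := by
  induction a using DirectSum.Decomposition.inductionOn B.grading with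
  | zero => simp
  | add x y hx hy => simp only [map_add, hx, hy]
  | @homogeneous i a =>
    rw [B.isParity i a a.2, B.isParity _ _ (B.σ_mem i.1 i.2 a a.2), map_zsmul]
    simp [add_comm]

end Basic

section Adjoin

variable (B : RCBBA.{u}) (m : ℤ) (r : B.carrier)

/-- The parity automorphism of `B[z]`. -/
abbrev polyPar : B.carrier[X] →ₐ[ℂ] B.carrier[X] := mapAlgHom B.par

/-- The ring `B[z] ⊗ Λ(α)`. -/
abbrev OddExt₁ := OddExt B.polyPar

/-- The ring `B[z] ⊗ Λ(α, β)`. -/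
abbrev OddExt₂ := OddExt (OddExt.par B.polyPar)

theorem isParity_polyPar :
    IsParity (polyGrading B.grading (m - 1, m - 1)) totalDegree B.polyPar :=
  isParity_mapAlgHom B.isParity (by simp)

/-- The bigrading of `B[z]`, with `z` of bidegree `(m - 1, m - 1)`. -/
abbrev grading₀ : ℤ × ℤ → Submodule ℂ B.carrier[X] := polyGrading B.grading (m - 1, m - 1)

/-- The bigrading of `B[z] ⊗ Λ(α)`, with `α` of bidegree `(m, m - 1)`. -/
abbrev grading₁ : ℤ × ℤ → Submodule ℂ B.OddExt₁ :=
  oddGrading (B.grading₀ m) B.polyPar (m, m - 1)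

/-- The bigrading of `B[z] ⊗ Λ(α, β)`, with `β` of bidegree `(m - 1, m)`. -/
abbrev grading₂ : ℤ × ℤ → Submodule ℂ B.OddExt₂ :=
  oddGrading (B.grading₁ m) (OddExt.par B.polyPar) (m - 1, m)

theorem isParity₁ : IsParity (B.grading₁ m) totalDegree (OddExt.par B.polyPar) :=
  isParity_par (B.isParity_polyPar m) ⟨m - 1, by simp; ring⟩

theorem isParity₂ : IsParity (B.grading₂ m) totalDegree (OddExt.par (OddExt.par B.polyPar)) :=
  letI := oddGradedAlgebra (q := (m, m - 1)) (B.isParity_polyPar m)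
  isParity_par (B.isParity₁ m) ⟨m - 1, by simp; ring⟩

/-- The bigrading of `B[z] ⊗ Λ(α)` is a grading of algebras. -/
abbrev gradedAlgebra₁ : GradedAlgebra (B.grading₁ m) := oddGradedAlgebra (B.isParity_polyPar m)

/-- The bigrading of `B[z] ⊗ Λ(α, β)` is a grading of algebras. -/
abbrev gradedAlgebra₂ : GradedAlgebra (B.grading₂ m) :=
  letI := B.gradedAlgebra₁ m
  oddGradedAlgebra (B.isParity₁ m)

theorem polyPar_polyPar (P : B.carrier[X]) : B.polyPar (B.polyPar P) = P :=
  (B.isParity_polyPar 0).invol P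

/-- The operator `∂` on `B[z] ⊗ Λ(α)`: it extends `∂` on `B` by `∂z = α`, `∂α = 0`. -/
def del₁ : B.OddExt₁ →ₗ[ℂ] B.OddExt₁ := OddExt.diff (coeffMap fun _ => B.del) 0 (derivativeₗ ℂ)

/-- The operator on `B[z] ⊗ Λ(α)` that extends `∂̄` on `B` by `z ↦ 0`, `α ↦ -ρ`. -/
def delbar₁ (ρ : B.carrier) : B.OddExt₁ →ₗ[ℂ] B.OddExt₁ :=
  OddExt.diff (coeffMap fun _ => B.delbar) (C (-ρ)) 0

/-- The operator `∂` on `B[z] ⊗ Λ(α, β)`, with `∂z = α`, `∂α = 0`, `∂β = ρ`. -/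
def del₂ (ρ : B.carrier) : B.OddExt₂ →ₗ[ℂ] B.OddExt₂ :=
  OddExt.diff B.del₁ (OddExt.incl _ (C ρ)) 0

/-- The operator `∂̄` on `B[z] ⊗ Λ(α, β)`, with `∂̄z = β`, `∂̄α = -ρ`, `∂̄β = 0`. -/
def delbar₂ (ρ : B.carrier) : B.OddExt₂ →ₗ[ℂ] B.OddExt₂ :=
  OddExt.diff (B.delbar₁ ρ) 0 (OddExt.ext₀ (derivativeₗ ℂ))

/-- The real structure on `B[z] ⊗ Λ(α, β)`, which fixes `z` and interchanges `α` and `β`. -/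
def σ₂ : B.OddExt₂ →+* B.OddExt₂ where
  toFun x := ⟨⟨mapRingHom B.σ x.fst.fst, mapRingHom B.σ x.snd.fst⟩,
    ⟨mapRingHom B.σ x.fst.snd, -mapRingHom B.σ x.snd.snd⟩⟩
  map_one' := by ext1 <;> ext1 <;> simp
  map_zero' := by ext1 <;> ext1 <;> simp
  map_add' x y := by ext1 <;> ext1 <;> simp; abel
  map_mul' x y := by
    have h : ∀ P : B.carrier[X], mapRingHom B.σ (B.polyPar P) = B.polyPar (mapRingHom B.σ P) := by
      intro P
      ext n
      simp [mapAlgHom, B.par_σ]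
    have h2 := B.polyPar_polyPar
    ext1 <;> ext1
    · simp only [OddExt.fst_mul, map_mul]
    · simp only [OddExt.fst_mul, OddExt.snd_mul, OddExt.fst_add, OddExt.fst_par,
        map_add, map_mul, h]
    · simp only [OddExt.fst_mul, OddExt.snd_mul, OddExt.fst_add, OddExt.fst_par,
        map_add, map_mul, h]
    · simp only [OddExt.snd_mul, OddExt.snd_add, OddExt.fst_par,
        OddExt.snd_par, map_add, map_mul, h, h2, map_neg, neg_mul, mul_neg]
      abel

theorem σ₂_apply (x : B.OddExt₂) : B.σ₂ x =
    ⟨⟨mapRingHom B.σ x.fst.fst, mapRingHom B.σ x.snd.fst⟩,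
      ⟨mapRingHom B.σ x.fst.snd, -mapRingHom B.σ x.snd.snd⟩⟩ := rfl

theorem mapσ_mapσ (P : B.carrier[X]) : mapRingHom B.σ (mapRingHom B.σ P) = P := by
  ext n; simp [B.σ_σ]

theorem mapσ_mem {n : ℤ × ℤ} {P : B.carrier[X]} (hP : P ∈ B.grading₀ m n) :
    mapRingHom B.σ P ∈ B.grading₀ m n.swap := by
  intro i
  rw [coe_mapRingHom, coeff_map]
  have := B.σ_mem _ _ _ (hP i)
  convert this using 2
  ext <;> simp

theorem σ₂_del₂ {ρ : B.carrier} (hρ : B.σ ρ = -ρ) (hpar : B.par ρ = ρ) (x : B.OddExt₂) :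
    B.σ₂ (B.del₂ ρ x) = B.delbar₂ ρ (B.σ₂ x) := by
  have h1 : ∀ P : B.carrier[X], mapRingHom B.σ (coeffMap (fun _ => B.del) P) =
      coeffMap (fun _ => B.delbar) (mapRingHom B.σ P) := by
    intro P; ext n; simp [B.σ_del]
  have h2 : ∀ P : B.carrier[X], mapRingHom B.σ (derivative P) = derivative (mapRingHom B.σ P) := by
    intro P; simp
  have h3 : mapRingHom B.σ (C ρ) = -C ρ := by simp [hρ]
  have h4 : B.polyPar (C ρ) = C ρ := by simp [mapAlgHom, hpar]
  ext1 <;> ext1 <;>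
    simp only [del₂, del₁, delbar₂, delbar₁, σ₂_apply, OddExt.fst_diff, OddExt.snd_diff,
      OddExt.fst_mul, OddExt.snd_mul, OddExt.fst_incl, OddExt.snd_incl, OddExt.fst_add,
      OddExt.snd_add, OddExt.fst_sub, OddExt.snd_sub, OddExt.fst_ext₀, OddExt.snd_ext₀, map_add,
      map_sub, map_mul, map_neg, h1, h3, h4, derivativeₗ_apply, h2, zero_mul, add_zero,
      zero_add, LinearMap.zero_apply, zero_sub, neg_mul, mul_neg, OddExt.fst_neg, OddExt.snd_neg] <;> abel


theorem isOddDer_coeffMap_del : IsOddDer B.polyPar (coeffMap fun _ => B.del) :=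
  isOddDer_coeffMap B.isOddDer_del

theorem isOddDer_coeffMap_delbar : IsOddDer B.polyPar (coeffMap fun _ => B.delbar) :=
  isOddDer_coeffMap B.isOddDer_delbar

theorem isOddDer_del₁ : IsOddDer (OddExt.par B.polyPar) B.del₁ :=
  OddExt.isOddDer_diff B.polyPar_polyPar B.isOddDer_coeffMap_del (IsEvenCentral.zero _)
    (isEvenDer_derivative _)

section Potential

variable {B m r}

theorem isEvenCentral_C (hr : r ∈ B.grading (m, m)) : IsEvenCentral B.polyPar (C r) :=
  (isGradedComm_poly (w := ((0 : ℤ), (0 : ℤ))) B.isGradedComm (by simp)).isEvenCentral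
    (isParity_mapAlgHom B.isParity (by simp)) (n := (m, m)) (by simp) (C_mem_polyGrading hr)

theorem isOddDer_delbar₁ (hr : r ∈ B.grading (m, m)) :
    IsOddDer (OddExt.par B.polyPar) (B.delbar₁ r) :=
  OddExt.isOddDer_diff B.polyPar_polyPar B.isOddDer_coeffMap_delbar
    (isEvenCentral_C (m := m) (neg_mem hr)) (IsEvenDer.zero _)

theorem isOddDer_del₂ (hr : r ∈ B.grading (m, m)) :
    IsOddDer (OddExt.par (OddExt.par B.polyPar)) (B.del₂ r) :=
  OddExt.isOddDer_diff (OddExt.par_par B.polyPar_polyPar) B.isOddDer_del₁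
    (OddExt.isEvenCentral_incl (isEvenCentral_C hr)) (IsEvenDer.zero _)

theorem isOddDer_delbar₂ (hr : r ∈ B.grading (m, m)) :
    IsOddDer (OddExt.par (OddExt.par B.polyPar)) (B.delbar₂ r) :=
  OddExt.isOddDer_diff (OddExt.par_par B.polyPar_polyPar) (isOddDer_delbar₁ hr)
    (IsEvenCentral.zero _) (OddExt.isEvenDer_ext₀ (isEvenDer_derivative _))

theorem coeffMap_coeffMap_zero {δ δ' : B.carrier →ₗ[ℂ] B.carrier} (h : ∀ a, δ (δ' a) = 0)
    (P : B.carrier[X]) : coeffMap (fun _ => δ) (coeffMap (fun _ => δ') P) = 0 := by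
  ext n; simp [h]

theorem del₁_del₁ (x : B.OddExt₁) : B.del₁ (B.del₁ x) = 0 :=
  OddExt.diff_diff B.isOddDer_coeffMap_del (IsEvenCentral.zero _) (isEvenDer_derivative _)
    (coeffMap_coeffMap_zero B.del_del) (map_zero _) (fun _ => zero_mul _)
    (derivative_coeffMap _) (map_zero _) x

theorem delbar₁_delbar₁ (hr : r ∈ B.grading (m, m)) (h : B.delbar r = 0) (x : B.OddExt₁) :
    B.delbar₁ r (B.delbar₁ r x) = 0 :=
  OddExt.diff_diff B.isOddDer_coeffMap_delbar (isEvenCentral_C (m := m) (neg_mem hr))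
    (IsEvenDer.zero _) (coeffMap_coeffMap_zero B.delbar_delbar)
    (by rw [coeffMap_C, map_neg, h, neg_zero, map_zero]) (fun _ => mul_zero _)
    (fun _ => (map_zero (coeffMap fun _ => B.delbar)).symm) rfl x

theorem del₂_del₂ (hr : r ∈ B.grading (m, m)) (h : B.del r = 0) (x : B.OddExt₂) :
    B.del₂ r (B.del₂ r x) = 0 :=
  OddExt.diff_diff B.isOddDer_del₁ (OddExt.isEvenCentral_incl (isEvenCentral_C hr))
    (IsEvenDer.zero _) del₁_del₁ (by ext1 <;> simp [del₁, coeffMap_C, h])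
    (fun _ => mul_zero _) (fun _ => (map_zero B.del₁).symm) rfl x

theorem ext₀_derivative_coeffMap_diff {δ : B.carrier →ₗ[ℂ] B.carrier} {s : B.carrier}
    {θ : B.carrier[X] →ₗ[ℂ] B.carrier[X]} (hθ : ∀ P, derivative (θ P) = θ (derivative P))
    (x : B.OddExt₁) :
    OddExt.ext₀ (derivativeₗ ℂ) (OddExt.diff (coeffMap fun _ => δ) (C s) θ x) =
      OddExt.diff (coeffMap fun _ => δ) (C s) θ (OddExt.ext₀ (derivativeₗ ℂ) x) := by
  ext1 <;> simp [derivative_coeffMap, hθ]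

theorem delbar₂_delbar₂ (hr : r ∈ B.grading (m, m)) (h : B.delbar r = 0) (x : B.OddExt₂) :
    B.delbar₂ r (B.delbar₂ r x) = 0 :=
  OddExt.diff_diff (isOddDer_delbar₁ hr) (IsEvenCentral.zero _)
    (OddExt.isEvenDer_ext₀ (isEvenDer_derivative _)) (delbar₁_delbar₁ hr h) (map_zero _)
    (fun _ => zero_mul _) (ext₀_derivative_coeffMap_diff (fun _ => by simp)) (map_zero _) x

theorem del₂_delbar₂ (hr : r ∈ B.grading (m, m)) (h : B.del r = 0) (h' : B.delbar r = 0)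
    (x : B.OddExt₂) : B.del₂ r (B.delbar₂ r x) + B.delbar₂ r (B.del₂ r x) = 0 := by
  have h1 : ∀ x, B.del₁ (B.delbar₁ r x) + B.delbar₁ r (B.del₁ x) =
      -(OddExt.incl _ (C r) * OddExt.ext₀ (derivativeₗ ℂ) x) := by
    intro x
    refine (OddExt.diff_diff_add B.isOddDer_coeffMap_del B.isOddDer_coeffMap_delbar
      (IsEvenCentral.zero _) (isEvenCentral_C (m := m) (neg_mem hr)) (isEvenDer_derivative _)
      (IsEvenDer.zero _) (by rw [coeffMap_C, map_neg, h]; simp) (by simp)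
      (fun P => by simp [derivative_coeffMap]) x).trans ?_
    have h2 : ∀ P : B.carrier[X], coeffMap (fun _ => B.del) (coeffMap (fun _ => B.delbar) P) +
        coeffMap (fun _ => B.delbar) (coeffMap (fun _ => B.del) P) = 0 := by
      intro P; ext n; simp [B.del_delbar]
    have h3 : B.par r = r := B.isParity.even hr (by simp)
    ext1 <;> simp [h2, h3]
  refine (OddExt.diff_diff_add B.isOddDer_del₁ (isOddDer_delbar₁ hr)
    (OddExt.isEvenCentral_incl (isEvenCentral_C hr)) (IsEvenCentral.zero _) (IsEvenDer.zero _)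
    (OddExt.isEvenDer_ext₀ (isEvenDer_derivative _)) ?_ ?_ (fun y => ?_) x).trans ?_
  · ext1 <;> simp [delbar₁, coeffMap_C, h']
  · ext1 <;> simp
  · have := ext₀_derivative_coeffMap_diff (B := B) (δ := B.del) (s := 0) (θ := derivativeₗ ℂ)
      (fun _ => rfl) y
    rw [map_zero] at this
    rw [LinearMap.zero_apply, LinearMap.zero_apply, map_zero, sub_zero, zero_add]
    exact sub_eq_zero.2 this
  · ext1 <;> simp [h1]

theorem del₁_mem {n : ℤ × ℤ} {x : B.OddExt₁} (hx : x ∈ B.grading₁ m n) :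
    B.del₁ x ∈ B.grading₁ m (n + (1, 0)) :=
  diff_mem (fun _ _ ha => coeffMap_mem B.del_mem' ha) (Submodule.zero_mem _)
    (fun n a ha => by
      have := derivative_mem ha
      rwa [show n + ((1, 0) - (m, m - 1)) = n - (m - 1, m - 1) by ext <;> simp <;> ring]) hx

theorem delbar₁_mem (hr : r ∈ B.grading (m, m)) {n : ℤ × ℤ} {x : B.OddExt₁}
    (hx : x ∈ B.grading₁ m n) : B.delbar₁ r x ∈ B.grading₁ m (n + (0, 1)) :=
  diff_mem (fun _ _ ha => coeffMap_mem B.delbar_mem' ha)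
    (C_mem_polyGrading (neg_mem (by simpa using hr))) (fun _ _ _ => Submodule.zero_mem _) hx

theorem del₂_mem (hr : r ∈ B.grading (m, m)) {n : ℤ × ℤ} {x : B.OddExt₂}
    (hx : x ∈ B.grading₂ m n) : B.del₂ r x ∈ B.grading₂ m (n + (1, 0)) :=
  letI := B.gradedAlgebra₁ m
  diff_mem (fun _ _ ha => del₁_mem ha) (incl_mem (C_mem_polyGrading (by simpa using hr)))
    (fun _ _ _ => Submodule.zero_mem _) hx

theorem delbar₂_mem (hr : r ∈ B.grading (m, m)) {n : ℤ × ℤ} {x : B.OddExt₂}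
    (hx : x ∈ B.grading₂ m n) : B.delbar₂ r x ∈ B.grading₂ m (n + (0, 1)) :=
  letI := B.gradedAlgebra₁ m
  diff_mem (fun _ _ ha => delbar₁_mem hr ha) (Submodule.zero_mem _)
    (fun n a ha => ext₀_mem (e := -(m - 1, m - 1))
      (fun n a ha => by rw [← sub_eq_add_neg]; exact derivative_mem ha) ha |> fun h => by
        convert h using 2; ext <;> simp) hx

theorem σ₂_σ₂ (x : B.OddExt₂) : B.σ₂ (B.σ₂ x) = x := by
  rw [σ₂_apply, σ₂_apply]
  ext1 <;> ext1 <;> simp only [mapσ_mapσ, map_neg, neg_neg]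

theorem σ₂_mem {n : ℤ × ℤ} {x : B.OddExt₂} (hx : x ∈ B.grading₂ m n) :
    B.σ₂ x ∈ B.grading₂ m n.swap := by
  refine ⟨⟨mapσ_mem B m hx.1.1, ?_⟩, ⟨?_, neg_mem ?_⟩⟩
  · exact mapσ_mem B m hx.2.1
  · exact mapσ_mem B m hx.1.2
  · have := mapσ_mem B m hx.2.2
    convert this using 1
    ext <;> (simp; ring_nf)

variable (B m r) in
/-- The `ℝ`-cbba obtained from `B` by adjoining a real potential `z` of bidegree `(m - 1, m - 1)`
of a closed element `r`, purely imaginary for the real structure: it is freely generated over `B`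
by `z`, `∂z` and `∂̄z`, subject to `∂∂̄z = r`. -/
def adjoin (hr : r ∈ B.grading (m, m)) (h : B.del r = 0) (h' : B.delbar r = 0)
    (hσ : B.σ r = -r) : RCBBA.{u} :=
  letI := B.gradedAlgebra₁ m
  have hc₂ : IsGradedComm (B.grading₂ m) totalDegree :=
    isGradedComm_odd (B.isParity₁ m) ⟨m - 1, by simp; ring⟩
      (isGradedComm_odd (B.isParity_polyPar m) ⟨m - 1, by simp; ring⟩
        (isGradedComm_poly B.isGradedComm (by simp)))
  have hpar : B.par r = r := B.isParity.even hr (by simp)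
  have hσd : ∀ x, B.σ₂ (B.del₂ r x) = B.delbar₂ r (B.σ₂ x) := B.σ₂_del₂ hσ hpar
  { carrier := B.OddExt₂
    grading := B.grading₂ m
    gradedAlgebra := B.gradedAlgebra₂ m
    del := B.del₂ r
    delbar := B.delbar₂ r
    del_mem := fun p q a ha => by
      have := del₂_mem hr ha
      rwa [Prod.mk_add_mk, add_zero] at this
    delbar_mem := fun p q a ha => by
      have := delbar₂_mem hr ha
      rwa [Prod.mk_add_mk, add_zero] at this
    del_del := del₂_del₂ hr h
    delbar_delbar := delbar₂_delbar₂ hr h'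
    del_delbar := del₂_delbar₂ hr h h'
    del_leibniz := fun p q a ha b =>
      letI := B.gradedAlgebra₂ m
      (isOddDer_del₂ hr).leibniz (B.isParity₂ m) ha b
    delbar_leibniz := fun p q a ha b =>
      letI := B.gradedAlgebra₂ m
      (isOddDer_delbar₂ hr).leibniz (B.isParity₂ m) ha b
    graded_comm := fun p q p' q' a ha b hb => hc₂ (p, q) (p', q') a ha b hb
    σ := B.σ₂
    σ_smul := fun c x => by
      have hs : ∀ P : B.carrier[X], mapRingHom B.σ (c • P) =
          (starRingEnd ℂ) c • mapRingHom B.σ P := by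
        intro P; ext n; simp [B.σ_smul]
      rw [σ₂_apply, σ₂_apply]
      ext1 <;> ext1 <;> simp [hs, -coe_mapRingHom]
    σ_σ := σ₂_σ₂
    σ_mem := fun p q a ha => σ₂_mem (m := m) (n := (p, q)) ha
    σ_d := fun x => by
      have e : B.σ₂ (B.delbar₂ r (B.σ₂ x)) = B.del₂ r x := by rw [← hσd, σ₂_σ₂]
      rw [map_add, hσd, σ₂_σ₂, add_comm, e] }

section Universal

variable (hr : r ∈ B.grading (m, m)) (h : B.del r = 0) (h' : B.delbar r = 0) (hσ : B.σ r = -r)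

/-- The inclusion of `B` in the algebra with an adjoined potential. -/
def adjoinIncl : B ⟶ B.adjoin m r hr h h' hσ where
  toAlgHom := ((OddExt.incl (OddExt.par B.polyPar)).comp (OddExt.incl B.polyPar)).comp CAlgHom
  map_mem b a ha := incl_mem (incl_mem (C_mem_polyGrading ha))
  map_del a := by
    apply OddExt.ext
    · apply OddExt.ext
      · change C (B.del a) = coeffMap (fun _ => B.del) (C a) + 0 * 0 + C r * 0
        rw [coeffMap_C]; simp
      · change 0 = derivative (C a) - coeffMap (fun _ => B.del) 0 + (0 * 0 + B.polyPar (C r) * 0)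
        simp
    · apply OddExt.ext
      · change 0 = 0 - (coeffMap (fun _ => B.del) 0 + 0 * 0)
        simp
      · change 0 = 0 - (derivative 0 - coeffMap (fun _ => B.del) 0)
        simp
  map_delbar a := by
    apply OddExt.ext
    · apply OddExt.ext
      · change C (B.delbar a) = coeffMap (fun _ => B.delbar) (C a) + C (-r) * 0 + 0 * 0
        rw [coeffMap_C]; simp
      · change 0 = 0 - coeffMap (fun _ => B.delbar) 0 + (0 * 0 + B.polyPar 0 * 0)
        simp
    · apply OddExt.ext
      · change 0 = derivative (C a) - (coeffMap (fun _ => B.delbar) 0 + C (-r) * 0)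
        simp
      · change 0 = derivative 0 - (0 - coeffMap (fun _ => B.delbar) 0)
        simp
  map_σ a := by
    apply OddExt.ext
    · apply OddExt.ext
      · exact (map_C B.σ).symm
      · exact (map_zero (mapRingHom B.σ)).symm
    · apply OddExt.ext
      · exact (map_zero (mapRingHom B.σ)).symm
      · change 0 = -mapRingHom B.σ 0
        simp

/-- The adjoined potential. -/
def adjoinPotential : (B.adjoin m r hr h h' hσ).carrier :=
  OddExt.incl (OddExt.par B.polyPar) (OddExt.incl B.polyPar X)

theorem del_delbar_adjoinPotential :
    (B.adjoin m r hr h h' hσ).del ((B.adjoin m r hr h h' hσ).delbar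
      (adjoinPotential hr h h' hσ)) = (adjoinIncl hr h h' hσ).toAlgHom r := by
  have h0 : ∀ δ : B.carrier →ₗ[ℂ] B.carrier, δ 1 = 0 → coeffMap (fun _ => δ) X = 0 := by
    intro δ hδ
    rw [← monomial_one_one_eq_X, coeffMap_monomial, hδ, map_zero]
  change B.del₂ r (B.delbar₂ r (OddExt.incl _ (OddExt.incl B.polyPar X))) =
    OddExt.incl _ (OddExt.incl B.polyPar (C r))
  ext1 <;> ext1 <;>
    simp [del₂, delbar₂, del₁, delbar₁, h0 _ B.delbar_one, coeffMap_C,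
      ← C_1, B.del_one, -map_one]
  rw [C_1, mul_one]

section Lift

theorem _root_.Polynomial.induction_mul_X {R : Type*} [Semiring R] {p : R[X] → Prop}
    (hC : ∀ a, p (C a)) (hadd : ∀ P Q, p P → p Q → p (P + Q)) (hX : ∀ P, p P → p (P * X))
    (P : R[X]) : p P :=
  Polynomial.induction_on P hC hadd fun n a h => by
    rw [pow_succ, ← mul_assoc]; exact hX _ h

variable {N : RCBBA.{u}} (F : B ⟶ N) (c : N.carrier) (hc : c ∈ N.grading (m - 1, m - 1))

theorem Hom.map_par (a : B.carrier) : F.toAlgHom (B.par a) = N.par (F.toAlgHom a) := by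
  induction a using DirectSum.Decomposition.inductionOn B.grading with
  | zero => simp
  | add x y hx hy => simp only [map_add, hx, hy]
  | @homogeneous i a =>
    rw [B.isParity i a a.2, N.isParity i _ (F.map_mem i a a.2), map_zsmul]

theorem even_comm {n : ℤ × ℤ} (hn : Even (n.1 + n.2)) (hc : c ∈ N.grading n) (x : N.carrier) :
    x * c = c * x :=
  (N.isGradedComm.isEvenCentral N.isParity (n := n) hn hc).comm x

/-- The extension of `F` to `B[z]` by `z ↦ c`. -/
def lift₀ : B.carrier[X] →+* N.carrier :=
  eval₂RingHom' (F.toAlgHom : B.carrier →+* N.carrier) c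
    (fun a => even_comm c (n := (m - 1, m - 1)) (by simp) hc (F.toAlgHom a))

theorem lift₀_C (a : B.carrier) : lift₀ F c hc (C a) = F.toAlgHom a :=
  eval₂_C _ _

theorem lift₀_X : lift₀ F c hc X = c := eval₂_X _ _

theorem lift₀_par (P : B.carrier[X]) : lift₀ F c hc (B.polyPar P) = N.par (lift₀ F c hc P) := by
  have hpar : N.par c = c := N.isParity.even hc (by simp)
  induction P using Polynomial.induction_mul_X with
  | hC a =>
    rw [show B.polyPar (C a) = C (B.par a) from map_C _, lift₀_C, lift₀_C, Hom.map_par]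
  | hadd P Q hP hQ => simp only [map_add, hP, hQ]
  | hX P ih =>
    rw [map_mul, map_mul, ih, map_mul, map_mul,
      show B.polyPar X = X from map_X _, lift₀_X, hpar]

theorem lift₀_coeffMap {δ : B.carrier →ₗ[ℂ] B.carrier} {D : N.carrier →ₗ[ℂ] N.carrier}
    (hδ : IsOddDer B.par δ) (hD : IsOddDer N.par D) (hF : ∀ a, F.toAlgHom (δ a) = D (F.toAlgHom a))
    (hδ1 : δ 1 = 0) (hDc : ∀ x, x * D c = D c * N.par x) (P : B.carrier[X]) :
    D (lift₀ F c hc P) = lift₀ F c hc (coeffMap (fun _ => δ) P) +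
      D c * lift₀ F c hc (derivative P) := by
  have hX : coeffMap (fun _ => δ) X = 0 := by
    rw [← monomial_one_one_eq_X, coeffMap_monomial, hδ1, map_zero]
  induction P using Polynomial.induction_mul_X with
  | hC a => simp only [lift₀_C, coeffMap_C, hF, derivative_C, map_zero, mul_zero, add_zero]
  | hadd P Q hP hQ => simp only [map_add, hP, hQ, mul_add]; abel
  | hX P ih =>
    rw [map_mul, hD.mul, ih, (isOddDer_coeffMap hδ).mul, hX, mul_zero, add_zero, derivative_mul,
      derivative_X, mul_one, map_mul, map_add, map_mul, lift₀_X, hDc, N.isParity.invol, mul_add,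
      add_mul, mul_assoc, add_assoc]

theorem lift₀_mem {n : ℤ × ℤ} {P : B.carrier[X]} (hP : P ∈ B.grading₀ m n) :
    lift₀ F c hc P ∈ N.grading n := by
  rw [P.as_sum_support_C_mul_X_pow, map_sum]
  refine Submodule.sum_mem _ fun i _ => ?_
  rw [map_mul, map_pow, lift₀_C, lift₀_X, ← sub_add_cancel n (i • (m - 1, m - 1))]
  exact SetLike.mul_mem_graded (F.map_mem _ _ (hP i)) (SetLike.pow_mem_graded i hc)

theorem lift₀_σ (hσc : N.σ c = c) (P : B.carrier[X]) :
    lift₀ F c hc (mapRingHom B.σ P) = N.σ (lift₀ F c hc P) := by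
  induction P using Polynomial.induction_mul_X with
  | hC a => rw [coe_mapRingHom, map_C, lift₀_C, lift₀_C, F.map_σ]
  | hadd P Q hP hQ => simp only [map_add, hP, hQ]
  | hX P ih =>
    rw [map_mul, map_mul, ih, map_mul, map_mul, coe_mapRingHom, map_X, lift₀_X, hσc]

theorem lift₀_smul (t : ℂ) (P : B.carrier[X]) :
    lift₀ F c hc (t • P) = t • lift₀ F c hc P := by
  rw [show t • P = C (algebraMap ℂ B.carrier t) * P from Algebra.smul_def t P, map_mul, lift₀_C,
    AlgHom.commutes, ← Algebra.smul_def]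

/-- The extension of `F` to `B[z] ⊗ Λ(α)` by `z ↦ c`, `α ↦ ∂c`. -/
def lift₁ : B.OddExt₁ →+* N.carrier :=
  OddExt.lift (lift₀ F c hc) (N.del c)
    (N.isGradedComm.odd_sq (n := (m - 1, m - 1) + (1, 0)) ⟨m - 1, by simp; ring⟩
      (N.del_mem' _ c hc))
    (fun P => by
      rw [lift₀_par]
      exact N.isGradedComm.mul_odd N.isParity (n := (m - 1, m - 1) + (1, 0))
        ⟨m - 1, by simp; ring⟩ (N.del_mem' _ c hc) _)

theorem lift₁_apply (x : B.OddExt₁) :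
    lift₁ F c hc x = lift₀ F c hc x.fst + N.del c * lift₀ F c hc x.snd := rfl

theorem odd_del : Odd (totalDegree ((m - 1, m - 1) + (1, 0))) := ⟨m - 1, by simp; ring⟩

theorem odd_delbar : Odd (totalDegree ((m - 1, m - 1) + (0, 1))) := ⟨m - 1, by simp; ring⟩

theorem par_del_potential (hc : c ∈ N.grading (m - 1, m - 1)) : N.par (N.del c) = -N.del c :=
  N.isParity.odd (N.del_mem' _ c hc) odd_del

theorem lift₁_par (x : B.OddExt₁) :
    lift₁ F c hc (OddExt.par B.polyPar x) = N.par (lift₁ F c hc x) := by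
  rw [lift₁_apply, lift₁_apply, OddExt.fst_par, OddExt.snd_par, map_neg, lift₀_par, lift₀_par,
    map_add, map_mul, par_del_potential c hc, mul_neg, neg_mul]

/-- The extension of `F` to `B[z] ⊗ Λ(α, β)` by `z ↦ c`, `α ↦ ∂c`, `β ↦ ∂̄c`. -/
def lift₂ : B.OddExt₂ →+* N.carrier :=
  OddExt.lift (lift₁ F c hc) (N.delbar c)
    (N.isGradedComm.odd_sq odd_delbar (N.delbar_mem' _ c hc))
    (fun P => by
      rw [lift₁_par]
      exact N.isGradedComm.mul_odd N.isParity odd_delbar (N.delbar_mem' _ c hc) _)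

theorem lift₂_apply (x : B.OddExt₂) :
    lift₂ F c hc x = lift₁ F c hc x.fst + N.delbar c * lift₁ F c hc x.snd := rfl

theorem del_mul_delbar (hc : c ∈ N.grading (m - 1, m - 1)) :
    N.del c * N.delbar c = -(N.delbar c * N.del c) :=
  N.isGradedComm.odd_mul_odd odd_del odd_delbar (N.del_mem' _ c hc) (N.delbar_mem' _ c hc)

theorem lift₂_del₂ (hdc : N.del (N.delbar c) = F.toAlgHom r) (x : B.OddExt₂) :
    lift₂ F c hc (B.del₂ r x) = N.del (lift₂ F c hc x) := by
  have h1 : ∀ x, N.del (lift₁ F c hc x) = lift₁ F c hc (B.del₁ x) := by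
    intro x
    have := OddExt.lift_diff (f := lift₀ F c hc) (c := N.del c) (D := N.del.toAddMonoidHom)
      (δ := coeffMap fun _ => B.del) (r := 0) (θ := derivativeₗ ℂ)
      (hc := N.isGradedComm.odd_sq odd_del (N.del_mem' _ c hc))
      (hf := fun P => by
        rw [lift₀_par]
        exact N.isGradedComm.mul_odd N.isParity odd_del (N.del_mem' _ c hc) _)
      (fun a => by
        change N.del (_ * a) = N.del _ * a - _ * N.del a
        rw [N.isOddDer_del.mul, par_del_potential c hc, neg_mul, sub_eq_add_neg])
      (fun P => lift₀_coeffMap F c hc B.isOddDer_del N.isOddDer_del F.map_del B.del_one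
        (N.isGradedComm.mul_odd N.isParity odd_del (N.del_mem' _ c hc)) P)
      (by rw [map_zero]; exact N.del_del c) x
    exact this
  have := OddExt.lift_diff (f := lift₁ F c hc) (c := N.delbar c) (D := N.del.toAddMonoidHom)
    (δ := B.del₁) (r := OddExt.incl _ (C r)) (θ := 0)
    (hc := N.isGradedComm.odd_sq odd_delbar (N.delbar_mem' _ c hc))
    (hf := fun P => by
      rw [lift₁_par]
      exact N.isGradedComm.mul_odd N.isParity odd_delbar (N.delbar_mem' _ c hc) _)
    (fun a => by
      change N.del (_ * a) = N.del _ * a - _ * N.del a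
      rw [N.isOddDer_del.mul, N.isParity.odd (N.delbar_mem' _ c hc) odd_delbar, neg_mul,
        sub_eq_add_neg])
    (fun y => by
      rw [LinearMap.zero_apply, map_zero, mul_zero, add_zero]
      exact h1 y)
    (by
      rw [lift₁_apply]
      simp only [OddExt.fst_incl, OddExt.snd_incl, map_zero, mul_zero, add_zero, lift₀_C]
      exact hdc) x
  exact this.symm

theorem lift₂_σ₂ (hσc : N.σ c = c) (x : B.OddExt₂) :
    lift₂ F c hc (B.σ₂ x) = N.σ (lift₂ F c hc x) := by
  have h1 : N.σ (N.del c) = N.delbar c := by rw [N.σ_del, hσc]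
  have h2 : N.σ (N.delbar c) = N.del c := by rw [N.σ_delbar, hσc]
  simp only [lift₂_apply, lift₁_apply, σ₂_apply, map_add, map_mul, map_neg, h1, h2,
    lift₀_σ F c hc hσc, mul_add, mul_neg, ← mul_assoc, del_mul_delbar c hc, neg_mul]
  abel

theorem lift₂_delbar₂ (hr : r ∈ B.grading (m, m)) (hσ : B.σ r = -r) (hσc : N.σ c = c)
    (hdc : N.del (N.delbar c) = F.toAlgHom r) (x : B.OddExt₂) :
    lift₂ F c hc (B.delbar₂ r x) = N.delbar (lift₂ F c hc x) := by
  -- conjugate the compatibility with `∂` by the real structures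
  have e1 := B.σ₂_del₂ hσ (B.isParity.even hr (by simp)) (B.σ₂ x)
  rw [σ₂_σ₂] at e1
  rw [← e1, lift₂_σ₂ F c hc hσc, lift₂_del₂ F c hc hdc, N.σ_del, lift₂_σ₂ F c hc hσc, N.σ_σ]

theorem lift₂_smul (t : ℂ) (x : B.OddExt₂) : lift₂ F c hc (t • x) = t • lift₂ F c hc x := by
  simp only [lift₂_apply, lift₁_apply, OddExt.fst_smul, OddExt.snd_smul, lift₀_smul, smul_add,
    mul_add, mul_smul_comm]

theorem lift₂_mem {n : ℤ × ℤ} {x : B.OddExt₂} (hx : x ∈ B.grading₂ m n) :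
    lift₂ F c hc x ∈ N.grading n := by
  have h1 : ∀ {n : ℤ × ℤ} {x : B.OddExt₁}, x ∈ B.grading₁ m n → lift₁ F c hc x ∈ N.grading n := by
    intro n x hx
    refine add_mem (lift₀_mem F c hc hx.1) ?_
    have := SetLike.mul_mem_graded (N.del_mem' _ c hc) (lift₀_mem F c hc hx.2)
    convert this using 2
    ext <;> simp
  refine add_mem (h1 hx.1) ?_
  have := SetLike.mul_mem_graded (N.delbar_mem' _ c hc) (h1 hx.2)
  convert this using 2
  ext <;> simp

/-- The universal property of the algebra with an adjoined potential: a morphism `F` out of `B`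
extends as soon as `F r` has a real potential. -/
theorem exists_adjoinLift (hc : c ∈ N.grading (m - 1, m - 1)) (hσc : N.σ c = c)
    (hdc : N.del (N.delbar c) = F.toAlgHom r) :
    ∃ G : B.adjoin m r hr h h' hσ ⟶ N, ∀ a,
      G.toAlgHom ((adjoinIncl hr h h' hσ).toAlgHom a) = F.toAlgHom a := by
  refine ⟨⟨AlgHom.mk' (lift₂ F c hc) (fun t x => ?_), fun b a ha => lift₂_mem F c hc ha,
    lift₂_del₂ F c hc hdc, lift₂_delbar₂ F c hc hr hσ hσc hdc, lift₂_σ₂ F c hc hσc⟩,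
    fun a => ?_⟩
  · exact lift₂_smul F c hc t x
  · change lift₀ F c hc (C a) + N.del c * lift₀ F c hc 0 +
      N.delbar c * (lift₀ F c hc 0 + N.del c * lift₀ F c hc 0) = F.toAlgHom a
    simp only [map_zero, mul_zero, add_zero, lift₀_C]

end Lift

end Universal

end Potential

end Adjoin

end RCBBA

/-! ### Bigraded models of complete intersections -/

namespace RCBBA

open Polynomial

section Adjoin

variable {B : RCBBA.{u}} {m : ℤ} {r : B.carrier}

theorem eq_C_of_derivative_eq_zero {P : B.carrier[X]} (h : derivative P = 0) :
    P = C (P.coeff 0) := by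
  have : Module ℚ B.carrier := Module.compHom _ (algebraMap ℚ ℂ)
  have : IsAddTorsionFree B.carrier := IsAddTorsionFree.of_module_rat _
  exact Polynomial.eq_C_of_derivative_eq_zero h

/-- An integration in the variable `z`: it reduces `∂̄`-cocycles to elements without `z` and
`∂̄z`. -/
theorem exists_const_add {u v : B.OddExt₁} (h : OddExt.ext₀ (derivativeₗ ℂ) u = B.delbar₁ r v) :
    ∃ (w : B.OddExt₁) (a b : B.carrier), v = OddExt.ext₀ (derivativeₗ ℂ) w ∧
      u = B.delbar₁ r w + ⟨C a, C b⟩ := by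
  let w : B.OddExt₁ := OddExt.ext₀ (antideriv (k := ℂ)) v
  have hw : v = OddExt.ext₀ (derivativeₗ ℂ) w := by
    ext1 <;> simp [w, derivative_antideriv]
  have h0 : OddExt.ext₀ (derivativeₗ ℂ) (u - B.delbar₁ r w) = 0 := by
    rw [map_sub, h, hw, delbar₁, ← ext₀_derivative_coeffMap_diff (fun _ => by simp), sub_self]
  refine ⟨w, (OddExt.fst (u - B.delbar₁ r w)).coeff 0, (OddExt.snd (u - B.delbar₁ r w)).coeff 0,
    hw, ?_⟩
  rw [← sub_eq_iff_eq_add']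
  exact OddExt.ext (eq_C_of_derivative_eq_zero (congrArg OddExt.fst h0))
    (eq_C_of_derivative_eq_zero (congrArg OddExt.snd h0))

theorem delbar₁_const (a b : B.carrier) : B.delbar₁ r ⟨C a, C b⟩ =
    ⟨C (B.delbar a - r * b), C (-B.delbar b)⟩ := by
  ext1
  · simp [delbar₁, coeffMap_C, sub_eq_add_neg]
  · simp [delbar₁, coeffMap_C]

end Adjoin

/-- The bidegrees `(p_i, p_i)` of the variables. -/
abbrev diagWeight {σ : Type*} (p : σ → ℕ) : σ → ℤ × ℤ := fun i => ((p i : ℤ), (p i : ℤ))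

section Model

variable {σ : Type u} (p : σ → ℕ)

theorem weight_diagWeight (n : σ →₀ ℕ) : Finsupp.weight (diagWeight p) n =
    (((Finsupp.weight p n : ℕ) : ℤ), ((Finsupp.weight p n : ℕ) : ℤ)) := by
  simp [Finsupp.weight_apply, Finsupp.sum, Prod.ext_iff, Prod.fst_sum, Prod.snd_sum]

theorem diagWeight_eq_zero {n : ℤ × ℤ} (hn : n.1 ≠ n.2 ∨ n.1 < 0) {f : MvPolynomial σ ℂ}
    (hf : f ∈ MvPolynomial.weightedHomogeneousSubmodule ℂ (diagWeight p) n) : f = 0 := by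
  by_contra h
  obtain ⟨m, hm⟩ := MvPolynomial.ne_zero_iff.1 h
  have h1 := hf hm
  rw [weight_diagWeight] at h1
  subst h1
  have : (0 : ℤ) ≤ ((Finsupp.weight p m : ℕ) : ℤ) := Int.natCast_nonneg _
  simp only at hn
  omega

/-- The polynomial ring with the real structure that fixes the variables. -/
def polynomialRCBBA : RCBBA.{u} where
  carrier := MvPolynomial σ ℂ
  grading := MvPolynomial.weightedHomogeneousSubmodule ℂ (diagWeight p)
  gradedAlgebra := MvPolynomial.weightedGradedAlgebra ℂ (diagWeight p)
  del := 0
  delbar := 0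
  del_mem _ _ _ _ := Submodule.zero_mem _
  delbar_mem _ _ _ _ := Submodule.zero_mem _
  del_del _ := rfl
  delbar_delbar _ := rfl
  del_delbar _ := add_zero _
  del_leibniz _ _ _ _ _ := by simp
  delbar_leibniz _ _ _ _ _ := by simp
  graded_comm p₁ q p' q' f hf g hg := by
    by_cases h : p₁ = q
    · rw [Int.negOnePow_even _ (Even.mul_right (by rw [h]; exact ⟨q, rfl⟩) _), mul_comm f g]
      simp
    · rw [diagWeight_eq_zero p (Or.inl h) hf]; simp
  σ := MvPolynomial.map (starRingEnd ℂ)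
  σ_smul c f := by rw [MvPolynomial.smul_eq_C_mul, map_mul, MvPolynomial.map_C,
    MvPolynomial.smul_eq_C_mul]
  σ_σ f := by
    rw [MvPolynomial.map_map]
    have : (starRingEnd ℂ).comp (starRingEnd ℂ) = RingHom.id ℂ := RingHom.ext Complex.conj_conj
    rw [this, MvPolynomial.map_id]
  σ_mem p₁ q f hf := by
    by_cases h : p₁ = q
    · subst h
      intro m hm
      rw [MvPolynomial.coeff_map] at hm
      exact hf (fun h => hm (by rw [h, map_zero]))
    · rw [diagWeight_eq_zero p (Or.inl h) hf, map_zero]; exact Submodule.zero_mem _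
  σ_d _ := by simp

/-- An `ℝ`-cbba under the polynomial ring `S = ℂ[x_i]`, with `x_i` of bidegree `(p_i, p_i)`, that is
a bigraded model of `S ⧸ I` obtained from `S` by adjoining potentials. The fields record that it
lives in the first quadrant, its cohomology with respect to `∂̄`, and its mapping property. That
elements of `I` are exact is required in the strong form of `∂∂̄`-exactness. -/
structure BigradedModel (I : Ideal (MvPolynomial σ ℂ)) where
  M : RCBBA.{u}
  ι : MvPolynomial σ ℂ →ₐ[ℂ] M.carrier
  ι_mem : ∀ n, ∀ f ∈ MvPolynomial.weightedHomogeneousSubmodule ℂ (diagWeight p) n,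
    ι f ∈ M.grading n
  del_ι : ∀ f, M.del (ι f) = 0
  delbar_ι : ∀ f, M.delbar (ι f) = 0
  σ_ι : ∀ f, M.σ (ι f) = ι (MvPolynomial.map (starRingEnd ℂ) f)
  nonneg : ∀ n, ∀ x ∈ M.grading n, n.1 < 0 ∨ n.2 < 0 → x = 0
  exists_rep : ∀ x, M.delbar x = 0 → ∃ f b, x = ι f + M.delbar b
  mem_of_exact : ∀ f b, ι f = M.delbar b → f ∈ I
  exact_of_mem : ∀ f ∈ I, ∃ b, ι f = M.del (M.delbar b)
  exists_extension : ∀ (N : RCBBA.{u}) (g : MvPolynomial σ ℂ →ₐ[ℂ] N.carrier),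
    (∀ n, ∀ f ∈ MvPolynomial.weightedHomogeneousSubmodule ℂ (diagWeight p) n,
      g f ∈ N.grading n) →
    (∀ f, N.del (g f) = 0) → (∀ f, N.delbar (g f) = 0) →
    (∀ f, N.σ (g f) = g (MvPolynomial.map (starRingEnd ℂ) f)) →
    (∀ f ∈ I, ∃ b, g f = N.del (N.delbar b)) →
    ∃ F : M ⟶ N, ∀ f, F.toAlgHom (ι f) = g f

/-- The polynomial ring is a bigraded model of itself. -/
def BigradedModel.bot : BigradedModel p ⊥ where
  M := polynomialRCBBA p
  ι := AlgHom.id ℂ _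
  ι_mem _ _ h := h
  del_ι _ := rfl
  delbar_ι _ := rfl
  σ_ι _ := rfl
  nonneg n f hf hn := diagWeight_eq_zero p (by omega) hf
  exists_rep f _ := ⟨f, 0, (add_zero _).symm⟩
  mem_of_exact f b h := Ideal.mem_bot.2 h
  exact_of_mem f hf := ⟨0, Ideal.mem_bot.1 hf⟩
  exists_extension N g hg h1 h2 h3 _ :=
    ⟨⟨g, hg, fun _ => (map_zero g).trans (h1 _).symm, fun _ => (map_zero g).trans (h2 _).symm,
      fun f => (h3 f).symm⟩, fun _ => rfl⟩

variable {p}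

theorem eq_zero_of_mem_adjoin {B : RCBBA.{u}} {m : ℤ} (hm : 1 ≤ m)
    (hB : ∀ n, ∀ x ∈ B.grading n, n.1 < 0 ∨ n.2 < 0 → x = 0) {n : ℤ × ℤ} (hn : n.1 < 0 ∨ n.2 < 0)
    {x : B.OddExt₂} (hx : x ∈ B.grading₂ m n) : x = 0 := by
  have h0 : ∀ {n : ℤ × ℤ} {P : B.carrier[X]}, (n.1 < 0 ∨ n.2 < 0) → P ∈ B.grading₀ m n → P = 0 := by
    intro n P hn hP
    ext i
    refine hB _ _ (hP i) ?_
    have : 0 ≤ (i : ℤ) * (m - 1) := by positivity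
    have e1 : (i • ((m - 1, m - 1) : ℤ × ℤ)).1 = i * (m - 1) := by simp
    have e2 : (i • ((m - 1, m - 1) : ℤ × ℤ)).2 = i * (m - 1) := by simp
    rw [Prod.fst_sub, Prod.snd_sub, e1, e2]
    omega
  have h1 : ∀ {n : ℤ × ℤ} {y : B.OddExt₁}, (n.1 < 0 ∨ n.2 < 0) → y ∈ B.grading₁ m n → y = 0 := by
    intro n y hn hy
    refine OddExt.ext (h0 hn hy.1) (h0 ?_ hy.2)
    simp only [Prod.fst_sub, Prod.snd_sub]
    omega
  refine OddExt.ext (h1 hn hx.1) (h1 ?_ hx.2)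
  simp only [Prod.fst_sub, Prod.snd_sub]
  omega

/-- A potential of a purely imaginary homogeneous element can be chosen homogeneous and real, by
projection to the right bidegree and passage to the real part. -/
theorem exists_real_potential {N : RCBBA.{u}} {m : ℤ} {s b : N.carrier}
    (hs : s ∈ N.grading (m, m)) (hσ : N.σ s = -s) (h : s = N.del (N.delbar b)) :
    ∃ c ∈ N.grading (m - 1, m - 1), N.σ c = c ∧ N.del (N.delbar c) = s := by
  set n := GradedAlgebra.proj N.grading (m - 1, m - 1) b with hn
  have hmem : n ∈ N.grading (m - 1, m - 1) := proj_mem _ _ _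
  have h1 : N.del (N.delbar n) = s := by
    have := N.proj_del_delbar b (m, m)
    rw [← h, proj_same N.grading hs] at this
    rw [this, hn]
    simp
  have h2 : N.del (N.delbar (N.σ n)) = s := by
    rw [eq_neg_of_add_eq_zero_left (N.del_delbar _), ← N.σ_delbar, ← N.σ_del, h1, hσ, neg_neg]
  refine ⟨(2⁻¹ : ℂ) • (n + N.σ n), Submodule.smul_mem _ _ (add_mem hmem (N.σ_mem _ _ _ hmem)),
    ?_, ?_⟩
  · rw [N.σ_smul, map_add, N.σ_σ, add_comm, map_inv₀, Complex.conj_ofNat]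
  · rw [map_smul, map_smul, map_add, map_add, h1, h2, ← two_smul ℂ, smul_smul]; simp

/-- Adjoining a potential of `r` to a model of `S ⧸ I` yields a model of `S ⧸ (I + (r))` if `r` is
real and not a zero divisor modulo `I`. -/
def BigradedModel.adjoin {I : Ideal (MvPolynomial σ ℂ)} (P : BigradedModel p I)
    {r : MvPolynomial σ ℂ} {m : ℤ} (hm : 1 ≤ m)
    (hr : r ∈ MvPolynomial.weightedHomogeneousSubmodule ℂ (diagWeight p) (m, m))
    (hσr : MvPolynomial.map (starRingEnd ℂ) r = r) (hreg : ∀ f, r * f ∈ I → f ∈ I) :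
    BigradedModel p (I ⊔ Ideal.span {r}) :=
  -- `∂∂̄z` is purely imaginary for a real potential `z`, whence the factor `I`
  let ρ := P.ι (Complex.I • r)
  have hρ : ρ ∈ P.M.grading (m, m) := P.ι_mem _ _ (Submodule.smul_mem _ _ hr)
  have hσρ : P.M.σ ρ = -ρ := by
    rw [P.σ_ι, ← map_neg, MvPolynomial.smul_eq_C_mul, map_mul, MvPolynomial.map_C, hσr]
    congr 1
    simp
  let M' := P.M.adjoin m ρ hρ (P.del_ι _) (P.delbar_ι _) hσρ
  let j : P.M ⟶ M' := adjoinIncl hρ (P.del_ι _) (P.delbar_ι _) hσρ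
  have hρc : ∀ x, P.M.delbar (ρ * x) = ρ * P.M.delbar x := fun x => by
    rw [P.M.isOddDer_delbar.mul, P.delbar_ι, zero_mul, zero_add,
      P.M.isParity.even hρ (by simp)]
  have hIr : ∀ f, Complex.I • r * f ∈ I → f ∈ I := fun f hf => hreg f (by
    have := I.mul_mem_left (MvPolynomial.C (-Complex.I)) hf
    rwa [smul_mul_assoc, MvPolynomial.smul_eq_C_mul, ← mul_assoc, ← map_mul, neg_mul,
      Complex.I_mul_I, neg_neg, map_one, one_mul] at this)
  { M := M'
    ι := j.toAlgHom.comp P.ι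
    ι_mem := fun n f hf => j.map_mem n _ (P.ι_mem n f hf)
    del_ι := fun f => (j.map_del _).symm.trans
      ((congrArg j.toAlgHom (P.del_ι _)).trans (map_zero _))
    delbar_ι := fun f => (j.map_delbar _).symm.trans
      ((congrArg j.toAlgHom (P.delbar_ι _)).trans (map_zero _))
    σ_ι := fun f => (j.map_σ _).symm.trans (congrArg j.toAlgHom (P.σ_ι f))
    nonneg := fun n x hx hn => eq_zero_of_mem_adjoin hm P.nonneg hn hx
    exists_rep := fun x hx => by
      have h1 : P.M.delbar₁ ρ (OddExt.fst x) = 0 := by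
        have := congrArg OddExt.fst hx
        change P.M.delbar₁ ρ (OddExt.fst x) + 0 * _ = 0 at this
        rwa [zero_mul, add_zero] at this
      have h2 : OddExt.ext₀ (derivativeₗ ℂ) (OddExt.fst x) = P.M.delbar₁ ρ (OddExt.snd x) :=
        sub_eq_zero.1 (congrArg OddExt.snd hx)
      obtain ⟨w, a, b, hv, hu⟩ := exists_const_add h2
      rw [hu, map_add, delbar₁_delbar₁ hρ (P.delbar_ι _), zero_add, delbar₁_const] at h1
      have hb : P.M.delbar b = 0 :=
        neg_eq_zero.1 (C_eq_zero.1 (congrArg OddExt.snd h1))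
      have ha : P.M.delbar a = ρ * b := sub_eq_zero.1 (C_eq_zero.1 (congrArg OddExt.fst h1))
      -- the coefficient `b` of `∂z` is killed by `r` in `S ⧸ I`, hence is exact
      obtain ⟨f, b', hfb⟩ := P.exists_rep b hb
      have hf : f ∈ I := hIr f (P.mem_of_exact _ (a - ρ * b') (by
        rw [map_mul, map_sub, hρc, ha, hfb, mul_add, add_sub_cancel_right]))
      -- `∂∂̄e = ∂̄(-∂e)`, so that `b` is the image of `c` under `∂̄`
      obtain ⟨e, he⟩ := P.exact_of_mem f hf
      set c := b' - P.M.del e with hc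
      have hbc : b = P.M.delbar c := by
        rw [hfb, he, hc, map_sub, eq_neg_of_add_eq_zero_left (P.M.del_delbar e)]
        abel
      obtain ⟨g, e', hg⟩ := P.exists_rep (a - ρ * c) (by rw [map_sub, hρc, ha, hbc, sub_self])
      refine ⟨g, (⟨w + ⟨C e', C (-c)⟩, 0⟩ : P.M.OddExt₂), ?_⟩
      apply OddExt.ext
      · change OddExt.fst x = OddExt.incl _ (C (P.ι g)) +
          (P.M.delbar₁ ρ (w + ⟨C e', C (-c)⟩) + 0 * 0)
        rw [hu, map_add, delbar₁_const, ← sub_add_cancel a (ρ * c), hg, hbc]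
        ext1
        · simp
          abel
        · simp
      · change OddExt.snd x = 0 + (OddExt.ext₀ (derivativeₗ ℂ) (w + ⟨C e', C (-c)⟩) -
          P.M.delbar₁ ρ 0)
        rw [hv]
        ext1 <;> simp
    mem_of_exact := fun f x hx => by
      have h1 : OddExt.incl _ (C (P.ι f)) = P.M.delbar₁ ρ (OddExt.fst x) := by
        have := congrArg OddExt.fst hx
        change OddExt.incl _ (C (P.ι f)) = P.M.delbar₁ ρ (OddExt.fst x) + 0 * _ at this
        rwa [zero_mul, add_zero] at this
      have h2 : OddExt.ext₀ (derivativeₗ ℂ) (OddExt.fst x) = P.M.delbar₁ ρ (OddExt.snd x) :=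
        (sub_eq_zero.1 (congrArg OddExt.snd hx).symm)
      obtain ⟨w, a, b, hv, hu⟩ := exists_const_add h2
      rw [hu, map_add, delbar₁_delbar₁ hρ (P.delbar_ι _), zero_add, delbar₁_const] at h1
      have hb : P.M.delbar b = 0 :=
        neg_eq_zero.1 (C_eq_zero.1 (congrArg OddExt.snd h1).symm)
      have ha : P.ι f = P.M.delbar a - ρ * b := C_injective (congrArg OddExt.fst h1)
      obtain ⟨g, b', hgb⟩ := P.exists_rep b hb
      have h3 : f + Complex.I • r * g ∈ I := P.mem_of_exact _ (a - ρ * b') (by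
        rw [map_add, map_mul, ha, map_sub, hρc, hgb, mul_add]
        abel)
      have h4 : f = (f + Complex.I • r * g) + (-Complex.I • g) * r := by
        rw [smul_mul_assoc, neg_smul, neg_mul, smul_mul_assoc, mul_comm g r, add_neg_cancel_right]
      rw [h4]
      exact Ideal.add_mem _ (Ideal.mem_sup_left h3)
        (Ideal.mem_sup_right (Ideal.mul_mem_left _ _ (Ideal.mem_span_singleton_self r)))
    exact_of_mem := fun f hf => by
      obtain ⟨g, hg, h, hh, rfl⟩ := Submodule.mem_sup.1 hf
      obtain ⟨s, rfl⟩ := Ideal.mem_span_singleton'.1 hh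
      obtain ⟨b, hb⟩ := P.exact_of_mem g hg
      let z : M'.carrier := adjoinPotential hρ (P.del_ι _) (P.delbar_ι _) hσρ
      have hz : M'.del (M'.delbar z) = j.toAlgHom ρ :=
        del_delbar_adjoinPotential hρ (P.del_ι _) (P.delbar_ι _) hσρ
      have h5 := M'.closed_mul_del_delbar (z := j.toAlgHom (P.ι (-Complex.I • s)))
        ((j.map_del _).symm.trans ((congrArg j.toAlgHom (P.del_ι _)).trans (map_zero _)))
        ((j.map_delbar _).symm.trans ((congrArg j.toAlgHom (P.delbar_ι _)).trans (map_zero _))) z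
      refine ⟨j.toAlgHom b + j.toAlgHom (P.ι (-Complex.I • s)) * z, ?_⟩
      have h6 : s * r = (-Complex.I • s) * (Complex.I • r) := by
        rw [smul_mul_smul_comm, neg_mul, Complex.I_mul_I, neg_neg, one_smul]
      have e : M'.del (M'.delbar (j.toAlgHom b + j.toAlgHom (P.ι (-Complex.I • s)) * z)) =
          j.toAlgHom (P.ι g) + j.toAlgHom (P.ι (-Complex.I • s)) * j.toAlgHom ρ := by
        rw [map_add, map_add, ← h5, hz, ← j.map_delbar, ← j.map_del, ← hb]
      rw [e, h6, ← map_mul, ← map_add, ← map_mul, ← map_add]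
      rfl
    exists_extension := fun N g hg h1 h2 h3 h4 => by
      obtain ⟨F, hF⟩ := P.exists_extension N g hg h1 h2 h3
        fun f hf => h4 f (Ideal.mem_sup_left hf)
      obtain ⟨b, hb⟩ := h4 (Complex.I • r) (Ideal.mem_sup_right (by
        rw [MvPolynomial.smul_eq_C_mul]
        exact Ideal.mul_mem_left _ _ (Ideal.mem_span_singleton_self r)))
      obtain ⟨c, hc, hσc, hcc⟩ := exists_real_potential (hg _ _ (Submodule.smul_mem _ _ hr))
        (by rw [← hF, ← F.map_σ, hσρ, map_neg]) hb
      obtain ⟨G, hG⟩ := exists_adjoinLift hρ (P.del_ι _) (P.delbar_ι _) hσρ F c hc hσc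
        (hcc.trans (hF _).symm)
      exact ⟨G, fun f => (hG _).trans (hF f)⟩ }

/-- The bigraded Koszul model of `S ⧸ (I + (rs))` for a regular sequence of real elements. -/
theorem BigradedModel.exists_of_regularModulo {rs : List (MvPolynomial σ ℂ)}
    (hrs : ∀ r ∈ rs, MvPolynomial.map (starRingEnd ℂ) r = r ∧ ∃ m : ℤ, 1 ≤ m ∧
      r ∈ MvPolynomial.weightedHomogeneousSubmodule ℂ (diagWeight p) (m, m))
    {I : Ideal (MvPolynomial σ ℂ)} (hreg : RegularModulo I rs) (P : BigradedModel p I) :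
    Nonempty (BigradedModel p (I ⊔ Ideal.ofList rs)) := by
  induction rs generalizing I with
  | nil => rw [Ideal.ofList_nil, sup_bot_eq]; exact ⟨P⟩
  | cons r rs ih =>
    rw [Ideal.ofList_cons, ← sup_assoc]
    obtain ⟨hσ, m, hm, hr⟩ := hrs r List.mem_cons_self
    exact ih (fun r' hr' => hrs r' (List.mem_cons_of_mem _ hr')) hreg.2
      (P.adjoin hm hr hσ hreg.1)

end Model

end RCBBA

/-! ### The double complex of a bigraded model -/

namespace RCBBA

section Ddbar

variable {N : RCBBA.{u}}

variable (N) in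
/-- The Bott-Chern class of a closed element. -/
def bcCls (x : N.carrier) (h : N.del x = 0 ∧ N.delbar x = 0) : N.HBC :=
  Ideal.Quotient.mk N.bcBoundaries ⟨x, h⟩

theorem exists_bcCls (x : N.HBC) : ∃ a h, x = N.bcCls a h := by
  obtain ⟨⟨x, h⟩, rfl⟩ := Ideal.Quotient.mk_surjective x
  exact ⟨x, h, rfl⟩

theorem d_eq_zero {x : N.carrier} (h : N.del x = 0 ∧ N.delbar x = 0) : N.total.d x = 0 := by
  change N.del x + N.delbar x = 0
  rw [h.1, h.2, add_zero]

theorem bcToDR_bcCls {x : N.carrier} (h : N.del x = 0 ∧ N.delbar x = 0) :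
    N.bcToDR (N.bcCls x h) = N.total.cls x (d_eq_zero h) := rfl

theorem bcCls_eq_iff {x y : N.carrier} (h : N.del x = 0 ∧ N.delbar x = 0)
    (h' : N.del y = 0 ∧ N.delbar y = 0) :
    N.bcCls x h = N.bcCls y h' ↔ ∃ b, x - y = N.del (N.delbar b) :=
  Ideal.Quotient.eq

theorem bcCls_eq_zero_iff {x : N.carrier} (h : N.del x = 0 ∧ N.delbar x = 0) :
    N.bcCls x h = 0 ↔ ∃ b, x = N.del (N.delbar b) :=
  Ideal.Quotient.eq_zero_iff_mem

theorem Hom.mapBC_bcCls {M : RCBBA.{u}} (f : M ⟶ N) {x : M.carrier}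
    (h : M.del x = 0 ∧ M.delbar x = 0) :
    Hom.mapBC f (M.bcCls x h) = N.bcCls (f.toAlgHom x)
      ⟨by rw [← f.map_del, h.1, map_zero], by rw [← f.map_delbar, h.2, map_zero]⟩ := rfl

theorem ddbarLemma_iff : N.DdbarLemma ↔ ∀ x, N.del x = 0 → N.delbar x = 0 →
    (∃ b, x = N.d b) → ∃ b, x = N.del (N.delbar b) := by
  constructor
  · intro h x h1 h2 hb
    rw [← bcCls_eq_zero_iff ⟨h1, h2⟩]
    refine h (Eq.trans ?_ (map_zero N.bcToDR).symm)
    rw [bcToDR_bcCls ⟨h1, h2⟩]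
    exact (CDGA.cls_eq_zero_iff (A := N.total) _).2 hb
  · intro h
    refine (injective_iff_map_eq_zero N.bcToDR).2 fun x hx => ?_
    obtain ⟨x, hd, rfl⟩ := exists_bcCls x
    rw [bcToDR_bcCls hd] at hx
    exact (bcCls_eq_zero_iff hd).2
      (h x hd.1 hd.2 ((CDGA.cls_eq_zero_iff (A := N.total) _).1 hx))

theorem d_delbar (b : N.carrier) : N.d (N.delbar b) = N.del (N.delbar b) := by
  rw [d_apply, N.delbar_delbar, add_zero]

theorem delbar_del (b : N.carrier) : N.delbar (N.del b) = -N.del (N.delbar b) :=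
  eq_neg_of_add_eq_zero_right (N.del_delbar b)

/-- Under the `∂∂̄`-Lemma, a `∂̄`-closed and `∂`-exact element is `∂∂̄`-exact. -/
theorem DdbarLemma.of_del (hN : N.DdbarLemma) {u : N.carrier} (hu : N.delbar (N.del u) = 0) :
    ∃ w, N.del u = N.del (N.delbar w) := by
  have key : ∀ n : ℤ × ℤ, ∃ w, N.del (GradedAlgebra.proj N.grading n u) = N.del (N.delbar w) := by
    intro n
    set v := GradedAlgebra.proj N.grading n u with hv
    have hvn : v ∈ N.grading n := proj_mem _ _ _
    have h0 : N.delbar (N.del v) = 0 := by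
      rw [hv, ← proj_del, ← proj_delbar, hu, map_zero]
    obtain ⟨w, hw⟩ := ddbarLemma_iff.1 hN (N.d v)
      (by rw [d_apply, map_add, N.del_del, zero_add, eq_neg_of_add_eq_zero_left (N.del_delbar v),
        h0, neg_zero])
      (by rw [d_apply, map_add, N.delbar_delbar, add_zero, h0]) ⟨v, rfl⟩
    have h1 := congrArg (GradedAlgebra.proj N.grading (n + (1, 0))) hw
    rw [proj_del_delbar, d_apply, map_add, proj_same N.grading (N.del_mem' _ _ hvn),
      proj_ne N.grading (N.delbar_mem' _ _ hvn) (by simp), add_zero] at h1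
    exact ⟨_, h1⟩
  choose w hw using key
  obtain ⟨s, hs⟩ := exists_sum_proj N.grading u
  refine ⟨∑ n ∈ s, w n, ?_⟩
  conv_lhs => rw [← hs]
  simp only [map_sum, hw]

theorem DdbarLemma.of_delbar (hN : N.DdbarLemma) {u : N.carrier} (hu : N.del (N.delbar u) = 0) :
    ∃ w, N.delbar u = N.del (N.delbar w) := by
  obtain ⟨w, hw⟩ := hN.of_del (u := N.σ u) (by rw [← N.σ_delbar, ← N.σ_del, hu, map_zero])
  refine ⟨-N.σ w, ?_⟩
  have := congrArg N.σ hw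
  rw [N.σ_del, N.σ_σ, N.σ_del, N.σ_delbar] at this
  rw [this, map_neg, map_neg, delbar_del]

/-- Under the `∂∂̄`-Lemma, every `d`-closed element is cohomologous to one that is both `∂`- and
`∂̄`-closed. -/
theorem DdbarLemma.exists_closed (hN : N.DdbarLemma) {z : N.carrier} (hz : N.d z = 0) :
    ∃ x w, N.del x = 0 ∧ N.delbar x = 0 ∧ z = x + N.d w := by
  rw [d_apply] at hz
  have h0 : N.delbar (N.del z) = 0 := by
    rw [eq_neg_of_add_eq_zero_left hz, map_neg, N.delbar_delbar, neg_zero]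
  obtain ⟨w, hw⟩ := hN.of_del h0
  have h1 : N.del (z - N.d w) = 0 := by
    rw [map_sub, d_apply, map_add, N.del_del, zero_add, hw, sub_self]
  refine ⟨z - N.d w, w, h1, ?_, (sub_add_cancel _ _).symm⟩
  have h2 : N.d (z - N.d w) = 0 := by
    rw [map_sub, show N.d (N.d w) = 0 from N.total.d_d w, sub_zero, d_apply, hz]
  rwa [d_apply, h1, zero_add] at h2

/-- Under the `∂∂̄`-Lemma, every Aeppli class is represented by an element that is both `∂`- and
`∂̄`-closed. -/
theorem DdbarLemma.exists_aeppli (hN : N.DdbarLemma) {x : N.carrier}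
    (hx : N.del (N.delbar x) = 0) :
    ∃ z a b, N.del z = 0 ∧ N.delbar z = 0 ∧ x = z + (N.del a + N.delbar b) := by
  obtain ⟨w, hw⟩ := hN.of_delbar hx
  obtain ⟨w', hw'⟩ := hN.of_del (u := x) (by rw [delbar_del, hx, neg_zero])
  refine ⟨x + N.del w - N.delbar w', -w, w', ?_, ?_, ?_⟩
  · rw [map_sub, map_add, N.del_del, add_zero, hw', sub_self]
  · rw [map_sub, map_add, N.delbar_delbar, sub_zero, delbar_del, hw, add_neg_cancel]
  · rw [map_neg]; abel

/-- Under the `∂∂̄`-Lemma, the map from Bott-Chern to Aeppli cohomology is injective. -/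
theorem DdbarLemma.exact_of_aeppli (hN : N.DdbarLemma) {z a b : N.carrier} (h1 : N.del z = 0)
    (h2 : N.delbar z = 0) (hz : z = N.del a + N.delbar b) : ∃ w, z = N.del (N.delbar w) := by
  rw [hz, map_add, N.del_del, zero_add] at h1
  rw [hz, map_add, N.delbar_delbar, add_zero] at h2
  obtain ⟨w, hw⟩ := hN.of_del h2
  obtain ⟨w', hw'⟩ := hN.of_delbar h1
  exact ⟨w + w', by rw [map_add, map_add, hz, hw, hw']⟩

/-- For algebras with the `∂∂̄`-Lemma, Bott-Chern and Aeppli cohomology agree, so that an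
isomorphism on the former is one on the latter. -/
theorem mapA_bijective {M : RCBBA.{u}} (hM : M.DdbarLemma) (hN : N.DdbarLemma) (f : M ⟶ N)
    (hf : Function.Bijective (Hom.mapBC f)) : Function.Bijective (Hom.mapA f) := by
  have hinj : ∀ z, M.del z = 0 → M.delbar z = 0 → (∃ b, f.toAlgHom z = N.del (N.delbar b)) →
      ∃ b, z = M.del (M.delbar b) := fun z h1 h2 hb => by
    rw [← bcCls_eq_zero_iff ⟨h1, h2⟩]
    refine hf.1 (Eq.trans ?_ (map_zero _).symm)
    rw [Hom.mapBC_bcCls]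
    exact (bcCls_eq_zero_iff _).2 hb
  constructor
  · refine (injective_iff_map_eq_zero (Hom.mapA f)).2 fun x hx => ?_
    obtain ⟨⟨x, hxd⟩, rfl⟩ := Submodule.Quotient.mk_surjective _ x
    obtain ⟨z, a, b, h1, h2, rfl⟩ := hM.exists_aeppli (x := x) hxd
    have hx' := (Submodule.Quotient.mk_eq_zero _).1 hx
    obtain ⟨_, ⟨a', rfl⟩, _, ⟨b', rfl⟩, h⟩ := Submodule.mem_sup.1
      (show f.toAlgHom (z + (M.del a + M.delbar b)) ∈ _ from hx')
    obtain ⟨w, hw⟩ := hinj z h1 h2 (hN.exact_of_aeppli (a := a' - f.toAlgHom a)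
      (b := b' - f.toAlgHom b) (by rw [← f.map_del, h1, map_zero])
      (by rw [← f.map_delbar, h2, map_zero]) (by
        rw [map_add, map_add, f.map_del, f.map_delbar] at h
        rw [map_sub, map_sub, eq_sub_of_add_eq h.symm]
        abel))
    refine (Submodule.Quotient.mk_eq_zero _).2 ?_
    refine Submodule.mem_sup.2 ⟨_, ⟨M.delbar w + a, rfl⟩, _, ⟨b, rfl⟩, ?_⟩
    change _ = z + (M.del a + M.delbar b)
    rw [map_add, hw, add_assoc]
  · intro y
    obtain ⟨⟨y, hyd⟩, rfl⟩ := Submodule.Quotient.mk_surjective _ y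
    obtain ⟨z, a, b, h1, h2, rfl⟩ := hN.exists_aeppli (x := y) hyd
    obtain ⟨x, hx⟩ := hf.2 (N.bcCls z ⟨h1, h2⟩)
    obtain ⟨x, ⟨h3, h4⟩, rfl⟩ := exists_bcCls x
    rw [Hom.mapBC_bcCls, bcCls_eq_iff] at hx
    obtain ⟨w, hw⟩ := hx
    refine ⟨Submodule.Quotient.mk ⟨x, by
      change M.del (M.delbar x) = 0
      rw [h4, map_zero]⟩, ?_⟩
    refine (Submodule.Quotient.eq _).2 ?_
    refine Submodule.mem_sup.2 ⟨_, ⟨N.delbar w - a, rfl⟩, _, ⟨-b, rfl⟩, ?_⟩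
    change _ = f.toAlgHom x - (z + (N.del a + N.delbar b))
    rw [map_sub, ← hw, map_neg]
    abel

end Ddbar

section Model

variable {σ : Type u} {p : σ → ℕ} {I : Ideal (MvPolynomial σ ℂ)} (P : BigradedModel p I)

theorem BigradedModel.proj_ι (n : ℤ × ℤ) (f : MvPolynomial σ ℂ) :
    ∃ g ∈ MvPolynomial.weightedHomogeneousSubmodule ℂ (diagWeight p) n,
      GradedAlgebra.proj P.M.grading n (P.ι f) = P.ι g :=
  ⟨_, proj_mem (polynomialRCBBA p).grading n f,
    proj_map (polynomialRCBBA p).grading (P.ι : MvPolynomial σ ℂ →+ P.M.carrier) id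
      Function.injective_id (fun j => (GradedAlgebra.proj P.M.grading j).toAddMonoidHom)
      (fun _ x hx => proj_same P.M.grading (P.ι_mem _ x hx))
      (fun _ _ h x hx => proj_ne P.M.grading (P.ι_mem _ x hx) h) n f⟩

theorem BigradedModel.exists_rep_homogeneous {n : ℤ × ℤ} {x : P.M.carrier}
    (hx : x ∈ P.M.grading n) (h : P.M.delbar x = 0) :
    ∃ f ∈ MvPolynomial.weightedHomogeneousSubmodule ℂ (diagWeight p) n,
      ∃ b ∈ P.M.grading (n - (0, 1)), x = P.ι f + P.M.delbar b := by
  obtain ⟨f, b, hfb⟩ := P.exists_rep x h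
  obtain ⟨g, hg, e⟩ := P.proj_ι n f
  refine ⟨g, hg, _, proj_mem P.M.grading (n - (0, 1)) b, ?_⟩
  rw [← proj_delbar, sub_add_cancel, ← e, ← map_add, ← hfb, proj_same P.M.grading hx]

/-- Off the diagonal, the model is `∂̄`-acyclic. -/
theorem BigradedModel.exists_delbar {n : ℤ × ℤ} (hn : n.1 ≠ n.2) {x : P.M.carrier}
    (hx : x ∈ P.M.grading n) (h : P.M.delbar x = 0) :
    ∃ b ∈ P.M.grading (n - (0, 1)), x = P.M.delbar b := by
  obtain ⟨f, hf, b, hb, e⟩ := P.exists_rep_homogeneous hx h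
  rw [diagWeight_eq_zero p (Or.inl hn) hf, map_zero, zero_add] at e
  exact ⟨b, hb, e⟩

theorem BigradedModel.exists_del {n : ℤ × ℤ} (hn : n.1 ≠ n.2) {x : P.M.carrier}
    (hx : x ∈ P.M.grading n) (h : P.M.del x = 0) :
    ∃ b ∈ P.M.grading (n - (1, 0)), x = P.M.del b := by
  obtain ⟨b, hb, e⟩ := P.exists_delbar (n := n.swap) hn.symm (P.M.σ_mem _ _ _ hx)
    (by rw [← P.M.σ_del, h, map_zero])
  refine ⟨P.M.σ b, P.M.σ_mem _ _ _ hb, ?_⟩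
  rw [← P.M.σ_delbar, ← e, P.M.σ_σ]

/-- A descent along the staircase below the diagonal, which ends because the model lives in the
first quadrant. -/
theorem BigradedModel.exists_correction (k : ℕ) : ∀ (a b : ℤ), b < k → b < a →
    ∀ y ∈ P.M.grading (a, b), P.M.delbar (P.M.del y) = 0 →
    ∃ u ∈ P.M.grading (a, b - 1), P.M.del (y + P.M.delbar u) = 0 := by
  induction k with
  | zero =>
    intro a b hb hab y hy h
    exact ⟨0, Submodule.zero_mem _, by
      rw [P.nonneg _ y hy (Or.inr hb), map_zero, add_zero, map_zero]⟩
  | succ k ih =>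
    intro a b hb hab y hy h
    obtain ⟨y', hy', e⟩ := P.exists_delbar (n := (a + 1, b)) (by simp only; omega)
      (P.M.del_mem _ _ _ hy) h
    have hy'' : y' ∈ P.M.grading (a + 1, b - 1) := by simpa using hy'
    obtain ⟨u', hu', e'⟩ := ih (a + 1) (b - 1) (by push_cast at hb; omega) (by omega) y' hy'' (by
      rw [delbar_del, ← e, P.M.del_del, neg_zero])
    have hmem : y' + P.M.delbar u' ∈ P.M.grading (a + 1, b - 1) := by
      have := P.M.delbar_mem _ _ _ hu'
      rw [sub_add_cancel] at this
      exact add_mem hy'' this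
    obtain ⟨v, hv, hv'⟩ := P.exists_del (by simp only; omega) hmem e'
    refine ⟨v, by simpa using hv, ?_⟩
    rw [map_add, e, eq_sub_of_add_eq hv', map_sub, P.M.delbar_delbar, sub_zero, delbar_del,
      neg_add_cancel]

/-- The Bott-Chern cohomology of the model is generated by polynomials. By conjugation, it suffices
to consider bidegrees on or below the diagonal. -/
theorem BigradedModel.exists_rep_closed {x : P.M.carrier} (h1 : P.M.del x = 0)
    (h2 : P.M.delbar x = 0) : ∃ f w, x = P.ι f + P.M.del (P.M.delbar w) := by
  have key : ∀ n : ℤ × ℤ, n.2 ≤ n.1 → ∀ x ∈ P.M.grading n, P.M.del x = 0 → P.M.delbar x = 0 →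
      ∃ f w, x = P.ι f + P.M.del (P.M.delbar w) := by
    intro n hn x hx h1 h2
    obtain ⟨f, -, y, hy, e⟩ := P.exists_rep_homogeneous hx h2
    rw [e, map_add, P.del_ι, zero_add] at h1
    have hy' : y ∈ P.M.grading (n.1, n.2 - 1) := by
      rwa [show n - (0, 1) = (n.1, n.2 - 1) by ext <;> simp] at hy
    obtain ⟨u, hu, hu'⟩ := P.exists_correction (n.2 - 1 + 1).toNat n.1 (n.2 - 1) (by omega)
      (by omega) y hy' (by rw [delbar_del, h1, neg_zero])
    have hmem : y + P.M.delbar u ∈ P.M.grading (n.1, n.2 - 1) := by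
      have := P.M.delbar_mem _ _ _ hu
      rw [sub_add_cancel] at this
      exact add_mem hy' this
    obtain ⟨v, -, hv⟩ := P.exists_del (by simp only; omega) hmem hu'
    refine ⟨f, -v, ?_⟩
    rw [e, eq_sub_of_add_eq hv, map_sub, P.M.delbar_delbar, sub_zero, delbar_del, map_neg, map_neg]
  have key' : ∀ n : ℤ × ℤ, ∃ f w, GradedAlgebra.proj P.M.grading n x =
      P.ι f + P.M.del (P.M.delbar w) := by
    intro n
    have h1' := P.M.del_proj_eq_zero h1 n
    have h2' := P.M.delbar_proj_eq_zero h2 n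
    by_cases hn : n.2 ≤ n.1
    · exact key n hn _ (proj_mem _ _ _) h1' h2'
    · obtain ⟨f, w, e⟩ := key n.swap (not_le.1 hn).le _ (P.M.σ_mem _ _ _ (proj_mem _ n x))
        (by rw [← P.M.σ_delbar, h2', map_zero]) (by rw [← P.M.σ_del, h1', map_zero])
      refine ⟨MvPolynomial.map (starRingEnd ℂ) f, -P.M.σ w, ?_⟩
      have := congrArg P.M.σ e
      rw [P.M.σ_σ, map_add, P.σ_ι, P.M.σ_del, P.M.σ_delbar] at this
      rw [this, delbar_del, map_neg, map_neg]
  choose f w hfw using key'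
  obtain ⟨s, hs⟩ := exists_sum_proj P.M.grading x
  refine ⟨∑ n ∈ s, f n, ∑ n ∈ s, w n, ?_⟩
  conv_lhs => rw [← hs]
  simp only [map_sum, hfw, Finset.sum_add_distrib]

variable {N : RCBBA.{u}} (F : P.M ⟶ N)

theorem Hom.map_d (a : P.M.carrier) : F.toAlgHom (P.M.d a) = N.d (F.toAlgHom a) := by
  rw [d_apply, d_apply, map_add, F.map_del, F.map_delbar]

/-- A bigraded model of `S ⧸ I` satisfies the `∂∂̄`-Lemma if it maps to an algebra in which only the
elements of `I` become exact. -/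
theorem BigradedModel.ddbarLemma
    (hI : ∀ f, (∃ b, F.toAlgHom (P.ι f) = N.d b) → f ∈ I) : P.M.DdbarLemma := by
  rw [ddbarLemma_iff]
  rintro x h1 h2 ⟨b, hb⟩
  obtain ⟨f, w, rfl⟩ := P.exists_rep_closed h1 h2
  obtain ⟨c, hc⟩ := P.exact_of_mem f (hI f ⟨F.toAlgHom (b - P.M.delbar w), by
    rw [← Hom.map_d, map_sub, ← hb, d_delbar, add_sub_cancel_right]⟩)
  exact ⟨c + w, by rw [map_add, map_add, hc]⟩

/-- A morphism from a bigraded model of `S ⧸ I` to an algebra with the `∂∂̄`-Lemma whose cohomology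
is `S ⧸ I` is a pluripotential quasi-isomorphism. -/
theorem BigradedModel.isPluripotentialQuasiIso (hN : N.DdbarLemma)
    (hI : ∀ f, (∃ b, F.toAlgHom (P.ι f) = N.d b) → f ∈ I)
    (hsurj : ∀ y, N.del y = 0 → N.delbar y = 0 →
      ∃ f w, y = F.toAlgHom (P.ι f) + N.del (N.delbar w)) : IsPluripotentialQuasiIso F := by
  have hBC : Function.Bijective (Hom.mapBC F) := by
    constructor
    · refine (injective_iff_map_eq_zero (Hom.mapBC F)).2 fun x hx => ?_
      obtain ⟨x, ⟨h1, h2⟩, rfl⟩ := exists_bcCls x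
      rw [Hom.mapBC_bcCls, bcCls_eq_zero_iff] at hx
      obtain ⟨b, hb⟩ := hx
      obtain ⟨f, w, rfl⟩ := P.exists_rep_closed h1 h2
      rw [map_add, F.map_del, F.map_delbar] at hb
      obtain ⟨c, hc⟩ := P.exact_of_mem f (hI f ⟨N.delbar (b - F.toAlgHom w), by
        rw [d_delbar, map_sub, map_sub, ← hb, add_sub_cancel_right]⟩)
      exact (bcCls_eq_zero_iff ⟨h1, h2⟩).2 ⟨c + w, by rw [map_add, map_add, hc]⟩
    · intro y
      obtain ⟨y, ⟨h1, h2⟩, rfl⟩ := exists_bcCls y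
      obtain ⟨f, w, e⟩ := hsurj y h1 h2
      refine ⟨P.M.bcCls (P.ι f) ⟨P.del_ι f, P.delbar_ι f⟩, ?_⟩
      rw [Hom.mapBC_bcCls, bcCls_eq_iff]
      refine ⟨-w, ?_⟩
      rw [e, map_neg, map_neg]
      abel
  exact ⟨hBC, mapA_bijective (P.ddbarLemma F hI) hN F hBC⟩

/-- A real exact element has a real primitive. -/
theorem exists_fixed_primitive {N : RCBBA.{u}} {x b : N.carrier} (hx : N.σ x = x)
    (h : x = N.d b) : ∃ c, N.σ c = c ∧ x = N.d c := by
  refine ⟨(2⁻¹ : ℂ) • (b + N.σ b), ?_, ?_⟩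
  · rw [N.σ_smul, map_add, N.σ_σ, add_comm, map_inv₀, Complex.conj_ofNat]
  · rw [map_smul, map_add, ← N.σ_d_comm, ← h, hx, ← two_smul ℂ, smul_smul]
    simp

/-- Under the same hypotheses, the map of real total cdga's is a quasi-isomorphism. -/
theorem BigradedModel.quasiIso_realTotalMap (hN : N.DdbarLemma)
    (hI : ∀ f, (∃ b, F.toAlgHom (P.ι f) = N.d b) → f ∈ I)
    (hsurj : ∀ y, N.del y = 0 → N.delbar y = 0 →
      ∃ f w, y = F.toAlgHom (P.ι f) + N.del (N.delbar w)) :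
    CDGA.quasiIso ℝ (realTotalMap F) := by
  constructor
  · refine (injective_iff_map_eq_zero (CDGA.Hom.mapH (realTotalMap F))).2 fun x hx => ?_
    obtain ⟨⟨a, hσa⟩, ha, rfl⟩ := CDGA.exists_cls x
    obtain ⟨b, hb⟩ := (CDGA.cls_eq_zero_iff _).1
      ((CDGA.mapH_cls (realTotalMap F) _ ha).symm.trans hx)
    have hb' : F.toAlgHom a = N.d b.1 := congrArg Subtype.val hb
    have ha' : P.M.d a = 0 := congrArg Subtype.val ha
    obtain ⟨z, w, h1, h2, e⟩ := (P.ddbarLemma F hI).exists_closed ha'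
    obtain ⟨f, w', rfl⟩ := P.exists_rep_closed h1 h2
    obtain ⟨c, hc⟩ := P.exact_of_mem f (hI f ⟨b.1 - F.toAlgHom (w + P.M.delbar w'), by
      rw [map_sub, ← hb', ← Hom.map_d, map_add P.M.d, d_delbar, ← map_sub, e]
      congr 1
      abel⟩)
    obtain ⟨c', hσc', hc'⟩ := exists_fixed_primitive (b := P.M.delbar c + P.M.delbar w' + w) hσa (by
      rw [e, hc, map_add, map_add, d_delbar, d_delbar])
    exact (CDGA.cls_eq_zero_iff ha).2 ⟨⟨c', hσc'⟩, Subtype.ext hc'⟩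
  · intro y
    obtain ⟨⟨y, hσy⟩, hy, rfl⟩ := CDGA.exists_cls y
    -- the real part of a preimage of the class of `y` is a preimage as well
    have hy' : N.d y = 0 := congrArg Subtype.val hy
    obtain ⟨z, w, h1, h2, e⟩ := hN.exists_closed hy'
    obtain ⟨f, w', rfl⟩ := hsurj z h1 h2
    have hσy' : N.σ y = y := hσy
    set g := (2⁻¹ : ℂ) • (P.ι f + P.M.σ (P.ι f)) with hg
    have hσg : P.M.σ g = g := by
      rw [hg, P.M.σ_smul, map_add, P.M.σ_σ, add_comm, map_inv₀, Complex.conj_ofNat]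
    have hgd : P.M.d g = 0 := by
      rw [hg, map_smul, map_add, ← P.M.σ_d_comm, d_apply, P.del_ι, P.delbar_ι, add_zero, map_zero,
        add_zero, smul_zero]
    set v := N.delbar w' + w with hv
    have e1 : y = F.toAlgHom (P.ι f) + N.d v := by rw [e, hv, map_add, d_delbar, add_assoc]
    have e2 : y = F.toAlgHom (P.M.σ (P.ι f)) + N.d (N.σ v) := by
      rw [F.map_σ, ← N.σ_d_comm, ← map_add, ← e1, hσy']
    have e3 : y - F.toAlgHom g = N.d ((2⁻¹ : ℂ) • (v + N.σ v)) := by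
      have e4 : y = (2⁻¹ : ℂ) • (y + y) := by rw [← two_smul ℂ, smul_smul]; simp
      have e5 : y + y - (F.toAlgHom (P.ι f) + F.toAlgHom (P.M.σ (P.ι f))) =
          N.d v + N.d (N.σ v) := by
        nth_rewrite 1 [e1]
        rw [e2]
        abel
      rw [map_smul N.d, map_add N.d, ← e5, smul_sub, ← e4, hg, map_smul, map_add]
    obtain ⟨c, hσc, hc⟩ := exists_fixed_primitive
      (by rw [map_sub, hσy', ← F.map_σ, hσg]) e3
    refine ⟨P.M.realTotal.cls ⟨g, hσg⟩ (Subtype.ext hgd), ?_⟩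
    exact ((CDGA.cls_eq_iff hy _).2 ⟨(⟨c, hσc⟩ : N.fixed), Subtype.ext hc⟩).symm

end Model

theorem ddbarLemma_bcCohomology (A : RCBBA.{u}) : A.bcCohomology.DdbarLemma :=
  ddbarLemma_iff.2 fun _ _ _ ⟨_, h⟩ => ⟨0, h.trans (add_zero (0 : A.HBC))⟩

end RCBBA

/-! ### Regular sequences and syzygies -/

section Syzygies

variable {R : Type*} [CommRing R]

theorem regularModulo_concat (J : Ideal R) (l : List R) (r : R) :
    RegularModulo J (l ++ [r]) ↔
      RegularModulo J l ∧ ∀ p, r * p ∈ J ⊔ Ideal.ofList l → p ∈ J ⊔ Ideal.ofList l := by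
  induction l generalizing J with
  | nil => simp [RegularModulo]
  | cons s l ih =>
    rw [List.cons_append, RegularModulo, RegularModulo, ih, Ideal.ofList_cons, ← sup_assoc,
      and_assoc]

/-- A weakly regular sequence is regular in the elementary sense of `RegularModulo`. -/
theorem regularModulo_of_isWeaklyRegular {rs : List R}
    (h : RingTheory.Sequence.IsWeaklyRegular R rs) : RegularModulo ⊥ rs := by
  have key : ∀ (J : Ideal R) (rs : List R), (∀ i (hi : i < rs.length), ∀ p,
      rs[i] * p ∈ J ⊔ Ideal.ofList (rs.take i) → p ∈ J ⊔ Ideal.ofList (rs.take i)) →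
      RegularModulo J rs := by
    intro J rs
    induction rs generalizing J with
    | nil => exact fun _ => trivial
    | cons r rs ih =>
      intro H
      refine ⟨fun p hp => ?_, ih _ fun i hi p hp => ?_⟩
      · simpa using H 0 (by simp) p (by simpa using hp)
      · have := H (i + 1) (by simpa using hi) p
        rw [List.take_succ_cons, Ideal.ofList_cons, ← sup_assoc] at this
        exact this hp
  refine key _ _ fun i hi p hp => ?_
  rw [bot_sup_eq] at hp ⊢
  have h1 := h.regular_mod_prev i hi
  have e : (Ideal.ofList (rs.take i) • ⊤ : Submodule R R) = Ideal.ofList (rs.take i) := by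
    rw [smul_eq_mul, Ideal.mul_top]
  have h2 : (Submodule.Quotient.mk p : R ⧸ (Ideal.ofList (rs.take i) • ⊤ : Submodule R R)) = 0 :=
    h1 (by
      change rs[i] • Submodule.Quotient.mk p = rs[i] • 0
      rw [smul_zero, ← Submodule.Quotient.mk_smul, Submodule.Quotient.mk_eq_zero, e]
      exact hp)
  rwa [Submodule.Quotient.mk_eq_zero, e] at h2

theorem mem_ofList_ofFn {m : ℕ} {r : Fin m → R} {x : R} :
    x ∈ Ideal.ofList (List.ofFn r) ↔ ∃ a : Fin m → R, ∑ i, a i * r i = x := by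
  have : {y | y ∈ List.ofFn r} = Set.range r := by
    ext y; simp
  rw [Ideal.ofList, this, Ideal.mem_span_range_iff_exists_fun]

/-- Every relation between the `r_i` is a consequence of the relations `r_j r_i = r_i r_j`; that is,
the first Koszul homology vanishes. Unlike regularity, this does not depend on the order of the
sequence and is invariant under invertible linear substitutions. -/
def TrivialSyzygies {ι : Type*} [Fintype ι] (r : ι → R) : Prop :=
  ∀ a : ι → R, ∑ i, a i * r i = 0 →
    ∃ S : ι → ι → R, (∀ i j, S i j = -S j i) ∧ ∀ i, a i = ∑ j, S i j * r j

theorem TrivialSyzygies.map {ι R' : Type*} [Fintype ι] [CommRing R'] (φ : R ≃+* R') {r : ι → R}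
    (h : TrivialSyzygies r) : TrivialSyzygies fun i => φ (r i) := by
  intro a ha
  obtain ⟨S, hS, hS'⟩ := h (fun i => φ.symm (a i)) (φ.injective (by simpa using ha))
  refine ⟨fun i j => φ (S i j), fun i j => by simp only [hS i j, map_neg], fun i => ?_⟩
  rw [← φ.apply_symm_apply (a i), hS' i]
  simp

/-- If `a` is a syzygy of `A r`, then `a A` is one of `r`; the antisymmetric matrix `S` for the
latter gives `Bᵀ S B` for the former, where `B` is the inverse of `A`. -/
theorem TrivialSyzygies.of_matrix {ι : Type*} [Fintype ι] [DecidableEq ι] {A B : Matrix ι ι R}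
    (hAB : A * B = 1) {r : ι → R} (h : TrivialSyzygies r) : TrivialSyzygies (A.mulVec r) := by
  have hBA : B * A = 1 := mul_eq_one_comm.1 hAB
  intro a ha
  obtain ⟨S, hS, hS'⟩ := h (Matrix.vecMul a A) (by
    change Matrix.vecMul a A ⬝ᵥ r = 0
    rw [← Matrix.dotProduct_mulVec]
    exact ha)
  have h1 : Matrix.vecMul a A = (Matrix.of S).mulVec r := funext hS'
  have hST : (Matrix.of S).transpose = -Matrix.of S := by
    ext i j
    exact hS j i
  refine ⟨B.transpose * Matrix.of S * B, fun i j => ?_, fun i => ?_⟩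
  · have : (B.transpose * Matrix.of S * B).transpose = -(B.transpose * Matrix.of S * B) := by
      rw [Matrix.transpose_mul, Matrix.transpose_mul, Matrix.transpose_transpose, hST,
        Matrix.neg_mul, Matrix.mul_neg, Matrix.mul_assoc]
    exact congrFun (congrFun this j) i
  · have : a = (B.transpose * Matrix.of S * B).mulVec (A.mulVec r) := by
      rw [Matrix.mulVec_mulVec, Matrix.mul_assoc, Matrix.mul_assoc, hBA, Matrix.mul_one,
        ← Matrix.mulVec_mulVec, ← h1, Matrix.mulVec_transpose, Matrix.vecMul_vecMul, hAB,
        Matrix.vecMul_one]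
    exact congrFun this i

theorem TrivialSyzygies.of_regularModulo {m : ℕ} {r : Fin m → R}
    (h : RegularModulo ⊥ (List.ofFn r)) : TrivialSyzygies r := by
  induction m with
  | zero => exact fun a _ => ⟨0, fun i => i.elim0, fun i => i.elim0⟩
  | succ m ih =>
    rw [List.ofFn_succ_last, regularModulo_concat, bot_sup_eq] at h
    intro a ha
    rw [Fin.sum_univ_castSucc] at ha
    obtain ⟨b, hb⟩ := mem_ofList_ofFn.1 (h.2 (a (Fin.last m)) (by
      rw [mul_comm, eq_neg_of_add_eq_zero_right ha]
      exact neg_mem (mem_ofList_ofFn.2 ⟨fun i => a i.castSucc, rfl⟩)))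
    obtain ⟨S, hS, hS'⟩ := ih h.1 (fun i => a i.castSucc + b i * r (Fin.last m)) (by
      rw [← ha, ← hb, Finset.sum_mul, ← Finset.sum_add_distrib]
      exact Finset.sum_congr rfl fun i _ => by ring)
    refine ⟨Fin.snoc (fun i => Fin.snoc (S i) (-b i)) (Fin.snoc b 0), fun i j => ?_, fun i => ?_⟩
    · induction i using Fin.lastCases with
      | last =>
        induction j using Fin.lastCases with
        | last => simp
        | cast j => simp
      | cast i =>
        induction j using Fin.lastCases with
        | last => simp
        | cast j => simpa using hS i j
    · rw [Fin.sum_univ_castSucc]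
      induction i using Fin.lastCases with
      | last => simp [hb]
      | cast i =>
        simp only [Fin.snoc_castSucc, Fin.snoc_last]
        rw [← hS' i]
        ring

end Syzygies

/-! ### Graded syzygies of polynomials -/

namespace MvPolynomial

section Coeffwise

variable {σ k k' : Type*} [CommSemiring k] [CommSemiring k']

/-- The additive map of polynomials that applies `f m` to the coefficient of the monomial `m`. -/
def coeffwise (f : (σ →₀ ℕ) → k →+ k') : MvPolynomial σ k →+ MvPolynomial σ k' :=
  (Finsupp.liftAddHom fun m => (monomial m).toAddMonoidHom.comp (f m)).comp
    (AddMonoidAlgebra.coeffLinearEquiv k : MvPolynomial σ k ≃ₗ[k] _).toLinearMap.toAddMonoidHom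

@[simp] theorem coeffwise_monomial (f : (σ →₀ ℕ) → k →+ k') (m : σ →₀ ℕ) (a : k) :
    coeffwise f (monomial m a) = monomial m (f m a) :=
  Finsupp.liftAddHom_apply_single (fun m => (monomial m).toAddMonoidHom.comp (f m)) m a

@[simp] theorem coeff_coeffwise (f : (σ →₀ ℕ) → k →+ k') (P : MvPolynomial σ k) (m : σ →₀ ℕ) :
    coeff m (coeffwise f P) = f m (coeff m P) := by
  classical
  induction P using MvPolynomial.induction_on' with
  | monomial n a =>
    rw [coeffwise_monomial, coeff_monomial, coeff_monomial]
    split_ifs with h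
    · rw [h]
    · rw [map_zero]
  | add P Q hP hQ => rw [map_add, coeff_add, coeff_add, hP, hQ, map_add]

end Coeffwise

section Trunc

variable {σ k : Type*} [CommRing k]

open scoped Classical in
/-- The sum of the components of weight less than `N`. -/
def weightTrunc (w : σ → ℤ) (N : ℤ) : MvPolynomial σ k →+ MvPolynomial σ k :=
  coeffwise fun m => if Finsupp.weight w m < N then AddMonoidHom.id k else 0

theorem coeff_weightTrunc_of_lt {w : σ → ℤ} {N : ℤ} {m : σ →₀ ℕ} (h : Finsupp.weight w m < N)
    (P : MvPolynomial σ k) : coeff m (weightTrunc w N P) = coeff m P := by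
  rw [weightTrunc, coeff_coeffwise, if_pos h, AddMonoidHom.id_apply]

theorem coeff_weightTrunc_of_not_lt {w : σ → ℤ} {N : ℤ} {m : σ →₀ ℕ}
    (h : ¬ Finsupp.weight w m < N) (P : MvPolynomial σ k) :
    coeff m (weightTrunc w N P) = 0 := by
  rw [weightTrunc, coeff_coeffwise, if_neg h, AddMonoidHom.zero_apply]

/-- Multiplication by a homogeneous polynomial of weight `q` shifts the truncation by `q`. -/
theorem weightTrunc_mul {w : σ → ℤ} {N q : ℤ} {r : MvPolynomial σ k}
    (hr : r ∈ weightedHomogeneousSubmodule k w q) (P : MvPolynomial σ k) :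
    weightTrunc w N (P * r) = weightTrunc w (N - q) P * r := by
  classical
  ext m
  have key : ∀ x ∈ Finset.HasAntidiagonal.antidiagonal m, coeff x.2 r = 0 ∨
      (Finsupp.weight w x.1 < N - q ↔ Finsupp.weight w m < N) := by
    intro x hx
    by_cases h : coeff x.2 r = 0
    · exact Or.inl h
    · right
      rw [← Finset.HasAntidiagonal.mem_antidiagonal.1 hx, map_add, hr h]
      omega
  rw [coeff_mul]
  by_cases h : Finsupp.weight w m < N
  · rw [coeff_weightTrunc_of_lt h, coeff_mul]
    refine Finset.sum_congr rfl fun x hx => ?_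
    rcases key x hx with h0 | h0
    · rw [h0, mul_zero, mul_zero]
    · rw [coeff_weightTrunc_of_lt (h0.2 h)]
  · rw [coeff_weightTrunc_of_not_lt h, eq_comm]
    refine Finset.sum_eq_zero fun x hx => ?_
    rcases key x hx with h0 | h0
    · rw [h0, mul_zero]
    · rw [coeff_weightTrunc_of_not_lt (fun h1 => h (h0.1 h1)), zero_mul]

theorem weightTrunc_of_nonpos {w : σ → ℤ} (hw : ∀ i, 0 ≤ w i) {N : ℤ} (hN : N ≤ 0)
    (P : MvPolynomial σ k) : weightTrunc w N P = 0 := by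
  ext m
  rw [coeff_weightTrunc_of_not_lt, coeff_zero]
  rw [not_lt]
  refine hN.trans ?_
  rw [Finsupp.weight_apply]
  exact Finset.sum_nonneg fun i _ => nsmul_nonneg (hw i) _

theorem exists_weightTrunc_eq (w : σ → ℤ) (P : MvPolynomial σ k) :
    ∃ N₀, ∀ N, N₀ ≤ N → weightTrunc w N P = P := by
  obtain ⟨M, hM⟩ := P.support.finite_toSet.image (Finsupp.weight w) |>.bddAbove
  refine ⟨M + 1, fun N hN => ?_⟩
  ext m
  by_cases h : coeff m P = 0
  · by_cases h' : Finsupp.weight w m < N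
    · rw [coeff_weightTrunc_of_lt h']
    · rw [coeff_weightTrunc_of_not_lt h', h]
  · refine coeff_weightTrunc_of_lt ?_ P
    have := hM ⟨m, mem_support_iff.2 h, rfl⟩
    omega

theorem weightTrunc_weightTrunc (w : σ → ℤ) (N : ℤ) (P : MvPolynomial σ k) :
    weightTrunc w N (weightTrunc w N P) = weightTrunc w N P := by
  ext m
  by_cases h' : Finsupp.weight w m < N
  · rw [coeff_weightTrunc_of_lt h']
  · rw [coeff_weightTrunc_of_not_lt h', coeff_weightTrunc_of_not_lt h']

end Trunc

end MvPolynomial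

open MvPolynomial in
/-- For homogeneous polynomials of positive weight, triviality of the syzygies passes to the initial
segments of a sequence. The induction on the weight replaces Nakayama's lemma. -/
theorem TrivialSyzygies.init {σ k : Type*} [Field k] [CharZero k] {w : σ → ℤ} (hw : ∀ i, 0 ≤ w i)
    {m : ℕ} {r : Fin (m + 1) → MvPolynomial σ k} {q : Fin (m + 1) → ℤ} (hq : ∀ i, 1 ≤ q i)
    (hr : ∀ i, r i ∈ weightedHomogeneousSubmodule k w (q i)) (h : TrivialSyzygies r) :
    TrivialSyzygies fun i : Fin m => r i.castSucc := by
  have key : ∀ (n : ℕ) (N : ℤ), N ≤ n → ∀ a : Fin m → MvPolynomial σ k,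
      (∀ i, weightTrunc w (N - q i.castSucc) (a i) = a i) → ∑ i, a i * r i.castSucc = 0 →
      ∃ S : Fin m → Fin m → MvPolynomial σ k, (∀ i j, S i j = -S j i) ∧
        ∀ i, a i = ∑ j, S i j * r j.castSucc := by
    intro n
    induction n with
    | zero =>
      intro N hN a ha _
      refine ⟨0, fun i j => by simp, fun i => ?_⟩
      rw [← ha i, weightTrunc_of_nonpos hw (by have := hq i.castSucc; push_cast at hN; omega)]
      simp
    | succ n ih =>
      intro N hN a ha hsum
      obtain ⟨S, hS, hS'⟩ := h (Fin.snoc a 0) (by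
        rw [Fin.sum_univ_castSucc]; simpa using hsum)
      -- truncating `S` makes the second syzygy one of smaller weight
      let T : Fin (m + 1) → Fin (m + 1) → MvPolynomial σ k :=
        fun i j => weightTrunc w (N - q i - q j) (S i j)
      have hT : ∀ i j, T i j = -T j i := fun i j => by
        simp only [T]
        rw [hS i j, map_neg, sub_right_comm]
      have hT' : ∀ i, (Fin.snoc a 0 : Fin (m + 1) → MvPolynomial σ k) i = ∑ j, T i j * r j := by
        intro i
        have e : weightTrunc w (N - q i) ((Fin.snoc a 0 : Fin (m + 1) → MvPolynomial σ k) i) =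
            (Fin.snoc a 0 : Fin (m + 1) → MvPolynomial σ k) i := by
          induction i using Fin.lastCases with
          | last => simp
          | cast i => simpa using ha i
        rw [← e, hS' i, map_sum]
        exact Finset.sum_congr rfl fun j _ => weightTrunc_mul (hr j) _
      have hll : T (Fin.last m) (Fin.last m) = 0 := self_eq_neg.1 (hT _ _)
      obtain ⟨U, hU, hU'⟩ := ih (N - q (Fin.last m))
        (by have := hq (Fin.last m); push_cast at hN; omega)
        (fun j => T (Fin.last m) j.castSucc)
        (fun j => weightTrunc_weightTrunc w (N - q (Fin.last m) - q j.castSucc) _) (by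
          have := hT' (Fin.last m)
          rw [Fin.sum_univ_castSucc, hll, zero_mul, add_zero, Fin.snoc_last] at this
          exact this.symm)
      refine ⟨fun i j => T i.castSucc j.castSucc - U i j * r (Fin.last m), fun i j => ?_,
        fun i => ?_⟩
      · simp only
        rw [hT, hU i j]; ring
      · have := hT' i.castSucc
        rw [Fin.sum_univ_castSucc, Fin.snoc_castSucc, hT i.castSucc (Fin.last m), hU' i] at this
        rw [this, neg_mul, Finset.sum_mul, ← Finset.sum_neg_distrib, ← Finset.sum_add_distrib]
        exact Finset.sum_congr rfl fun j _ => by ring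
  intro a ha
  choose N₀ hN₀ using fun i => exists_weightTrunc_eq w (a i)
  obtain ⟨N, hN⟩ := Finite.exists_le fun i => N₀ i + q i.castSucc
  exact key N.toNat N (Int.self_le_toNat N) a (fun i => hN₀ i _ (by have := hN i; omega)) ha

open MvPolynomial in
/-- A sequence of homogeneous polynomials of positive weight with trivial syzygies is regular. -/
theorem TrivialSyzygies.regularModulo {σ k : Type*} [Field k] [CharZero k] {w : σ → ℤ}
    (hw : ∀ i, 0 ≤ w i) {m : ℕ} {r : Fin m → MvPolynomial σ k} {q : Fin m → ℤ}
    (hq : ∀ i, 1 ≤ q i) (hr : ∀ i, r i ∈ weightedHomogeneousSubmodule k w (q i))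
    (h : TrivialSyzygies r) : RegularModulo ⊥ (List.ofFn r) := by
  induction m with
  | zero => simp [RegularModulo]
  | succ m ih =>
    rw [List.ofFn_succ_last, regularModulo_concat, bot_sup_eq]
    refine ⟨ih (fun i => hq i.castSucc) (fun i => hr i.castSucc) (h.init hw hq hr),
      fun p hp => ?_⟩
    obtain ⟨a, ha⟩ := mem_ofList_ofFn.1 hp
    obtain ⟨S, hS, hS'⟩ := h (Fin.snoc (fun i => -a i) p) (by
      rw [Fin.sum_univ_castSucc]
      simp [ha, mul_comm])
    have hll : S (Fin.last m) (Fin.last m) = 0 := self_eq_neg.1 (hS _ _)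
    have := hS' (Fin.last m)
    rw [Fin.sum_univ_castSucc, hll, zero_mul, add_zero, Fin.snoc_last] at this
    exact mem_ofList_ofFn.2 ⟨_, this.symm⟩

/-! ### Polynomials over a field extension -/

section Span

/-- An injective degree-preserving map reflects degrees. -/
theorem mem_of_map_mem {k k' ι A B : Type*} [Field k] [Field k'] [DecidableEq ι] [AddMonoid ι]
    [Ring A] [Algebra k A] [Ring B] [Algebra k' B] (𝒜 : ι → Submodule k A) [GradedAlgebra 𝒜]
    (ℬ : ι → Submodule k' B) [GradedAlgebra ℬ] (f : A →+ B) (hf : Function.Injective f)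
    (h : ∀ i, ∀ x ∈ 𝒜 i, f x ∈ ℬ i) {i : ι} {x : A} (hx : f x ∈ ℬ i) : x ∈ 𝒜 i := by
  have h1 : GradedAlgebra.proj ℬ i (f x) = f (GradedAlgebra.proj 𝒜 i x) :=
    proj_map 𝒜 f id Function.injective_id (fun j => (GradedAlgebra.proj ℬ j).toAddMonoidHom)
      (fun i x hx => proj_same _ (h i x hx)) (fun i j hij x hx => proj_ne _ (h j x hx) hij) i x
  have h2 : f (GradedAlgebra.proj 𝒜 i x) = f x := h1.symm.trans (proj_same _ hx)
  rw [← hf h2]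
  exact proj_mem _ i x

variable {k M N ι : Type*} [Field k] [AddCommGroup M] [Module k M] [AddCommGroup N] [Module k N]

/-- A multilinear form that does not vanish somewhere does not vanish at some point of prescribed
spanning sets. -/
theorem MultilinearMap.exists_ne_zero_of_mem_span [Fintype ι] [DecidableEq ι]
    (f : MultilinearMap k (fun _ : ι => M) k) {S : ι → Set M} {v : ι → M}
    (hv : ∀ i, v i ∈ Submodule.span k (S i)) (hf : f v ≠ 0) :
    ∃ s : ι → M, (∀ i, s i ∈ S i) ∧ f s ≠ 0 := by
  have key : ∀ t : Finset ι, ∃ s : ι → M, (∀ i ∈ t, s i ∈ S i) ∧ (∀ i ∉ t, s i = v i) ∧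
      f s ≠ 0 := by
    intro t
    induction t using Finset.induction_on with
    | empty => exact ⟨v, by simp, fun _ _ => rfl, hf⟩
    | insert j t hj ih =>
      obtain ⟨s, hs, hs', hs0⟩ := ih
      by_contra hcon
      push Not at hcon
      have h0 : ∀ x ∈ S j, f.toLinearMap s j x = 0 := by
        intro x hx
        refine hcon (Function.update s j x) (fun i hi => ?_) (fun i hi => ?_)
        · by_cases hij : i = j
          · subst hij; simpa using hx
          · rw [Function.update_of_ne hij]
            exact hs i ((Finset.mem_insert.1 hi).resolve_left hij)
        · have hij : i ≠ j := fun e => hi (e ▸ Finset.mem_insert_self _ _)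
          rw [Function.update_of_ne hij]
          exact hs' i fun h => hi (Finset.mem_insert_of_mem h)
      have h1 : Submodule.span k (S j) ≤ LinearMap.ker (f.toLinearMap s j) :=
        Submodule.span_le.2 h0
      have h2 : f.toLinearMap s j (s j) = 0 := by
        rw [hs' j hj]; exact h1 (hv j)
      rw [MultilinearMap.toLinearMap_apply, Function.update_eq_self] at h2
      exact hs0 h2
  obtain ⟨s, hs, -, hs0⟩ := key Finset.univ
  exact ⟨s, fun i => hs i (Finset.mem_univ i), hs0⟩

/-- If every element of `T` lifts to `V` and `v ∈ V` maps to the span of `T`, then `v` is in the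
span of the elements of `V` over `T`. -/
theorem Submodule.mem_span_of_map_mem_span (V : Submodule k M) (L : M →ₗ[k] N) {T : Set N}
    (h0 : (0 : N) ∈ T) (hT : ∀ t ∈ T, ∃ u ∈ V, L u = t) {v : M} (hv : v ∈ V)
    (hLv : L v ∈ Submodule.span k T) : v ∈ Submodule.span k {u | u ∈ V ∧ L u ∈ T} := by
  have e : T = L '' {u | u ∈ V ∧ L u ∈ T} := by
    ext t
    refine ⟨fun ht => ?_, ?_⟩
    · obtain ⟨u, hu, rfl⟩ := hT t ht
      exact ⟨u, ⟨hu, ht⟩, rfl⟩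
    · rintro ⟨u, hu, rfl⟩
      exact hu.2
  rw [e, ← Submodule.map_span] at hLv
  obtain ⟨u, hu, huv⟩ := hLv
  have huV : u ∈ V := (Submodule.span_le (p := V)).2 (fun x hx => hx.1) hu
  have : v - u ∈ Submodule.span k {u | u ∈ V ∧ L u ∈ T} :=
    Submodule.subset_span ⟨V.sub_mem hv huV, by rw [map_sub, huv, sub_self]; exact h0⟩
  rw [← sub_add_cancel v u]
  exact Submodule.add_mem _ this hu

end Span

namespace MvPolynomial

section Functional

variable {σ k K : Type*} [Field k] [Field K] [Algebra k K]

/-- The polynomial obtained by applying a `k`-linear functional to all coefficients. -/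
def mapFunctional (l : K →ₗ[k] k) : MvPolynomial σ K →+ MvPolynomial σ k :=
  coeffwise fun _ => l.toAddMonoidHom

@[simp] theorem coeff_mapFunctional (l : K →ₗ[k] k) (f : MvPolynomial σ K) (m : σ →₀ ℕ) :
    coeff m (mapFunctional l f) = l (coeff m f) :=
  coeff_coeffwise _ _ _

theorem mapFunctional_monomial (l : K →ₗ[k] k) (m : σ →₀ ℕ) (c : K) :
    mapFunctional l (monomial m c) = monomial m (l c) :=
  coeffwise_monomial _ _ _

theorem mapFunctional_mul_map (l : K →ₗ[k] k) (f : MvPolynomial σ K) (g : MvPolynomial σ k) :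
    mapFunctional l (f * map (algebraMap k K) g) = mapFunctional l f * g := by
  classical
  ext m
  rw [coeff_mapFunctional, coeff_mul, coeff_mul, map_sum]
  refine Finset.sum_congr rfl fun x _ => ?_
  rw [coeff_map, coeff_mapFunctional, mul_comm, ← Algebra.smul_def, map_smul, smul_eq_mul, mul_comm]

theorem mapFunctional_map {l : K →ₗ[k] k} (hl : l 1 = 1) (g : MvPolynomial σ k) :
    mapFunctional l (map (algebraMap k K) g) = g := by
  ext m
  rw [coeff_mapFunctional, coeff_map, Algebra.algebraMap_eq_smul_one, map_smul, hl, smul_eq_mul,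
    mul_one]

theorem mapFunctional_mem {ι : Type*} [AddCommMonoid ι] {w : σ → ι} {n : ι} (l : K →ₗ[k] k)
    {f : MvPolynomial σ K} (hf : f ∈ weightedHomogeneousSubmodule K w n) :
    mapFunctional l f ∈ weightedHomogeneousSubmodule k w n := by
  intro m hm
  refine hf fun h => hm ?_
  rw [coeff_mapFunctional, h, map_zero]

theorem map_mem_weightedHomogeneousSubmodule {ι : Type*} [AddCommMonoid ι] {w : σ → ι} {n : ι}
    {f : MvPolynomial σ k} (hf : f ∈ weightedHomogeneousSubmodule k w n) :
    map (algebraMap k K) f ∈ weightedHomogeneousSubmodule K w n := by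
  intro m hm
  refine hf fun h => hm ?_
  rw [coeff_map, h, map_zero]

variable (k) in
/-- A polynomial is a linear combination of the polynomials obtained from it by applying
functionals to its coefficients. -/
theorem mem_span_map_mapFunctional (f : MvPolynomial σ K) :
    f ∈ Submodule.span K (Set.range fun l : K →ₗ[k] k =>
      map (algebraMap k K) (mapFunctional l f)) := by
  classical
  let b := Module.Basis.ofVectorSpace k K
  let s := f.support.biUnion fun m => (b.repr (coeff m f)).support
  have h : f = ∑ i ∈ s, b i • map (algebraMap k K) (mapFunctional (b.coord i) f) := by
    ext m
    rw [coeff_sum]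
    simp only [coeff_smul, coeff_map, coeff_mapFunctional, Module.Basis.coord_apply, smul_eq_mul]
    by_cases hm : coeff m f = 0
    · simp [hm]
    · conv_lhs => rw [← b.linearCombination_repr (coeff m f), Finsupp.linearCombination_apply]
      rw [Finsupp.sum_of_support_subset (s := s) _ (fun i hi =>
        Finset.mem_biUnion.2 ⟨m, mem_support_iff.2 hm, hi⟩) _ (by simp)]
      exact Finset.sum_congr rfl fun i _ => by rw [Algebra.smul_def, mul_comm]
  rw [h]
  exact Submodule.sum_mem _ fun i _ => Submodule.smul_mem _ _
    (h ▸ Submodule.subset_span ⟨b.coord i, rfl⟩)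

end Functional

section Substitution

variable {σ k : Type*} [Field k] {w : σ → ℤ}

theorem aeval_mem_weightedHomogeneousSubmodule {P : σ → MvPolynomial σ k}
    (hP : ∀ i, P i ∈ weightedHomogeneousSubmodule k w (w i)) {n : ℤ} {f : MvPolynomial σ k}
    (hf : f ∈ weightedHomogeneousSubmodule k w n) :
    aeval P f ∈ weightedHomogeneousSubmodule k w n := by
  let := weightedGradedAlgebra k w
  have h := evalCentral_mem (RingHom.id k) P (fun i x => mul_comm _ _)
    (𝒩 := weightedHomogeneousSubmodule k w) hP hf
  have e : evalCentral (RingHom.id k) P (fun i x => mul_comm _ _) =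
      (aeval P : MvPolynomial σ k →ₐ[k] MvPolynomial σ k).toRingHom :=
    ringHom_ext (fun c => by simp) (fun i => by simp)
  rw [e] at h
  exact h

/-- A surjective endomorphism of a noetherian ring is injective. -/
theorem injective_of_surjective_ringEnd {R : Type*} [CommRing R] [IsNoetherianRing R]
    (φ : R →+* R) (hφ : Function.Surjective φ) : Function.Injective φ := by
  have hs : ∀ n, Function.Surjective (φ ^ n : R →+* R) := by
    intro n
    rw [RingHom.coe_pow]
    exact hφ.iterate n
  obtain ⟨n, hn⟩ := monotone_stabilizes_iff_noetherian.2 (inferInstanceAs (IsNoetherian R R))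
    ⟨fun n => RingHom.ker (φ ^ n : R →+* R), monotone_nat_of_le_succ fun n x hx => by
      rw [RingHom.mem_ker] at hx ⊢
      rw [pow_succ', RingHom.mul_def, RingHom.comp_apply, hx, map_zero]⟩
  rw [injective_iff_map_eq_zero]
  intro x hx
  obtain ⟨y, rfl⟩ := hs n x
  have h1 : y ∈ RingHom.ker (φ ^ (n + 1) : R →+* R) := by
    rw [RingHom.mem_ker, pow_succ', RingHom.mul_def, RingHom.comp_apply, hx]
  have h2 : RingHom.ker (φ ^ n : R →+* R) = RingHom.ker (φ ^ (n + 1) : R →+* R) :=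
    hn (n + 1) (Nat.le_succ n)
  rw [← h2] at h1
  exact h1

theorem le_weight_of_mem_support (hw : ∀ i, 1 ≤ w i) {m : σ →₀ ℕ} {i : σ} (hi : m i ≠ 0) :
    w i ≤ Finsupp.weight w m := by
  rw [Finsupp.weight_apply, Finsupp.sum]
  refine le_trans ?_ (Finset.single_le_sum (f := fun i => m i • w i)
    (fun j _ => nsmul_nonneg (by have := hw j; omega) _) (Finsupp.mem_support_iff.2 hi))
  rw [nsmul_eq_mul]
  have : (1 : ℤ) ≤ m i := by exact_mod_cast Nat.one_le_iff_ne_zero.2 hi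
  have := hw i
  nlinarith

variable [Fintype σ] [DecidableEq σ]

/-- A homogeneous substitution of positively weighted variables whose linear part is invertible is
surjective. By induction on the weight, each variable lies in the image: the linear part of `P`
preserves weights, and the other terms of `P i` involve only variables of smaller weight. -/
theorem aeval_surjective_of_det_ne_zero (hw : ∀ i, 1 ≤ w i) {P : σ → MvPolynomial σ k}
    (hP : ∀ i, P i ∈ weightedHomogeneousSubmodule k w (w i))
    (hdet : (Matrix.of fun i l => coeff (Finsupp.single l 1) (P i)).det ≠ 0) :
    Function.Surjective (aeval P : MvPolynomial σ k →ₐ[k] MvPolynomial σ k) := by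
  set J := Matrix.of fun i l => coeff (Finsupp.single l 1) (P i) with hJ
  have hJw : ∀ i l, J i l ≠ 0 → w l = w i := fun i l h => by
    have := hP i h
    rwa [Finsupp.weight_single, one_smul] at this
  have key : ∀ (n : ℕ) (j : σ), w j ≤ n → X j ∈ (aeval P : _ →ₐ[k] MvPolynomial σ k).range := by
    intro n
    induction n with
    | zero => intro j hj; have := hw j; push_cast at hj; omega
    | succ n ih =>
      intro j hj
      set A := (aeval P : _ →ₐ[k] MvPolynomial σ k).range
      let y : σ → MvPolynomial σ k := fun l => if w l = w j then X l else 0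
      have h1 : ∀ i, ∑ l, C (J i l) * y l ∈ A := by
        intro i
        by_cases hi : w i = w j
        · have e : ∑ l, C (J i l) * y l = P i - (P i - ∑ l, C (J i l) * X l) := by
            rw [sub_sub_cancel]
            refine Finset.sum_congr rfl fun l _ => ?_
            by_cases h0 : J i l = 0
            · simp [h0]
            · simp only [y, if_pos ((hJw i l h0).trans hi)]
          rw [e]
          refine Subalgebra.sub_mem _ ⟨X i, by simp⟩ ?_
          -- the remainder involves only variables of smaller weight
          rw [(P i - ∑ l, C (J i l) * X l).as_sum]
          refine Subalgebra.sum_mem _ fun m hm => ?_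
          have hm0 := mem_support_iff.1 hm
          have hlin : ∀ l, m ≠ Finsupp.single l 1 := by
            rintro l rfl
            refine hm0 ?_
            rw [coeff_sub, coeff_sum, Finset.sum_eq_single l]
            · simp [hJ, coeff_C_mul]
            · intro l' _ hl'
              rw [coeff_C_mul, coeff_X, if_neg, mul_zero]
              exact fun e => hl' (Finsupp.single_left_injective one_ne_zero e)
            · simp
          have hwm : Finsupp.weight w m = w i := by
            refine hP i fun h0 => hm0 ?_
            rw [coeff_sub, coeff_sum, h0, zero_sub, neg_eq_zero]
            refine Finset.sum_eq_zero fun l _ => ?_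
            rw [coeff_C_mul, coeff_X, if_neg (fun e => hlin l e.symm), mul_zero]
          rw [monomial_eq]
          refine Subalgebra.mul_mem _ (Subalgebra.algebraMap_mem _ _) ?_
          refine Subalgebra.prod_mem _ fun l hl => Subalgebra.pow_mem _ (ih l ?_) _
          have hl0 := Finsupp.mem_support_iff.1 hl
          obtain ⟨m', rfl⟩ : ∃ m', m = Finsupp.single l 1 + m' :=
            ⟨m - Finsupp.single l 1, (add_tsub_cancel_of_le
              (Finsupp.single_le_iff.2 (Nat.one_le_iff_ne_zero.2 hl0))).symm⟩
          have hm' : m' ≠ 0 := by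
            rintro rfl
            exact hlin l (by simp)
          obtain ⟨l', hl'⟩ := Finsupp.ne_iff.1 hm'
          have h2 := le_weight_of_mem_support hw hl'
          rw [map_add, Finsupp.weight_single, one_smul] at hwm
          have := hw l'
          push_cast at hj
          omega
        · rw [Finset.sum_eq_zero fun l _ => ?_]
          · exact Subalgebra.zero_mem _
          · by_cases h0 : J i l = 0
            · simp [h0]
            · simp only [y]
              rw [if_neg (fun e => hi ((hJw i l h0).symm.trans e)), mul_zero]
      have h2 : X j = ∑ i, C (J⁻¹ j i) * ∑ l, C (J i l) * y l := by
        have hJJ : J⁻¹ * J = 1 := Matrix.nonsing_inv_mul _ (isUnit_iff_ne_zero.2 hdet)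
        simp_rw [Finset.mul_sum]
        rw [Finset.sum_comm]
        have : ∀ l, ∑ i, C (J⁻¹ j i) * (C (J i l) * y l) =
            (C ((1 : Matrix σ σ k) j l) : MvPolynomial σ k) * y l := by
          intro l
          rw [← hJJ, Matrix.mul_apply, map_sum, Finset.sum_mul]
          exact Finset.sum_congr rfl fun i _ => by rw [← mul_assoc, map_mul]
        simp_rw [this]
        rw [Finset.sum_eq_single j]
        · simp [y]
        · intro l _ hl
          rw [Matrix.one_apply_ne (Ne.symm hl), map_zero, zero_mul]
        · simp
      rw [h2]
      exact Subalgebra.sum_mem _ fun i _ => Subalgebra.mul_mem _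
        (Subalgebra.algebraMap_mem _ _) (h1 i)
  have htop : (⊤ : Subalgebra k (MvPolynomial σ k)) ≤
      (aeval P : _ →ₐ[k] MvPolynomial σ k).range := by
    rw [← adjoin_range_X, Algebra.adjoin_le_iff]
    rintro _ ⟨j, rfl⟩
    exact key (w j).toNat j (Int.self_le_toNat _)
  exact fun x => htop trivial

end Substitution

end MvPolynomial

/-! ### Descent of presentations of complete intersections -/

section Descent

open MvPolynomial

theorem MvPolynomial.eq_C_of_weight_zero {σ K : Type*} [Field K] {w : σ → ℤ}
    (hw : ∀ i, 1 ≤ w i) {f : MvPolynomial σ K}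
    (hf : f ∈ weightedHomogeneousSubmodule K w 0) : f = C (constantCoeff f) := by
  classical
  ext m
  rw [coeff_C]
  split_ifs with h
  · rw [← h]; rfl
  · by_contra h0
    obtain ⟨i, hi⟩ := Finsupp.ne_iff.1 (Ne.symm h)
    have := le_weight_of_mem_support hw hi
    have := hf h0
    have := hw i
    omega

variable {σ k K HQ HC : Type*} [Fintype σ] [DecidableEq σ] [Field k] [Field K] [CharZero k]
  [CharZero K] [Algebra k K] [Ring HQ] [Algebra k HQ] [Ring HC] [Algebra K HC] {w : σ → ℤ}

/-- New generators of a polynomial ring, mapping to prescribed homogeneous spanning sets. The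
determinant of the linear part, as a function of the new generators, is a multilinear form that does
not vanish at the given generators. Hence it does not vanish at suitable elements over the spanning
sets. -/
theorem exists_substitution (hw : ∀ i, 1 ≤ w i) (π : MvPolynomial σ K →ₐ[K] HC)
    (T : ℤ → Set HC) (h0 : ∀ d, 0 ∈ T d)
    (hspan : ∀ d, ∀ f ∈ weightedHomogeneousSubmodule K w d, π f ∈ Submodule.span K (T d))
    (hT : ∀ d, ∀ t ∈ T d, ∃ f ∈ weightedHomogeneousSubmodule K w d, π f = t) :
    ∃ φ : MvPolynomial σ K ≃ₐ[K] MvPolynomial σ K,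
      (∀ i, π (φ (X i)) ∈ T (w i)) ∧
      (∀ d, ∀ f ∈ weightedHomogeneousSubmodule K w d,
        φ f ∈ weightedHomogeneousSubmodule K w d) ∧
      (∀ d, ∀ f ∈ weightedHomogeneousSubmodule K w d,
        φ.symm f ∈ weightedHomogeneousSubmodule K w d) := by
  let ℓ : MvPolynomial σ K →ₗ[K] (σ → K) := LinearMap.pi fun l => lcoeff K (Finsupp.single l 1)
  let F : MultilinearMap K (fun _ : σ => MvPolynomial σ K) K :=
    (Matrix.detRowAlternating (R := K) (n := σ)).toMultilinearMap.compLinearMap fun _ => ℓ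
  have hF : ∀ P, F P = (Matrix.of fun i l => coeff (Finsupp.single l 1) (P i)).det :=
    fun P => rfl
  obtain ⟨P, hP, hP0⟩ := F.exists_ne_zero_of_mem_span
    (S := fun i => {f | f ∈ weightedHomogeneousSubmodule K w (w i) ∧ π.toLinearMap f ∈ T (w i)})
    (v := X) (fun i => Submodule.mem_span_of_map_mem_span _ _ (h0 _) (hT _)
      (isWeightedHomogeneous_X K w i) (hspan _ _ (isWeightedHomogeneous_X K w i)))
    (by
      have : (Matrix.of fun i l => coeff (Finsupp.single l 1) (X i : MvPolynomial σ K)) =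
          (1 : Matrix σ σ K) := by
        ext i l
        rw [Matrix.of_apply, coeff_X, Matrix.one_apply]
        simp [Finsupp.single_left_inj]
      rw [hF, this, Matrix.det_one]
      exact one_ne_zero)
  have hs := aeval_surjective_of_det_ne_zero hw (fun i => (hP i).1) hP0
  have hi := injective_of_surjective_ringEnd
    ((aeval P : _ →ₐ[K] MvPolynomial σ K) : MvPolynomial σ K →+* MvPolynomial σ K) hs
  have hφ : ∀ d, ∀ f ∈ weightedHomogeneousSubmodule K w d,
      aeval P f ∈ weightedHomogeneousSubmodule K w d := fun d f hf =>
    aeval_mem_weightedHomogeneousSubmodule (fun i => (hP i).1) hf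
  let φ := AlgEquiv.ofBijective (aeval P : _ →ₐ[K] MvPolynomial σ K) ⟨hi, hs⟩
  refine ⟨φ, fun i => ?_, hφ, fun d f hf => ?_⟩
  · have : φ (X i) = P i := aeval_X _ _
    rw [this]
    exact (hP i).2
  · let := weightedGradedAlgebra K w
    refine mem_of_map_mem (weightedHomogeneousSubmodule K w) (weightedHomogeneousSubmodule K w)
      ((aeval P : _ →ₐ[K] MvPolynomial σ K) : MvPolynomial σ K →+ MvPolynomial σ K) hi hφ
      (i := d) (x := φ.symm f) ?_
    have : aeval P (φ.symm f) = f := φ.apply_symm_apply f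
    exact this.symm ▸ hf

/-- If an ideal generated by homogeneous polynomials is defined over `k`, then homogeneous
generators over `k` are obtained from the given ones by an invertible linear substitution. As in
`exists_substitution`, the multilinear form used to find the substitution is a determinant, here the
constant term of that of the coefficient matrix `A`. The matrix is homogeneous, so that its
determinant is constant. -/
theorem exists_rational_generators (hw : ∀ i, 1 ≤ w i) {m : ℕ} {r : Fin m → MvPolynomial σ K}
    {q : Fin m → ℤ} (hr : ∀ i, r i ∈ weightedHomogeneousSubmodule K w (q i))
    (hK : ∀ f ∈ Ideal.ofList (List.ofFn r), ∀ l : K →ₗ[k] k,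
      map (algebraMap k K) (mapFunctional l f) ∈ Ideal.ofList (List.ofFn r)) :
    ∃ (r' : Fin m → MvPolynomial σ k) (A B : Matrix (Fin m) (Fin m) (MvPolynomial σ K)),
      A * B = 1 ∧ (∀ i, r' i ∈ weightedHomogeneousSubmodule k w (q i)) ∧
      (fun i => map (algebraMap k K) (r' i)) = A.mulVec r := by
  let I := Ideal.ofList (List.ofFn r)
  -- the candidates for the rows of `A`, and the elements of the ideal that they define
  let V : Fin m → Submodule K (Fin m → MvPolynomial σ K) := fun j =>
    Submodule.pi Set.univ fun l => weightedHomogeneousSubmodule K w (q j - q l)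
  let L : (Fin m → MvPolynomial σ K) →ₗ[K] MvPolynomial σ K :=
    { toFun := fun a => ∑ l, a l * r l
      map_add' := fun a b => by simp [add_mul, Finset.sum_add_distrib]
      map_smul' := fun c a => by simp [Finset.smul_sum] }
  have hL : ∀ a, L a = ∑ l, a l * r l := fun _ => rfl
  let T : Fin m → Set (MvPolynomial σ K) := fun j =>
    {t | t ∈ I ∧ ∃ g ∈ weightedHomogeneousSubmodule k w (q j), map (algebraMap k K) g = t}
  let F : MultilinearMap K (fun _ : Fin m => Fin m → MvPolynomial σ K) K :=
    (Matrix.detRowAlternating (R := K) (n := Fin m)).toMultilinearMap.compLinearMap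
      fun _ => LinearMap.pi fun l => (lcoeff K 0).comp (LinearMap.proj l)
  have hF : ∀ A : Fin m → Fin m → MvPolynomial σ K,
      F A = constantCoeff (Matrix.of A).det := by
    intro A
    rw [RingHom.map_det]
    rfl
  have hT : ∀ j, ∀ t ∈ T j, ∃ u ∈ V j, L u = t := by
    rintro j _ ⟨ht, g, hg, rfl⟩
    obtain ⟨a, ha⟩ := mem_ofList_ofFn.1 ht
    let := weightedGradedAlgebra K w
    refine ⟨fun l => GradedAlgebra.proj (weightedHomogeneousSubmodule K w) (q j - q l) (a l),
      fun l _ => proj_mem _ _ _, ?_⟩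
    have hg' : map (algebraMap k K) g ∈ weightedHomogeneousSubmodule K w (q j) :=
      map_mem_weightedHomogeneousSubmodule hg
    rw [← proj_same (weightedHomogeneousSubmodule K w) hg', ← ha, map_sum, hL]
    refine Finset.sum_congr rfl fun l _ => ?_
    have h1 := proj_map (weightedHomogeneousSubmodule K w)
      (AddMonoidHom.mulRight (r l)) (· + q l) (add_left_injective _)
      (fun j => (GradedAlgebra.proj (weightedHomogeneousSubmodule K w) j).toAddMonoidHom)
      (fun i x hx => proj_same _ (SetLike.mul_mem_graded hx (hr l)))
      (fun i i' h x hx => proj_ne _ (SetLike.mul_mem_graded hx (hr l)) h) (q j - q l) (a l)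
    have h2 : GradedAlgebra.proj (weightedHomogeneousSubmodule K w) (q j - q l + q l)
        (a l * r l) = GradedAlgebra.proj (weightedHomogeneousSubmodule K w) (q j - q l) (a l) *
          r l := h1
    rw [sub_add_cancel] at h2
    exact h2.symm
  have hLV : ∀ j, ∀ v ∈ V j, L v ∈ Submodule.span K (T j) := by
    intro j v hv
    have h1 : L v ∈ weightedHomogeneousSubmodule K w (q j) := by
      rw [hL]
      refine Submodule.sum_mem _ fun l _ => ?_
      have := IsWeightedHomogeneous.mul
        (show IsWeightedHomogeneous w (v l) (q j - q l) from hv l trivial) (hr l)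
      rwa [sub_add_cancel] at this
    have h2 : L v ∈ I := mem_ofList_ofFn.2 ⟨v, rfl⟩
    refine Submodule.span_mono ?_ (mem_span_map_mapFunctional k (L v))
    rintro _ ⟨l, rfl⟩
    exact ⟨hK _ h2 l, _, mapFunctional_mem l h1, rfl⟩
  obtain ⟨A, hA, hA0⟩ := F.exists_ne_zero_of_mem_span
    (S := fun j => {u | u ∈ V j ∧ L u ∈ T j}) (v := (1 : Matrix (Fin m) (Fin m) _))
    (fun j => by
      have hj : (1 : Matrix (Fin m) (Fin m) (MvPolynomial σ K)) j ∈ V j := by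
        intro l _
        change (1 : Matrix (Fin m) (Fin m) (MvPolynomial σ K)) j l ∈
          weightedHomogeneousSubmodule K w (q j - q l)
        by_cases h : j = l
        · subst h
          rw [Matrix.one_apply_eq, sub_self]
          exact isWeightedHomogeneous_one K w
        · rw [Matrix.one_apply_ne h]
          exact Submodule.zero_mem _
      have h0 : 0 ∈ T j := ⟨I.zero_mem, 0, Submodule.zero_mem _, map_zero _⟩
      exact Submodule.mem_span_of_map_mem_span (V j) L h0 (hT j) hj (hLV j _ hj))
    (by
      have h1 : constantCoeff (Matrix.det (1 : Matrix (Fin m) (Fin m) (MvPolynomial σ K))) = 1 := by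
        rw [Matrix.det_one, map_one]
      exact ((hF _).trans h1).trans_ne one_ne_zero)
  rw [hF] at hA0
  have hdet : (Matrix.of A).det ∈ weightedHomogeneousSubmodule K w 0 := by
    rw [Matrix.det_apply]
    refine Submodule.sum_mem _ fun τ _ => ?_
    rw [Units.smul_def]
    refine zsmul_mem ?_ _
    have := IsWeightedHomogeneous.prod Finset.univ (fun i => Matrix.of A (τ i) i)
      (fun i => q (τ i) - q i) (w := w) (fun i _ => (hA (τ i)).1 i trivial)
    rwa [Finset.sum_sub_distrib, Equiv.sum_comp τ q, sub_self] at this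
  have hunit : IsUnit (Matrix.of A).det := by
    rw [eq_C_of_weight_zero hw hdet]
    exact (isUnit_iff_ne_zero.2 hA0).map C
  choose r' hr' hr'' using fun j => (hA j).2.2
  exact ⟨r', Matrix.of A, (Matrix.of A)⁻¹, Matrix.mul_nonsing_inv _ hunit, hr',
    funext fun j => hr'' j⟩

/-- If the complete intersection `HC = K[x]/(r)` is spanned by the image of a `k`-algebra `HQ`, in
such a way that functionals `K → k` extend to `HC → HQ`, then `HQ` is a complete intersection with
variables and relations of the same degrees. -/
theorem exists_rational_presentation (hw : ∀ i, 1 ≤ w i) (j : HQ →+* HC)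
    (hj : ∀ c : k, j (algebraMap k HQ c) = algebraMap K HC (algebraMap k K c))
    (W : ℤ → Submodule k HQ) (hcent : ∀ d, ∀ x ∈ W d, ∀ y, y * x = x * y)
    (hΛ : ∀ l : K →ₗ[k] k, ∃ Λ : HC →+ HQ, ∀ c x, Λ (c • j x) = l c • x)
    {m : ℕ} {r : Fin m → MvPolynomial σ K} {q : Fin m → ℤ} (hq : ∀ i, 1 ≤ q i)
    (hr : ∀ i, r i ∈ weightedHomogeneousSubmodule K w (q i)) (hsyz : TrivialSyzygies r)
    (π : MvPolynomial σ K →ₐ[K] HC) (hπ : Function.Surjective π)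
    (hker : ∀ f, π f = 0 ↔ f ∈ Ideal.ofList (List.ofFn r))
    (hspan : ∀ d, ∀ f ∈ weightedHomogeneousSubmodule K w d,
      π f ∈ Submodule.span K (j '' (W d : Set HQ)))
    (hW : ∀ d, ∀ x ∈ W d, ∃ f ∈ weightedHomogeneousSubmodule K w d, π f = j x) :
    ∃ (h : σ → HQ) (r' : Fin m → MvPolynomial σ k) (ev : MvPolynomial σ k →+* HQ)
      (π' : MvPolynomial σ K →ₐ[K] HC),
      (∀ i, h i ∈ W (w i)) ∧ (∀ i, ev (X i) = h i) ∧ (∀ i, π' (X i) = j (h i)) ∧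
      (∀ i, r' i ∈ weightedHomogeneousSubmodule k w (q i)) ∧
      RegularModulo ⊥ (List.ofFn r') ∧
      RegularModulo ⊥ (List.ofFn fun i => map (algebraMap k K) (r' i)) ∧
      Function.Surjective ev ∧ (∀ f, ev f = 0 ↔ f ∈ Ideal.ofList (List.ofFn r')) ∧
      Function.Surjective π' ∧
      (∀ f, π' f = 0 ↔ f ∈ Ideal.ofList (List.ofFn fun i => map (algebraMap k K) (r' i))) := by
  have hw0 : ∀ i, 0 ≤ w i := fun i => by have := hw i; omega
  obtain ⟨φ, hφT, hφ, hφ'⟩ := exists_substitution hw π (fun d => j '' (W d : Set HQ))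
    (fun d => ⟨0, Submodule.zero_mem _, map_zero j⟩) hspan (by
      rintro d _ ⟨x, hx, rfl⟩
      exact hW d x hx)
  choose h hh hjh using hφT
  let π' : MvPolynomial σ K →ₐ[K] HC := π.comp φ.toAlgHom
  have hπ'φ : ∀ f, π' f = π (φ f) := fun _ => rfl
  have hπ' : Function.Surjective π' := hπ.comp φ.surjective
  let r₁ : Fin m → MvPolynomial σ K := fun i => φ.symm (r i)
  have hker₁ : ∀ f, π' f = 0 ↔ f ∈ Ideal.ofList (List.ofFn r₁) := by
    intro f
    rw [hπ'φ, hker, mem_ofList_ofFn, mem_ofList_ofFn]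
    constructor
    · rintro ⟨a, ha⟩
      refine ⟨fun i => φ.symm (a i), ?_⟩
      rw [← φ.symm_apply_apply f, ← ha, map_sum]
      exact Finset.sum_congr rfl fun i _ => (map_mul φ.symm _ _).symm
    · rintro ⟨a, rfl⟩
      refine ⟨fun i => φ (a i), ?_⟩
      rw [map_sum]
      exact Finset.sum_congr rfl fun i _ => by rw [map_mul, φ.apply_symm_apply]
  let ev : MvPolynomial σ k →+* HQ :=
    evalCentral (RingHom.id k) h fun i x => hcent _ _ (hh i) x
  have hevC : ∀ c, ev (C c) = algebraMap k HQ c := fun c => evalCentral_C _ _ _ c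
  have hevX : ∀ i, ev (X i) = h i := fun i => evalCentral_X _ _ _ i
  have hπ'X : ∀ i, π' (X i) = j (h i) := fun i => (hjh i).symm
  have hev : ∀ g, π' (map (algebraMap k K) g) = j (ev g) := by
    have : (π' : MvPolynomial σ K →+* HC).comp (map (algebraMap k K)) = j.comp ev := by
      refine ringHom_ext (fun c => ?_) fun i => ?_
      · rw [RingHom.comp_apply, RingHom.comp_apply, map_C, hevC, hj]
        exact π'.commutes _
      · rw [RingHom.comp_apply, RingHom.comp_apply, map_X, hevX]
        exact hπ'X i
    exact fun g => congrArg (fun F => F g) this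
  have hΛπ : ∀ (l : K →ₗ[k] k) (Λ : HC →+ HQ), (∀ c x, Λ (c • j x) = l c • x) →
      ∀ f, Λ (π' f) = ev (mapFunctional l f) := by
    intro l Λ hΛ f
    induction f using MvPolynomial.induction_on' with
    | monomial n c =>
      have e1 : monomial n c = c • map (algebraMap k K) (monomial n (1 : k)) := by
        rw [map_monomial, map_one, smul_monomial, smul_eq_mul, mul_one]
      rw [mapFunctional_monomial, e1, map_smul, hev, hΛ, ← mul_one (l c), ← C_mul_monomial,
        map_mul, hevC, mul_one, Algebra.smul_def]
    | add f g hf hg => rw [map_add, map_add, map_add, map_add, hf, hg]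
  obtain ⟨r', A, B, hAB, hr', hr'A⟩ := exists_rational_generators (k := k) hw
    (fun i => hφ' _ _ (hr i)) (r := r₁) (by
      intro f hf l
      obtain ⟨Λ, hΛ⟩ := hΛ l
      rw [← hker₁] at hf ⊢
      rw [hev, ← hΛπ l Λ hΛ, hf, map_zero, map_zero])
  have hsyz' : TrivialSyzygies fun i => map (algebraMap k K) (r' i) := by
    rw [hr'A]
    exact TrivialSyzygies.of_matrix hAB (hsyz.map φ.symm.toRingEquiv)
  obtain ⟨l₁, hl₁⟩ : ∃ l : K →ₗ[k] k, l 1 = 1 := by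
    obtain ⟨l, hl⟩ := LinearMap.exists_leftInverse_of_injective (Algebra.linearMap k K)
      (LinearMap.ker_eq_bot.2 (algebraMap k K).injective)
    refine ⟨l, ?_⟩
    have := LinearMap.congr_fun hl 1
    simpa using this
  obtain ⟨Λ₁, hΛ₁⟩ := hΛ l₁
  have hΛ₁j : ∀ x, Λ₁ (j x) = x := fun x => by
    have := hΛ₁ 1 x
    rwa [one_smul, hl₁, one_smul] at this
  have hΛ₁π := hΛπ l₁ Λ₁ hΛ₁
  have hsyzk : TrivialSyzygies r' := by
    intro a ha
    obtain ⟨S, hS, hS'⟩ := hsyz' (fun i => map (algebraMap k K) (a i)) (by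
      simp_rw [← map_mul, ← map_sum]
      rw [ha, map_zero])
    refine ⟨fun i i' => mapFunctional l₁ (S i i'), fun i i' => by simp only [hS i i', map_neg],
      fun i => ?_⟩
    rw [← mapFunctional_map (K := K) hl₁ (a i), hS', map_sum]
    exact Finset.sum_congr rfl fun i' _ => mapFunctional_mul_map _ _ _
  have hker' : ∀ f, π' f = 0 ↔
      f ∈ Ideal.ofList (List.ofFn fun i => map (algebraMap k K) (r' i)) := by
    intro f
    have hBA : B * A = 1 := mul_eq_one_comm.1 hAB
    rw [hr'A, hker₁, mem_ofList_ofFn, mem_ofList_ofFn]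
    constructor
    · rintro ⟨a, rfl⟩
      refine ⟨Matrix.vecMul a B, ?_⟩
      change Matrix.vecMul a B ⬝ᵥ A.mulVec r₁ = a ⬝ᵥ r₁
      rw [Matrix.dotProduct_mulVec, Matrix.vecMul_vecMul, hBA, Matrix.vecMul_one]
    · rintro ⟨a, rfl⟩
      refine ⟨Matrix.vecMul a A, ?_⟩
      change Matrix.vecMul a A ⬝ᵥ r₁ = a ⬝ᵥ A.mulVec r₁
      rw [Matrix.dotProduct_mulVec]
  refine ⟨h, r', ev, π', hh, hevX, hπ'X, hr', hsyzk.regularModulo hw0 hq hr',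
    hsyz'.regularModulo hw0 hq fun i => map_mem_weightedHomogeneousSubmodule (hr' i), fun x => ?_,
    fun f => ⟨fun hf => ?_, fun hf => ?_⟩, hπ', hker'⟩
  · obtain ⟨f, hf⟩ := hπ' (j x)
    exact ⟨mapFunctional l₁ f, by rw [← hΛ₁π, hf, hΛ₁j]⟩
  · have h1 : π' (map (algebraMap k K) f) = 0 := by rw [hev, hf, map_zero]
    obtain ⟨a, ha⟩ := mem_ofList_ofFn.1 ((hker' _).1 h1)
    refine mem_ofList_ofFn.2 ⟨fun i => mapFunctional l₁ (a i), ?_⟩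
    rw [← mapFunctional_map (K := K) hl₁ f, ← ha, map_sum]
    exact Finset.sum_congr rfl fun i _ => (mapFunctional_mul_map _ _ _).symm
  · obtain ⟨a, rfl⟩ := mem_ofList_ofFn.1 hf
    rw [← hΛ₁j (ev _), ← hev, (hker' _).2, map_zero]
    refine mem_ofList_ofFn.2 ⟨fun i => map (algebraMap k K) (a i), ?_⟩
    simp

end Descent

/-! ### Additive maps in cohomology and degrees -/

namespace CDGA

section CohAddMap

variable {k k' : Type*} [Field k] [Field k'] {A : CDGA.{u} k} {B : CDGA.{u} k'}

/-- The map induced in cohomology by an additive map that commutes with the differentials. -/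
def cohAddMap (f : A.carrier →+ B.carrier) (hf : ∀ a, f (A.d a) = B.d (f a)) : A.H →+ B.H :=
  QuotientAddGroup.map A.coboundaries.toAddSubgroup B.coboundaries.toAddSubgroup
    ((f.comp A.cocycles.val.toRingHom.toAddMonoidHom).codRestrict
      (Subalgebra.toSubmodule B.cocycles).toAddSubgroup (fun z => by
        change B.d (f z) = 0
        rw [← hf, show A.d z = 0 from z.2, map_zero]))
    (by
      rintro z ⟨b, hb⟩
      exact ⟨f b, by rw [← hf, ← hb]; rfl⟩)

theorem cohAddMap_mem (f : A.carrier →+ B.carrier) (hf : ∀ a, f (A.d a) = B.d (f a))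
    (h : ∀ n, ∀ a ∈ A.grading n, f a ∈ B.grading n) {n : ℤ} {x : A.H}
    (hx : x ∈ A.cohomology.grading n) : cohAddMap f hf x ∈ B.cohomology.grading n := by
  obtain ⟨a, ha, han, rfl⟩ := cls_mem_iff.1 hx
  exact cls_mem_iff.2 ⟨f a, _, h n a han, rfl⟩

end CohAddMap

section Degree

variable {k : Type v} [Field k] {A B C : CDGA.{u} k}

theorem mapH_mem (f : A ⟶ B) {n : ℤ} {x : A.H} (hx : x ∈ A.cohomology.grading n) :
    Hom.mapH f x ∈ B.cohomology.grading n := by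
  obtain ⟨a, ha, han, rfl⟩ := cls_mem_iff.1 hx
  exact cls_mem_iff.2 ⟨f.toAlgHom a, _, f.map_mem n a han, rfl⟩

theorem hoMapH_map (f : A ⟶ B) : hoMapH ((toHo k).map f) = Hom.mapH f := rfl

theorem hoMapH_comp (f : (toHo k).obj A ⟶ (toHo k).obj B) (g : (toHo k).obj B ⟶ (toHo k).obj C)
    (x : A.H) : hoMapH (f ≫ g) x = hoMapH g (hoMapH f x) := by
  unfold hoMapH
  rw [Functor.map_comp]
  rfl

theorem hoMapH_id (x : A.H) : hoMapH (𝟙 ((toHo k).obj A)) x = x := by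
  unfold hoMapH
  rw [CategoryTheory.Functor.map_id]
  rfl

theorem hoMapH_mem (f : (toHo k).obj A ⟶ (toHo k).obj B) {n : ℤ} {x : A.H}
    (hx : x ∈ A.cohomology.grading n) : hoMapH f x ∈ B.cohomology.grading n := by
  refine localization_induction (quasiIso k) (fun {X Y} f => ∀ n, ∀ x : X.H,
    x ∈ X.cohomology.grading n → hoMapH f x ∈ Y.cohomology.grading n) ?_ ?_ ?_ f n x hx
  · intro X Y f n x hx
    rw [hoMapH_map]
    exact mapH_mem f hx
  · intro X Y s hs n y hy
    set t := (Localization.isoOfHom (quasiIso k).Q (quasiIso k) s hs).inv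
    have h1 : Hom.mapH s (hoMapH t y) = y := by
      rw [← hoMapH_map, ← hoMapH_comp]
      have : t ≫ (toHo k).map s = 𝟙 _ :=
        (Localization.isoOfHom (quasiIso k).Q (quasiIso k) s hs).inv_hom_id
      rw [this, hoMapH_id]
    refine mem_of_map_mem X.cohomology.grading Y.cohomology.grading
      (Hom.mapH s : X.H →+ Y.H) hs.1 (fun n x hx => mapH_mem s hx) (x := hoMapH t y) ?_
    exact h1.symm ▸ hy
  · intro X Y Z f g hf hg n x hx
    rw [hoMapH_comp]
    exact hg n _ (hf n x hx)

/-- A bijective morphism of cdga's is an isomorphism. -/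
def isoOfBijective (f : A ⟶ B) (hf : Function.Bijective f.toAlgHom) : A ≅ B where
  hom := f
  inv :=
    { toAlgHom := (AlgEquiv.ofBijective f.toAlgHom hf).symm.toAlgHom
      map_mem := fun _ b hb => mem_of_map_mem A.grading B.grading
        (f.toAlgHom : A.carrier →+ B.carrier) hf.1 f.map_mem
        (x := (AlgEquiv.ofBijective f.toAlgHom hf).symm b)
        (((AlgEquiv.ofBijective f.toAlgHom hf).apply_symm_apply b).symm ▸ hb)
      map_d := fun b => hf.1 (((AlgEquiv.ofBijective f.toAlgHom hf).apply_symm_apply _).trans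
        ((congrArg B.d ((AlgEquiv.ofBijective f.toAlgHom hf).apply_symm_apply b)).symm.trans
          (f.map_d _).symm)) }
  hom_inv_id := Hom.ext (AlgHom.ext (AlgEquiv.ofBijective f.toAlgHom hf).symm_apply_apply)
  inv_hom_id := Hom.ext (AlgHom.ext (AlgEquiv.ofBijective f.toAlgHom hf).apply_symm_apply)

end Degree

/-! ### The cohomology of a base change -/

section BaseChange

variable {K : Type} [Field K] [Algebra ℚ K] {A B : CDGA.{u} ℚ}

/-- The contraction `K ⊗ A → A` of the first factor with a functional. -/
def contract (l : K →ₗ[ℚ] ℚ) : K ⊗[ℚ] A.carrier →ₗ[ℚ] A.carrier :=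
  (TensorProduct.lid ℚ A.carrier).toLinearMap ∘ₗ TensorProduct.map l LinearMap.id

theorem contract_tmul (l : K →ₗ[ℚ] ℚ) (c : K) (a : A.carrier) :
    contract l (c ⊗ₜ a) = l c • a := by
  simp [contract]

theorem contract_d (l : K →ₗ[ℚ] ℚ) (x : K ⊗[ℚ] A.carrier) :
    contract l (A.d.baseChange K x) = A.d (contract l x) := by
  induction x using TensorProduct.induction_on with
  | zero => simp
  | tmul c a => rw [LinearMap.baseChange_tmul, contract_tmul, contract_tmul, map_smul]
  | add x y hx hy => simp only [map_add, hx, hy]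

theorem contract_map (l : K →ₗ[ℚ] ℚ) (f : A ⟶ B) (x : K ⊗[ℚ] A.carrier) :
    contract l ((baseChangeMap K f).toAlgHom x) = f.toAlgHom (contract l x) := by
  change contract l (Algebra.TensorProduct.map (AlgHom.id K K) f.toAlgHom x) = _
  induction x using TensorProduct.induction_on with
  | zero => simp
  | tmul c a =>
    rw [Algebra.TensorProduct.map_tmul, contract_tmul, contract_tmul, map_smul]
    rfl
  | add x y hx hy => simp only [map_add, hx, hy]

theorem contract_mem (l : K →ₗ[ℚ] ℚ) {n : ℤ} {x : K ⊗[ℚ] A.carrier}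
    (hx : x ∈ (A.grading n).baseChange K) : contract l x ∈ A.grading n := by
  rw [Submodule.baseChange_eq_span] at hx
  induction hx using Submodule.span_induction generalizing l with
  | mem x hx =>
    obtain ⟨a, ha, rfl⟩ := hx
    rw [TensorProduct.mk_apply, contract_tmul]
    exact Submodule.smul_mem _ _ ha
  | zero => rw [map_zero]; exact Submodule.zero_mem _
  | add x y _ _ hx hy => rw [map_add]; exact Submodule.add_mem _ (hx l) (hy l)
  | smul c x _ hx =>
    have : ∀ y : K ⊗[ℚ] A.carrier, contract l (c • y) =
        contract (l ∘ₗ LinearMap.mulLeft ℚ c) y := by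
      intro y
      induction y using TensorProduct.induction_on with
      | zero => simp
      | tmul e a =>
        rw [TensorProduct.smul_tmul', contract_tmul, contract_tmul]
        rfl
      | add x y hx hy => rw [smul_add, map_add, hx, hy, map_add]
    rw [this]
    exact hx _

variable (K) in
/-- Elements of a tensor product are determined by their contractions. -/
theorem exists_sum_contract (x : K ⊗[ℚ] A.carrier) :
    ∃ s : Finset (Module.Basis.ofVectorSpaceIndex ℚ K),
      x = ∑ i ∈ s, Module.Basis.ofVectorSpace ℚ K i ⊗ₜ
        contract ((Module.Basis.ofVectorSpace ℚ K).coord i) x := by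
  classical
  set b := Module.Basis.ofVectorSpace ℚ K
  have key : ∃ s₀ : Finset (Module.Basis.ofVectorSpaceIndex ℚ K), ∀ s, s₀ ⊆ s →
      x = ∑ i ∈ s, b i ⊗ₜ contract (b.coord i) x := by
    induction x using TensorProduct.induction_on with
    | zero => exact ⟨∅, fun s _ => by simp⟩
    | tmul c a =>
      refine ⟨(b.repr c).support, fun s hs => ?_⟩
      conv_lhs => rw [← b.linearCombination_repr c, Finsupp.linearCombination_apply,
        Finsupp.sum_of_support_subset _ hs _ (by simp), TensorProduct.sum_tmul]
      refine Finset.sum_congr rfl fun i _ => ?_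
      rw [contract_tmul, TensorProduct.tmul_smul, TensorProduct.smul_tmul']
      rfl
    | add x y hx hy =>
      obtain ⟨s, hs⟩ := hx
      obtain ⟨t, ht⟩ := hy
      refine ⟨s ∪ t, fun v hv => ?_⟩
      simp only [map_add, TensorProduct.tmul_add, Finset.sum_add_distrib]
      rw [← hs v (Finset.union_subset_left hv), ← ht v (Finset.union_subset_right hv)]
  obtain ⟨s, hs⟩ := key
  exact ⟨s, hs s subset_rfl⟩

/-- The contraction in cohomology. -/
def contractH (l : K →ₗ[ℚ] ℚ) : (baseChange K A).H →+ A.H :=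
  cohAddMap (A := baseChange K A) (contract l).toAddMonoidHom (contract_d l)

theorem contractH_smul_toBaseChangeH (l : K →ₗ[ℚ] ℚ) (c : K) (h : A.H) :
    contractH l (c • toBaseChangeH K A h) = l c • h := by
  obtain ⟨a, ha, rfl⟩ := exists_cls h
  refine congrArg (Ideal.Quotient.mk A.coboundaries) (Subtype.ext ?_)
  change contract l (c • ((1 : K) ⊗ₜ[ℚ] a)) = l c • a
  rw [TensorProduct.smul_tmul', smul_eq_mul, mul_one, contract_tmul]

theorem contractH_mem (l : K →ₗ[ℚ] ℚ) {n : ℤ} {x : (baseChange K A).H}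
    (hx : x ∈ (baseChange K A).cohomology.grading n) : contractH l x ∈ A.cohomology.grading n :=
  cohAddMap_mem _ _ (fun _ _ ha => contract_mem l ha) hx

/-- A linear combination of tensors of cocycles as a linear combination of classes. -/
theorem cls_sum_tmul {ι : Type*} (s : Finset ι) (b : ι → K) (a : ι → A.carrier)
    (ha : ∀ i, A.d (a i) = 0) (x : (baseChange K A).carrier) (hx : (baseChange K A).d x = 0)
    (h : x = ∑ i ∈ s, (b i ⊗ₜ a i : K ⊗[ℚ] A.carrier)) :
    (baseChange K A).cls x hx = ∑ i ∈ s, b i • toBaseChangeH K A (A.cls (a i) (ha i)) := by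
  let z : ι → (baseChange K A).cocycles := fun i => ⟨((1 : K) ⊗ₜ a i : K ⊗[ℚ] A.carrier), by
    change A.d.baseChange K _ = 0
    rw [LinearMap.baseChange_tmul, ha, TensorProduct.tmul_zero]⟩
  have e : (⟨x, hx⟩ : (baseChange K A).cocycles) = ∑ i ∈ s, b i • z i := Subtype.ext (by
    rw [AddSubmonoidClass.coe_finsetSum]
    refine h.trans (Finset.sum_congr rfl fun i _ => ?_)
    change _ = b i • ((1 : K) ⊗ₜ a i : K ⊗[ℚ] A.carrier)
    rw [TensorProduct.smul_tmul', smul_eq_mul, mul_one])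
  have e' := congrArg (Ideal.Quotient.mkₐ K (baseChange K A).coboundaries) e
  rw [map_sum] at e'
  exact e'.trans (Finset.sum_congr rfl fun i _ => map_smul _ _ _)

/-- The cohomology of a base change is spanned by the original cohomology; the coefficients of a
class are its contractions. -/
theorem mem_span_toBaseChangeH (x : (baseChange K A).H) :
    x ∈ Submodule.span K (Set.range fun l : K →ₗ[ℚ] ℚ => toBaseChangeH K A (contractH l x)) := by
  obtain ⟨a, ha, rfl⟩ := exists_cls x
  obtain ⟨s, hs⟩ := exists_sum_contract K (A := A) a
  have hd : ∀ i, A.d (contract ((Module.Basis.ofVectorSpace ℚ K).coord i) a) = 0 := fun i =>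
    (contract_d _ a).symm.trans ((congrArg (contract _) ha).trans (map_zero _))
  have key : ∀ S : Submodule K (baseChange K A).H,
      (∀ i, toBaseChangeH K A (A.cls _ (hd i)) ∈ S) → (baseChange K A).cls a ha ∈ S := by
    intro S hS
    rw [cls_sum_tmul s (Module.Basis.ofVectorSpace ℚ K) _ hd a ha hs]
    exact Submodule.sum_mem _ fun i _ => Submodule.smul_mem _ _ (hS i)
  exact key _ fun i => Submodule.subset_span ⟨(Module.Basis.ofVectorSpace ℚ K).coord i, rfl⟩

/-- Base change preserves quasi-isomorphisms. -/
theorem quasiIso_baseChangeMap {f : A ⟶ B} (hf : quasiIso ℚ f) :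
    quasiIso K (baseChangeMap K f) := by
  have hcontr : ∀ (l : K →ₗ[ℚ] ℚ) (x : (baseChange K A).H),
      contractH l (Hom.mapH (baseChangeMap K f) x) = Hom.mapH f (contractH l x) := by
    intro l x
    obtain ⟨a, ha, rfl⟩ := exists_cls x
    exact congrArg (Ideal.Quotient.mk B.coboundaries) (Subtype.ext (contract_map l f a))
  constructor
  · rw [injective_iff_map_eq_zero]
    intro x hx
    have h0 : ∀ l : K →ₗ[ℚ] ℚ, contractH l x = 0 := fun l => hf.1 (by
      rw [← hcontr, hx, map_zero, map_zero])
    have h1 := mem_span_toBaseChangeH x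
    simp only [h0, map_zero, Set.range_const, Submodule.span_zero_singleton,
      Submodule.mem_bot] at h1
    exact h1
  · intro y
    have h1 : Submodule.span K (Set.range fun l : K →ₗ[ℚ] ℚ =>
        toBaseChangeH K B (contractH l y)) ≤
        LinearMap.range (Hom.mapH (baseChangeMap K f)).toLinearMap := by
      rw [Submodule.span_le]
      rintro _ ⟨l, rfl⟩
      obtain ⟨x, hx⟩ := hf.2 (contractH l y)
      refine ⟨toBaseChangeH K A x, ?_⟩
      simp only [← hx]
      obtain ⟨a, ha, rfl⟩ := exists_cls x
      refine congrArg (Ideal.Quotient.mk (baseChange K B).coboundaries) (Subtype.ext ?_)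
      exact Algebra.TensorProduct.map_tmul _ _ _ _
    exact h1 (mem_span_toBaseChangeH y)

end BaseChange

end CDGA

/-! ### Real forms in cohomology -/

namespace RCBBA

variable (N : RCBBA.{u})

/-- The real part `a ↦ (a + σ a) / 2`. -/
def rePart : N.carrier →+ N.fixed where
  toFun a := ⟨(2⁻¹ : ℂ) • (a + N.σ a), by
    change N.σ ((2⁻¹ : ℂ) • (a + N.σ a)) = (2⁻¹ : ℂ) • (a + N.σ a)
    rw [N.σ_smul, map_add, N.σ_σ, add_comm (N.σ a), map_inv₀, Complex.conj_ofNat]⟩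
  map_zero' := Subtype.ext (by
    change (2⁻¹ : ℂ) • ((0 : N.carrier) + N.σ 0) = 0
    rw [map_zero, add_zero, smul_zero])
  map_add' a b := Subtype.ext (by
    change (2⁻¹ : ℂ) • ((a + b) + N.σ (a + b)) =
      (2⁻¹ : ℂ) • (a + N.σ a) + (2⁻¹ : ℂ) • (b + N.σ b)
    rw [map_add, ← smul_add]
    congr 1
    abel)

theorem coe_rePart (a : N.carrier) : (N.rePart a : N.carrier) = (2⁻¹ : ℂ) • (a + N.σ a) := rfl

theorem rePart_d (a : N.carrier) : (N.rePart (N.d a) : N.carrier) = N.d (N.rePart a) := by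
  rw [coe_rePart, coe_rePart, map_smul, map_add, N.σ_d_comm]

/-- The real part in cohomology. -/
def reH : N.total.H →+ N.realTotal.H :=
  CDGA.cohAddMap (A := N.total) (B := N.realTotal) N.rePart fun a => Subtype.ext (N.rePart_d a)

theorem totalGrading_σ {n : ℤ} {a : N.carrier} (ha : a ∈ N.totalGrading n) :
    N.σ a ∈ N.totalGrading n := by
  rw [← N.totalProj_same ha, N.σ_totalProj]
  have h := proj_mem N.totalGrading n (N.σ a)
  have h1 : GradedAlgebra.proj N.totalGrading n (N.σ a) = N.totalProj n (N.σ a) :=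
    (proj_map N.totalGrading (AddMonoidHom.id _) id Function.injective_id
      (fun j => (N.totalProj j).toAddMonoidHom) (fun _ _ hx => N.totalProj_same hx)
      (fun _ _ h _ hx => N.totalProj_ne h hx) n (N.σ a)).symm
  exact h1 ▸ h

theorem reH_mem {n : ℤ} {x : N.total.H} (hx : x ∈ N.total.cohomology.grading n) :
    N.reH x ∈ N.realTotal.cohomology.grading n :=
  CDGA.cohAddMap_mem _ _ (fun n (a : N.carrier) ha =>
    show (2⁻¹ : ℂ) • (a + N.σ a) ∈ N.totalGrading n from
      Submodule.smul_mem _ _ (Submodule.add_mem _ ha (N.totalGrading_σ ha))) hx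

theorem realToComplexH_mem {n : ℤ} {x : N.realTotal.H}
    (hx : x ∈ N.realTotal.cohomology.grading n) :
    N.realToComplexH x ∈ N.total.cohomology.grading n := by
  obtain ⟨a, ha, han, rfl⟩ := CDGA.cls_mem_iff.1 hx
  exact CDGA.cls_mem_iff.2 ⟨_, _, han, rfl⟩

theorem realToComplexH_smul (c : ℝ) (x : N.realTotal.H) :
    N.realToComplexH (c • x) = (c : ℂ) • N.realToComplexH x := by
  obtain ⟨a, ha, rfl⟩ := CDGA.exists_cls x
  exact congrArg (Ideal.Quotient.mk N.total.coboundaries) (Subtype.ext rfl)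

theorem reH_smul (c : ℂ) (x : N.realTotal.H) : N.reH (c • N.realToComplexH x) = c.re • x := by
  obtain ⟨a, ha, rfl⟩ := CDGA.exists_cls x
  refine congrArg (Ideal.Quotient.mk N.realTotal.coboundaries) (Subtype.ext (Subtype.ext ?_))
  obtain ⟨a, hfix⟩ := a
  change (2⁻¹ : ℂ) • (c • a + N.σ (c • a)) = (c.re : ℂ) • a
  rw [N.σ_smul, show N.σ a = a from hfix, ← add_smul, smul_smul, Complex.add_conj]
  congr 1
  push_cast
  ring

theorem realToComplexH_injective : Function.Injective N.realToComplexH := by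
  intro x y h
  have key : ∀ x, x = N.reH (N.realToComplexH x) := fun x => by
    have := N.reH_smul 1 x
    rw [one_smul, Complex.one_re, one_smul] at this
    exact this.symm
  rw [key x, h, ← key y]

/-- The decomposition of a class in real and imaginary part. -/
theorem eq_re_add_im (x : N.total.H) : x = N.realToComplexH (N.reH x) +
    Complex.I • N.realToComplexH (N.reH (-Complex.I • x)) := by
  obtain ⟨(a : N.carrier), ha, rfl⟩ := CDGA.exists_cls x
  refine congrArg (Ideal.Quotient.mk N.total.coboundaries) (Subtype.ext ?_)
  change (a : N.carrier) = (2⁻¹ : ℂ) • (a + N.σ a) +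
    Complex.I • (2⁻¹ : ℂ) • (-Complex.I • (a : N.carrier) + N.σ (-Complex.I • (a : N.carrier)))
  have h1 : Complex.I * 2⁻¹ * Complex.I = -2⁻¹ := by
    rw [mul_right_comm, Complex.I_mul_I]; ring
  rw [N.σ_smul, map_neg, Complex.conj_I, neg_neg, neg_smul, smul_add, smul_add, smul_add,
    smul_neg, smul_neg, smul_smul, smul_smul, smul_smul, smul_smul, h1, neg_smul, neg_smul,
    neg_neg, add_add_add_comm, ← add_smul, add_neg_cancel, add_zero]
  norm_num

/-- The de Rham class of a real Bott-Chern class is real. -/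
theorem bcToDR_bcσ {x : N.HBC} (hx : N.bcσ x = x) :
    N.bcToDR x = N.realToComplexH (N.reH (N.bcToDR x)) := by
  obtain ⟨a, h, rfl⟩ := N.exists_bcCls x
  have h1 := congrArg N.bcToDR hx
  obtain ⟨(b : N.carrier), hb⟩ := (CDGA.cls_eq_iff _ (d_eq_zero h)).1 h1
  refine (CDGA.cls_eq_iff _ _).2 ⟨-((2⁻¹ : ℂ) • b), ?_⟩
  change a - (2⁻¹ : ℂ) • (a + N.σ a) = N.d (-((2⁻¹ : ℂ) • b))
  have hb' : N.σ a - a = N.d b := hb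
  rw [map_neg, map_smul, ← hb', smul_add, smul_sub, neg_sub]
  have : a = (2⁻¹ : ℂ) • a + (2⁻¹ : ℂ) • a := by
    rw [← add_smul]; norm_num
  nth_rewrite 1 [this]
  abel

/-- Under the `∂∂̄`-Lemma, a Bott-Chern class with real de Rham class is real. -/
theorem bcσ_eq_of_bcToDR (hN : N.DdbarLemma) {x : N.HBC} {u : N.realTotal.H}
    (h : N.bcToDR x = N.realToComplexH u) : N.bcσ x = x := by
  obtain ⟨a, ha, rfl⟩ := N.exists_bcCls x
  obtain ⟨z, hz, rfl⟩ := CDGA.exists_cls u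
  obtain ⟨(b : N.carrier), hb⟩ := (CDGA.cls_eq_iff _ _).1 h
  refine hN ((CDGA.cls_eq_iff _ _).2 ⟨N.σ b - b, ?_⟩)
  change N.σ a - a = N.d (N.σ b - b)
  have hb' : a - z.1 = N.d b := hb
  have hz' : N.σ z.1 = z.1 := z.2
  rw [map_sub, ← N.σ_d_comm, ← hb', map_sub, hz']
  abel

theorem bcToDR_mem {n : ℤ} {x : N.HBC} (hx : x ∈ N.bcCohomology.totalGrading n) :
    N.bcToDR x ∈ N.total.cohomology.grading n := by
  let L : N.HBC →ₗ[ℂ] N.total.H :=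
    { N.bcToDR with
      map_smul' := fun c x => by
        obtain ⟨a, h, rfl⟩ := N.exists_bcCls x
        rfl }
  have : N.bcCohomology.totalGrading n ≤ (N.total.cohomology.grading n).comap L :=
    N.bcCohomology.totalGrading_le fun p q h x hx => by
      obtain ⟨z, hz, rfl⟩ := hx
      exact CDGA.cls_mem_iff.2 ⟨z.1, _, N.le_totalGrading p q n h hz, rfl⟩
  exact this hx

theorem bcToDR_smul (c : ℂ) (x : N.HBC) : N.bcToDR (c • x) = c • N.bcToDR x := by
  obtain ⟨a, h, rfl⟩ := N.exists_bcCls x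
  rfl

end RCBBA

/-! ### The rational structure in cohomology -/

namespace RationalCBBA

open CDGA

variable (A : RationalCBBA.{u})

/-- The map `H(A_ℚ) → H_dR(A_ℂ)` induced by `φ`. -/
def ratToDR : A.AQ.H →+* A.AC.total.H :=
  A.AC.realToComplexH.comp ((hoMapH A.φ.hom : _ →+* A.AC.realTotal.H).comp (toBaseChangeH ℝ A.AQ))

theorem ratToDR_apply (h : A.AQ.H) :
    A.ratToDR h = A.AC.realToComplexH (hoMapH A.φ.hom (toBaseChangeH ℝ A.AQ h)) := rfl

theorem hoMapH_inv_hom (x : (baseChange ℝ A.AQ).H) : hoMapH A.φ.inv (hoMapH A.φ.hom x) = x := by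
  rw [← hoMapH_comp, A.φ.hom_inv_id, hoMapH_id]

theorem hoMapH_hom_inv (x : A.AC.realTotal.H) : hoMapH A.φ.hom (hoMapH A.φ.inv x) = x := by
  rw [← hoMapH_comp, A.φ.inv_hom_id, hoMapH_id]

theorem ratToDR_mem {n : ℤ} {h : A.AQ.H} (hh : h ∈ A.AQ.cohomology.grading n) :
    A.ratToDR h ∈ A.AC.total.cohomology.grading n := by
  refine A.AC.realToComplexH_mem (hoMapH_mem _ ?_)
  obtain ⟨a, ha, han, rfl⟩ := cls_mem_iff.1 hh
  exact cls_mem_iff.2 ⟨_, _, Submodule.tmul_mem_baseChange_of_mem 1 han, rfl⟩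

/-- A real class as a linear combination of rational ones. -/
theorem mem_span_hoMapH (u : A.AC.realTotal.H) :
    u ∈ Submodule.span ℝ (Set.range fun l : ℝ →ₗ[ℚ] ℚ =>
      hoMapH A.φ.hom (toBaseChangeH ℝ A.AQ (contractH l (hoMapH A.φ.inv u)))) := by
  have h := Submodule.mem_map_of_mem (f := (hoMapH A.φ.hom).toLinearMap)
    (mem_span_toBaseChangeH (hoMapH A.φ.inv u))
  rw [Submodule.map_span, ← Set.range_comp] at h
  have e : (hoMapH A.φ.hom).toLinearMap (hoMapH A.φ.inv u) = u := A.hoMapH_hom_inv u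
  rw [e] at h
  exact h

theorem realToComplexH_mem_span (u : A.AC.realTotal.H) :
    A.AC.realToComplexH u ∈ Submodule.span ℂ (Set.range fun l : ℝ →ₗ[ℚ] ℚ =>
      A.ratToDR (contractH l (hoMapH A.φ.inv u))) := by
  have key : ∀ v ∈ Submodule.span ℝ (Set.range fun l : ℝ →ₗ[ℚ] ℚ =>
      hoMapH A.φ.hom (toBaseChangeH ℝ A.AQ (contractH l (hoMapH A.φ.inv u)))),
      A.AC.realToComplexH v ∈ Submodule.span ℂ (Set.range fun l : ℝ →ₗ[ℚ] ℚ =>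
        A.ratToDR (contractH l (hoMapH A.φ.inv u))) := by
    intro v hv
    induction hv using Submodule.span_induction with
    | mem v hv =>
      obtain ⟨l, rfl⟩ := hv
      exact Submodule.subset_span ⟨l, rfl⟩
    | zero => rw [map_zero]; exact Submodule.zero_mem _
    | add v w _ _ hv hw => rw [map_add]; exact Submodule.add_mem _ hv hw
    | smul c v _ hv => rw [A.AC.realToComplexH_smul]; exact Submodule.smul_mem _ _ hv
  exact key u (A.mem_span_hoMapH u)

/-- `H_dR(A_ℂ)` is spanned by the rational classes, degree by degree. -/
theorem mem_span_ratToDR {n : ℤ} {x : A.AC.total.H}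
    (hx : x ∈ A.AC.total.cohomology.grading n) :
    x ∈ Submodule.span ℂ (A.ratToDR '' {h | h ∈ A.AQ.cohomology.grading n}) := by
  have key : ∀ u : A.AC.realTotal.H, u ∈ A.AC.realTotal.cohomology.grading n →
      A.AC.realToComplexH u ∈
        Submodule.span ℂ (A.ratToDR '' {h | h ∈ A.AQ.cohomology.grading n}) := by
    intro u hu
    refine Submodule.span_mono ?_ (A.realToComplexH_mem_span u)
    rintro _ ⟨l, rfl⟩
    exact ⟨_, contractH_mem l (hoMapH_mem _ hu), rfl⟩
  rw [A.AC.eq_re_add_im x]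
  exact Submodule.add_mem _ (key _ (A.AC.reH_mem hx)) (Submodule.smul_mem _ _
    (key _ (A.AC.reH_mem (Submodule.smul_mem (A.AC.total.cohomology.grading n) _ hx))))

theorem contractH_smul_ratToDR (l : ℝ →ₗ[ℚ] ℚ) (c : ℂ) (h : A.AQ.H) :
    contractH l (hoMapH A.φ.inv (A.AC.reH (c • A.ratToDR h))) = l c.re • h := by
  rw [ratToDR_apply, A.AC.reH_smul, map_smul, hoMapH_inv_hom, contractH_smul_toBaseChangeH]

/-- Rational functionals on `ℂ` extend to `H_dR(A_ℂ)`, which is `ℂ ⊗ H(A_ℚ)`. -/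
theorem exists_extend_functional (l : ℂ →ₗ[ℚ] ℚ) :
    ∃ Λ : A.AC.total.H →+ A.AQ.H, ∀ c h, Λ (c • A.ratToDR h) = l c • h := by
  let l₁ : ℝ →ₗ[ℚ] ℚ := l ∘ₗ (Complex.ofRealAm.restrictScalars ℚ).toLinearMap
  let l₂ : ℝ →ₗ[ℚ] ℚ := l ∘ₗ LinearMap.mulLeft ℚ Complex.I ∘ₗ
    (Complex.ofRealAm.restrictScalars ℚ).toLinearMap
  let F : (ℝ →ₗ[ℚ] ℚ) → A.AC.realTotal.H →+ A.AQ.H := fun l =>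
    (contractH l).comp (hoMapH A.φ.inv : A.AC.realTotal.H →+ (baseChange ℝ A.AQ).H)
  have hF : ∀ (l : ℝ →ₗ[ℚ] ℚ) (c : ℂ) (h : A.AQ.H),
      F l (A.AC.reH (c • A.ratToDR h)) = l c.re • h := A.contractH_smul_ratToDR
  refine ⟨(F l₁).comp A.AC.reH + ((F l₂).comp A.AC.reH).comp
    (DistribSMul.toAddMonoidHom _ (-Complex.I)), fun c h => ?_⟩
  change F l₁ (A.AC.reH (c • A.ratToDR h)) +
    F l₂ (A.AC.reH (-Complex.I • c • A.ratToDR h)) = _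
  rw [smul_smul, hF, hF, ← add_smul]
  congr 1
  change l (c.re : ℂ) + l (Complex.I * ((-Complex.I * c).re : ℂ)) = l c
  rw [← map_add]
  congr 1
  apply Complex.ext <;> simp

/-- If `H_BC(A_ℂ) → H_dR(A_ℂ)` is bijective, the isomorphism `H(φ)` exists. -/
theorem exists_isInducedByφ (hinj : A.AC.DdbarLemma) (hsurj : Function.Surjective A.AC.bcToDR) :
    ∃ ψ, A.IsInducedByφ ψ := by
  let e : A.AC.HBC ≃+* A.AC.total.H := RingEquiv.ofBijective A.AC.bcToDR ⟨hinj, hsurj⟩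
  have he : ∀ x, A.AC.bcToDR (e.symm x) = x := e.apply_symm_apply
  let f : SemiHom A.AQ.cohomology A.AC.bcCohomology.realTotal :=
    { toRingHom := ((e.symm : A.AC.total.H →+* A.AC.HBC).comp A.ratToDR).codRestrict
        A.AC.bcCohomology.fixed (fun h => A.AC.bcσ_eq_of_bcToDR hinj (he _))
      map_mem := fun n h hh => by
        refine mem_of_map_mem A.AC.bcCohomology.totalGrading A.AC.total.cohomology.grading
          (A.AC.bcToDR : A.AC.HBC →+ A.AC.total.H) hinj (fun n x hx => A.AC.bcToDR_mem hx)
          (x := e.symm (A.ratToDR h)) ?_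
        exact (he (A.ratToDR h)).symm ▸ A.ratToDR_mem hh
      map_d := fun h => by
        refine (map_zero _).trans (Subtype.ext ?_)
        exact (add_zero (0 : A.AC.HBC)).symm }
  have hf : ∀ h : A.AQ.H, A.AC.bcToDR (A.AC.bcCohomology.fixed.val (f.toRingHom h)) =
      A.ratToDR h := fun h => he _
  -- `bcToDR ∘ f.extend` as a map of real vector spaces
  let T : ℝ ⊗[ℚ] A.AQ.H →+ A.AC.total.H :=
    AddMonoidHom.mk' (fun x => A.AC.bcToDR (A.AC.bcCohomology.fixed.val (f.extend.toAlgHom x)))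
      (fun x y => (congrArg (fun y => A.AC.bcToDR (A.AC.bcCohomology.fixed.val y))
        (map_add f.extend.toAlgHom x y)).trans (map_add A.AC.bcToDR _ _))
  have hT : ∀ (c : ℝ) (h : A.AQ.H), T (c ⊗ₜ h) = (c : ℂ) • A.ratToDR h := by
    intro c h
    rw [← hf]
    exact (congrArg (fun y => A.AC.bcToDR (A.AC.bcCohomology.fixed.val y))
      (f.extend_tmul c h)).trans (A.AC.bcToDR_smul _ _)
  have hTinj : Function.Injective T → Function.Injective f.extend.toAlgHom := fun h x y hxy =>
    h (congrArg (fun y => A.AC.bcToDR (A.AC.bcCohomology.fixed.val y)) hxy)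
  have hbij : Function.Bijective f.extend.toAlgHom := by
    constructor
    · refine hTinj ((injective_iff_map_eq_zero T).2 fun x hx => ?_)
      have h1 : ∀ (l : ℝ →ₗ[ℚ] ℚ) (x : ℝ ⊗[ℚ] A.AQ.H), contract (A := A.AQ.cohomology) l x =
          contractH l (hoMapH A.φ.inv (A.AC.reH (T x))) := by
        intro l x
        induction x using TensorProduct.induction_on with
        | zero => simp only [map_zero]; exact map_zero (contract (A := A.AQ.cohomology) l)
        | tmul c h =>
          rw [hT, contractH_smul_ratToDR]
          exact contract_tmul (A := A.AQ.cohomology) l c h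
        | add x y hx hy =>
          simp only [map_add]
          exact (map_add _ _ _).trans (congrArg₂ (· + ·) hx hy)
      obtain ⟨s, hs⟩ := exists_sum_contract ℝ (A := A.AQ.cohomology) x
      refine hs.trans (Finset.sum_eq_zero fun i _ => ?_)
      have h2 := (h1 ((Module.Basis.ofVectorSpace ℚ ℝ).coord i) x).trans
        (by rw [hx, map_zero, map_zero, map_zero] :
          contractH _ (hoMapH A.φ.inv (A.AC.reH (T x))) = 0)
      exact (congrArg _ h2).trans (TensorProduct.tmul_zero _ _)
    · intro y
      have h1 : ∀ v ∈ Submodule.span ℝ (Set.range fun l : ℝ →ₗ[ℚ] ℚ =>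
          hoMapH A.φ.hom (toBaseChangeH ℝ A.AQ (contractH l (hoMapH A.φ.inv
            (A.AC.reH (A.AC.bcToDR (A.AC.bcCohomology.fixed.val y))))))),
          ∃ x, T x = A.AC.realToComplexH v := by
        intro v hv
        induction hv using Submodule.span_induction with
        | mem v hv =>
          obtain ⟨l, rfl⟩ := hv
          refine ⟨1 ⊗ₜ contractH l (hoMapH A.φ.inv
            (A.AC.reH (A.AC.bcToDR (A.AC.bcCohomology.fixed.val y)))), (hT _ _).trans ?_⟩
          rw [Complex.ofReal_one, one_smul]
          rfl
        | zero => exact ⟨0, by rw [map_zero, map_zero]⟩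
        | add v w _ _ hv hw =>
          obtain ⟨x, hx⟩ := hv
          obtain ⟨x', hx'⟩ := hw
          exact ⟨x + x', by rw [map_add, map_add, hx, hx']⟩
        | smul c v _ hv =>
          obtain ⟨x, hx⟩ := hv
          refine ⟨c • x, ?_⟩
          rw [A.AC.realToComplexH_smul, ← hx]
          have h3 : f.extend.toAlgHom (c • x : ℝ ⊗[ℚ] A.AQ.H) = c • f.extend.toAlgHom x :=
            map_smul f.extend.toAlgHom c x
          exact (congrArg (fun y => A.AC.bcToDR (A.AC.bcCohomology.fixed.val y)) h3).trans
            (A.AC.bcToDR_smul _ _)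
      obtain ⟨x, hx⟩ := h1 _ (A.mem_span_hoMapH _)
      refine ⟨x, Subtype.ext (hinj (hx.trans ?_))⟩
      exact (A.AC.bcToDR_bcσ y.2).symm
  refine ⟨isoOfBijective f.extend hbij, fun h => ?_⟩
  have h1 : f.extend.toAlgHom ((1 : ℝ) ⊗ₜ[ℚ] h : ℝ ⊗[ℚ] A.AQ.H) = f.toRingHom h :=
    (f.extend_tmul 1 h).trans (one_smul ℝ _)
  exact (congrArg (fun y => A.AC.bcToDR (A.AC.bcCohomology.fixed.val y)) h1).trans (hf h)

end RationalCBBA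

/-! ### Cohomology of complete intersection type -/

section Presentation

open MvPolynomial

/-- The weights `p_i`; the bidegrees are `(p_i, p_i)` and the cohomological degrees `2 p_i`. -/
abbrev linWeight {σ : Type*} (p : σ → ℕ) : σ → ℤ := fun i => (p i : ℤ)

variable {σ τ k : Type*} [Field k] {p : σ → ℕ}

theorem weight_linWeight (m : σ →₀ ℕ) :
    Finsupp.weight (linWeight p) m = ((Finsupp.weight p m : ℕ) : ℤ) := by
  simp [Finsupp.weight_apply, Finsupp.sum]

theorem mem_diagWeight_iff {d : ℤ} {f : MvPolynomial σ k} :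
    f ∈ weightedHomogeneousSubmodule k (RCBBA.diagWeight p) (d, d) ↔
      f ∈ weightedHomogeneousSubmodule k (linWeight p) d := by
  have h : ∀ m : σ →₀ ℕ, Finsupp.weight (RCBBA.diagWeight p) m = (d, d) ↔
      Finsupp.weight (linWeight p) m = d := fun m => by
    rw [weight_linWeight, RCBBA.weight_diagWeight, Prod.mk.injEq, and_self]
  exact ⟨fun hf m hm => (h m).1 (hf hm), fun hf m hm => (h m).2 (hf hm)⟩

theorem mem_evenWeight {d : ℤ} {f : MvPolynomial σ k}
    (hf : f ∈ weightedHomogeneousSubmodule k (linWeight p) d) :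
    f ∈ weightedHomogeneousSubmodule k (CDGA.evenWeight p) (2 * d) := by
  intro m hm
  rw [← hf hm]
  simp only [Finsupp.weight_apply, Finsupp.sum, Finset.mul_sum]
  exact Finset.sum_congr rfl fun i _ => (mul_smul_comm _ _ _).symm

theorem rename_mem {ι : Type*} [AddCommMonoid ι] (e : σ → τ) {w : τ → ι} {d : ι}
    {f : MvPolynomial σ k} (hf : f ∈ weightedHomogeneousSubmodule k (w ∘ e) d) :
    rename e f ∈ weightedHomogeneousSubmodule k w d := by
  intro m hm
  obtain ⟨u, rfl, hu⟩ := coeff_rename_ne_zero _ _ _ hm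
  rw [← hf hu, Finsupp.weight_apply, Finsupp.weight_apply]
  exact Finsupp.sum_mapDomain_index (fun _ => zero_smul _ _) fun _ _ _ => add_smul _ _ _

/-- A presentation of an algebra of complete intersection type, with the variables in an arbitrary
universe and regularity replaced by triviality of the syzygies. -/
theorem IsCompleteIntersectionType.exists_presentation {H : Type*} [Ring H] [Algebra k H]
    {𝓗 : ℤ × ℤ → Submodule k H} (h : IsCompleteIntersectionType 𝓗) :
    ∃ (σ : Type u) (_ : Fintype σ) (_ : DecidableEq σ) (p : σ → ℕ) (m : ℕ)
      (r : Fin m → MvPolynomial σ k) (q : Fin m → ℤ) (π : MvPolynomial σ k →ₐ[k] H),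
      (∀ i, 1 ≤ linWeight p i) ∧ (∀ i, 1 ≤ q i) ∧
      (∀ i, r i ∈ weightedHomogeneousSubmodule k (linWeight p) (q i)) ∧ TrivialSyzygies r ∧
      Function.Surjective π ∧ (∀ f, π f = 0 ↔ f ∈ Ideal.ofList (List.ofFn r)) ∧
      ∀ d, ∀ f ∈ weightedHomogeneousSubmodule k (linWeight p) d, π f ∈ 𝓗 (d, d) := by
  obtain ⟨n, p, r, hp, hr, hreg, e, he⟩ := h
  have hp' : ∀ i, 1 ≤ linWeight p i := fun i => by exact_mod_cast hp i
  have hdeg : ∀ i : Fin r.length, ∃ q : ℤ, 1 ≤ q ∧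
      r.get i ∈ weightedHomogeneousSubmodule k (linWeight p) q := by
    intro i
    by_cases h0 : r.get i = 0
    · exact ⟨1, le_rfl, by rw [h0]; exact Submodule.zero_mem _⟩
    · obtain ⟨b, hb⟩ := hr _ (List.get_mem r i)
      obtain ⟨m, hm⟩ := ne_zero_iff.1 h0
      have hb' : b = (Finsupp.weight (linWeight p) m, Finsupp.weight (linWeight p) m) := by
        rw [← hb hm, weight_linWeight]
        exact RCBBA.weight_diagWeight p m
      have hq : r.get i ∈ weightedHomogeneousSubmodule k (linWeight p)
          (Finsupp.weight (linWeight p) m) := mem_diagWeight_iff.1 (hb' ▸ hb)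
      refine ⟨_, ?_, hq⟩
      have hge : 0 ≤ Finsupp.weight (linWeight p) m := by
        rw [weight_linWeight]; exact Int.natCast_nonneg _
      by_contra hlt
      have hz : Finsupp.weight (linWeight p) m = 0 := by omega
      -- a nonzero relation of weight zero would be a unit
      rw [hz] at hq
      have hC := eq_C_of_weight_zero hp' hq
      have hc : constantCoeff (r.get i) ≠ 0 := fun hc => h0 (by rw [hC, hc, map_zero])
      refine hreg.top_ne_smul ?_
      rw [smul_eq_mul, Ideal.mul_top, eq_comm]
      refine Ideal.eq_top_of_isUnit_mem _ (Ideal.subset_span (List.get_mem r i)) ?_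
      rw [hC]
      exact (isUnit_iff_ne_zero.2 hc).map C
  choose q hq hrq using hdeg
  let ρ : MvPolynomial (Fin n) k ≃ₐ[k] MvPolynomial (ULift.{u} (Fin n)) k :=
    renameEquiv k Equiv.ulift.symm
  have hsyz : TrivialSyzygies r.get := TrivialSyzygies.of_regularModulo (by
    rw [List.ofFn_get]; exact regularModulo_of_isWeaklyRegular hreg.toIsWeaklyRegular)
  refine ⟨ULift.{u} (Fin n), inferInstance, inferInstance, fun i => p i.down, r.length,
    fun i => ρ (r.get i), q, e.toAlgHom.comp ((Ideal.Quotient.mkₐ k _).comp ρ.symm.toAlgHom),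
    fun i => hp' i.down, hq, fun i => rename_mem _ (hrq i), hsyz.map ρ.toRingEquiv,
    e.surjective.comp ((Ideal.Quotient.mkₐ_surjective k _).comp ρ.symm.surjective),
    fun f => ?_, fun d f hf => ?_⟩
  · change e (Ideal.Quotient.mk _ (ρ.symm f)) = 0 ↔ _
    rw [map_eq_zero_iff e e.injective, Ideal.Quotient.eq_zero_iff_mem]
    conv_lhs => rw [← List.ofFn_get r]
    rw [mem_ofList_ofFn, mem_ofList_ofFn]
    constructor
    · rintro ⟨a, ha⟩
      refine ⟨fun i => ρ (a i), ?_⟩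
      rw [← ρ.apply_symm_apply f, ← ha, map_sum]
      exact Finset.sum_congr rfl fun i _ => (map_mul ρ _ _).symm
    · rintro ⟨a, rfl⟩
      refine ⟨fun i => ρ.symm (a i), ?_⟩
      rw [map_sum]
      exact Finset.sum_congr rfl fun i _ => by rw [map_mul, ρ.symm_apply_apply]
  · have h1 : ρ.symm f ∈ weightedHomogeneousSubmodule k (linWeight p) d :=
      rename_mem (σ := ULift.{u} (Fin n)) (w := linWeight p) Equiv.ulift hf
    exact (he (d, d)).le ⟨_, ⟨_, mem_diagWeight_iff.2 h1, rfl⟩, rfl⟩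

end Presentation

namespace RCBBA

variable {N : RCBBA.{u}}

theorem exists_of_mem_dRPiece {a b : ℤ} {x : N.total.H} (hx : x ∈ N.dRPiece (a, b)) :
    ∃ z ∈ N.grading (a, b), ∃ h, x = N.bcToDR (N.bcCls z h) := by
  obtain ⟨z, hz, rfl⟩ := hx
  have hd : N.del z.1 + N.delbar z.1 = 0 := z.2
  have hz' : z.1 ∈ N.grading (a, b) := hz
  have h1 := congrArg (GradedAlgebra.proj N.grading (a + 1, b)) hd
  rw [map_add, proj_same N.grading (N.del_mem a b _ hz'),
    proj_ne N.grading (N.delbar_mem a b _ hz') (by simp), add_zero, map_zero] at h1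
  rw [h1, zero_add] at hd
  exact ⟨z.1, hz', ⟨h1, hd⟩, rfl⟩

theorem dRPiece_le {a b : ℤ} {x : N.total.H} (hx : x ∈ N.dRPiece (a, b)) :
    x ∈ N.total.cohomology.grading (a + b) := by
  obtain ⟨z, hz, h, rfl⟩ := exists_of_mem_dRPiece hx
  exact CDGA.cls_mem_iff.2 ⟨z, _, N.le_totalGrading a b _ rfl hz, rfl⟩

section Presentation

open MvPolynomial

variable {σ : Type*} {p : σ → ℕ} {π : MvPolynomial σ ℂ →ₐ[ℂ] N.total.H}

theorem mem_grading_of_dRPiece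
    (hπd : ∀ d, ∀ f ∈ weightedHomogeneousSubmodule ℂ (linWeight p) d, π f ∈ N.dRPiece (d, d))
    {d : ℤ} {f : MvPolynomial σ ℂ} (hf : f ∈ weightedHomogeneousSubmodule ℂ (linWeight p) d) :
    π f ∈ N.total.cohomology.grading (2 * d) := by
  have := dRPiece_le (hπd d f hf)
  rwa [← two_mul] at this

theorem exists_of_mem_even (hπ : Function.Surjective π)
    (hπd : ∀ d, ∀ f ∈ weightedHomogeneousSubmodule ℂ (linWeight p) d, π f ∈ N.dRPiece (d, d))
    {d : ℤ} {x : N.total.H} (hx : x ∈ N.total.cohomology.grading (2 * d)) :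
    ∃ f ∈ weightedHomogeneousSubmodule ℂ (linWeight p) d, π f = x := by
  let := weightedGradedAlgebra ℂ (linWeight p)
  obtain ⟨f, rfl⟩ := hπ x
  refine ⟨GradedAlgebra.proj (weightedHomogeneousSubmodule ℂ (linWeight p)) d f,
    proj_mem _ _ _, ?_⟩
  have h := proj_map (weightedHomogeneousSubmodule ℂ (linWeight p))
    (π : MvPolynomial σ ℂ →+ N.total.H) (2 * ·) (mul_right_injective₀ two_ne_zero)
    (fun j => (GradedAlgebra.proj N.total.cohomology.grading j).toAddMonoidHom)
    (fun i x hx => proj_same N.total.cohomology.grading (mem_grading_of_dRPiece hπd hx))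
    (fun i j hij x hx =>
      proj_ne N.total.cohomology.grading (mem_grading_of_dRPiece hπd hx) hij) d f
  exact h.symm.trans (proj_same N.total.cohomology.grading hx)

theorem eq_zero_of_odd (hπ : Function.Surjective π)
    (hπd : ∀ d, ∀ f ∈ weightedHomogeneousSubmodule ℂ (linWeight p) d, π f ∈ N.dRPiece (d, d))
    {n : ℤ} (hn : Odd n) {x : N.total.H} (hx : x ∈ N.total.cohomology.grading n) : x = 0 := by
  let := weightedGradedAlgebra ℂ (linWeight p)
  obtain ⟨f, rfl⟩ := hπ x
  have h : ∀ f, GradedAlgebra.proj N.total.cohomology.grading n (π f) = 0 := by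
    intro f
    induction f using DirectSum.Decomposition.inductionOn
      (weightedHomogeneousSubmodule ℂ (linWeight p)) with
    | zero => rw [map_zero]; exact map_zero (GradedAlgebra.proj N.total.cohomology.grading n)
    | @homogeneous d f =>
      refine proj_ne N.total.cohomology.grading (mem_grading_of_dRPiece hπd f.2) fun e => ?_
      rw [e] at hn
      exact Int.not_even_iff_odd.2 hn (even_two_mul d)
    | add f g hf hg =>
      rw [map_add]
      refine (map_add (GradedAlgebra.proj N.total.cohomology.grading n) _ _).trans ?_
      exact (congrArg₂ (· + ·) hf hg).trans (add_zero _)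
  exact (proj_same N.total.cohomology.grading hx).symm.trans (h f)

/-- If `H_dR` is generated by classes of pure type, then `H_BC → H_dR` is surjective. -/
theorem bcToDR_surjective (hπ : Function.Surjective π)
    (hπd : ∀ d, ∀ f ∈ weightedHomogeneousSubmodule ℂ (linWeight p) d, π f ∈ N.dRPiece (d, d)) :
    Function.Surjective N.bcToDR := by
  let := weightedGradedAlgebra ℂ (linWeight p)
  intro x
  obtain ⟨f, rfl⟩ := hπ x
  induction f using DirectSum.Decomposition.inductionOn
    (weightedHomogeneousSubmodule ℂ (linWeight p)) with
  | zero => exact ⟨0, by rw [map_zero, map_zero]⟩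
  | @homogeneous d f =>
    obtain ⟨z, -, h, hz⟩ := exists_of_mem_dRPiece (hπd d f f.2)
    exact ⟨_, hz.symm⟩
  | add f g hf hg =>
    obtain ⟨y, hy⟩ := hf
    obtain ⟨z, hz⟩ := hg
    exact ⟨y + z, by rw [map_add, map_add, hy, hz]⟩

/-- A real class of bidegree `(d, d)` has a real representative of bidegree `(d, d)` that is closed
for both differentials. -/
theorem exists_real_rep {d : ℤ} {u : N.realTotal.H}
    (hu : N.realToComplexH u ∈ N.dRPiece (d, d)) :
    ∃ z ∈ N.grading (d, d), ∃ h, N.σ z = z ∧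
      N.bcToDR (N.bcCls z h) = N.realToComplexH u := by
  obtain ⟨z, hz, h, e⟩ := exists_of_mem_dRPiece hu
  have hσ : N.del (N.σ z) = 0 ∧ N.delbar (N.σ z) = 0 :=
    ⟨by rw [← N.σ_delbar, h.2, map_zero], by rw [← N.σ_del, h.1, map_zero]⟩
  refine ⟨N.rePart z, Submodule.smul_mem _ _ (Submodule.add_mem _ hz (N.σ_mem _ _ _ hz)),
    ⟨?_, ?_⟩, (N.rePart z).2, ?_⟩
  · rw [coe_rePart, map_smul, map_add, h.1, hσ.1, add_zero, smul_zero]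
  · rw [coe_rePart, map_smul, map_add, h.2, hσ.2, add_zero, smul_zero]
  · have h1 := N.reH_smul 1 u
    rw [one_smul, Complex.one_re, one_smul, e] at h1
    rw [← h1]
    rfl

end Presentation

end RCBBA

/-! ### Maps out of the models -/

namespace CDGA

open MvPolynomial

section PureMaps

variable {σ : Type u} {p : σ → ℕ} {I : Ideal (MvPolynomial σ ℚ)} (P : PureModel p I)
  {B : CDGA.{u} ℚ}

/-- A semilinear map over `ℚ` is a morphism. -/
def SemiHom.toHom {M N : CDGA.{u} ℚ} (f : SemiHom M N) : M ⟶ N where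
  toAlgHom := f.toRingHom.toRatAlgHom
  map_mem := f.map_mem
  map_d := f.map_d

/-- A model of `S ⧸ I` maps quasi-isomorphically to every cdga with cohomology `S ⧸ I`. -/
theorem PureModel.exists_quasiIso {ev : MvPolynomial σ ℚ →+* B.H}
    (hev : ∀ i, ev (X i) ∈ B.cohomology.grading (evenWeight p i)) (hs : Function.Surjective ev)
    (hI : ∀ f, ev f = 0 ↔ f ∈ I) :
    ∃ F : P.M ⟶ B, quasiIso ℚ F ∧
      ∀ f, Hom.mapH F (P.M.cls (P.ι.toRingHom f) (P.d_ι f)) = ev f := by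
  choose a had ha haX using fun i => cls_mem_iff.1 (hev i)
  let g := evalCocycles p a ha had
  have hg : ∀ f : MvPolynomial σ ℚ, B.d (g.toRingHom f) = 0 :=
    d_evalCentral a (mul_comm_of_even p ha) had
  have hcls : ∀ f : MvPolynomial σ ℚ, B.cls (g.toRingHom f) (hg f) = ev f := by
    intro f
    let G : MvPolynomial σ ℚ →+* B.H := (Ideal.Quotient.mk B.coboundaries).comp
      ((show MvPolynomial σ ℚ →+* B.carrier from g.toRingHom).codRestrict B.cocycles hg)
    refine polynomialCDGA_ringHom_ext p (f := G) (g := ev) (fun i => ?_) f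
    refine Eq.trans ?_ (haX i).symm
    exact congrArg (Ideal.Quotient.mk B.coboundaries) (Subtype.ext (evalCocycles_X p a ha had i))
  obtain ⟨F, hF⟩ := P.exists_extension ℚ B g fun f hf => by
    rw [← cls_eq_zero_iff (hg f), hcls, hI]
    exact hf
  have hFcls : ∀ f, Hom.mapH F.toHom (P.M.cls (P.ι.toRingHom f) (P.d_ι f)) = ev f := fun f =>
    (congrArg (Ideal.Quotient.mk B.coboundaries) (Subtype.ext (hF f))).trans (hcls f)
  refine ⟨F.toHom, ⟨?_, fun y => ?_⟩, hFcls⟩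
  · rw [injective_iff_map_eq_zero]
    intro x hx
    obtain ⟨x, hxd, rfl⟩ := exists_cls x
    obtain ⟨f, b, hfb⟩ := P.exists_rep x hxd
    have e : P.M.cls x hxd = P.M.cls (P.ι.toRingHom f) (P.d_ι f) :=
      (cls_eq_iff _ _).2 ⟨b, by rw [hfb, add_sub_cancel_left]⟩
    rw [e] at hx ⊢
    exact (cls_eq_zero_iff _).2 ((P.exact_iff f).2 ((hI f).1 ((hFcls f).symm.trans hx)))
  · obtain ⟨f, rfl⟩ := hs y
    exact ⟨_, hFcls f⟩

/-- A model of `S ⧸ I` maps to `S ⧸ I`. -/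
theorem PureModel.exists_hom_cohomology {ev : MvPolynomial σ ℚ →+* B.H}
    (hev : ∀ i, ev (X i) ∈ B.cohomology.grading (evenWeight p i))
    (hI : ∀ f ∈ I, ev f = 0) :
    ∃ G : P.M ⟶ B.cohomology, ∀ f, G.toAlgHom (P.ι.toRingHom f) = ev f := by
  let g := evalCocycles (N := B.cohomology) p (fun i => ev (X i)) hev (fun _ => rfl)
  have hg : ∀ f : MvPolynomial σ ℚ, g.toRingHom f = ev f :=
    polynomialCDGA_ringHom_ext p (f := g.toRingHom) (g := ev)
      (evalCocycles_X (N := B.cohomology) p (fun i => ev (X i)) hev fun _ => rfl)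
  obtain ⟨G, hG⟩ := P.exists_extension ℚ B.cohomology g fun f hf =>
    ⟨0, (hg f).trans ((hI f hf).trans (map_zero B.cohomology.d).symm)⟩
  exact ⟨G.toHom, fun f => (hG f).trans (hg f)⟩

end PureMaps

end CDGA

namespace RCBBA

open MvPolynomial

section BigradedMaps

variable {σ : Type u} {p : σ → ℕ} {N : RCBBA.{u}}

theorem mul_comm_of_diag {z : σ → N.carrier} (hz : ∀ i, z i ∈ N.grading (diagWeight p i)) (i : σ)
    (x : N.carrier) : x * z i = z i * x :=
  even_comm (z i) (n := diagWeight p i) ⟨_, rfl⟩ (hz i) x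

/-- The evaluation of polynomials at real closed elements extends to a bigraded model. -/
theorem BigradedModel.exists_hom {I : Ideal (MvPolynomial σ ℂ)} (P : BigradedModel p I)
    (hN : N.DdbarLemma) {z : σ → N.carrier} (hz : ∀ i, z i ∈ N.grading (diagWeight p i))
    (hzd : ∀ i, N.del (z i) = 0 ∧ N.delbar (z i) = 0) (hσ : ∀ i, N.σ (z i) = z i)
    {π : MvPolynomial σ ℂ →ₐ[ℂ] N.total.H} (hπz : ∀ i, π (X i) = N.bcToDR (N.bcCls (z i) (hzd i)))
    (hπ : Function.Surjective π) (hI : ∀ f, π f = 0 ↔ f ∈ I) :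
    ∃ F : P.M ⟶ N, IsPluripotentialQuasiIso F ∧ CDGA.quasiIso ℝ (realTotalMap F) ∧
      ∀ i, F.toAlgHom (P.ι (X i)) = z i := by
  let g₀ : MvPolynomial σ ℂ →+* N.carrier :=
    evalCentral (RingHom.id ℂ) z (mul_comm_of_diag hz)
  let g : MvPolynomial σ ℂ →ₐ[ℂ] N.carrier :=
    { g₀ with commutes' := fun c => evalCentral_C _ _ _ c }
  have hgX : ∀ i, g (X i) = z i := fun i => evalCentral_X (RingHom.id ℂ) z (mul_comm_of_diag hz) i
  have hgd : ∀ f, N.del (g f) = 0 ∧ N.delbar (g f) = 0 := by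
    intro f
    have : (⊤ : Subalgebra ℂ (MvPolynomial σ ℂ)) ≤ N.bcCocycles.comap g := by
      rw [← adjoin_range_X, Algebra.adjoin_le_iff]
      rintro _ ⟨i, rfl⟩
      change g (X i) ∈ N.bcCocycles
      rw [hgX]
      exact hzd i
    exact this trivial
  have hgσ : ∀ f, N.σ (g f) = g (map (starRingEnd ℂ) f) := by
    intro f
    have : N.σ.comp (g : MvPolynomial σ ℂ →+* N.carrier) =
        (g : MvPolynomial σ ℂ →+* N.carrier).comp (map (starRingEnd ℂ)) := by
      refine ringHom_ext (fun c => ?_) fun i => ?_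
      · have h1 : ∀ c : ℂ, g (C c) = c • (1 : N.carrier) := fun c => by
          rw [← Algebra.algebraMap_eq_smul_one]; exact g.commutes c
        change N.σ (g (C c)) = g (map (starRingEnd ℂ) (C c))
        rw [map_C, h1, h1, N.σ_smul, map_one]
      · change N.σ (g (X i)) = g (map (starRingEnd ℂ) (X i))
        rw [map_X, hgX, hσ]
    exact congrArg (fun F => F f) this
  have hcls : ∀ f, N.bcToDR (N.bcCls (g f) (hgd f)) = π f := by
    intro f
    let G : MvPolynomial σ ℂ →ₐ[ℂ] N.total.H := (Ideal.Quotient.mkₐ ℂ N.total.coboundaries).comp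
      ((show MvPolynomial σ ℂ →ₐ[ℂ] N.total.carrier from g).codRestrict N.total.cocycles
        fun f => d_eq_zero (hgd f))
    have : G = π := algHom_ext fun i => by
      rw [hπz]
      exact congrArg (Ideal.Quotient.mk N.total.coboundaries) (Subtype.ext (hgX i))
    exact congrArg (fun F => F f) this
  have hexact : ∀ f, (∃ b, g f = N.d b) ↔ f ∈ I := fun f => by
    rw [← hI, ← hcls]
    exact (CDGA.cls_eq_zero_iff (A := N.total) (d_eq_zero (hgd f))).symm
  obtain ⟨F, hF⟩ := P.exists_extension N g
    (fun n f hf => evalCentral_mem (RingHom.id ℂ) z (mul_comm_of_diag hz) hz hf)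
    (fun f => (hgd f).1) (fun f => (hgd f).2) hgσ
    (fun f hf => ddbarLemma_iff.1 hN _ (hgd f).1 (hgd f).2 ((hexact f).2 hf))
  have hFI : ∀ f, (∃ b, F.toAlgHom (P.ι f) = N.d b) → f ∈ I := fun f => by
    rw [hF]; exact (hexact f).1
  have hsurj : ∀ y, N.del y = 0 → N.delbar y = 0 →
      ∃ f w, y = F.toAlgHom (P.ι f) + N.del (N.delbar w) := by
    intro y h1 h2
    obtain ⟨f, hf⟩ := hπ (N.bcToDR (N.bcCls y ⟨h1, h2⟩))
    rw [← hcls] at hf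
    obtain ⟨w, hw⟩ := (bcCls_eq_iff _ _).1 (hN hf)
    refine ⟨f, -w, ?_⟩
    rw [hF, map_neg, map_neg, ← hw]
    abel
  exact ⟨F, P.isPluripotentialQuasiIso F hN hFI hsurj, P.quasiIso_realTotalMap F hN hFI hsurj,
    fun i => (hF _).trans (hgX i)⟩

/-- A bigraded model of `S ⧸ I` maps to `S ⧸ I`. -/
theorem BigradedModel.exists_hom_cohomology {I : Ideal (MvPolynomial σ ℂ)} (P : BigradedModel p I)
    {π : MvPolynomial σ ℂ →ₐ[ℂ] N.HBC}
    (hmem : ∀ i, π (X i) ∈ N.bcCohomology.grading (diagWeight p i))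
    (hσ : ∀ i, N.bcσ (π (X i)) = π (X i)) (hπ : Function.Surjective π)
    (hI : ∀ f, π f = 0 ↔ f ∈ I) :
    ∃ F : P.M ⟶ N.bcCohomology, IsPluripotentialQuasiIso F ∧
      ∀ i, F.toAlgHom (P.ι (X i)) = π (X i) := by
  have hd : ∀ y : N.bcCohomology.carrier, N.bcCohomology.total.d y = 0 :=
    fun y => add_zero (0 : N.HBC)
  let π' : MvPolynomial σ ℂ →ₐ[ℂ] N.bcCohomology.total.H :=
    (Ideal.Quotient.mkₐ ℂ N.bcCohomology.total.coboundaries).comp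
      ((show MvPolynomial σ ℂ →ₐ[ℂ] N.bcCohomology.total.carrier from π).codRestrict
        N.bcCohomology.total.cocycles fun f => hd (π f))
  obtain ⟨F, hF, -, hFX⟩ := P.exists_hom (ddbarLemma_bcCohomology N) (z := fun i => π (X i)) hmem
    (fun i => ⟨rfl, rfl⟩) hσ (π := π') (fun i => rfl) (fun y => by
      obtain ⟨y, hy, rfl⟩ := CDGA.exists_cls y
      obtain ⟨f, hf⟩ := hπ y
      exact ⟨f, congrArg (Ideal.Quotient.mk N.bcCohomology.total.coboundaries)
        (Subtype.ext hf)⟩) (fun f => by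
      rw [← hI]
      refine (CDGA.cls_eq_zero_iff (A := N.bcCohomology.total) (hd (π f))).trans ⟨?_, fun h => ?_⟩
      · rintro ⟨b, hb⟩
        exact hb.trans (hd b)
      · exact ⟨0, h.trans (hd 0).symm⟩)
  exact ⟨F, hF, hFX⟩

end BigradedMaps

end RCBBA

/-! ### Strong formality -/

namespace RationalCBBA

open CDGA MvPolynomial

/-- The chain `A ← M → H(A)`, with the rational structure of `M` transported from `A`. -/
theorem connected_of_span {A : RationalCBBA.{u}} {T : RationalCBBA.{u}} {MQ : CDGA.{u} ℚ}
    {MC : RCBBA.{u}} (fQ : MQ ⟶ A.AQ) (fC : MC ⟶ A.AC) (gQ : MQ ⟶ T.AQ) (gC : MC ⟶ T.AC)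
    (hfQ : quasiIso ℚ fQ) (hfC : RCBBA.IsPluripotentialQuasiIso fC)
    (hfC' : quasiIso ℝ (RCBBA.realTotalMap fC)) (hgC : RCBBA.IsPluripotentialQuasiIso gC)
    (hcomm : ∀ φ : (toHo ℝ).obj (baseChange ℝ MQ) ⟶ (toHo ℝ).obj MC.realTotal,
      φ ≫ (toHo ℝ).map (RCBBA.realTotalMap fC) =
        (toHo ℝ).map (baseChangeMap ℝ fQ) ≫ A.φ.hom →
      φ ≫ (toHo ℝ).map (RCBBA.realTotalMap gC) =
        (toHo ℝ).map (baseChangeMap ℝ gQ) ≫ T.φ.hom) : Connected A T := by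
  let φ : (toHo ℝ).obj (baseChange ℝ MQ) ≅ (toHo ℝ).obj MC.realTotal :=
    Localization.isoOfHom (toHo ℝ) (quasiIso ℝ) _ (quasiIso_baseChangeMap hfQ) ≪≫ A.φ ≪≫
      (Localization.isoOfHom (toHo ℝ) (quasiIso ℝ) _ hfC').symm
  have hφ : φ.hom ≫ (toHo ℝ).map (RCBBA.realTotalMap fC) =
      (toHo ℝ).map (baseChangeMap ℝ fQ) ≫ A.φ.hom := by
    simp only [φ, Iso.trans_hom, Iso.symm_hom, Category.assoc]
    rw [← Localization.isoOfHom_hom (toHo ℝ) (quasiIso ℝ) _ hfC', Iso.inv_hom_id,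
      Category.comp_id, Localization.isoOfHom_hom]
  let M : RationalCBBA.{u} := ⟨MQ, MC, φ⟩
  let f : Hom M A := ⟨fQ, fC, hφ⟩
  let g : Hom M T := ⟨gQ, gC, hcomm φ.hom hφ⟩
  exact .trans _ M _ (.symm _ _ (.rel M A ⟨f, hfC⟩)) (.rel M T ⟨g, hgC⟩)

variable (A : RationalCBBA.{u})

/-- Compatibility of the maps from the models to the cohomology with the rational structures. Both
sides are represented by morphisms of cdga's, which agree because they agree on the variables. -/
theorem comm_cohomology {σ : Type u} {p : σ → ℕ} {I : Ideal (MvPolynomial σ ℚ)}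
    (P : PureModel p I) {J : Ideal (MvPolynomial σ ℂ)} (Q : RCBBA.BigradedModel p J)
    (hA : A.AC.DdbarLemma)
    (hodd : ∀ n, Odd n → ∀ x ∈ A.AC.bcCohomology.realTotal.grading n, x = 0)
    {ψ : baseChange ℝ A.AQ.cohomology ≅ A.AC.bcCohomology.realTotal} (hψ : A.IsInducedByφ ψ)
    {h : σ → A.AQ.H} {z : σ → A.AC.carrier}
    (hz : ∀ i, A.AC.del (z i) = 0 ∧ A.AC.delbar (z i) = 0)
    (hzh : ∀ i, A.AC.bcToDR (A.AC.bcCls (z i) (hz i)) = A.ratToDR (h i))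
    {fQ : P.M ⟶ A.AQ} {gQ : P.M ⟶ A.AQ.cohomology} {fC : Q.M ⟶ A.AC}
    {gC : Q.M ⟶ A.AC.bcCohomology} (hfC' : quasiIso ℝ (RCBBA.realTotalMap fC))
    (hfQX : ∀ i, Hom.mapH fQ (P.M.cls (P.ι.toRingHom (polyX p i)) (P.d_ι _)) = h i)
    (hgQX : ∀ i, gQ.toAlgHom (P.ι.toRingHom (polyX p i)) = h i)
    (hfCX : ∀ i, fC.toAlgHom (Q.ι (X i)) = z i)
    (hgCX : ∀ i, gC.toAlgHom (Q.ι (X i)) = A.AC.bcCls (z i) (hz i))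
    (φ : (toHo ℝ).obj (baseChange ℝ P.M) ⟶ (toHo ℝ).obj Q.M.realTotal)
    (hφ : φ ≫ (toHo ℝ).map (RCBBA.realTotalMap fC) =
      (toHo ℝ).map (baseChangeMap ℝ fQ) ≫ A.φ.hom) :
    φ ≫ (toHo ℝ).map (RCBBA.realTotalMap gC) =
      (toHo ℝ).map (baseChangeMap ℝ gQ) ≫ (toHo ℝ).map ψ.hom := by
  -- a representative `v` of the left hand side
  obtain ⟨v, hv⟩ := (P.lifting ℝ).exists_toHo_map_eq
    (φ ≫ (toHo ℝ).map (RCBBA.realTotalMap gC))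
  rw [← hv, ← Functor.map_comp]
  congr 1
  -- the image of a variable under `φ`, computed in the cohomology of `A`
  let ξ : ∀ i, Q.M.realTotal.carrier := fun i =>
    (⟨Q.ι (X i), (Q.σ_ι _).trans (by rw [map_X])⟩ : Q.M.fixed)
  have hξd : ∀ i, Q.M.realTotal.d (ξ i) = 0 := fun i =>
    Subtype.ext (RCBBA.d_eq_zero ⟨Q.del_ι _, Q.delbar_ι _⟩)
  have hφX : ∀ i, hoMapH φ (toBaseChangeH ℝ P.M (P.M.cls (P.ι.toRingHom (polyX p i)) (P.d_ι _))) =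
      Q.M.realTotal.cls (ξ i) (hξd i) := by
    intro i
    apply hfC'.1
    rw [← hoMapH_map, ← hoMapH_comp, hφ, hoMapH_comp, hoMapH_map]
    apply A.AC.realToComplexH_injective
    have e1 : Hom.mapH (baseChangeMap ℝ fQ) (toBaseChangeH ℝ P.M
        (P.M.cls (P.ι.toRingHom (polyX p i)) (P.d_ι _))) = toBaseChangeH ℝ A.AQ (h i) := by
      rw [← hfQX]
      exact congrArg (Ideal.Quotient.mk (baseChange ℝ A.AQ).coboundaries)
        (Subtype.ext (Algebra.TensorProduct.map_tmul _ _ _ _))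
    rw [e1, ← ratToDR_apply, ← hzh]
    exact congrArg (Ideal.Quotient.mk A.AC.total.coboundaries) (Subtype.ext (hfCX i).symm)
  have hvX : ∀ i, v.toAlgHom ((1 : ℝ) ⊗ₜ[ℚ] P.ι.toRingHom (polyX p i)) =
      (RCBBA.realTotalMap gC).toAlgHom (ξ i) := by
    intro i
    have h1 : Hom.mapH v (toBaseChangeH ℝ P.M
        (P.M.cls (P.ι.toRingHom (polyX p i)) (P.d_ι _))) =
        Hom.mapH (RCBBA.realTotalMap gC) (Q.M.realTotal.cls (ξ i) (hξd i)) := by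
      rw [← hφX, ← hoMapH_map, ← hoMapH_map, hv, hoMapH_comp]
    obtain ⟨c, hc⟩ := (cls_eq_iff _ _).1 h1
    have hc0 : A.AC.bcCohomology.realTotal.d c = 0 := Subtype.ext (add_zero (0 : A.AC.HBC))
    exact sub_eq_zero.1 (hc.trans hc0)
  -- the target vanishes in odd degrees, so that the variables determine the morphism
  have key : ∀ x, (SemiHom.restrict v).toRingHom x =
      (SemiHom.restrict (baseChangeMap ℝ gQ ≫ ψ.hom)).toRingHom x := by
    refine P.ext_of_even ℝ _ hodd _ _ fun f => ?_
    refine polynomialCDGA_ringHom_ext p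
      (f := (SemiHom.restrict v).toRingHom.comp P.ι.toRingHom)
      (g := (SemiHom.restrict (baseChangeMap ℝ gQ ≫ ψ.hom)).toRingHom.comp P.ι.toRingHom)
      (fun i => (hvX i).trans (Subtype.ext (hA ?_))) f
    have e1 : A.AC.bcToDR (gC.toAlgHom (Q.ι (X i))) = A.ratToDR (h i) := by
      rw [hgCX]; exact hzh i
    refine e1.trans ((hψ (h i)).symm.trans ?_)
    refine congrArg (fun y => A.AC.bcToDR (A.AC.bcCohomology.fixed.val (ψ.hom.toAlgHom y))) ?_
    exact ((Algebra.TensorProduct.map_tmul (AlgHom.id ℝ ℝ) gQ.toAlgHom 1 _).trans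
      (congrArg ((1 : ℝ) ⊗ₜ[ℚ] ·) (hgQX i))).symm
  exact SemiHom.hom_ext key

end RationalCBBA

open CDGA MvPolynomial in
theorem RationalCBBA.stronglyFormal_of_isCompleteIntersectionType (A : RationalCBBA.{u})
    (hA : A.AC.DdbarLemma) (hH : IsCompleteIntersectionType A.AC.dRPiece) : A.StronglyFormal := by
  obtain ⟨σ, _, _, p, m, r, q, π, hp, hq, hr, hsyz, hπ, hker, hπd⟩ :=
    IsCompleteIntersectionType.exists_presentation.{u} hH
  have hbc : Function.Surjective A.AC.bcToDR := RCBBA.bcToDR_surjective hπ hπd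
  have hodd : ∀ n, Odd n → ∀ x ∈ A.AC.bcCohomology.realTotal.grading n, x = 0 := by
    intro n hn x hx
    refine Subtype.ext (hA ?_)
    exact (RCBBA.eq_zero_of_odd hπ hπd hn (A.AC.bcToDR_mem hx)).trans (map_zero _).symm
  obtain ⟨ψ, hψ⟩ := A.exists_isInducedByφ hA hbc
  have hℚ : ∀ c : ℚ, A.ratToDR (algebraMap ℚ A.AQ.H c) =
      algebraMap ℂ A.AC.total.H (algebraMap ℚ ℂ c) := fun c =>
    congrArg (fun F : ℚ →+* A.AC.total.H => F c) (Subsingleton.elim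
      (A.ratToDR.comp (algebraMap ℚ A.AQ.H))
      ((algebraMap ℂ A.AC.total.H).comp (algebraMap ℚ ℂ)))
  -- `H(A_ℚ)` is a complete intersection with generators `h` and relations `r'`, and `H_dR(A_ℂ)` is
  -- the complete intersection with the same generators and relations
  obtain ⟨h, r', ev, π', hh, hev, hπ'X, hr', hreg, hreg', hevs, hevI, hπ', hπ'I⟩ :=
    exists_rational_presentation hp A.ratToDR hℚ (fun d => A.AQ.cohomology.grading (2 * d))
      (fun d x hx y => (A.AQ.cohomology.isGradedComm.isEvenCentral A.AQ.cohomology.isParity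
        (n := 2 * d) (even_two_mul d) hx).comm y)
      A.exists_extend_functional hq hr hsyz π hπ hker
      (fun d f hf => A.mem_span_ratToDR (RCBBA.mem_grading_of_dRPiece hπd hf))
      (fun d x hx => RCBBA.exists_of_mem_even hπ hπd (A.ratToDR_mem hx))
  -- the models; the relations of the second one are real because they are rational
  obtain ⟨P⟩ := PureModel.exists_of_regularModulo (p := p) (fun f hf => by
    obtain ⟨i, rfl⟩ := List.mem_ofFn.1 hf
    exact ⟨q i, mem_evenWeight (hr' i)⟩) hreg (PureModel.bot p)
  obtain ⟨Q⟩ := RCBBA.BigradedModel.exists_of_regularModulo (p := p) (fun f hf => by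
    obtain ⟨i, rfl⟩ := List.mem_ofFn.1 hf
    refine ⟨?_, q i, hq i, mem_diagWeight_iff.2 (map_mem_weightedHomogeneousSubmodule (hr' i))⟩
    rw [map_map,
      Subsingleton.elim ((starRingEnd ℂ).comp (algebraMap ℚ ℂ)) (algebraMap ℚ ℂ)]) hreg'
    (RCBBA.BigradedModel.bot p)
  rw [bot_sup_eq] at P Q
  -- the generators are real classes of pure type, and so have real representatives of pure type
  -- that are closed for both differentials
  choose z hz hzd hzσ hzh using fun i => RCBBA.exists_real_rep (d := linWeight p i)
    (u := hoMapH A.φ.hom (toBaseChangeH ℝ A.AQ (h i))) (by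
      rw [← ratToDR_apply]
      obtain ⟨f, hf, hf'⟩ := RCBBA.exists_of_mem_even hπ hπd (A.ratToDR_mem (hh i))
      rw [← hf']
      exact hπd _ f hf)
  have hevX : ∀ i, ev (X i) ∈ A.AQ.cohomology.grading (evenWeight p i) := fun i => by
    rw [hev]; exact hh i
  obtain ⟨fQ, hfQ, hfQX⟩ := P.exists_quasiIso hevX hevs hevI
  obtain ⟨gQ, hgQX⟩ := P.exists_hom_cohomology hevX fun f hf => (hevI f).2 hf
  obtain ⟨fC, hfC, hfC', hfCX⟩ := Q.exists_hom hA hz hzd hzσ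
    (fun i => (hπ'X i).trans (hzh i).symm) hπ' hπ'I
  let e : A.AC.HBC ≃ₐ[ℂ] A.AC.total.H :=
    AlgEquiv.ofRingEquiv (f := RingEquiv.ofBijective A.AC.bcToDR ⟨hA, hbc⟩) fun c => by
      rw [Algebra.algebraMap_eq_smul_one, Algebra.algebraMap_eq_smul_one,
        ← map_one A.AC.bcToDR]
      exact A.AC.bcToDR_smul c 1
  have heX : ∀ i, (e.symm.toAlgHom.comp π') (X i) = A.AC.bcCls (z i) (hzd i) := fun i =>
    e.symm_apply_eq.2 ((hπ'X i).trans (hzh i).symm)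
  obtain ⟨gC, hgC, hgCX⟩ := Q.exists_hom_cohomology (π := e.symm.toAlgHom.comp π')
    (fun i => by rw [heX]; exact ⟨⟨z i, hzd i⟩, hz i, rfl⟩)
    (fun i => by
      rw [heX]
      exact congrArg (Ideal.Quotient.mk A.AC.bcBoundaries) (Subtype.ext (hzσ i)))
    (e.symm.surjective.comp hπ')
    (fun f => (map_eq_zero_iff e.symm e.symm.injective).trans (hπ'I f))
  refine ⟨hA, ψ, hψ, connected_of_span (T := A.cohomologyTriple ψ) fQ fC gQ gC hfQ hfC hfC' hgC ?_⟩
  exact A.comm_cohomology P Q hA hodd hψ hzd hzh hfC' (fun i => (hfQX _).trans (hev i))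
    (fun i => (hgQX _).trans (hev i)) hfCX fun i => (hgCX i).trans (heX i)

end

theorem mainTheorem4 (A : RationalCBBA.{u}) (hA : A.AC.DdbarLemma)
    (hH : IsCompleteIntersectionType A.AC.dRPiece) : A.StronglyFormal :=
  A.stronglyFormal_of_isCompleteIntersectionType hA hH
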